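/- **Setting.** Let $q\in\mathbb C$ be neither zero nor a root of unity, and let $\ell\in\mathbb C$. For $n\in\mathbb Z$ let $f_n(x)\in\mathbb C((x))$ be the Laurent expansion at $x=0$ of $$\frac{q^{n+1}e^{x}}{(1-q^{n+1}e^{x})^2}-\frac{q^{n-1}e^{x}}{(1-q^{n-1}e^{x})^2}.$$ Let $\hat B_q$ be the complex Lie algebra with generators $c$ and $\beta^{(r)}_m$ ($r,m\in\mathbb Z$), where $c$ is central and, with $\beta^{(r)}(x)=\sum_{m\in\mathbb Z}\beta^{(r)}_m x^{-m-1}$ and $\delta(x)=\sum_{n\in\mathbb Z}x^n$, $$[\beta^{(r)}(x_1),\beta^{(s)}(x_2)]=f_{r-s}(-x_2+x_1)\,c+(\delta_{r,s}-\delta_{r,s+1})\frac{\partial}{\partial x_2}x_1^{-1}\delta\!\left(\frac{x_2}{x_1}\right)c ,\qquad r,s\in\mathbb Z,$$ the first term being expanded in nonnegative powers of $x_1$. A $\hat B_q$-module $W$ has level $\ell$ if $c$ acts as $\ell$, and is restricted if for all $w\in W$ and $r\in\mathbb Z$ one has $\beta^{(r)}_nw=0$ for $n$ sufficiently large. Let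 $V=V_{\hat B_q}(\ell,0)=U(\hat B_q)\otimes_{U(\hat B_q^++\mathbb Cc)}\mathbb C_\ell$, where $\hat B_q^+$ is spanned by the $\beta^{(r)}_n$ with $n\ge 0$ and acts as zero on $\mathbb C_\ell=\mathbb C$, and $c$ acts on $\mathbb C_\ell$ as $\ell$. Put $\mathbf 1=1\otimes1$ and $\beta^{(r)}=\beta^{(r)}_{-1}\mathbf 1\in V$. **Definitions.** A weak quantum vertex algebra is a complex vector space $V$ with a vector $\mathbf 1$ and a linear map $Y(\cdot,x):V\to\mathrm{Hom}(V,V((x)))$ such that: $Y(\mathbf 1,x)v=v$, $Y(v,x)\mathbf 1\in V[[x]]$ and $\lim_{x\to0}Y(v,x)\mathbf 1=v$; for all $u,v,w\in V$ there is $l\ge0$ with $$(x_0+x_2)^lY(u,x_0+x_2)Y(v,x_2)w=(x_0+x_2)^lY(Y(u,x_0)v,x_2)w ;$$ and for all $u,v\in V$ there are finitely many $u^{(i)},v^{(i)}\in V$, $g_i\in\mathbb C((x))$ and a $k\ge0$ with $$(x_1-x_2)^kY(u,x_1)Y(v,x_2)=(x_1-x_2)^k\sum_i g_i(x_2-x_1)Y(v^{(i)},x_2)Y(u^{(i)},x_1).$$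 A $V$-module is a vector space $W$ with a linear map $Y_W(\cdot,x):V\to\mathrm{Hom}(W,W((x)))$ such that $Y_W(\mathbf 1,x)=1_W$ and for all $u,v\in V$, $w\in W$ there is $l\ge 0$ with $(x_0+x_2)^lY_W(u,x_0+x_2)Y_W(v,x_2)w=(x_0+x_2)^lY_W(Y(u,x_0)v,x_2)w$. $V$ is irreducible if $V\ne0$ and it has no $V$-submodules other than $0$ and $V$. $V$ is non-degenerate if for every $n\ge1$ the linear map $$V^{\otimes n}\otimes\mathbb C((x_1))\cdots((x_n))\to V((x_1))\cdots((x_n)),\quad v^{(1)}\otimes\cdots\otimes v^{(n)}\otimes f\mapsto fY(v^{(1)},x_1)\cdots Y(v^{(n)},x_n)\mathbf 1$$ is injective. A quantum vertex algebra is a weak quantum vertex algebra with a linear map $\mathcal S(x):V\otimes V\to V\otimes V\otimes\mathbb C((x))$ satisfying the quantum Yang–Baxter equation $\mathcal S^{12}(x)\mathcal S^{13}(x+z)\mathcal S^{23}(z)=\mathcal S^{23}(z)\mathcal S^{13}(x+z)\mathcal S^{12}(x)$, unitarity $\mathcal S(x)\mathcal S^{21}(-x)=1$, and, with $\mathcal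 D v$ the coefficient of $x$ in $Y(v,x)\mathbf 1$, $$\mathcal S(x)(\mathbf 1\otimes v)=\mathbf 1\otimes v,\qquad [\mathcal D\otimes1,\mathcal S(x)]=-\tfrac{d}{dx}\mathcal S(x),$$ $$Y(u,x)v=e^{x\mathcal D}Y(-x)\mathcal S(-x)(v\otimes u),\qquad \mathcal S(x_1)(Y(x_2)\otimes1)=(Y(x_2)\otimes1)\mathcal S^{23}(x_1)\mathcal S^{13}(x_1+x_2).$$ Here $Y(x)(u\otimes v)=Y(u,x)v$, and powers of a sum are expanded in nonnegative powers of its second term. **Theorem.** 1. There exists exactly one weak quantum vertex algebra structure $Y$ on $V_{\hat B_q}(\ell,0)$ such that $\mathbf 1$ is the vacuum vector and $Y(\beta^{(r)},x)=\beta^{(r)}(x)$ for all $r\in\mathbb Z$. 2. If $\ell\ne0$, then with this structure $V_{\hat B_q}(\ell,0)$ is irreducible and non-degenerate, and there is exactly one $\mathcal S(x)$ for which it is a quantum vertex algebra. 3. For every restricted $\hat B_q$-module $W$ of level $\ell$ there exists exactly one $V_{\hat B_q}(\ell,0)$-module structure $Y_W$ on $W$ such that $Y_W(\beta^{(r)},x)=\beta^{(r)}(x)$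 for all $r\in\mathbb Z$. -/

import Mathlib

open scoped TensorProduct

noncomputable section

namespace QVA

/-! ## Formal Laurent series

For a complex vector space `M`, the space `M((x))` is `LaurentSeries M`. -/

section Series

variable {M N P : Type*} [AddCommGroup M] [Module ℂ M]
  [AddCommGroup N] [Module ℂ N] [AddCommGroup P] [Module ℂ P]

/-- Coefficientwise application of a linear map `M → N`, as a map `M((x)) → N((x))`. -/
def mapCoeff : (M →ₗ[ℂ] N) →ₗ[ℂ] LaurentSeries M →ₗ[ℂ] LaurentSeries N :=
  LinearMap.mk₂ ℂ (fun T f => f.map T)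
    (fun _ _ _ => by ext; simp) (fun _ _ _ => by ext; simp)
    (fun _ _ _ => by ext; simp) (fun _ _ _ => by ext; simp)

/-- The substitution `x ↦ -x` on `M((x))`. -/
def negX : LaurentSeries M →ₗ[ℂ] LaurentSeries M where
  toFun f :=
    { coeff := fun n => (-1 : ℂ) ^ n • f.coeff n
      isPWO_support' := f.isPWO_support.mono fun n hn h => hn (by simp [h]) }
  map_add' f g := by ext n; simp
  map_smul' c f := by ext n; simp [smul_comm c]

theorem mulSeries_support (B : M →ₗ[ℂ] N →ₗ[ℂ] P) (f : LaurentSeries M) (g : LaurentSeries N)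
    (n i : ℤ) (h : B (f.coeff i) (g.coeff (n - i)) ≠ 0) : f.order ≤ i ∧ i ≤ n - g.order := by
  constructor
  · apply HahnSeries.order_le_of_coeff_ne_zero
    intro h0
    simp [h0] at h
  · have : g.order ≤ n - i := by
      apply HahnSeries.order_le_of_coeff_ne_zero
      intro h0
      simp [h0] at h
    linarith

theorem mulSeries_finite (B : M →ₗ[ℂ] N →ₗ[ℂ] P) (f : LaurentSeries M) (g : LaurentSeries N)
    (n : ℤ) : (Function.support fun i : ℤ => B (f.coeff i) (g.coeff (n - i))).Finite :=
  (Set.finite_Icc f.order (n - g.order)).subset fun i hi => mulSeries_support B f g n i hi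

/-- The product `M((x)) × N((x)) → P((x))` induced by a bilinear map `B : M × N → P`: the
coefficient of `x ^ n` in the product of `f` and `g` is `∑ i, B (f_i, g_{n - i})`, a finite sum. -/
def mulSeries (B : M →ₗ[ℂ] N →ₗ[ℂ] P) :
    LaurentSeries M →ₗ[ℂ] LaurentSeries N →ₗ[ℂ] LaurentSeries P :=
  LinearMap.mk₂ ℂ
    (fun f g => HahnSeries.ofSuppBddBelow
      (fun n : ℤ => ∑ᶠ i : ℤ, B (f.coeff i) (g.coeff (n - i)))
      ⟨f.order + g.order, fun n hn => by
        by_contra hlt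
        refine hn (finsum_eq_zero_of_forall_eq_zero fun i => ?_)
        by_contra hi
        have := mulSeries_support B f g n i hi
        exact hlt (by linarith)⟩)
    (fun f f' g => by
      ext n
      simp only [HahnSeries.ofSuppBddBelow, HahnSeries.coeff_add, map_add, LinearMap.add_apply]
      exact finsum_add_distrib (mulSeries_finite B f g n) (mulSeries_finite B f' g n))
    (fun c f g => by
      ext n
      simp only [HahnSeries.ofSuppBddBelow, HahnSeries.coeff_smul, map_smul, LinearMap.smul_apply]
      exact (smul_finsum' c (mulSeries_finite B f g n)).symm)
    (fun f g g' => by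
      ext n
      simp only [HahnSeries.ofSuppBddBelow, HahnSeries.coeff_add, map_add]
      exact finsum_add_distrib (mulSeries_finite B f g n) (mulSeries_finite B f g' n))
    (fun c f g => by
      ext n
      simp only [HahnSeries.ofSuppBddBelow, HahnSeries.coeff_smul, map_smul]
      exact (smul_finsum' c (mulSeries_finite B f g n)).symm)

/-- For a two-variable formal series `F = ∑ F i j x₁ ^ i x₂ ^ j`, the series
`(x₁ + x₂) ^ l F`. -/
def mulAddPow (l : ℕ) (F : ℤ → ℤ → M) : ℤ → ℤ → M := fun i j =>
  ∑ a ∈ Finset.range (l + 1), (l.choose a : ℂ) • F (i - (l - a : ℤ)) (j - a)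

/-- For a two-variable formal series `F = ∑ F i j x₁ ^ i x₂ ^ j`, the series
`(x₁ - x₂) ^ k F`. -/
def mulSubPow (k : ℕ) (F : ℤ → ℤ → M) : ℤ → ℤ → M := fun i j =>
  ∑ a ∈ Finset.range (k + 1), ((-1 : ℂ) ^ a * (k.choose a : ℂ)) • F (i - (k - a : ℤ)) (j - a)

/-- The coefficient of `x₁ ^ i x₂ ^ j` in `f (x₂ - x₁) ∈ ℂ((x₂))((x₁))`, where
`(x₂ - x₁) ^ n = ∑_{i ≥ 0} (n choose i) (-1) ^ i x₂ ^ (n - i) x₁ ^ i` is expanded in nonnegative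
powers of `x₁`. -/
def expandSub (f : LaurentSeries ℂ) (i j : ℤ) : ℂ :=
  if 0 ≤ i then (-1 : ℂ) ^ i * (Ring.choose (i + j) i.toNat : ℤ) * f.coeff (i + j) else 0

end Series

/-! ## Vertex operators

`VertexOperator ℂ W` is `Hom (W, W((x)))`, and `HVertexOperator.coeff A n : W → W` is the
coefficient of `x ^ n` in `A`. -/

section Vertex

universe u w

variable {V : Type u} [AddCommGroup V] [Module ℂ V] {W : Type w} [AddCommGroup W] [Module ℂ W]

/-- The weak associativity relation: for all `u v ∈ V` and `w ∈ W` there is a nonnegative integer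
`l` such that
`(x₀ + x₂) ^ l Y_W (u, x₀ + x₂) Y_W (v, x₂) w = (x₀ + x₂) ^ l Y_W (Y (u, x₀) v, x₂) w`,
where powers of `x₀ + x₂` are expanded in nonnegative powers of `x₂`. The functions of `i j` are
the coefficients of `x₀ ^ i x₂ ^ j`. -/
def WeakAssociativity (Y : V →ₗ[ℂ] VertexOperator ℂ V) (YW : V →ₗ[ℂ] VertexOperator ℂ W) : Prop :=
  ∀ (u v : V) (w : W), ∃ l : ℕ,
    mulAddPow l (fun i j => ∑ᶠ a : ℕ, ((Ring.choose (i + a) a : ℤ) : ℂ) •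
      (YW u).coeff (i + a) ((YW v).coeff (j - a) w)) =
    mulAddPow l (fun i j => (YW ((Y u).coeff i v)).coeff j w)

/-- A weak quantum vertex algebra structure on `V`, with vacuum vector `vac`. -/
structure IsWeakQuantumVertexAlgebra (vac : V) (Y : V →ₗ[ℂ] VertexOperator ℂ V) : Prop where
  /-- `Y (1, x) v = v` -/
  vacuum : ∀ (v : V) (n : ℤ), (Y vac).coeff n v = if n = 0 then v else 0
  /-- `Y (v, x) 1 ∈ V[[x]]` -/
  creation_regular : ∀ (v : V) (n : ℤ), n < 0 → (Y v).coeff n vac = 0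
  /-- the constant term of `Y (v, x) 1` is `v` -/
  creation : ∀ v : V, (Y v).coeff 0 vac = v
  weak_assoc : WeakAssociativity Y Y
  /-- `(x₁ - x₂) ^ k Y (u, x₁) Y (v, x₂)
      = (x₁ - x₂) ^ k ∑ₜ fₜ (x₂ - x₁) Y (v⁽ᵗ⁾, x₂) Y (u⁽ᵗ⁾, x₁)` -/
  S_locality : ∀ u v : V, ∃ (r : ℕ) (u' v' : Fin r → V) (f : Fin r → LaurentSeries ℂ) (k : ℕ),
    ∀ w : V,
      mulSubPow k (fun i j => (Y u).coeff i ((Y v).coeff j w)) =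
      mulSubPow k (fun i j => ∑ t : Fin r, ∑ᶠ p : ℤ × ℤ,
        expandSub (f t) p.1 p.2 • (Y (v' t)).coeff (j - p.2) ((Y (u' t)).coeff (i - p.1) w))

/-- A module structure on `W` for the weak quantum vertex algebra `(V, Y, vac)`. -/
structure IsModuleFor (vac : V) (Y : V →ₗ[ℂ] VertexOperator ℂ V)
    (YW : V →ₗ[ℂ] VertexOperator ℂ W) : Prop where
  /-- `Y_W (1, x)` is the identity operator -/
  vacuum : ∀ (w : W) (n : ℤ), (YW vac).coeff n w = if n = 0 then w else 0
  weak_assoc : WeakAssociativity Y YW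

/-- `V` is irreducible as a (left) module over itself: `V ≠ 0` and the only subspaces stable under
all the coefficients of all `Y (v, x)` are `0` and `V`. -/
def IsIrreducible (Y : V →ₗ[ℂ] VertexOperator ℂ V) : Prop :=
  Nontrivial V ∧ ∀ U : Submodule ℂ V,
    (∀ (v : V) (n : ℤ), ∀ a ∈ U, (Y v).coeff n a ∈ U) → U = ⊥ ∨ U = ⊤

/-- The bilinear map `(u, v) ↦ Y (u, x) v ∈ V((x))`. -/
def series (Y : V →ₗ[ℂ] VertexOperator ℂ V) : V →ₗ[ℂ] V →ₗ[ℂ] LaurentSeries V :=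
  LinearMap.mk₂ ℂ (fun u v => (HahnModule.of ℂ).symm (Y u v))
    (fun _ _ _ => by simp) (fun _ _ _ => by simp; rfl)
    (fun _ _ _ => by simp) (fun _ _ _ => by simp; rfl)

/-! ### Non-degeneracy -/

/-- The iterated Laurent series `M((x₁))((x₂))⋯((xₙ))`. -/
def iterLaurent (M : ModuleCat.{u} ℂ) : ℕ → ModuleCat.{u} ℂ
  | 0 => M
  | n + 1 => ModuleCat.of ℂ (LaurentSeries (iterLaurent M n))

/-- The product of a scalar series in `ℂ((x₁))⋯((xₙ))` and a series in `M((x₁))⋯((xₙ))`. -/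
def iterMul (M : ModuleCat.{u} ℂ) : (n : ℕ) →
    (iterLaurent (ModuleCat.of ℂ ℂ) n →ₗ[ℂ] iterLaurent M n →ₗ[ℂ] iterLaurent M n)
  | 0 => LinearMap.lsmul ℂ M
  | n + 1 => mulSeries (iterMul M n)

/-- The product `Y (v⁽¹⁾, x₁) ⋯ Y (v⁽ⁿ⁾, xₙ) : V → V((x₁))⋯((xₙ))`, multilinear in the `v⁽ⁱ⁾`;
`Y (v⁽ⁿ⁺¹⁾, xₙ₊₁)` is applied first, and then the first `n` factors are applied to the
coefficients of the powers of `xₙ₊₁`. -/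
def iterY (Y : V →ₗ[ℂ] VertexOperator ℂ V) : (n : ℕ) →
    MultilinearMap ℂ (fun _ : Fin n => V) (V →ₗ[ℂ] iterLaurent (ModuleCat.of ℂ V) n)
  | 0 => MultilinearMap.constOfIsEmpty ℂ _ LinearMap.id
  | n + 1 =>
    (((LinearMap.lcomp ℂ (V →ₗ[ℂ] LaurentSeries (iterLaurent (ModuleCat.of ℂ V) n)) (series Y)) ∘ₗ
      (LinearMap.llcomp ℂ V (LaurentSeries V) (LaurentSeries (iterLaurent (ModuleCat.of ℂ V) n))) ∘ₗ
      mapCoeff).compMultilinearMap (iterY Y n)).uncurryRight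

/-- The map `Zₙ : V^{⊗ n} ⊗ ℂ((x₁))⋯((xₙ)) → V((x₁))⋯((xₙ))`,
`v⁽¹⁾ ⊗ ⋯ ⊗ v⁽ⁿ⁾ ⊗ f ↦ f Y (v⁽¹⁾, x₁) ⋯ Y (v⁽ⁿ⁾, xₙ) 1`. -/
def Zmap (vac : V) (Y : V →ₗ[ℂ] VertexOperator ℂ V) (n : ℕ) :
    (⨂[ℂ] _ : Fin n, V) ⊗[ℂ] iterLaurent (ModuleCat.of ℂ ℂ) n →ₗ[ℂ]
      iterLaurent (ModuleCat.of ℂ V) n :=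
  TensorProduct.lift ((iterMul (ModuleCat.of ℂ V) n).flip ∘ₗ
    PiTensorProduct.lift ((LinearMap.applyₗ vac).compMultilinearMap (iterY Y n)))

/-- Non-degeneracy: `Zₙ` is injective for every positive integer `n`. -/
def IsNondegenerate (vac : V) (Y : V →ₗ[ℂ] VertexOperator ℂ V) : Prop :=
  ∀ n : ℕ, 0 < n → Function.Injective (Zmap vac Y n)

/-! ### Quantum Yang-Baxter operators and quantum vertex algebras

A map `𝒮(x) : V ⊗ V → V ⊗ V ⊗ ℂ((x))` is a linear map `S : V ⊗ V → ℂ((x)) ⊗ (V ⊗ V)`: the scalar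
tensor factor is written on the left. -/

/-- The multiplication of `ℂ((x))`. -/
def mulX : LaurentSeries ℂ →ₗ[ℂ] LaurentSeries ℂ →ₗ[ℂ] LaurentSeries ℂ :=
  mulSeries (LinearMap.mul ℂ ℂ)

/-- The multiplication of `ℂ((x))((z))`. -/
def mulXZ : LaurentSeries (LaurentSeries ℂ) →ₗ[ℂ] LaurentSeries (LaurentSeries ℂ) →ₗ[ℂ]
    LaurentSeries (LaurentSeries ℂ) :=
  mulSeries mulX

section YangBaxter

variable {K : Type*} [AddCommMonoid K] [Module ℂ K] {M N : Type*} [AddCommMonoid M] [Module ℂ M]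
  [AddCommMonoid N] [Module ℂ N]

/-- The `K`-linear extension `M ⊗ K → N ⊗ K` of a linear map `A : M → N ⊗ K`, where `K` is an
algebra with multiplication `μ`. -/
def extendScalars (μ : K →ₗ[ℂ] K →ₗ[ℂ] K) (A : M →ₗ[ℂ] K ⊗[ℂ] N) : K ⊗[ℂ] M →ₗ[ℂ] K ⊗[ℂ] N :=
  (TensorProduct.lift μ).rTensor N ∘ₗ (TensorProduct.assoc ℂ K K N).symm.toLinearMap ∘ₗ A.lTensor K

/-- `A¹² : V ⊗ V ⊗ V → V ⊗ V ⊗ V ⊗ K` for `A : V ⊗ V → V ⊗ V ⊗ K`. -/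
def leg12 (A : V ⊗[ℂ] V →ₗ[ℂ] K ⊗[ℂ] (V ⊗[ℂ] V)) :
    (V ⊗[ℂ] V) ⊗[ℂ] V →ₗ[ℂ] K ⊗[ℂ] ((V ⊗[ℂ] V) ⊗[ℂ] V) :=
  (TensorProduct.assoc ℂ K (V ⊗[ℂ] V) V).toLinearMap ∘ₗ A.rTensor V

/-- `A²³ : V ⊗ V ⊗ V → V ⊗ V ⊗ V ⊗ K` for `A : V ⊗ V → V ⊗ V ⊗ K`. -/
def leg23 (A : V ⊗[ℂ] V →ₗ[ℂ] K ⊗[ℂ] (V ⊗[ℂ] V)) :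
    (V ⊗[ℂ] V) ⊗[ℂ] V →ₗ[ℂ] K ⊗[ℂ] ((V ⊗[ℂ] V) ⊗[ℂ] V) :=
  (TensorProduct.assoc ℂ V V V).symm.toLinearMap.lTensor K ∘ₗ
    (TensorProduct.leftComm ℂ V K (V ⊗[ℂ] V)).toLinearMap ∘ₗ
    A.lTensor V ∘ₗ (TensorProduct.assoc ℂ V V V).toLinearMap

/-- `A¹³ : V ⊗ V ⊗ V → V ⊗ V ⊗ V ⊗ K` for `A : V ⊗ V → V ⊗ V ⊗ K`: it is `A¹²` conjugated by the
flip of the second and third factors. -/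
def leg13 (A : V ⊗[ℂ] V →ₗ[ℂ] K ⊗[ℂ] (V ⊗[ℂ] V)) :
    (V ⊗[ℂ] V) ⊗[ℂ] V →ₗ[ℂ] K ⊗[ℂ] ((V ⊗[ℂ] V) ⊗[ℂ] V) :=
  (TensorProduct.rightComm ℂ V V V).toLinearMap.lTensor K ∘ₗ leg12 A ∘ₗ
    (TensorProduct.rightComm ℂ V V V).toLinearMap

/-- Given `ρ : ℂ((x)) → K`, the map `V ⊗ V → V ⊗ V ⊗ K` obtained from `S` by applying `ρ` to the
scalar factor. -/
def changeScalars (ρ : LaurentSeries ℂ →ₗ[ℂ] K)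
    (S : V ⊗[ℂ] V →ₗ[ℂ] LaurentSeries ℂ ⊗[ℂ] (V ⊗[ℂ] V)) : V ⊗[ℂ] V →ₗ[ℂ] K ⊗[ℂ] (V ⊗[ℂ] V) :=
  ρ.rTensor (V ⊗[ℂ] V) ∘ₗ S

end YangBaxter

/-- The embedding `f (x) ↦ f (x)` of `ℂ((x))` into `ℂ((x))((z))`. -/
def substX : LaurentSeries ℂ →ₗ[ℂ] LaurentSeries (LaurentSeries ℂ) :=
  HahnSeries.single.linearMap 0

/-- The map `f (x) ↦ f (z)` from `ℂ((x))` to `ℂ((x))((z))`. -/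
def substZ : LaurentSeries ℂ →ₗ[ℂ] LaurentSeries (LaurentSeries ℂ) :=
  mapCoeff (HahnSeries.single.linearMap 0)

/-- The map `f (x) ↦ f (x + z)` from `ℂ((x))` to `ℂ((x))((z))`, where `f (x + z)` is expanded in
nonnegative powers of `z`: the coefficient of `z ^ a` is the divided derivative `f⁽ᵃ⁾ (x) / a!`. -/
def substXZ : LaurentSeries ℂ →ₗ[ℂ] LaurentSeries (LaurentSeries ℂ) where
  toFun f := HahnSeries.ofSuppBddBelow
    (fun n : ℤ => if 0 ≤ n then LaurentSeries.hasseDeriv ℂ n.toNat f else 0)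
    ⟨0, fun n hn => by
      by_contra h
      exact hn (if_neg h)⟩
  map_add' f g := by
    ext n : 2
    by_cases h : 0 ≤ n <;> simp [HahnSeries.ofSuppBddBelow, h]
  map_smul' c f := by
    ext n : 2
    by_cases h : 0 ≤ n <;> simp [HahnSeries.ofSuppBddBelow, h]

/-- The quantum Yang-Baxter equation
`𝒮¹²(x) 𝒮¹³(x + z) 𝒮²³(z) = 𝒮²³(z) 𝒮¹³(x + z) 𝒮¹²(x)` over `ℂ((x))((z))`. -/
def IsYangBaxter (S : V ⊗[ℂ] V →ₗ[ℂ] LaurentSeries ℂ ⊗[ℂ] (V ⊗[ℂ] V)) : Prop :=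
  extendScalars mulXZ (leg12 (changeScalars substX S)) ∘ₗ
      extendScalars mulXZ (leg13 (changeScalars substXZ S)) ∘ₗ
      leg23 (changeScalars substZ S) =
    extendScalars mulXZ (leg23 (changeScalars substZ S)) ∘ₗ
      extendScalars mulXZ (leg13 (changeScalars substXZ S)) ∘ₗ
      leg12 (changeScalars substX S)

/-- `𝒮²¹(x) = σ 𝒮(x) σ`, where `σ` is the flip on `V ⊗ V`. -/
def flip21 (S : V ⊗[ℂ] V →ₗ[ℂ] LaurentSeries ℂ ⊗[ℂ] (V ⊗[ℂ] V)) :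
    V ⊗[ℂ] V →ₗ[ℂ] LaurentSeries ℂ ⊗[ℂ] (V ⊗[ℂ] V) :=
  (TensorProduct.comm ℂ V V).toLinearMap.lTensor (LaurentSeries ℂ) ∘ₗ S ∘ₗ
    (TensorProduct.comm ℂ V V).toLinearMap

/-- Unitarity `𝒮(x) 𝒮²¹(-x) = 1`. -/
def IsUnitary (S : V ⊗[ℂ] V →ₗ[ℂ] LaurentSeries ℂ ⊗[ℂ] (V ⊗[ℂ] V)) : Prop :=
  ∀ p : V ⊗[ℂ] V, extendScalars mulX S (changeScalars negX (flip21 S) p) = 1 ⊗ₜ p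

/-- The operator `𝒟` on `V`: `𝒟 v` is the coefficient of `x` in `Y (v, x) 1`. -/
def Dop (vac : V) (Y : V →ₗ[ℂ] VertexOperator ℂ V) : V →ₗ[ℂ] V where
  toFun v := (Y v).coeff 1 vac
  map_add' _ _ := by simp
  map_smul' _ _ := by simp

/-- The map `Y(x) : V ⊗ V ⊗ ℂ((x)) → V((x))`, `u ⊗ v ⊗ f ↦ f(x) Y (u, x) v`. -/
def Yx (Y : V →ₗ[ℂ] VertexOperator ℂ V) :
    LaurentSeries ℂ ⊗[ℂ] (V ⊗[ℂ] V) →ₗ[ℂ] LaurentSeries V :=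
  TensorProduct.lift
    ((mulSeries (LinearMap.lsmul ℂ V)).compl₂ (TensorProduct.lift (series Y)))

/-- The map `Y(z) ⊗ 1 : V ⊗ V ⊗ V ⊗ ℂ((x))((z)) → (V ⊗ V ⊗ ℂ((x)))((z))`,
`u ⊗ v ⊗ w ⊗ g ↦ g(x, z) (Y (u, z) v ⊗ w)`. -/
def YzOne (Y : V →ₗ[ℂ] VertexOperator ℂ V) :
    LaurentSeries (LaurentSeries ℂ) ⊗[ℂ] ((V ⊗[ℂ] V) ⊗[ℂ] V) →ₗ[ℂ]
      LaurentSeries (LaurentSeries ℂ ⊗[ℂ] (V ⊗[ℂ] V)) :=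
  TensorProduct.lift
    ((mulSeries (M := LaurentSeries ℂ) (N := V ⊗[ℂ] V) (P := LaurentSeries ℂ ⊗[ℂ] (V ⊗[ℂ] V))
      (TensorProduct.mk ℂ (LaurentSeries ℂ) (V ⊗[ℂ] V))).compl₂
      (TensorProduct.lift ((mapCoeff (M := V) (N := V ⊗[ℂ] V) ∘ₗ (TensorProduct.mk ℂ V V).flip).flip ∘ₗ
        TensorProduct.lift (series Y))))

/-- A quantum vertex algebra structure `(V, Y, 1, 𝒮)` on `V`. -/
structure IsQuantumVertexAlgebra (vac : V) (Y : V →ₗ[ℂ] VertexOperator ℂ V)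
    (S : V ⊗[ℂ] V →ₗ[ℂ] LaurentSeries ℂ ⊗[ℂ] (V ⊗[ℂ] V)) : Prop
    extends IsWeakQuantumVertexAlgebra vac Y where
  yang_baxter : IsYangBaxter S
  unitary : IsUnitary S
  /-- `𝒮(x) (1 ⊗ v) = 1 ⊗ v` -/
  S_vacuum : ∀ v : V, S (vac ⊗ₜ v) = 1 ⊗ₜ (vac ⊗ₜ v)
  /-- `[𝒟 ⊗ 1, 𝒮(x)] = - d/dx 𝒮(x)` -/
  S_derivative : ∀ p : V ⊗[ℂ] V,
    ((Dop vac Y).rTensor V).lTensor (LaurentSeries ℂ) (S p) - S ((Dop vac Y).rTensor V p) =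
      - (LaurentSeries.derivative ℂ).rTensor (V ⊗[ℂ] V) (S p)
  /-- `Y (u, x) v = e ^ (x 𝒟) Y(-x) 𝒮(-x) (v ⊗ u)`, compared at `x ^ n` -/
  S_skew_symmetry : ∀ (u v : V) (n : ℤ), (Y u).coeff n v =
    ∑ᶠ a : ℕ, (a.factorial : ℂ)⁻¹ •
      ((Dop vac Y) ^ a) ((negX (Yx Y (S (v ⊗ₜ u)))).coeff (n - a))
  /-- `𝒮(x) (Y(z) ⊗ 1) = (Y(z) ⊗ 1) 𝒮²³(x) 𝒮¹³(x + z)`, compared at `z ^ n` -/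
  hexagon : ∀ (u v w : V) (n : ℤ),
    S ((Y u).coeff n v ⊗ₜ w) =
      (YzOne Y (extendScalars mulXZ (leg23 (changeScalars substX S))
        (leg13 (changeScalars substXZ S) ((u ⊗ₜ v) ⊗ₜ w)))).coeff n

end Vertex

/-! ## The Lie algebra `B̂_q` and its vacuum module -/

/-- The Laurent expansion at `x = 0` of `a e ^ x / (1 - a e ^ x) ^ 2`. -/
def ratExp (a : ℂ) : LaurentSeries ℂ :=
  a • ((PowerSeries.exp ℂ : PowerSeries ℂ) : LaurentSeries ℂ) /
    (1 - a • ((PowerSeries.exp ℂ : PowerSeries ℂ) : LaurentSeries ℂ)) ^ 2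

/-- The series `f_n(x) ∈ ℂ((x))`, the Laurent expansion at `x = 0` of
`q ^ (n + 1) e ^ x / (1 - q ^ (n + 1) e ^ x) ^ 2 - q ^ (n - 1) e ^ x / (1 - q ^ (n - 1) e ^ x) ^ 2`.
-/
def fSeries (q : ℂ) (n : ℤ) : LaurentSeries ℂ :=
  ratExp (q ^ (n + 1)) - ratExp (q ^ (n - 1))

/-- The coefficient of `x₁ ^ (-m - 1) x₂ ^ (-n - 1)` in
`f_{r - s} (-x₂ + x₁) + (δ_{r,s} - δ_{r,s+1}) ∂/∂x₂ (x₁⁻¹ δ(x₂ / x₁))`, where the first term is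
expanded in nonnegative powers of `x₁` and `x₁⁻¹ δ(x₂ / x₁) = ∑_{m ∈ ℤ} x₁ ^ (-m - 1) x₂ ^ m`. -/
def structureConst (q : ℂ) (r s m n : ℤ) : ℂ :=
  expandSub (negX (fSeries q (r - s))) (-m - 1) (-n - 1) +
    ((if r = s then 1 else 0) - (if r = s + 1 then 1 else 0)) *
      (if m - 1 = -n - 1 then (m : ℂ) else 0)

/-- The generators `β⁽ʳ⁾_m` and `c`. -/
inductive Gen : Type
  | beta (r m : ℤ) : Gen
  | c : Gen

/-- The defining relations of `B̂_q`: `c` is central and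
`[β⁽ʳ⁾_m, β⁽ˢ⁾_n] = structureConst q r s m n • c`. -/
def relations (q : ℂ) : Set (FreeLieAlgebra ℂ Gen) :=
  {x | ∃ g : Gen, x = ⁅FreeLieAlgebra.of ℂ Gen.c, FreeLieAlgebra.of ℂ g⁆} ∪
  {x | ∃ r s m n : ℤ,
    x = ⁅FreeLieAlgebra.of ℂ (Gen.beta r m), FreeLieAlgebra.of ℂ (Gen.beta s n)⁆ -
      structureConst q r s m n • FreeLieAlgebra.of ℂ Gen.c}

/-- The Lie algebra `B̂_q`, given by generators and relations. -/
def BHat (q : ℂ) : Type :=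
  FreeLieAlgebra ℂ Gen ⧸ LieSubmodule.lieSpan ℂ (FreeLieAlgebra ℂ Gen) (relations q)

instance (q : ℂ) : LieRing (BHat q) :=
  inferInstanceAs (LieRing
    (FreeLieAlgebra ℂ Gen ⧸ LieSubmodule.lieSpan ℂ (FreeLieAlgebra ℂ Gen) (relations q)))

instance (q : ℂ) : LieAlgebra ℂ (BHat q) :=
  inferInstanceAs (LieAlgebra ℂ
    (FreeLieAlgebra ℂ Gen ⧸ LieSubmodule.lieSpan ℂ (FreeLieAlgebra ℂ Gen) (relations q)))

/-- The image of a generator in `B̂_q`. -/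
def gen (q : ℂ) (g : Gen) : BHat q :=
  LieSubmodule.Quotient.mk (FreeLieAlgebra.of ℂ g)

/-- The element `β⁽ʳ⁾_m` of `B̂_q`. -/
def beta (q : ℂ) (r m : ℤ) : BHat q := gen q (Gen.beta r m)

/-- The element `c` of `B̂_q`. -/
def cent (q : ℂ) : BHat q := gen q Gen.c

/-- A `B̂_q`-module is restricted if for all `w` and `r`, `β⁽ʳ⁾_n w = 0` for `n` large. -/
def IsRestricted (q : ℂ) (W : Type*) [AddCommGroup W] [LieRingModule (BHat q) W] : Prop :=
  ∀ (w : W) (r : ℤ), ∃ N : ℤ, ∀ n : ℤ, N ≤ n → ⁅beta q r n, w⁆ = 0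

/-- A `B̂_q`-module has level `ℓ` if `c` acts as the scalar `ℓ`. -/
def HasLevel (q ℓ : ℂ) (W : Type*) [AddCommGroup W] [Module ℂ W] [LieRingModule (BHat q) W] :
    Prop :=
  ∀ w : W, ⁅cent q, w⁆ = ℓ • w

/-- The left ideal of `U(B̂_q)` generated by the `β⁽ʳ⁾_n` with `n ≥ 0` and by `c - ℓ`. -/
def vacuumIdeal (q ℓ : ℂ) : Submodule (UniversalEnvelopingAlgebra ℂ (BHat q))
    (UniversalEnvelopingAlgebra ℂ (BHat q)) :=
  Submodule.span _
    ({x | ∃ r n : ℤ, 0 ≤ n ∧ x = UniversalEnvelopingAlgebra.ι ℂ (beta q r n)} ∪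
      {UniversalEnvelopingAlgebra.ι ℂ (cent q) - algebraMap ℂ _ ℓ})

/-- The induced module `V(ℓ, 0) = U(B̂_q) ⊗_{U(B̂_q⁺ + ℂ c)} ℂ_ℓ`. Since `ℂ_ℓ` is the quotient of
`U(B̂_q⁺ + ℂ c)` by the left ideal generated by `B̂_q⁺` and `c - ℓ`, the induced module is the
quotient of `U(B̂_q)` by the left ideal generated by these elements. -/
def VacuumModule (q ℓ : ℂ) : Type :=
  UniversalEnvelopingAlgebra ℂ (BHat q) ⧸ vacuumIdeal q ℓ

instance (q ℓ : ℂ) : AddCommGroup (VacuumModule q ℓ) :=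
  inferInstanceAs (AddCommGroup (UniversalEnvelopingAlgebra ℂ (BHat q) ⧸ vacuumIdeal q ℓ))

instance (q ℓ : ℂ) : Module ℂ (VacuumModule q ℓ) :=
  inferInstanceAs (Module ℂ (UniversalEnvelopingAlgebra ℂ (BHat q) ⧸ vacuumIdeal q ℓ))

instance (q ℓ : ℂ) : Module (UniversalEnvelopingAlgebra ℂ (BHat q)) (VacuumModule q ℓ) :=
  inferInstanceAs (Module (UniversalEnvelopingAlgebra ℂ (BHat q))
    (UniversalEnvelopingAlgebra ℂ (BHat q) ⧸ vacuumIdeal q ℓ))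

instance (q ℓ : ℂ) : IsScalarTower ℂ (UniversalEnvelopingAlgebra ℂ (BHat q)) (VacuumModule q ℓ) :=
  inferInstanceAs (IsScalarTower ℂ (UniversalEnvelopingAlgebra ℂ (BHat q))
    (UniversalEnvelopingAlgebra ℂ (BHat q) ⧸ vacuumIdeal q ℓ))

/-- The action of `B̂_q` on `V(ℓ, 0)` by left multiplication. -/
instance (q ℓ : ℂ) : LieRingModule (BHat q) (VacuumModule q ℓ) where
  bracket x v := UniversalEnvelopingAlgebra.ι ℂ x • v
  add_lie x y v := by simp [add_smul]
  lie_add x v w := by simp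
  leibniz_lie x y v := by
    change UniversalEnvelopingAlgebra.ι ℂ x • UniversalEnvelopingAlgebra.ι ℂ y • v =
      UniversalEnvelopingAlgebra.ι ℂ ⁅x, y⁆ • v +
        UniversalEnvelopingAlgebra.ι ℂ y • UniversalEnvelopingAlgebra.ι ℂ x • v
    let _ : LieRing (UniversalEnvelopingAlgebra ℂ (BHat q)) := LieRing.ofAssociativeRing
    rw [LieHom.map_lie, LieRing.of_associative_ring_bracket, sub_smul, mul_smul, mul_smul,
      sub_add_cancel]

instance (q ℓ : ℂ) : LieModule ℂ (BHat q) (VacuumModule q ℓ) where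
  smul_lie t x v := by
    change UniversalEnvelopingAlgebra.ι ℂ (t • x) • v = t • UniversalEnvelopingAlgebra.ι ℂ x • v
    simp
  lie_smul t x v := by
    change UniversalEnvelopingAlgebra.ι ℂ x • t • v = t • UniversalEnvelopingAlgebra.ι ℂ x • v
    exact smul_comm _ _ _

/-- The vacuum vector `1 = 1 ⊗ 1` of `V(ℓ, 0)`. -/
def vac (q ℓ : ℂ) : VacuumModule q ℓ := (vacuumIdeal q ℓ).mkQ 1

/-- The vector `β⁽ʳ⁾ = β⁽ʳ⁾_{-1} 1` of `V(ℓ, 0)`. -/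
def betaVec (q ℓ : ℂ) (r : ℤ) : VacuumModule q ℓ := ⁅beta q r (-1), vac q ℓ⁆

/-- The vertex operator `A` on the `B̂_q`-module `W` is the generating function
`β⁽ʳ⁾(x) = ∑_{m ∈ ℤ} β⁽ʳ⁾_m x ^ (-m - 1)`. -/
def IsBetaField (q : ℂ) (r : ℤ) {W : Type*} [AddCommGroup W] [Module ℂ W]
    [LieRingModule (BHat q) W] (A : VertexOperator ℂ W) : Prop :=
  ∀ (m : ℤ) (w : W), A.ncoeff m w = ⁅beta q r m, w⁆

end QVA

end

set_option linter.unusedSectionVars false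

noncomputable section

namespace QVA

/-! ### The universal property of the vacuum module and induction on its vectors. -/

section Universal

attribute [local instance] LieRing.ofAssociativeRing

variable {q ℓ : ℂ} {M : Type*} [AddCommGroup M] [Module ℂ M]

/-! Write V for the vacuum module. Everything rests on its universal property (`vacLift`): operators
on M that satisfy the defining relations at level ℓ, together with a vector killed by those of
nonnegative mode, give a linear map V → M. With the matching principle `vacuum_induction`, this
replaces a PBW basis, which is never used.

Vertex operators. On Hom(W, W((x))), for W restricted of level ℓ, let β⁽ʳ⁾_m act by φ ↦ Res_{x₁}((x₁
- x)ᵐ β⁽ʳ⁾(x₁)φ(x) - (-x + x₁)ᵐ φ(x)β⁽ʳ⁾(x₁)). These operators satisfy the relations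
(`fieldMode_comm`), because the structure constants come from functions of x₁ - x₂
(`structureConst_translation`) and the nonnegative modes commute. The identity field is killed by
the nonnegative modes, so sending the vacuum to it defines Y_W (`fieldMap`), and W = V gives Y. Weak
associativity is proved by induction on the first vector (`eqvMod_prodSeries_iterSeries`): applying
β_m to it changes both sides by the same three kinds of terms, up to the direction in which powers
of x₀ + x₂ are expanded. Conversely, associativity for the vectors β⁽ʳ⁾ forces this recursion, which
is uniqueness (`eq_fieldOp`); a structure on V is a module over itself, so both uniqueness claims
are covered.

The operator 𝒮. Let ∂_{r,m} be the derivative with respect to the creation operator β⁽ʳ⁾_m, m < 0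
(`grad`). Formally, 𝒮(x) = exp(∑ κ ∂ ⊗ ∂), where κ collects the modes of ℓ f_{r-s}(-x + x₁ - x₂).
Precisely, 𝒮 is the unique operator that fixes N ⊗ 1 and shifts each β_m on the second factor by a
constant-coefficient derivation on the first (`IsTwist`). The shifts of such twists add under
composition and they commute when their shifts do, so the Yang-Baxter equation and unitarity follow
from uniqueness. The link with Y is the commutator formula `adField_vacField`: besides the usual
terms ∑ⱼ (m choose j) x^{m-j} Y(β_j a, x), the bracket [β_m, Y(a, x)] contains the derivation with
coefficients κ, and the shift in 𝒮 is made to absorb it. This gives skew symmetry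
(`skewSymmetry_Sop`) and 𝒮-locality (`exists_mulLin_pow_prodSeries_eq`). The hexagon identity says
how derivations act on Y(u, z)v (`mapCoeff_der`).

The hypothesis on q enters through the poles at 0: f_n has one exactly for n = ±1, and it is a
double pole without residue. This matches the delta functions in the relations and makes the
structure constants antisymmetric (`structureConst_antisymm`), hence V ≠ 0 by a Fock space action
(`vac_ne_zero`).

Nonzero level. For m ≥ 0, β⁽ʳ⁾_m acts as ℓm(∂_{r,-m} - ∂_{r-1,-m}) (`beta_eq_grad`). If all positive
modes kill v, then ∂_{r,n}v does not depend on r, hence is zero, since only finitely many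
derivatives of v are nonzero; an Euler operator then shows that v is a multiple of the vacuum
(`mem_span_vac`). So a nonzero subspace of U ⊗ V stable under the annihilation operators contains
some nonzero a ⊗ 1 (`exists_tmul_vac_mem`). Irreducibility follows. The kernel of f ⊗ u ⊗ v ↦ f Y(u,
x)v is stable under annihilation in both factors, and it contains no nonzero f ⊗ 1 ⊗ 1, so this map
is injective (`Yx_injective`). Iteration gives non-degeneracy, and 𝒮 is unique because skew symmetry
determines Y(x)𝒮(x)(v ⊗ u). -/

/-- The images of the generators in a representation of level `ℓ`. -/
def genAct (ℓ : ℂ) (T : ℤ → ℤ → Module.End ℂ M) : Gen → Module.End ℂ M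
  | Gen.beta r m => T r m
  | Gen.c => ℓ • 1

theorem lift_genAct_relations (T : ℤ → ℤ → Module.End ℂ M)
    (hT : ∀ r s m n, T r m * T s n - T s n * T r m = (structureConst q r s m n * ℓ) • 1)
    (x : FreeLieAlgebra ℂ Gen)
    (hx : x ∈ LieSubmodule.lieSpan ℂ (FreeLieAlgebra ℂ Gen) (relations q)) :
    FreeLieAlgebra.lift ℂ (genAct ℓ T) x = 0 := by
  have : LieSubmodule.lieSpan ℂ (FreeLieAlgebra ℂ Gen) (relations q) ≤
      (FreeLieAlgebra.lift ℂ (genAct ℓ T)).ker := by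
    rw [LieSubmodule.lieSpan_le]
    rintro x (⟨g, rfl⟩ | ⟨r, s, m, n, rfl⟩)
    · simp only [SetLike.mem_coe, LieHom.mem_ker, LieHom.map_lie, FreeLieAlgebra.lift_of_apply]
      cases g <;> simp [genAct, LieRing.of_associative_ring_bracket]
    · simp only [SetLike.mem_coe, LieHom.mem_ker, LieHom.map_lie, FreeLieAlgebra.lift_of_apply,
        map_sub, map_smul]
      simp [genAct, LieRing.of_associative_ring_bracket, hT, smul_smul]
  exact LieHom.mem_ker.1 (this hx)

/-- The representation of `B̂_q` given by operators satisfying the defining relations. -/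
def repHom (T : ℤ → ℤ → Module.End ℂ M)
    (hT : ∀ r s m n, T r m * T s n - T s n * T r m = (structureConst q r s m n * ℓ) • 1) :
    BHat q →ₗ⁅ℂ⁆ Module.End ℂ M where
  toLinearMap := Submodule.liftQ
    (LieSubmodule.lieSpan ℂ (FreeLieAlgebra ℂ Gen) (relations q)).toSubmodule
    (FreeLieAlgebra.lift ℂ (genAct ℓ T)).toLinearMap
    (fun x hx => lift_genAct_relations T hT x hx)
  map_lie' := by
    intro x y
    obtain ⟨x, rfl⟩ := Submodule.Quotient.mk_surjective _ x
    obtain ⟨y, rfl⟩ := Submodule.Quotient.mk_surjective _ y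
    exact (FreeLieAlgebra.lift ℂ (genAct ℓ T)).map_lie x y

theorem repHom_gen (T : ℤ → ℤ → Module.End ℂ M)
    (hT : ∀ r s m n, T r m * T s n - T s n * T r m = (structureConst q r s m n * ℓ) • 1) (g : Gen) :
    repHom T hT (gen q g) = genAct ℓ T g :=
  FreeLieAlgebra.lift_of_apply (genAct ℓ T) g

/-- The map out of the vacuum module determined by a vacuum-like vector. -/
def vacLift (T : ℤ → ℤ → Module.End ℂ M)
    (hT : ∀ r s m n, T r m * T s n - T s n * T r m = (structureConst q r s m n * ℓ) • 1)
    (w : M) (hw : ∀ r m, 0 ≤ m → T r m w = 0) : VacuumModule q ℓ →ₗ[ℂ] M :=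
  Submodule.liftQ ((vacuumIdeal q ℓ).restrictScalars ℂ)
    ((LinearMap.applyₗ w) ∘ₗ (UniversalEnvelopingAlgebra.lift ℂ (repHom T hT)).toLinearMap) (by
      intro x hx
      have hx' : x ∈ vacuumIdeal q ℓ := hx
      rw [LinearMap.mem_ker]
      change UniversalEnvelopingAlgebra.lift ℂ (repHom T hT) x w = 0
      refine Submodule.span_induction (p := fun x _ =>
        UniversalEnvelopingAlgebra.lift ℂ (repHom T hT) x w = 0) ?_ ?_ ?_ ?_ hx'
      · rintro x (⟨r, n, hn, rfl⟩ | rfl)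
        · rw [UniversalEnvelopingAlgebra.lift_ι_apply, beta, repHom_gen]
          exact hw r n hn
        · rw [map_sub, UniversalEnvelopingAlgebra.lift_ι_apply, cent, repHom_gen, AlgHom.commutes]
          simp [genAct, Module.algebraMap_end_apply]
      · simp
      · intro x y _ _ hx hy
        simp [hx, hy]
      · intro a x _ hx
        simp [hx])

theorem vacLift_vac (T : ℤ → ℤ → Module.End ℂ M) (hT) (w : M) (hw) :
    vacLift (q := q) (ℓ := ℓ) T hT w hw (vac q ℓ) = w := by
  change UniversalEnvelopingAlgebra.lift ℂ (repHom T hT) 1 w = w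
  simp

theorem vacLift_beta (T : ℤ → ℤ → Module.End ℂ M) (hT) (w : M) (hw) (r m : ℤ)
    (v : VacuumModule q ℓ) :
    vacLift (q := q) (ℓ := ℓ) T hT w hw ⁅beta q r m, v⁆ = T r m (vacLift T hT w hw v) := by
  obtain ⟨a, rfl⟩ := Submodule.Quotient.mk_surjective (vacuumIdeal q ℓ) v
  change UniversalEnvelopingAlgebra.lift ℂ (repHom T hT)
    (UniversalEnvelopingAlgebra.ι ℂ (beta q r m) * a) w =
    T r m (UniversalEnvelopingAlgebra.lift ℂ (repHom T hT) a w)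
  rw [map_mul, UniversalEnvelopingAlgebra.lift_ι_apply, beta, repHom_gen]
  rfl

/-- The free Lie algebra maps to L by freeness; followed by the inclusion this agrees with the
quotient map on generators, hence everywhere. -/
theorem bhat_subalgebra_eq_top (L : LieSubalgebra ℂ (BHat q)) (h : ∀ g, gen q g ∈ L) (x : BHat q) :
    x ∈ L := by
  let π : FreeLieAlgebra ℂ Gen →ₗ⁅ℂ⁆ BHat q :=
    { toLinearMap := Submodule.mkQ
        (LieSubmodule.lieSpan ℂ (FreeLieAlgebra ℂ Gen) (relations q)).toSubmodule
      map_lie' := by intro x y; rfl }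
  obtain ⟨y, rfl⟩ : ∃ y, π y = x := Submodule.mkQ_surjective _ x
  have : L.incl.comp (FreeLieAlgebra.lift ℂ fun g => (⟨gen q g, h g⟩ : L)) = π := by
    apply FreeLieAlgebra.hom_ext
    intro g
    rw [LieHom.comp_apply, FreeLieAlgebra.lift_of_apply]
    rfl
  rw [← this]
  exact Subtype.property _

/-- The map B̂_q → U lifts to the enveloping algebra, and its composite with the inclusion of U is
the identity, again by uniqueness of lifts. -/
theorem enveloping_subalgebra_eq_top
    (U : Subalgebra ℂ (UniversalEnvelopingAlgebra ℂ (BHat q)))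
    (h : ∀ g, UniversalEnvelopingAlgebra.ι ℂ (gen q g) ∈ U)
    (a : UniversalEnvelopingAlgebra ℂ (BHat q)) : a ∈ U := by
  have hx : ∀ x : BHat q, UniversalEnvelopingAlgebra.ι ℂ x ∈ U := by
    let L : LieSubalgebra ℂ (BHat q) :=
      { (U.toSubmodule.comap (UniversalEnvelopingAlgebra.ι ℂ (L := BHat q)).toLinearMap) with
        lie_mem' := by
          intro x y hx hy
          change UniversalEnvelopingAlgebra.ι ℂ ⁅x, y⁆ ∈ U
          rw [LieHom.map_lie, LieRing.of_associative_ring_bracket]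
          exact U.sub_mem (U.mul_mem hx hy) (U.mul_mem hy hx) }
    exact bhat_subalgebra_eq_top L h
  let f : BHat q →ₗ⁅ℂ⁆ U :=
    { toFun := fun x => ⟨UniversalEnvelopingAlgebra.ι ℂ x, hx x⟩
      map_add' := by intros; ext; simp
      map_smul' := by intros; ext; simp
      map_lie' := by
        intro x y
        ext
        simp [LieRing.of_associative_ring_bracket] }
  have : U.val.comp (UniversalEnvelopingAlgebra.lift ℂ f) = AlgHom.id ℂ _ := by
    apply UniversalEnvelopingAlgebra.hom_ext
    ext x
    simp [f]
  have ha := congrArg (fun F => F a) this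
  simp only [AlgHom.comp_apply, AlgHom.id_apply] at ha
  rw [← ha]
  exact Subtype.property _

/-- The elements of the enveloping algebra that preserve X form a subalgebra containing all
generators. -/
theorem vacuum_span_gen (X : Submodule ℂ (VacuumModule q ℓ)) (h0 : vac q ℓ ∈ X)
    (h : ∀ g, ∀ v ∈ X, ⁅gen q g, v⁆ ∈ X) (v : VacuumModule q ℓ) : v ∈ X := by
  let U : Subalgebra ℂ (UniversalEnvelopingAlgebra ℂ (BHat q)) :=
    { carrier := {a | ∀ v ∈ X, a • v ∈ X}
      mul_mem' := fun {a b} ha hb v hv => by rw [mul_smul]; exact ha _ (hb _ hv)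
      add_mem' := fun {a b} ha hb v hv => by rw [add_smul]; exact X.add_mem (ha _ hv) (hb _ hv)
      algebraMap_mem' := fun c v hv => by rw [algebraMap_smul]; exact X.smul_mem c hv }
  obtain ⟨a, rfl⟩ := Submodule.Quotient.mk_surjective (vacuumIdeal q ℓ) v
  have ha : a ∈ U := enveloping_subalgebra_eq_top U (fun g v hv => h g v hv) a
  have := ha _ h0
  have h1 : a • vac q ℓ = Submodule.Quotient.mk a := by
    change Submodule.Quotient.mk (a * 1) = _
    rw [mul_one]
  rwa [h1] at this

theorem gen_c_lie (g : Gen) : ⁅cent q, gen q g⁆ = 0 := by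
  change LieSubmodule.Quotient.mk (N := LieSubmodule.lieSpan ℂ (FreeLieAlgebra ℂ Gen) (relations q))
    ⁅FreeLieAlgebra.of ℂ Gen.c, FreeLieAlgebra.of ℂ g⁆ = _
  apply (LieSubmodule.Quotient.mk_eq_zero' ..).2
  exact LieSubmodule.subset_lieSpan (Or.inl ⟨g, rfl⟩)

theorem beta_lie_beta (r s m n : ℤ) :
    ⁅beta q r m, beta q s n⁆ = structureConst q r s m n • cent q := by
  rw [← sub_eq_zero]
  change LieSubmodule.Quotient.mk (N := LieSubmodule.lieSpan ℂ (FreeLieAlgebra ℂ Gen) (relations q))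
    (⁅FreeLieAlgebra.of ℂ (Gen.beta r m), FreeLieAlgebra.of ℂ (Gen.beta s n)⁆ -
      structureConst q r s m n • FreeLieAlgebra.of ℂ Gen.c) = _
  apply (LieSubmodule.Quotient.mk_eq_zero' ..).2
  exact LieSubmodule.subset_lieSpan (Or.inr ⟨r, s, m, n, rfl⟩)

theorem beta_vac (r m : ℤ) (hm : 0 ≤ m) : ⁅beta q r m, vac q ℓ⁆ = 0 := by
  change (vacuumIdeal q ℓ).mkQ (UniversalEnvelopingAlgebra.ι ℂ (beta q r m) * 1) = 0
  rw [mul_one, Submodule.mkQ_apply, Submodule.Quotient.mk_eq_zero]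
  exact Submodule.subset_span (Or.inl ⟨r, m, hm, rfl⟩)

theorem cent_vac : ⁅cent q, vac q ℓ⁆ = ℓ • vac q ℓ := by
  rw [← sub_eq_zero]
  change (vacuumIdeal q ℓ).mkQ (UniversalEnvelopingAlgebra.ι ℂ (cent q) * 1) -
    ℓ • (vacuumIdeal q ℓ).mkQ 1 = 0
  have : ℓ • (vacuumIdeal q ℓ).mkQ 1 =
      (vacuumIdeal q ℓ).mkQ (algebraMap ℂ (UniversalEnvelopingAlgebra ℂ (BHat q)) ℓ) := by
    rw [Algebra.algebraMap_eq_smul_one]; rfl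
  rw [mul_one, this, ← map_sub, Submodule.mkQ_apply, Submodule.Quotient.mk_eq_zero]
  exact Submodule.subset_span (Or.inr rfl)

/-- The central element commutes with the generators, so the eigenspace containing the vacuum is
stable under them. -/
theorem hasLevel_vacuumModule : HasLevel q ℓ (VacuumModule q ℓ) := by
  intro v
  let X : Submodule ℂ (VacuumModule q ℓ) :=
    { carrier := {v | ⁅cent q, v⁆ = ℓ • v}
      add_mem' := fun {a b} ha hb => by
        simp only [Set.mem_ofPred_eq] at *; rw [lie_add, ha, hb, smul_add]
      zero_mem' := by simp
      smul_mem' := fun c v hv => by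
        simp only [Set.mem_ofPred_eq] at *; rw [lie_smul, hv, smul_comm] }
  refine vacuum_span_gen X cent_vac (fun g v hv => ?_) v
  change ⁅cent q, ⁅gen q g, v⁆⁆ = ℓ • ⁅gen q g, v⁆
  rw [leibniz_lie, gen_c_lie, zero_lie, zero_add, show ⁅cent q, v⁆ = ℓ • v from hv, lie_smul]

theorem vacuum_span (X : Submodule ℂ (VacuumModule q ℓ)) (h0 : vac q ℓ ∈ X)
    (h : ∀ r m, ∀ v ∈ X, ⁅beta q r m, v⁆ ∈ X) (v : VacuumModule q ℓ) : v ∈ X := by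
  refine vacuum_span_gen X h0 (fun g v hv => ?_) v
  cases g with
  | beta r m => exact h r m v hv
  | c =>
    have : ⁅gen q Gen.c, v⁆ = ℓ • v := hasLevel_vacuumModule v
    rw [this]
    exact X.smul_mem _ hv

-- The basic tool for statements about all vectors: it plays the role of a PBW spanning set, without
-- any ordering of the modes.
@[elab_as_elim]
theorem vacuum_induction {P : VacuumModule q ℓ → Prop} (h0 : P (vac q ℓ))
    (hβ : ∀ r m v, P v → P ⁅beta q r m, v⁆) (hadd : ∀ u v, P u → P v → P (u + v))
    (hsmul : ∀ (c : ℂ) v, P v → P (c • v)) (v : VacuumModule q ℓ) : P v := by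
  have hzero : P 0 := by simpa using hsmul 0 _ h0
  exact vacuum_span (X := { carrier := {v | P v}
                            add_mem' := fun ha hb => hadd _ _ ha hb
                            zero_mem' := hzero
                            smul_mem' := fun c v hv => hsmul c v hv }) h0 hβ v

/-- The operator by which `β⁽ʳ⁾_m` acts on a module. -/
def betaOp (q : ℂ) (W : Type*) [AddCommGroup W] [Module ℂ W] [LieRingModule (BHat q) W]
    [LieModule ℂ (BHat q) W] (r m : ℤ) : Module.End ℂ W :=
  LieModule.toEnd ℂ (BHat q) W (beta q r m)

theorem betaOp_apply {W : Type*} [AddCommGroup W] [Module ℂ W] [LieRingModule (BHat q) W]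
    [LieModule ℂ (BHat q) W] (r m : ℤ) (w : W) : betaOp q W r m w = ⁅beta q r m, w⁆ := rfl

theorem betaOp_comm {W : Type*} [AddCommGroup W] [Module ℂ W] [LieRingModule (BHat q) W]
    [LieModule ℂ (BHat q) W] (hW : HasLevel q ℓ W) (r s m n : ℤ) (w : W) :
    betaOp q W r m (betaOp q W s n w) =
      betaOp q W s n (betaOp q W r m w) + (structureConst q r s m n * ℓ) • w := by
  simp only [betaOp_apply]
  rw [leibniz_lie, beta_lie_beta, smul_lie, hW, smul_smul, add_comm]

end Universal

end QVA

namespace QVA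

/-! ### Binomial coefficients with integer upper index, as complex numbers. -/

section Binomial

/-- The binomial coefficient of an integer, as a complex number. -/
def bc (m : ℤ) (k : ℕ) : ℂ := ((Ring.choose m k : ℤ) : ℂ)

@[simp] theorem bc_zero (m : ℤ) : bc m 0 = 1 := by simp [bc]

@[simp] theorem bc_one (m : ℤ) : bc m 1 = m := by simp [bc]

theorem bc_natCast (n k : ℕ) : bc n k = (n.choose k : ℂ) := by
  simp [bc, Ring.choose_natCast]

theorem bc_natCast_of_lt {n k : ℕ} (h : n < k) : bc n k = 0 := by
  rw [bc_natCast, Nat.choose_eq_zero_of_lt h, Nat.cast_zero]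

theorem bc_succ_succ (m : ℤ) (k : ℕ) : bc (m + 1) (k + 1) = bc m k + bc m (k + 1) := by
  simp [bc, Ring.choose_succ_succ]

theorem bc_mul_bc_add (m : ℤ) (k a : ℕ) :
    bc m k * bc (m - k) a = ((k + a).choose k : ℂ) * bc m (k + a) := by
  have := Ring.choose_smul_choose m (Nat.le_add_right k a)
  rw [Nat.add_sub_cancel_left] at this
  rw [bc, bc, bc, ← Int.cast_mul, ← this]
  push_cast [nsmul_eq_mul]
  rfl

theorem bc_mul_bc_comm (m : ℤ) (k a : ℕ) : bc m k * bc (m - k) a = bc m a * bc (m - a) k := by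
  rw [bc_mul_bc_add, bc_mul_bc_add, add_comm a k, Nat.choose_symm_add]

theorem succ_mul_bc_succ (m : ℤ) (k : ℕ) : ((k : ℂ) + 1) * bc m (k + 1) = bc m k * (m - k) := by
  have := bc_mul_bc_add m k 1
  rw [bc_one, Nat.choose_succ_self_right] at this
  push_cast at this
  exact this.symm

theorem succ_mul_bc_succ' (m : ℤ) (k : ℕ) : ((k : ℂ) + 1) * bc m (k + 1) = m * bc (m - 1) k := by
  have := bc_mul_bc_comm m 1 k
  rw [bc_one, bc_one, Nat.cast_one] at this
  rw [this, succ_mul_bc_succ]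
  push_cast
  ring

theorem bc_neg (m : ℤ) (k : ℕ) : bc (-m) k = (-1) ^ k * bc (m + k - 1) k := by
  rw [bc, Ring.choose_neg, bc, Units.smul_def, Int.negOnePow_def]
  simp

theorem bc_add (m n : ℤ) (k : ℕ) :
    bc (m + n) k = ∑ p ∈ Finset.HasAntidiagonal.antidiagonal k, bc m p.1 * bc n p.2 := by
  simp [bc, Ring.add_choose_eq k (Commute.all m n)]

end Binomial

/-! ### Exchange of finitely supported sums. -/

section Finsum

variable {M : Type*} [AddCommMonoid M]

theorem finsum_nat_eq_sum_range {f : ℕ → M} {N : ℕ} (h : ∀ k, N ≤ k → f k = 0) :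
    ∑ᶠ k, f k = ∑ k ∈ Finset.range N, f k := by
  refine finsum_eq_sum_of_support_subset _ fun k hk => ?_
  simp only [Finset.coe_range, Set.mem_Iio]
  by_contra hlt
  exact hk (h k (not_lt.1 hlt))

theorem finite_support_of_eventually_zero {f : ℕ → M} {N : ℕ} (h : ∀ k, N ≤ k → f k = 0) :
    (Function.support f).Finite :=
  (Set.finite_Iio N).subset fun k hk => by
    by_contra hlt
    exact hk (h k (not_lt.1 hlt))

theorem finsum_prod_eq {α β : Type*} {f : α → β → M}
    (h : (Function.support fun p : α × β => f p.1 p.2).Finite) :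
    ∑ᶠ a, ∑ᶠ b, f a b = ∑ᶠ p : α × β, f p.1 p.2 :=
  (finsum_curry (fun p : α × β => f p.1 p.2) h).symm

theorem finsum_comm_of_finite {α β : Type*} {f : α → β → M}
    (h : (Function.support fun p : α × β => f p.1 p.2).Finite) :
    ∑ᶠ a, ∑ᶠ b, f a b = ∑ᶠ b, ∑ᶠ a, f a b := by
  rw [finsum_prod_eq h, finsum_prod_eq (f := fun b a => f a b)]
  · exact finsum_eq_of_bijective (Prod.swap) Prod.swap_bijective (fun _ => rfl)
  · refine (h.image Prod.swap).subset ?_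
    rintro ⟨b, a⟩ hp
    exact ⟨(a, b), hp, rfl⟩

end Finsum

/-- The coefficientwise algebra structure on Laurent series. -/
@[reducible] def laurentAlgebra (A : Type*) [Ring A] [Algebra ℂ A] : Algebra ℂ (LaurentSeries A) :=
  HahnSeries.instAlgebra

attribute [local instance] laurentAlgebra

/-! ### Laurent series over an algebra acting on Laurent series over a module. -/

section SeriesAction

variable {A : Type*} [Ring A] [Algebra ℂ A] {M N P Q R S : Type*}
  [AddCommGroup M] [Module ℂ M] [AddCommGroup N] [Module ℂ N] [AddCommGroup P] [Module ℂ P]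
  [AddCommGroup Q] [Module ℂ Q] [AddCommGroup R] [Module ℂ R] [AddCommGroup S] [Module ℂ S]

@[simp] theorem mapCoeff_coeff (T : M →ₗ[ℂ] N) (f : LaurentSeries M) (n : ℤ) :
    (mapCoeff T f).coeff n = T (f.coeff n) := rfl

@[simp] theorem negX_coeff (f : LaurentSeries M) (n : ℤ) :
    (negX f).coeff n = (-1 : ℂ) ^ n • f.coeff n := rfl

theorem mulSeries_coeff (B : M →ₗ[ℂ] N →ₗ[ℂ] P) (f : LaurentSeries M) (g : LaurentSeries N)
    (n : ℤ) : (mulSeries B f g).coeff n = ∑ᶠ i : ℤ, B (f.coeff i) (g.coeff (n - i)) := rfl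

/-- The orders of f, g, k leave finitely many nonzero triple products in each degree, so the sums
may be exchanged and reindexed by (i, j) ↦ (i, i + j). -/
theorem mulSeries_assoc (B₁ : M →ₗ[ℂ] Q →ₗ[ℂ] R) (B₂ : N →ₗ[ℂ] P →ₗ[ℂ] Q) (B₃ : S →ₗ[ℂ] P →ₗ[ℂ] R)
    (B₄ : M →ₗ[ℂ] N →ₗ[ℂ] S) (h : ∀ a b c, B₁ a (B₂ b c) = B₃ (B₄ a b) c)
    (f : LaurentSeries M) (g : LaurentSeries N) (k : LaurentSeries P) :
    mulSeries B₁ f (mulSeries B₂ g k) = mulSeries B₃ (mulSeries B₄ f g) k := by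
  ext n
  simp only [mulSeries_coeff]
  have hfin : (Function.support fun p : ℤ × ℤ =>
      B₁ (f.coeff p.1) (B₂ (g.coeff p.2) (k.coeff (n - p.1 - p.2)))).Finite := by
    refine ((Set.finite_Icc f.order (n - g.order - k.order)).prod
      (Set.finite_Icc g.order (n - f.order - k.order))).subset ?_
    rintro ⟨i, j⟩ hp
    have h1 : f.order ≤ i := HahnSeries.order_le_of_coeff_ne_zero fun h0 => hp (by simp [h0])
    have h2 : g.order ≤ j := HahnSeries.order_le_of_coeff_ne_zero fun h0 => hp (by simp [h0])
    have h3 : k.order ≤ n - i - j :=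
      HahnSeries.order_le_of_coeff_ne_zero fun h0 => hp (by simp [h0])
    simp only [Set.mem_prod, Set.mem_Icc]
    omega
  have e1 : ∀ i, B₁ (f.coeff i) (∑ᶠ j, B₂ (g.coeff j) (k.coeff (n - i - j))) =
      ∑ᶠ j, B₁ (f.coeff i) (B₂ (g.coeff j) (k.coeff (n - i - j))) := fun i =>
    map_finsum _ (mulSeries_finite B₂ g k (n - i))
  have e2 : ∀ m, B₃ (∑ᶠ i, B₄ (f.coeff i) (g.coeff (m - i))) (k.coeff (n - m)) =
      ∑ᶠ i, B₁ (f.coeff i) (B₂ (g.coeff (m - i)) (k.coeff (n - m))) := fun m => by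
    rw [← LinearMap.flip_apply B₃, map_finsum _ (mulSeries_finite B₄ f g m)]
    simp [h]
  simp only [e1, e2]
  rw [finsum_prod_eq hfin, finsum_comm_of_finite, finsum_prod_eq]
  · refine finsum_eq_of_bijective (fun p : ℤ × ℤ => (p.1, p.1 + p.2)) ?_ ?_
    · refine Function.bijective_iff_has_inverse.2 ⟨fun p => (p.1, p.2 - p.1), ?_, ?_⟩
      · rintro ⟨i, j⟩; simp
      · rintro ⟨i, j⟩; simp
    · rintro ⟨i, j⟩
      simp [sub_sub]
  all_goals
    first
    | refine (hfin.image fun p : ℤ × ℤ => (p.1, p.1 + p.2)).subset ?_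
      rintro ⟨i, m⟩ hp
      refine ⟨(i, m - i), ?_, by simp⟩
      simpa [sub_sub] using hp
    | refine (hfin.image fun p : ℤ × ℤ => (p.1 + p.2, p.1)).subset ?_
      rintro ⟨m, i⟩ hp
      refine ⟨(i, m - i), ?_, by simp⟩
      simpa [sub_sub] using hp

theorem mulSeries_single (B : M →ₗ[ℂ] N →ₗ[ℂ] P) (i : ℤ) (a : M) (g : LaurentSeries N) (n : ℤ) :
    (mulSeries B (HahnSeries.single i a) g).coeff n = B a (g.coeff (n - i)) := by
  rw [mulSeries_coeff, finsum_eq_single _ i]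
  · simp
  · intro j hj
    simp [HahnSeries.coeff_single_of_ne hj]

theorem laurent_mul_coeff {A : Type*} [Ring A] (f g : LaurentSeries A) (n : ℤ) :
    (f * g).coeff n = ∑ᶠ i : ℤ, f.coeff i * g.coeff (n - i) := by
  rw [HahnSeries.coeff_mul]
  have hinj : Set.InjOn Prod.fst
      (Finset.antidiagonal f.isPWO_support g.isPWO_support n : Set (ℤ × ℤ)) := by
    rintro ⟨a, b⟩ ha ⟨a', b'⟩ ha' h
    simp only [Finset.mem_coe, Finset.mem_antidiagonal] at ha ha' h
    obtain rfl : a = a' := h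
    obtain rfl : b = b' := by omega
    rfl
  rw [finsum_eq_sum_of_support_subset
    (s := (Finset.antidiagonal f.isPWO_support g.isPWO_support n).image Prod.fst),
    Finset.sum_image hinj]
  · refine Finset.sum_congr rfl ?_
    rintro ⟨a, b⟩ h
    simp only [Finset.mem_antidiagonal] at h
    rw [← h.2.2, add_sub_cancel_left]
  · intro i hi
    simp only [Finset.coe_image, Set.mem_image, Finset.mem_coe, Finset.mem_antidiagonal]
    refine ⟨(i, n - i), ⟨fun h0 => hi ?_, fun h0 => hi ?_, by simp⟩, rfl⟩
    · simp [h0]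
    · simp [h0]

theorem mulSeries_mul (f g : LaurentSeries A) : mulSeries (LinearMap.mul ℂ A) f g = f * g := by
  ext n
  rw [laurent_mul_coeff]
  rfl

/-- The action of `A((x))` on `M((x))` induced by an action of the algebra `A` on `M`. -/
def serAct (ρ : A →ₐ[ℂ] Module.End ℂ M) :
    LaurentSeries A →ₐ[ℂ] Module.End ℂ (LaurentSeries M) :=
  AlgHom.ofLinearMap (mulSeries (P := M) ρ.toLinearMap)
    (by
      ext g n
      rw [← HahnSeries.single_zero_one, mulSeries_single]
      simp)
    (by
      intro f g
      ext k : 1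
      rw [Module.End.mul_apply, ← mulSeries_mul]
      exact (mulSeries_assoc _ _ _ _ (by intros; simp) _ _ _).symm)

theorem serAct_coeff (ρ : A →ₐ[ℂ] Module.End ℂ M) (f : LaurentSeries A) (g : LaurentSeries M)
    (n : ℤ) : (serAct ρ f g).coeff n = ∑ᶠ i : ℤ, ρ (f.coeff i) (g.coeff (n - i)) := rfl

@[simp] theorem serAct_single (ρ : A →ₐ[ℂ] Module.End ℂ M) (i : ℤ) (a : A) (g : LaurentSeries M)
    (n : ℤ) : (serAct ρ (HahnSeries.single i a) g).coeff n = ρ a (g.coeff (n - i)) :=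
  mulSeries_single _ _ _ _ _

/-- Multiplication of a series in `M((x))` by a scalar series. -/
def fmul : LaurentSeries ℂ →ₐ[ℂ] Module.End ℂ (LaurentSeries M) :=
  serAct (Algebra.ofId ℂ (Module.End ℂ M))

theorem fmul_eq_mulSeries (f : LaurentSeries ℂ) (g : LaurentSeries M) :
    fmul f g = mulSeries (LinearMap.lsmul ℂ M) f g := by
  ext n
  rfl

theorem fmul_coeff (f : LaurentSeries ℂ) (g : LaurentSeries M) (n : ℤ) :
    (fmul f g).coeff n = ∑ᶠ i : ℤ, f.coeff i • g.coeff (n - i) := rfl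

@[simp] theorem fmul_single (i : ℤ) (a : ℂ) (g : LaurentSeries M) (n : ℤ) :
    (fmul (HahnSeries.single i a) g).coeff n = a • g.coeff (n - i) :=
  mulSeries_single _ _ _ _ _

theorem mapCoeff_fmul (T : M →ₗ[ℂ] N) (f : LaurentSeries ℂ) (g : LaurentSeries M) :
    mapCoeff T (fmul f g) = fmul f (mapCoeff T g) := by
  ext n
  rw [mapCoeff_coeff, fmul_coeff, fmul_coeff, map_finsum]
  · simp
  · exact mulSeries_finite (LinearMap.lsmul ℂ M) f g n

/-- Scalar series embed in A((x)) as central elements. -/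
theorem serAct_fmul_comm (ρ : A →ₐ[ℂ] Module.End ℂ M) (f : LaurentSeries A) (h : LaurentSeries ℂ)
    (g : LaurentSeries M) : serAct ρ f (fmul h g) = fmul h (serAct ρ f g) := by
  have h1 : ∀ h' : LaurentSeries ℂ, ∀ g' : LaurentSeries M,
      fmul h' g' = serAct ρ (h'.map (algebraMap ℂ A)) g' := by
    intro h' g'
    ext n
    rw [fmul_coeff, serAct_coeff]
    simp
  rw [h1, h1, ← Module.End.mul_apply, ← Module.End.mul_apply, ← map_mul, ← map_mul]
  congr 2
  ext n
  rw [laurent_mul_coeff, laurent_mul_coeff]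
  refine finsum_eq_of_bijective (fun i => n - i) ?_ ?_
  · exact (Equiv.subLeft n).bijective
  · intro i
    simp [Algebra.commutes]

/-- The power series with given coefficients, as a Laurent series. -/
def powSer (p : ℕ → M) : LaurentSeries M :=
  HahnSeries.ofSuppBddBelow (fun n : ℤ => if 0 ≤ n then p n.toNat else 0)
    ⟨0, fun n hn => by
      by_contra h
      exact hn (if_neg h)⟩

theorem powSer_coeff (p : ℕ → M) (n : ℤ) :
    (powSer p).coeff n = if 0 ≤ n then p n.toNat else 0 := rfl

@[simp] theorem powSer_coeff_natCast (p : ℕ → M) (n : ℕ) : (powSer p).coeff (n : ℤ) = p n := by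
  simp [powSer_coeff]

theorem powSer_coeff_neg (p : ℕ → M) (n : ℤ) (h : n < 0) : (powSer p).coeff n = 0 := by
  simp [powSer_coeff, not_le.2 h]

theorem finsum_int_eq_finsum_nat {f : ℤ → M} (h : ∀ i < 0, f i = 0) :
    ∑ᶠ i : ℤ, f i = ∑ᶠ k : ℕ, f k := by
  rw [← finsum_mem_univ (f := fun k : ℕ => f k),
    ← finsum_mem_image (f := f) (g := fun k : ℕ => (k : ℤ)) (s := Set.univ)
      (Set.injOn_of_injective Nat.cast_injective), ← finsum_mem_univ f]
  refine finsum_mem_inter_support_eq' _ _ _ fun i hi => ?_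
  simp only [Set.mem_univ, true_iff, Set.image_univ, Set.mem_range]
  refine ⟨i.toNat, Int.toNat_of_nonneg ?_⟩
  by_contra hlt
  exact hi (h i (not_le.1 hlt))

theorem serAct_powSer_coeff (ρ : A →ₐ[ℂ] Module.End ℂ M) (p : ℕ → A) (g : LaurentSeries M) (n : ℤ) :
    (serAct ρ (powSer p) g).coeff n = ∑ᶠ k : ℕ, ρ (p k) (g.coeff (n - k)) := by
  rw [serAct_coeff, finsum_int_eq_finsum_nat]
  · simp
  · intro i hi
    simp [powSer_coeff_neg _ _ hi]

theorem powSer_mul (p p' : ℕ → A) :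
    powSer p * powSer p' = powSer fun n => ∑ k ∈ Finset.HasAntidiagonal.antidiagonal n, p k.1 * p' k.2 := by
  ext n
  rw [laurent_mul_coeff]
  rcases lt_or_ge n 0 with hn | hn
  · rw [powSer_coeff_neg _ _ hn]
    refine finsum_eq_zero_of_forall_eq_zero fun i => ?_
    rcases lt_or_ge i 0 with hi | hi
    · simp [powSer_coeff_neg _ _ hi]
    · rw [powSer_coeff_neg p' (n - i) (by omega), mul_zero]
  · lift n to ℕ using hn
    rw [powSer_coeff_natCast, finsum_int_eq_finsum_nat, finsum_nat_eq_sum_range (N := n + 1),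
      Finset.Nat.sum_antidiagonal_eq_sum_range_succ_mk]
    · refine Finset.sum_congr rfl fun k hk => ?_
      rw [Finset.mem_range] at hk
      rw [← Nat.cast_sub (by omega)]
      simp
    · intro k hk
      rw [powSer_coeff_neg p' _ (by omega), mul_zero]
    · intro i hi
      rw [powSer_coeff_neg p _ hi, zero_mul]

theorem coeff_finsum {ι : Type*} {f : ι → LaurentSeries M} (h : (Function.support f).Finite) (n : ℤ) :
    (∑ᶠ i, f i).coeff n = ∑ᶠ i, (f i).coeff n :=
  map_finsum ({ toFun := fun f => f.coeff n, map_zero' := rfl, map_add' := fun _ _ => rfl } :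
    LaurentSeries M →+ M) h

end SeriesAction

end QVA

namespace QVA

/-! ### Translation invariance of the structure constants. -/

section StructureConst

/-- For m ≥ 0 the exponent -m - 1 of x₁ is negative, where the expansion of f in nonnegative powers
of x₁ has no terms; only the delta function remains. -/
theorem structureConst_of_nonneg_left (q : ℂ) (r s m n : ℤ) (hm : 0 ≤ m) :
    structureConst q r s m n = ((if r = s then 1 else 0) - (if r = s + 1 then 1 else 0)) *
      (if m + n = 0 then (m : ℂ) else 0) := by
  rw [structureConst, expandSub, if_neg (by omega), zero_add]
  simp only [show m - 1 = -n - 1 ↔ m + n = 0 by omega]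

/-- The delta term needs m + n = 0, hence m = n = 0, and then its factor m vanishes. -/
theorem structureConst_of_nonneg (q : ℂ) (r s m n : ℤ) (hm : 0 ≤ m) (hn : 0 ≤ n) :
    structureConst q r s m n = 0 := by
  rw [structureConst_of_nonneg_left q r s m n hm]
  split_ifs with h1 h2 h3 h3 <;> simp
  all_goals omega

/-- This is (∂₁ + ∂₂) f(x₂ - x₁) = 0 on coefficients. At i = -1 the first factor is 0, so the
cut-off at nonnegative powers of x₁ does no harm. -/
theorem expandSub_translation (f : LaurentSeries ℂ) (i j : ℤ) :
    ((i : ℂ) + 1) * expandSub f (i + 1) j + (j + 1) * expandSub f i (j + 1) = 0 := by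
  rcases lt_trichotomy i (-1) with hi | rfl | hi
  · rw [expandSub, expandSub, if_neg (by omega), if_neg (by omega)]
    ring
  · rw [expandSub, expandSub, if_pos (by omega), if_neg (by omega)]
    push_cast
    ring
  · obtain ⟨k, rfl⟩ : ∃ k : ℕ, i = k := ⟨i.toNat, by omega⟩
    have h := succ_mul_bc_succ (k + 1 + j) k
    rw [expandSub, expandSub, if_pos (by omega), if_pos (by omega)]
    simp only [show ((k : ℤ) + 1).toNat = k + 1 by omega, Int.toNat_natCast,
      show (k : ℤ) + (j + 1) = k + 1 + j by ring]
    change ((k : ℤ) + 1 : ℂ) * ((-1) ^ ((k : ℤ) + 1) * bc (k + 1 + j) (k + 1) * _) +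
      (j + 1) * ((-1) ^ (k : ℤ) * bc (k + 1 + j) k * _) = 0
    rw [zpow_add₀ (by norm_num), zpow_one, zpow_natCast]
    push_cast at h ⊢
    linear_combination (-(-1 : ℂ) ^ k * f.coeff (k + 1 + j)) * h

/-- Both f_{r-s}(-x₂ + x₁) and the derivative of the delta function are annihilated by ∂₁ + ∂₂. -/
theorem structureConst_translation (q : ℂ) (r s m n : ℤ) :
    m * structureConst q r s (m - 1) n + n * structureConst q r s m (n - 1) = 0 := by
  have h := expandSub_translation (negX (fSeries q (r - s))) (-m - 1) (-n - 1)
  simp only [structureConst]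
  rw [show -(m - 1) - 1 = -m - 1 + 1 by ring, show -(n - 1) - 1 = -n - 1 + 1 by ring]
  simp only [show m - 1 - 1 = -n - 1 ↔ m + n = 1 by omega,
    show m - 1 = -n - 1 + 1 ↔ m + n = 1 by omega]
  by_cases hmn : m + n = 1
  · obtain rfl : n = 1 - m := by omega
    push_cast at h ⊢
    simp only [add_sub_cancel, if_true]
    linear_combination -h
  · push_cast at h ⊢
    simp only [if_neg hmn]
    linear_combination -h

/-- The sum is the divided power of order N + 1 of the operator that `hA` says kills A. Multiplying
by N + 1 peels off one factor of this operator, which gives the induction. -/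
theorem sum_translation {A : ℤ → ℤ → ℂ}
    (hA : ∀ m n : ℤ, m * A (m - 1) n + n * A m (n - 1) = 0) (N : ℕ) (m n : ℤ) :
    ∑ p ∈ Finset.HasAntidiagonal.antidiagonal (N + 1), bc m p.1 * bc n p.2 * A (m - p.1) (n - p.2) =
      0 := by
  have key : ∀ N : ℕ, ∀ m n : ℤ, ((N : ℂ) + 1) *
      ∑ p ∈ Finset.HasAntidiagonal.antidiagonal (N + 1), bc m p.1 * bc n p.2 * A (m - p.1) (n - p.2) =
      m * (∑ p ∈ Finset.HasAntidiagonal.antidiagonal N,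
        bc (m - 1) p.1 * bc n p.2 * A (m - 1 - p.1) (n - p.2)) +
      n * (∑ p ∈ Finset.HasAntidiagonal.antidiagonal N,
        bc m p.1 * bc (n - 1) p.2 * A (m - p.1) (n - 1 - p.2)) := by
    intro N m n
    have h1 : ((N : ℂ) + 1) * ∑ p ∈ Finset.HasAntidiagonal.antidiagonal (N + 1),
        bc m p.1 * bc n p.2 * A (m - p.1) (n - p.2) =
        (∑ p ∈ Finset.HasAntidiagonal.antidiagonal (N + 1),
          (p.1 * bc m p.1) * bc n p.2 * A (m - p.1) (n - p.2)) +
        ∑ p ∈ Finset.HasAntidiagonal.antidiagonal (N + 1),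
          bc m p.1 * (p.2 * bc n p.2) * A (m - p.1) (n - p.2) := by
      rw [Finset.mul_sum, ← Finset.sum_add_distrib]
      refine Finset.sum_congr rfl fun p hp => ?_
      have : ((p.1 : ℂ) + p.2) = N + 1 := by
        exact_mod_cast Finset.HasAntidiagonal.mem_antidiagonal.1 hp
      rw [← this]
      ring
    rw [h1, Finset.Nat.sum_antidiagonal_succ, Finset.Nat.sum_antidiagonal_succ', Finset.mul_sum,
      Finset.mul_sum]
    simp only [Nat.cast_zero, zero_mul, mul_zero, zero_add]
    congr 1 <;> refine Finset.sum_congr rfl fun p hp => ?_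
    · push_cast
      rw [succ_mul_bc_succ', show m - ((p.1 : ℤ) + 1) = m - 1 - p.1 by ring]
      ring
    · push_cast
      rw [succ_mul_bc_succ', show n - ((p.2 : ℤ) + 1) = n - 1 - p.2 by ring]
      ring
  have hne : ∀ N : ℕ, (N : ℂ) + 1 ≠ 0 := fun N => Nat.cast_add_one_ne_zero N
  induction N generalizing m n with
  | zero =>
    refine (mul_eq_zero.1 ((key 0 m n).trans ?_)).resolve_left (hne 0)
    simpa using hA m n
  | succ N ih =>
    refine (mul_eq_zero.1 ((key (N + 1) m n).trans ?_)).resolve_left (hne (N + 1))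
    rw [ih, ih, mul_zero, mul_zero, add_zero]

end StructureConst

/-! ### The action of the modes β_m on fields. -/

section Fields

attribute [local instance] laurentAlgebra

variable {W : Type*} [AddCommGroup W] [Module ℂ W]

/-- A family of operators is restricted if it vanishes eventually on every vector. -/
def Restricted (β : ℤ → Module.End ℂ W) : Prop := ∀ w, ∃ N : ℕ, ∀ n : ℤ, N ≤ n → β n w = 0

/-- The series `∑ₖ (m choose k) (-x) ^ k β_{m - k}`. -/
def leftSer (β : ℤ → Module.End ℂ W) (m : ℤ) : LaurentSeries (Module.End ℂ W) :=
  powSer fun k => ((-1) ^ k * bc m k) • β (m - k)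

/-- The operator `Res_{x₁} (x₁ - x) ^ m β(x₁)` on `W((x))`. -/
def leftMode (β : ℤ → Module.End ℂ W) (m : ℤ) : Module.End ℂ (LaurentSeries W) :=
  serAct (AlgHom.id ℂ _) (leftSer β m)

theorem leftMode_coeff (β : ℤ → Module.End ℂ W) (m : ℤ) (g : LaurentSeries W) (n : ℤ) :
    (leftMode β m g).coeff n = ∑ᶠ k : ℕ, ((-1) ^ k * bc m k) • β (m - k) (g.coeff (n - k)) :=
  serAct_powSer_coeff _ _ _ _

theorem leftMode_fmul (β : ℤ → Module.End ℂ W) (m : ℤ) (f : LaurentSeries ℂ) (g : LaurentSeries W) :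
    leftMode β m (fmul f g) = fmul f (leftMode β m g) :=
  serAct_fmul_comm _ _ _ _

/-- The coefficient of (-x)ᴺ in the commutator is ∑ (m choose p)(n choose p') A(m - p, n - p') over
p + p' = N. By `sum_translation` it vanishes for N > 0, and N = 0 gives A(m, n). -/
theorem leftMode_comm (β β' : ℤ → Module.End ℂ W) (A : ℤ → ℤ → ℂ)
    (hc : ∀ m n, β m * β' n - β' n * β m = A m n • 1)
    (hA : ∀ m n : ℤ, m * A (m - 1) n + n * A m (n - 1) = 0) (m n : ℤ) :
    leftMode β m * leftMode β' n - leftMode β' n * leftMode β m = A m n • 1 := by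
  have : leftSer β m * leftSer β' n - leftSer β' n * leftSer β m = A m n • 1 := by
    rw [leftSer, leftSer, powSer_mul, powSer_mul]
    apply HahnSeries.ext
    funext i
    refine Eq.trans (b := (powSer fun N => ∑ p ∈ Finset.HasAntidiagonal.antidiagonal N,
      ((-1 : ℂ) ^ N * (bc m p.1 * bc n p.2 * A (m - p.1) (n - p.2))) •
        (1 : Module.End ℂ W)).coeff i) ?_ ?_
    · rw [HahnSeries.coeff_sub, powSer_coeff, powSer_coeff, powSer_coeff]
      split_ifs
      · generalize i.toNat = N
        rw [← Finset.Nat.sum_antidiagonal_swap (f := fun p =>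
          (((-1 : ℂ) ^ p.1 * bc n p.1) • β' (n - p.1)) * (((-1) ^ p.2 * bc m p.2) • β (m - p.2))),
          ← Finset.sum_sub_distrib]
        refine Finset.sum_congr rfl fun p hp => ?_
        rw [← Finset.HasAntidiagonal.mem_antidiagonal.1 hp]
        simp only [Prod.fst_swap, Prod.snd_swap, smul_mul_smul_comm]
        rw [mul_comm ((-1) ^ p.2 * bc n p.2), ← smul_sub, hc, smul_smul, pow_add]
        congr 1
        ring
      · simp
    · rw [powSer_coeff, HahnSeries.coeff_smul, HahnSeries.coeff_one]
      rcases lt_trichotomy i 0 with hi | rfl | hi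
      · rw [if_neg (by omega), if_neg (by omega), smul_zero]
      · simp
      · obtain ⟨N, rfl⟩ : ∃ N : ℕ, i = N + 1 := ⟨i.toNat - 1, by omega⟩
        rw [if_pos (by omega), if_neg (by omega), smul_zero, ← Finset.sum_smul, ← Finset.mul_sum,
          show ((N : ℤ) + 1).toNat = N + 1 by omega, sum_translation hA, mul_zero, zero_smul]
  rw [leftMode, leftMode, ← map_mul, ← map_mul, ← map_sub, this, map_smul, map_one]

/-- The monomial `(m choose j) (-x) ^ (m - j)`. -/
def rightCoeff (m : ℤ) (j : ℕ) : LaurentSeries ℂ :=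
  HahnSeries.single (m - j) ((-1 : ℂ) ^ (m - j) * bc m j)

theorem rightMode_finite {β : ℤ → Module.End ℂ W} (hβ : Restricted β) (m : ℤ)
    (φ : W →ₗ[ℂ] LaurentSeries W) (w : W) :
    (Function.support fun j : ℕ => fmul (rightCoeff m j) (φ (β j w))).Finite := by
  obtain ⟨N, hN⟩ := hβ w
  refine finite_support_of_eventually_zero (N := N) fun k hk => ?_
  rw [hN k (by exact_mod_cast hk), map_zero, map_zero]

/-- The operation `φ(x) ↦ Res_{x₁} (-x + x₁) ^ m φ(x) β(x₁)` on fields. -/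
def rightMode {β : ℤ → Module.End ℂ W} (hβ : Restricted β) (m : ℤ) :
    Module.End ℂ (W →ₗ[ℂ] LaurentSeries W) where
  toFun φ :=
    { toFun := fun w => ∑ᶠ j : ℕ, fmul (rightCoeff m j) (φ (β j w))
      map_add' := fun w w' => by
        simp only [map_add]
        exact finsum_add_distrib (rightMode_finite hβ m φ w) (rightMode_finite hβ m φ w')
      map_smul' := fun c w => by
        simp only [map_smul, RingHom.id_apply]
        exact (smul_finsum' c (rightMode_finite hβ m φ w)).symm }
  map_add' φ ψ := by
    ext w : 1
    simp only [LinearMap.add_apply, map_add, LinearMap.coe_mk, AddHom.coe_mk]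
    exact finsum_add_distrib (rightMode_finite hβ m φ w) (rightMode_finite hβ m ψ w)
  map_smul' c φ := by
    ext w : 1
    simp only [LinearMap.smul_apply, map_smul, RingHom.id_apply, LinearMap.coe_mk, AddHom.coe_mk]
    exact (smul_finsum' c (rightMode_finite hβ m φ w)).symm

theorem rightMode_apply {β : ℤ → Module.End ℂ W} (hβ : Restricted β) (m : ℤ)
    (φ : W →ₗ[ℂ] LaurentSeries W) (w : W) :
    rightMode hβ m φ w = ∑ᶠ j : ℕ, fmul (rightCoeff m j) (φ (β j w)) := rfl

/-- Only nonnegative modes occur in right modes, and these commute. -/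
theorem rightMode_comm {β β' : ℤ → Module.End ℂ W} (hβ : Restricted β) (hβ' : Restricted β')
    (hc : ∀ m n : ℕ, β m * β' n = β' n * β m) (m n : ℤ) :
    rightMode hβ m * rightMode hβ' n = rightMode hβ' n * rightMode hβ m := by
  ext φ w : 2
  simp only [Module.End.mul_apply, rightMode_apply]
  have hc' : ∀ (j k : ℕ) (w : W), β' k (β j w) = β j (β' k w) := fun j k w =>
    (LinearMap.congr_fun (hc j k) w).symm
  have e1 : ∀ j : ℕ, fmul (rightCoeff m j) (∑ᶠ k : ℕ, fmul (rightCoeff n k) (φ (β' k (β j w)))) =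
      ∑ᶠ k : ℕ, fmul (rightCoeff m j * rightCoeff n k) (φ (β j (β' k w))) := fun j => by
    rw [map_finsum _ (rightMode_finite hβ' n φ (β j w))]
    simp only [map_mul, Module.End.mul_apply, hc']
  have e2 : ∀ k : ℕ, fmul (rightCoeff n k) (∑ᶠ j : ℕ, fmul (rightCoeff m j) (φ (β j (β' k w)))) =
      ∑ᶠ j : ℕ, fmul (rightCoeff m j * rightCoeff n k) (φ (β j (β' k w))) := fun k => by
    rw [map_finsum _ (rightMode_finite hβ m φ (β' k w))]
    simp only [mul_comm (rightCoeff m _), map_mul, Module.End.mul_apply]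
  simp only [e1, e2]
  refine finsum_comm_of_finite ?_
  obtain ⟨N, hN⟩ := hβ w
  obtain ⟨N', hN'⟩ := hβ' w
  refine ((Set.finite_Iio N).prod (Set.finite_Iio N')).subset ?_
  rintro ⟨j, k⟩ hp
  simp only [Set.mem_prod, Set.mem_Iio]
  constructor <;> by_contra hlt <;> refine hp ?_
  · simp only [← hc', hN j (by omega), map_zero]
  · simp only [hN' k (by omega), map_zero]

/-- One operation acts on the values of the field and the other on its arguments, apart from scalar
series, which commute with left modes. -/
theorem leftMode_rightMode (β : ℤ → Module.End ℂ W) {β' : ℤ → Module.End ℂ W}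
    (hβ' : Restricted β') (m n : ℤ) (φ : W →ₗ[ℂ] LaurentSeries W) :
    rightMode hβ' n (leftMode β m ∘ₗ φ) = leftMode β m ∘ₗ rightMode hβ' n φ := by
  ext w : 1
  rw [LinearMap.comp_apply, rightMode_apply, rightMode_apply,
    map_finsum _ (rightMode_finite hβ' n φ w)]
  simp only [LinearMap.comp_apply, leftMode_fmul]

/-- The `m`-th mode `Res_{x₁} ((x₁ - x) ^ m β(x₁) φ(x) - (-x + x₁) ^ m φ(x) β(x₁))` of the action
of `β(x₁)` on the space of fields. -/
def fieldMode {β : ℤ → Module.End ℂ W} (hβ : Restricted β) (m : ℤ) :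
    Module.End ℂ (W →ₗ[ℂ] LaurentSeries W) :=
  LinearMap.llcomp ℂ W (LaurentSeries W) (LaurentSeries W) (leftMode β m) - rightMode hβ m

theorem fieldMode_apply {β : ℤ → Module.End ℂ W} (hβ : Restricted β) (m : ℤ)
    (φ : W →ₗ[ℂ] LaurentSeries W) (w : W) :
    fieldMode hβ m φ w =
      leftMode β m (φ w) - ∑ᶠ j : ℕ, fmul (rightCoeff m j) (φ (β j w)) := rfl

theorem fieldMode_eq {β : ℤ → Module.End ℂ W} (hβ : Restricted β) (m : ℤ)
    (φ : W →ₗ[ℂ] LaurentSeries W) :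
    fieldMode hβ m φ = leftMode β m ∘ₗ φ - rightMode hβ m φ := rfl

/-- The cross terms between left and right modes cancel and the right modes commute with each other,
so the commutator is that of the left modes. -/
theorem fieldMode_comm {β β' : ℤ → Module.End ℂ W} (hβ : Restricted β) (hβ' : Restricted β')
    (A : ℤ → ℤ → ℂ) (hc : ∀ m n, β m * β' n - β' n * β m = A m n • 1)
    (hA : ∀ m n : ℤ, m * A (m - 1) n + n * A m (n - 1) = 0)
    (hA0 : ∀ m n : ℕ, A m n = 0) (m n : ℤ) :
    fieldMode hβ m * fieldMode hβ' n - fieldMode hβ' n * fieldMode hβ m = A m n • 1 := by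
  ext φ : 1
  have h1 := leftMode_comm β β' A hc hA m n
  have h2 := LinearMap.congr_fun (rightMode_comm hβ hβ'
    (fun m n => by rw [← sub_eq_zero, hc, hA0, zero_smul]) m n) φ
  simp only [LinearMap.sub_apply, Module.End.mul_apply, fieldMode_eq, map_sub,
    leftMode_rightMode] at h2 ⊢
  rw [h2, ← LinearMap.comp_assoc, ← LinearMap.comp_assoc]
  have h3 : leftMode β m ∘ₗ leftMode β' n = leftMode β' n ∘ₗ leftMode β m + A m n • 1 := by
    rw [← sub_eq_iff_eq_add']; exact h1
  rw [h3, LinearMap.add_comp]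
  ext w : 1
  simp only [LinearMap.sub_apply, LinearMap.add_apply, LinearMap.smul_apply, LinearMap.comp_apply,
    Module.End.one_apply]
  abel

theorem fieldMode_coeff {β : ℤ → Module.End ℂ W} (hβ : Restricted β) (m : ℤ)
    (φ : W →ₗ[ℂ] LaurentSeries W) (w : W) (n : ℤ) :
    (fieldMode hβ m φ w).coeff n =
      (∑ᶠ k : ℕ, ((-1) ^ k * bc m k) • β (m - k) ((φ w).coeff (n - k))) -
      ∑ᶠ j : ℕ, ((-1 : ℂ) ^ (m - j) * bc m j) • (φ (β j w)).coeff (n - (m - j)) := by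
  rw [fieldMode_apply, HahnSeries.coeff_sub, leftMode_coeff,
    coeff_finsum (rightMode_finite hβ m φ w)]
  simp only [rightCoeff, fmul_single]

/-- The identity field. -/
def idField (W : Type*) [AddCommGroup W] [Module ℂ W] : W →ₗ[ℂ] LaurentSeries W :=
  HahnSeries.single.linearMap 0

theorem idField_coeff (w : W) (n : ℤ) : (idField W w).coeff n = if n = 0 then w else 0 := by
  change (HahnSeries.single 0 w).coeff n = _
  rw [HahnSeries.coeff_single]
  congr

theorem fieldMode_idField_coeff {β : ℤ → Module.End ℂ W} (hβ : Restricted β) (m : ℤ) (w : W)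
    (n : ℤ) : (fieldMode hβ m (idField W) w).coeff n =
      (if 0 ≤ n then ((-1) ^ n * bc m n.toNat) • β (m - n) w else 0) -
      if n ≤ m then ((-1 : ℂ) ^ n * bc m (m - n).toNat) • β (m - n) w else 0 := by
  rw [fieldMode_coeff]
  congr 1
  · split_ifs with h
    · obtain ⟨k, rfl⟩ : ∃ k : ℕ, n = k := ⟨n.toNat, by omega⟩
      rw [finsum_eq_single _ k]
      · simp [idField_coeff]
      · intro j hj
        rw [idField_coeff, if_neg (by omega), map_zero, smul_zero]
    · refine finsum_eq_zero_of_forall_eq_zero fun k => ?_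
      rw [idField_coeff, if_neg (by omega), map_zero, smul_zero]
  · split_ifs with h
    · obtain ⟨k, hk⟩ : ∃ k : ℕ, m - n = k := ⟨(m - n).toNat, by omega⟩
      rw [finsum_eq_single _ k]
      · rw [idField_coeff, if_pos (by omega), show m - k = n by omega, hk, Int.toNat_natCast]
      · intro j hj
        rw [idField_coeff, if_neg (by omega), smul_zero]
    · refine finsum_eq_zero_of_forall_eq_zero fun k => ?_
      rw [idField_coeff, if_neg (by omega), smul_zero]

/-- For m ≥ 0 the two expansions of (x₁ - x)ᵐ are the same polynomial, and β(x₁) commutes with the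
identity. -/
theorem fieldMode_idField {β : ℤ → Module.End ℂ W} (hβ : Restricted β) (m : ℤ) (hm : 0 ≤ m) :
    fieldMode hβ m (idField W) = 0 := by
  ext w n
  rw [fieldMode_idField_coeff]
  lift m to ℕ using hm
  change _ = (0 : W)
  by_cases h1 : 0 ≤ n
  · lift n to ℕ using h1
    rw [if_pos (by omega)]
    split_ifs with h2
    · have h2' : n ≤ m := by omega
      rw [show ((m : ℤ) - n).toNat = m - n by omega, Int.toNat_natCast, bc_natCast, bc_natCast,
        Nat.choose_symm h2', sub_self]
    · rw [Int.toNat_natCast, bc_natCast_of_lt (by omega), mul_zero, zero_smul, sub_zero]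
  · rw [if_neg h1, if_pos (by omega)]
    have : ((m : ℤ) - n).toNat = (m + (-n).toNat) := by omega
    rw [this, bc_natCast_of_lt (by omega), mul_zero, zero_smul, sub_zero]

theorem bc_neg_one (k : ℕ) : bc (-1) k = (-1) ^ k := by
  have := bc_neg 1 k
  rw [this, show (1 : ℤ) + k - 1 = k by ring, bc_natCast, Nat.choose_self, Nat.cast_one, mul_one]

/-- The two expansions of (x₁ - x)⁻¹ differ by a delta function, whose residue against β(x₁) is
β(x). -/
theorem fieldMode_neg_one_idField {β : ℤ → Module.End ℂ W} (hβ : Restricted β) (w : W) (n : ℤ) :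
    (fieldMode hβ (-1) (idField W) w).coeff n = β (-n - 1) w := by
  rw [fieldMode_idField_coeff, show (-1 : ℤ) - n = -n - 1 by ring]
  have hs : ∀ k : ℤ, (-1 : ℂ) ^ k * (-1) ^ k = 1 := fun k => by
    rw [← mul_zpow]; norm_num
  by_cases h : 0 ≤ n
  · lift n to ℕ using h
    rw [if_pos (by omega), if_neg (by omega), sub_zero, Int.toNat_natCast, bc_neg_one,
      ← zpow_natCast, hs, one_smul]
  · rw [if_neg h, if_pos (by omega), zero_sub, bc_neg_one, ← zpow_natCast,
      Int.toNat_of_nonneg (by omega), ← zpow_add₀ (by norm_num), show n + (-n - 1) = -1 by ring]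
    simp

end Fields

/-! ### The vertex operators of a restricted module. -/

section FieldMap

variable {q ℓ : ℂ} {W : Type*} [AddCommGroup W] [Module ℂ W] [LieRingModule (BHat q) W]
  [LieModule ℂ (BHat q) W]

theorem IsRestricted.restricted (h : IsRestricted q W) (r : ℤ) : Restricted (betaOp q W r) := by
  intro w
  obtain ⟨N, hN⟩ := h w r
  exact ⟨N.toNat, fun n hn => hN n (by omega)⟩

theorem isRestricted_vacuumModule (q ℓ : ℂ) : IsRestricted q (VacuumModule q ℓ) := by
  intro v r
  induction v using vacuum_induction with
  | h0 => exact ⟨0, fun n hn => beta_vac r n hn⟩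
  | hβ s k v hv =>
    obtain ⟨N, hN⟩ := hv
    -- The bound n ≥ 0 leaves only the delta term in the bracket with β_k, and n > -k kills that
    -- term.
    refine ⟨max N (max 0 (1 - k)), fun n hn => ?_⟩
    simp only [max_le_iff] at hn
    rw [← betaOp_apply, ← betaOp_apply, betaOp_comm hasLevel_vacuumModule, betaOp_apply r n,
      hN n hn.1, map_zero, structureConst_of_nonneg_left _ _ _ _ _ hn.2.1, if_neg (c := n + k = 0)
      (by omega)]
    simp
  | hadd u v hu hv =>
    obtain ⟨N, hN⟩ := hu
    obtain ⟨N', hN'⟩ := hv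
    exact ⟨max N N', fun n hn => by
      rw [lie_add, hN n (le_trans (le_max_left _ _) hn), hN' n (le_trans (le_max_right _ _) hn),
        add_zero]⟩
  | hsmul c v hv =>
    obtain ⟨N, hN⟩ := hv
    exact ⟨N, fun n hn => by rw [lie_smul, hN n hn, smul_zero]⟩

/-- The map from the vacuum module to the space of fields on a restricted module. -/
def fieldMap (hW : IsRestricted q W) (hℓ : HasLevel q ℓ W) :
    VacuumModule q ℓ →ₗ[ℂ] W →ₗ[ℂ] LaurentSeries W :=
  vacLift (fun r m => fieldMode (hW.restricted r) m)
    (fun r s m n => fieldMode_comm _ _ (fun m n => structureConst q r s m n * ℓ)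
      (fun m n => by
        ext w
        rw [LinearMap.sub_apply, Module.End.mul_apply, Module.End.mul_apply,
          betaOp_comm hℓ r s m n, add_sub_cancel_left]
        rfl)
      (fun m n => by
        have := structureConst_translation q r s m n
        linear_combination ℓ * this)
      (fun m n => by rw [structureConst_of_nonneg] <;> simp) m n)
    (idField W) (fun r m hm => fieldMode_idField _ m hm)

theorem fieldMap_vac (hW : IsRestricted q W) (hℓ : HasLevel q ℓ W) :
    fieldMap hW hℓ (vac q ℓ) = idField W := vacLift_vac _ _ _ _

theorem fieldMap_beta (hW : IsRestricted q W) (hℓ : HasLevel q ℓ W) (r m : ℤ)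
    (v : VacuumModule q ℓ) :
    fieldMap hW hℓ ⁅beta q r m, v⁆ = fieldMode (hW.restricted r) m (fieldMap hW hℓ v) :=
  vacLift_beta _ _ _ _ r m v

theorem fieldMap_betaVec_coeff (hW : IsRestricted q W) (hℓ : HasLevel q ℓ W) (r : ℤ) (w : W)
    (n : ℤ) : (fieldMap hW hℓ (betaVec q ℓ r) w).coeff n = ⁅beta q r (-n - 1), w⁆ := by
  rw [betaVec, fieldMap_beta, fieldMap_vac, fieldMode_neg_one_idField]
  rfl

end FieldMap

end QVA

namespace QVA

/-! ### Two-variable series up to powers of x + cy. -/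

section TwoVariable

variable {M N : Type*} [AddCommGroup M] [Module ℂ M] [AddCommGroup N] [Module ℂ N]

/-- Multiplication by the first variable. -/
def mulFst : Module.End ℂ (ℤ → ℤ → M) where
  toFun G i j := G (i - 1) j
  map_add' _ _ := rfl
  map_smul' _ _ := rfl

/-- Multiplication by the second variable. -/
def mulSnd : Module.End ℂ (ℤ → ℤ → M) where
  toFun G i j := G i (j - 1)
  map_add' _ _ := rfl
  map_smul' _ _ := rfl

theorem mulFst_pow_apply (k : ℕ) (G : ℤ → ℤ → M) (i j : ℤ) :
    (mulFst ^ k) G i j = G (i - k) j := by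
  induction k generalizing i with
  | zero => simp
  | succ k ih =>
    rw [pow_succ', Module.End.mul_apply]
    change (mulFst ^ k) G (i - 1) j = _
    rw [ih]; push_cast; congr 1; ring

theorem mulSnd_pow_apply (k : ℕ) (G : ℤ → ℤ → M) (i j : ℤ) :
    (mulSnd ^ k) G i j = G i (j - k) := by
  induction k generalizing j with
  | zero => simp
  | succ k ih =>
    rw [pow_succ', Module.End.mul_apply]
    change (mulSnd ^ k) G i (j - 1) = _
    rw [ih]; push_cast; congr 1; ring

/-- Multiplication by `x + c y`. -/
def mulLin (c : ℂ) : Module.End ℂ (ℤ → ℤ → M) := mulFst + c • mulSnd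

theorem mulLin_apply (c : ℂ) (G : ℤ → ℤ → M) (i j : ℤ) :
    mulLin c G i j = G (i - 1) j + c • G i (j - 1) := rfl

theorem mulLin_pow_apply (c : ℂ) (l : ℕ) (G : ℤ → ℤ → M) (i j : ℤ) :
    (mulLin c ^ l) G i j =
      ∑ a ∈ Finset.range (l + 1), (c ^ a * (l.choose a : ℂ)) • G (i - (l - a : ℤ)) (j - a) := by
  have hcomm : Commute (mulFst : Module.End ℂ (ℤ → ℤ → M)) (c • mulSnd) := by
    refine Commute.smul_right ?_ c
    ext G i j
    rfl
  rw [mulLin, add_comm, hcomm.symm.add_pow, LinearMap.sum_apply, Finset.sum_apply, Finset.sum_apply]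
  refine Finset.sum_congr rfl fun a ha => ?_
  rw [Finset.mem_range] at ha
  rw [smul_pow, mul_assoc, smul_mul_assoc, LinearMap.smul_apply, ← mul_assoc,
    (Nat.cast_commute _ _).symm.eq, ← nsmul_eq_mul, LinearMap.smul_apply, Module.End.mul_apply]
  simp only [Pi.smul_apply, mulSnd_pow_apply, mulFst_pow_apply]
  rw [Nat.cast_sub (by omega), mul_smul, Nat.cast_smul_eq_nsmul]

theorem mulAddPow_eq (l : ℕ) (G : ℤ → ℤ → M) : mulAddPow l G = (mulLin 1 ^ l) G := by
  funext i j
  rw [mulLin_pow_apply]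
  simp [mulAddPow]

theorem mulSubPow_eq (l : ℕ) (G : ℤ → ℤ → M) : mulSubPow l G = (mulLin (-1) ^ l) G := by
  funext i j
  rw [mulLin_pow_apply]
  simp [mulSubPow]

/-- The series is bounded below in the second variable. -/
def BddSnd (G : ℤ → ℤ → M) : Prop := ∃ J : ℤ, ∀ i j, j < J → G i j = 0

/-- The series is bounded below in the first variable. -/
def BddFst (G : ℤ → ℤ → M) : Prop := ∃ I : ℤ, ∀ i j, i < I → G i j = 0

theorem BddSnd.eventually {G : ℤ → ℤ → M} (hG : BddSnd G) (j : ℤ) :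
    ∃ N : ℕ, ∀ k : ℕ, N ≤ k → ∀ i, G i (j - k) = 0 := by
  obtain ⟨J, hJ⟩ := hG
  exact ⟨(j - J + 1).toNat, fun k hk i => hJ i _ (by omega)⟩

/-- `(x + c y) ^ n G`, expanded in nonnegative powers of `y`. -/
def expSnd (c : ℂ) (n : ℤ) (G : ℤ → ℤ → M) : ℤ → ℤ → M := fun i j =>
  ∑ᶠ k : ℕ, (bc n k * c ^ k) • G (i - n + k) (j - k)

/-- `(y + c x) ^ n G`, expanded in nonnegative powers of `x`. -/
def expFst (c : ℂ) (n : ℤ) (G : ℤ → ℤ → M) : ℤ → ℤ → M := fun i j =>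
  ∑ᶠ k : ℕ, (bc n k * c ^ k) • G (i - k) (j - n + k)

theorem expFst_eq (c : ℂ) (n : ℤ) (G : ℤ → ℤ → M) :
    expFst c n G = fun i j => expSnd c n (fun i j => G j i) j i := rfl

theorem expSnd_zero (c : ℂ) (G : ℤ → ℤ → M) : expSnd c 0 G = G := by
  funext i j
  rw [expSnd, finsum_eq_single _ 0]
  · simp
  · intro k hk
    have : bc 0 k = 0 := by
      have := bc_natCast_of_lt (n := 0) (k := k) (by omega)
      simpa using this
    rw [this, zero_mul, zero_smul]

/-- Pascal's rule; boundedness below in y makes the sums finite. -/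
theorem mulLin_expSnd (c : ℂ) (n : ℤ) {G : ℤ → ℤ → M} (hG : BddSnd G) :
    mulLin c (expSnd c n G) = expSnd c (n + 1) G := by
  funext i j
  rw [mulLin_apply, expSnd, expSnd, expSnd]
  obtain ⟨N, hN⟩ := hG.eventually j
  obtain ⟨N', hN'⟩ := hG.eventually (j - 1)
  rw [finsum_nat_eq_sum_range (N := N + N' + 1), finsum_nat_eq_sum_range (N := N + N'),
    finsum_nat_eq_sum_range (N := N + N' + 1), Finset.sum_range_succ', Finset.sum_range_succ' _ (N + N'),
    Finset.smul_sum, add_right_comm, ← Finset.sum_add_distrib]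
  · congr 1
    · refine Finset.sum_congr rfl fun k _ => ?_
      rw [bc_succ_succ, smul_smul]
      push_cast
      rw [show i - 1 - n + ((k : ℤ) + 1) = i - n + k by ring,
        show i - (n + 1) + ((k : ℤ) + 1) = i - n + k by ring,
        show j - 1 - (k : ℤ) = j - (k + 1) by ring, ← add_smul]
      congr 1
      ring
    · simp [sub_sub, add_comm]
  · intro k hk; rw [hN k (by omega), smul_zero]
  · intro k hk; rw [hN' k (by omega), smul_zero]
  · intro k hk; rw [hN k (by omega), smul_zero]

theorem mulLin_pow_expSnd (c : ℂ) (l : ℕ) (n : ℤ) {G : ℤ → ℤ → M} (hG : BddSnd G) :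
    (mulLin c ^ l) (expSnd c n G) = expSnd c (n + l) G := by
  induction l generalizing n with
  | zero => simp
  | succ l ih =>
    rw [pow_succ, Module.End.mul_apply, mulLin_expSnd c n hG, ih]
    push_cast; congr 1; ring

theorem expSnd_natCast (c : ℂ) (n : ℕ) {G : ℤ → ℤ → M} (hG : BddSnd G) :
    expSnd c n G = (mulLin c ^ n) G := by
  have := mulLin_pow_expSnd c n 0 hG
  rw [expSnd_zero, zero_add] at this
  exact this.symm

/-- Once n + l ≥ 0 the expansion is multiplication by a polynomial and no longer remembers its
direction. This and `mulLin_pow_expFst` are how the two expansions are compared. -/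
theorem mulLin_pow_expSnd' (c : ℂ) (l n' : ℕ) (n : ℤ) (h : n + l = n') {G : ℤ → ℤ → M}
    (hG : BddSnd G) : (mulLin c ^ l) (expSnd c n G) = (mulLin c ^ n') G := by
  rw [mulLin_pow_expSnd c l n hG, h, expSnd_natCast c n' hG]

theorem mulLin_swap (c : ℂ) (hc : c * c = 1) (G : ℤ → ℤ → M) :
    mulLin c G = fun i j => (c • mulLin c (fun i j => G j i)) j i := by
  funext i j
  simp only [mulLin_apply, Pi.smul_apply, smul_add, smul_smul, hc, one_smul]
  rw [add_comm]

theorem mulLin_pow_swap (c : ℂ) (hc : c * c = 1) (l : ℕ) (G : ℤ → ℤ → M) :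
    (mulLin c ^ l) G = fun i j => (c ^ l • (mulLin c ^ l) (fun i j => G j i)) j i := by
  induction l with
  | zero => simp
  | succ l ih =>
    rw [pow_succ', Module.End.mul_apply, ih, mulLin_swap c hc]
    simp only [pow_succ', Module.End.mul_apply]
    funext i j
    have : (fun i j => (c ^ l • (mulLin c ^ l) (fun i j => G j i)) i j) =
        c ^ l • (mulLin c ^ l) (fun i j => G j i) := rfl
    rw [this, map_smul, smul_smul]

/-- The sign comes from x + cy = c(y + cx), valid as c² = 1: it is used l times in one direction and
n' times in the other. -/
theorem mulLin_pow_expFst (c : ℂ) (hc : c * c = 1) (l n' : ℕ) (n : ℤ) (h : n + l = n')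
    {G : ℤ → ℤ → M} (hG : BddFst G) :
    (mulLin c ^ l) (expFst c n G) = c ^ (l + n') • (mulLin c ^ n') G := by
  have hG' : BddSnd fun i j => G j i := by
    obtain ⟨I, hI⟩ := hG
    exact ⟨I, fun i j hj => hI j i hj⟩
  rw [expFst_eq, mulLin_pow_swap c hc]
  funext i j
  rw [mulLin_pow_swap c hc n' G]
  simp only [Pi.smul_apply, smul_smul]
  have := congrFun (congrFun (mulLin_pow_expSnd' c l n' n h hG') j) i
  rw [← this, pow_add, mul_assoc, ← mul_pow, hc, one_pow, mul_one]

/-- Equality of two series up to multiplication by a power of `x + c y`. -/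
def EqvMod (c : ℂ) (G H : ℤ → ℤ → M) : Prop :=
  ∃ l : ℕ, ∀ l', l ≤ l' → (mulLin c ^ l') G = (mulLin c ^ l') H

theorem EqvMod.of_eq {c : ℂ} {l : ℕ} {G H : ℤ → ℤ → M}
    (h : (mulLin c ^ l) G = (mulLin c ^ l) H) : EqvMod c G H := by
  refine ⟨l, fun l' hl => ?_⟩
  obtain ⟨k, rfl⟩ := Nat.exists_eq_add_of_le' hl
  rw [pow_add, Module.End.mul_apply, Module.End.mul_apply, h]

theorem EqvMod.refl (c : ℂ) (G : ℤ → ℤ → M) : EqvMod c G G := ⟨0, fun _ _ => rfl⟩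

theorem EqvMod.add {c : ℂ} {G H G' H' : ℤ → ℤ → M} (h : EqvMod c G H) (h' : EqvMod c G' H') :
    EqvMod c (G + G') (H + H') := by
  obtain ⟨l, hl⟩ := h
  obtain ⟨l', hl'⟩ := h'
  refine ⟨max l l', fun k hk => ?_⟩
  rw [map_add, map_add, hl k (le_trans (le_max_left _ _) hk),
    hl' k (le_trans (le_max_right _ _) hk)]

theorem EqvMod.smul {c : ℂ} {G H : ℤ → ℤ → M} (a : ℂ) (h : EqvMod c G H) :
    EqvMod c (a • G) (a • H) := by
  obtain ⟨l, hl⟩ := h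
  exact ⟨l, fun k hk => by rw [map_smul, map_smul, hl k hk]⟩

theorem EqvMod.sub {c : ℂ} {G H G' H' : ℤ → ℤ → M} (h : EqvMod c G H) (h' : EqvMod c G' H') :
    EqvMod c (G - G') (H - H') := by
  have := h.add (h'.smul (-1))
  simpa [sub_eq_add_neg] using this

theorem EqvMod.sum {c : ℂ} {ι : Type*} (s : Finset ι) {G H : ι → ℤ → ℤ → M}
    (h : ∀ i ∈ s, EqvMod c (G i) (H i)) : EqvMod c (∑ i ∈ s, G i) (∑ i ∈ s, H i) := by
  classical
  induction s using Finset.induction_on with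
  | empty => exact EqvMod.refl c _
  | insert a s ha ih =>
    rw [Finset.sum_insert ha, Finset.sum_insert ha]
    exact (h a (Finset.mem_insert_self a s)).add
      (ih fun i hi => h i (Finset.mem_insert_of_mem hi))

/-- The expansions of (x + y)ⁿ in opposite directions become the same polynomial after
multiplication by a high power of x + y. Each one is only applied to a series bounded in the right
variable. -/
theorem EqvMod.exp {G H : ℤ → ℤ → M} (h : EqvMod 1 G H) (n : ℤ) (hG : BddSnd G) (hH : BddFst H) :
    EqvMod 1 (expSnd 1 n G) (expFst 1 n H) := by
  obtain ⟨l, hl⟩ := h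
  -- The summand |n| ensures that n + l' is still at least l.
  refine ⟨l + n.natAbs, fun l' hl' => ?_⟩
  obtain ⟨n', hn'⟩ : ∃ n' : ℕ, n + l' = n' := ⟨(n + l').toNat, by omega⟩
  rw [mulLin_pow_expSnd' 1 l' n' n hn' hG, mulLin_pow_expFst 1 (by norm_num) l' n' n hn' hH,
    hl n' (by omega), one_pow, one_smul]

/-- Multiplication by a power of the first variable. -/
def shiftFst (n : ℤ) : Module.End ℂ (ℤ → ℤ → M) where
  toFun G i j := G (i - n) j
  map_add' _ _ := rfl
  map_smul' _ _ := rfl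

theorem shiftFst_apply (n : ℤ) (G : ℤ → ℤ → M) (i j : ℤ) : shiftFst n G i j = G (i - n) j := rfl

theorem shiftFst_zero (G : ℤ → ℤ → M) : shiftFst 0 G = G := by
  funext i j
  simp [shiftFst_apply]

theorem mulLin_pow_shiftFst (c : ℂ) (l : ℕ) (n : ℤ) (G : ℤ → ℤ → M) :
    (mulLin c ^ l) (shiftFst n G) = shiftFst n ((mulLin c ^ l) G) := by
  funext i j
  simp only [mulLin_pow_apply, shiftFst_apply, sub_right_comm]

theorem EqvMod.shiftFst {c : ℂ} {G H : ℤ → ℤ → M} (h : EqvMod c G H) (n : ℤ) :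
    EqvMod c (shiftFst n G) (shiftFst n H) := by
  obtain ⟨l, hl⟩ := h
  exact ⟨l, fun k hk => by rw [mulLin_pow_shiftFst, mulLin_pow_shiftFst, hl k hk]⟩

/-- `∑ₖ Tₖ (x + y) ^ k G`. -/
def powSumLin (T : ℕ → Module.End ℂ M) (G : ℤ → ℤ → M) : ℤ → ℤ → M := fun i j =>
  ∑ᶠ k : ℕ, T k ((mulLin 1 ^ k) G i j)

theorem mulLin_pow_map (c : ℂ) (l : ℕ) (T : M →ₗ[ℂ] N) (G : ℤ → ℤ → M) :
    (mulLin c ^ l) (fun i j => T (G i j)) = fun i j => T ((mulLin c ^ l) G i j) := by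
  funext i j
  simp [mulLin_pow_apply, map_sum]

theorem mulLin_pow_finsum (c : ℂ) (l : ℕ) {ι : Type*} (G : ι → ℤ → ℤ → M)
    (hG : ∀ i j, (Function.support fun k => G k i j).Finite) :
    (mulLin c ^ l) (fun i j => ∑ᶠ k, G k i j) = fun i j => ∑ᶠ k, (mulLin c ^ l) (G k) i j := by
  funext i j
  simp only [mulLin_pow_apply]
  rw [finsum_sum_comm]
  · exact Finset.sum_congr rfl fun a _ => smul_finsum' _ (hG _ _)
  · intro a _
    exact (hG (i - (l - a)) (j - a)).subset fun k hk h => hk (by simp [h])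

theorem mulLin_pow_powSumLin (l : ℕ) (T : ℕ → Module.End ℂ M) (G : ℤ → ℤ → M)
    (hG : ∀ i j, ∃ N : ℕ, ∀ k, N ≤ k → (mulLin 1 ^ k) G i j = 0) :
    (mulLin 1 ^ l) (powSumLin T G) = powSumLin T ((mulLin 1 ^ l) G) := by
  change (mulLin 1 ^ l) (fun i j => ∑ᶠ k : ℕ, T k ((mulLin 1 ^ k) G i j)) = _
  rw [mulLin_pow_finsum]
  · funext i j
    refine finsum_congr fun k => ?_
    rw [mulLin_pow_map, ← Module.End.mul_apply, ← Module.End.mul_apply, ← pow_add, ← pow_add,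
      add_comm]
  · intro i j
    obtain ⟨N, hN⟩ := hG i j
    exact finite_support_of_eventually_zero fun k hk => by rw [hN k hk, map_zero]

theorem EqvMod.powSumLin (T : ℕ → Module.End ℂ M) {G H : ℤ → ℤ → M} (h : EqvMod 1 G H)
    (hG : ∀ i j, ∃ N : ℕ, ∀ k, N ≤ k → (mulLin 1 ^ k) G i j = 0)
    (hH : ∀ i j, ∃ N : ℕ, ∀ k, N ≤ k → (mulLin 1 ^ k) H i j = 0) :
    EqvMod 1 (powSumLin T G) (powSumLin T H) := by
  obtain ⟨l, hl⟩ := h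
  exact ⟨l, fun k hk => by rw [mulLin_pow_powSumLin k T G hG, mulLin_pow_powSumLin k T H hH, hl k hk]⟩

/-- The substitution `x ↦ x + y`, expanded in nonnegative powers of `y`. -/
def substAdd (G : ℤ → ℤ → M) : ℤ → ℤ → M := fun i j =>
  ∑ᶠ a : ℕ, bc (i + a) a • G (i + a) (j - a)

/-- The factor x becomes x + y; on coefficients this is Pascal's rule. -/
theorem substAdd_mulFst {G : ℤ → ℤ → M} (hG : BddSnd G) :
    substAdd (mulFst G) = mulLin 1 (substAdd G) := by
  funext i j
  rw [mulLin_apply, one_smul, substAdd, substAdd, substAdd]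
  obtain ⟨N, hN⟩ := hG.eventually j
  obtain ⟨N', hN'⟩ := hG.eventually (j - 1)
  rw [finsum_nat_eq_sum_range (N := N + N' + 1), finsum_nat_eq_sum_range (N := N + N' + 1),
    finsum_nat_eq_sum_range (N := N + N'), Finset.sum_range_succ', Finset.sum_range_succ' _ (N + N'),
    add_right_comm, ← Finset.sum_add_distrib]
  · congr 1
    · refine Finset.sum_congr rfl fun k _ => ?_
      change bc (i + ((k + 1 : ℕ) : ℤ)) (k + 1) • G (i + ((k + 1 : ℕ) : ℤ) - 1) _ = _
      push_cast
      rw [show i + ((k : ℤ) + 1) - 1 = i + k by ring,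
        show i - 1 + ((k : ℤ) + 1) = i + k by ring, show i + ((k : ℤ) + 1) = i + k + 1 by ring,
        show j - 1 - (k : ℤ) = j - (k + 1) by ring, bc_succ_succ, add_comm (bc _ _), add_smul]
    · change bc (i + ((0 : ℕ) : ℤ)) 0 • G (i + ((0 : ℕ) : ℤ) - 1) _ = _
      simp
  · intro k hk; rw [hN' k (by omega), smul_zero]
  · intro k hk; rw [hN k (by omega), smul_zero]
  · intro k hk
    change bc (i + k) k • G (i + k - 1) _ = 0
    rw [hN k (by omega), smul_zero]

theorem substAdd_support {G : ℤ → ℤ → M} (hG : BddSnd G) (i j : ℤ) :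
    (Function.support fun a : ℕ => bc (i + a) a • G (i + a) (j - a)).Finite := by
  obtain ⟨N, hN⟩ := hG.eventually j
  exact finite_support_of_eventually_zero fun k hk => by rw [hN k hk, smul_zero]

theorem substAdd_mulSnd (G : ℤ → ℤ → M) : substAdd (mulSnd G) = mulSnd (substAdd G) := by
  funext i j
  change ∑ᶠ a : ℕ, bc (i + a) a • G (i + a) (j - a - 1) = ∑ᶠ a : ℕ, _ • G _ (j - 1 - a)
  simp only [sub_right_comm]

theorem substAdd_add {G H : ℤ → ℤ → M} (hG : BddSnd G) (hH : BddSnd H) :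
    substAdd (G + H) = substAdd G + substAdd H := by
  funext i j
  simp only [substAdd, Pi.add_apply, smul_add]
  exact finsum_add_distrib (substAdd_support hG i j) (substAdd_support hH i j)

theorem substAdd_smul (c : ℂ) {G : ℤ → ℤ → M} (hG : BddSnd G) :
    substAdd (c • G) = c • substAdd G := by
  funext i j
  simp only [substAdd, Pi.smul_apply]
  rw [smul_finsum' _ (substAdd_support hG i j)]
  simp only [smul_comm c]

theorem BddSnd.add {G H : ℤ → ℤ → M} (hG : BddSnd G) (hH : BddSnd H) : BddSnd (G + H) := by
  obtain ⟨J, hJ⟩ := hG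
  obtain ⟨J', hJ'⟩ := hH
  refine ⟨min J J', fun i j hj => ?_⟩
  rw [Pi.add_apply, Pi.add_apply, hJ i j (lt_of_lt_of_le hj (min_le_left _ _)),
    hJ' i j (lt_of_lt_of_le hj (min_le_right _ _)), add_zero]

theorem BddSnd.smul {G : ℤ → ℤ → M} (c : ℂ) (hG : BddSnd G) : BddSnd (c • G) := by
  obtain ⟨J, hJ⟩ := hG
  exact ⟨J, fun i j hj => by rw [Pi.smul_apply, Pi.smul_apply, hJ i j hj, smul_zero]⟩

theorem BddSnd.sub {G H : ℤ → ℤ → M} (hG : BddSnd G) (hH : BddSnd H) : BddSnd (G - H) := by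
  have := hG.add (hH.smul (-1))
  simpa [sub_eq_add_neg] using this

theorem substAdd_sub {G H : ℤ → ℤ → M} (hG : BddSnd G) (hH : BddSnd H) :
    substAdd (G - H) = substAdd G - substAdd H := by
  rw [sub_eq_add_neg, ← neg_one_smul ℂ H, substAdd_add hG (hH.smul _), substAdd_smul _ hH,
    neg_one_smul, sub_eq_add_neg]

theorem BddSnd.sum {ι : Type*} (s : Finset ι) {G : ι → ℤ → ℤ → M} (hG : ∀ i ∈ s, BddSnd (G i)) :
    BddSnd (∑ i ∈ s, G i) := by
  classical
  induction s using Finset.induction_on with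
  | empty => exact ⟨0, fun _ _ _ => rfl⟩
  | insert a s ha ih =>
    rw [Finset.sum_insert ha]
    exact (hG a (Finset.mem_insert_self a s)).add
      (ih fun i hi => hG i (Finset.mem_insert_of_mem hi))

theorem substAdd_sum {ι : Type*} (s : Finset ι) {G : ι → ℤ → ℤ → M}
    (hG : ∀ i ∈ s, BddSnd (G i)) : substAdd (∑ i ∈ s, G i) = ∑ i ∈ s, substAdd (G i) := by
  classical
  induction s using Finset.induction_on with
  | empty =>
    funext i j
    simp [substAdd]
  | insert a s ha ih =>
    rw [Finset.sum_insert ha, Finset.sum_insert ha, substAdd_add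
      (hG a (Finset.mem_insert_self a s))
      (BddSnd.sum s fun i hi => hG i (Finset.mem_insert_of_mem hi)),
      ih fun i hi => hG i (Finset.mem_insert_of_mem hi)]

theorem BddSnd.shiftFst {G : ℤ → ℤ → M} (n : ℤ) (hG : BddSnd G) : BddSnd (shiftFst n G) := by
  obtain ⟨J, hJ⟩ := hG
  exact ⟨J, fun i j hj => hJ _ j hj⟩

theorem BddSnd.mulSnd {G : ℤ → ℤ → M} (hG : BddSnd G) : BddSnd (mulSnd G) := by
  obtain ⟨J, hJ⟩ := hG
  exact ⟨J, fun i j hj => hJ i (j - 1) (by omega)⟩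

theorem BddSnd.expSnd {G : ℤ → ℤ → M} (c : ℂ) (n : ℤ) (hG : BddSnd G) : BddSnd (expSnd c n G) := by
  obtain ⟨J, hJ⟩ := hG
  refine ⟨J, fun i j hj => finsum_eq_zero_of_forall_eq_zero fun k => ?_⟩
  rw [hJ _ _ (by omega), smul_zero]

theorem BddSnd.substAdd {G : ℤ → ℤ → M} (hG : BddSnd G) : BddSnd (substAdd G) := by
  obtain ⟨J, hJ⟩ := hG
  refine ⟨J, fun i j hj => finsum_eq_zero_of_forall_eq_zero fun k => ?_⟩
  rw [hJ _ _ (by omega), smul_zero]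

theorem substAdd_mulLin {G : ℤ → ℤ → M} (hG : BddSnd G) :
    substAdd (mulLin (-1) G) = shiftFst 1 (substAdd G) := by
  have h : mulLin (-1) G = mulFst G - mulSnd G := by
    rw [mulLin]; simp [sub_eq_add_neg]
  have hb : BddSnd (mulFst G) := hG.shiftFst 1
  rw [h, substAdd_sub hb hG.mulSnd, substAdd_mulFst hG, substAdd_mulSnd, mulLin,
    one_smul, LinearMap.add_apply, add_sub_cancel_right]
  rfl

/-- The factor (x - y)ⁿ becomes xⁿ. Powers of x are invertible, so the case n < 0 follows by
comparing with exponent 0. -/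
theorem substAdd_expSnd {G : ℤ → ℤ → M} (hG : BddSnd G) (n : ℤ) :
    substAdd (expSnd (-1) n G) = shiftFst n (substAdd G) := by
  have hpos : ∀ (l : ℕ) (n : ℤ), substAdd (expSnd (-1) (n + l) G) =
      shiftFst l (substAdd (expSnd (-1) n G)) := by
    intro l n
    induction l with
    | zero => simp [shiftFst_zero]
    | succ l ih =>
      push_cast
      rw [← add_assoc, ← mulLin_expSnd _ _ hG, substAdd_mulLin (hG.expSnd _ _), ih]
      funext i j
      simp only [shiftFst_apply]
      rw [show i - 1 - (l : ℤ) = i - (l + 1) by ring]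
  rcases le_total 0 n with hn | hn
  · lift n to ℕ using hn
    have := hpos n 0
    rwa [zero_add, expSnd_zero] at this
  · obtain ⟨l, hl⟩ : ∃ l : ℕ, n + l = 0 := ⟨(-n).toNat, by omega⟩
    have := hpos l n
    rw [hl, expSnd_zero] at this
    funext i j
    rw [shiftFst_apply, this, shiftFst_apply, show i - n - l = i by omega]

theorem substAdd_mulFst_pow {G : ℤ → ℤ → M} (hG : BddSnd G) (k : ℕ) :
    substAdd (shiftFst k G) = (mulLin 1 ^ k) (substAdd G) := by
  induction k with
  | zero => simp [shiftFst_zero]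
  | succ k ih =>
    have : shiftFst ((k + 1 : ℕ) : ℤ) G = mulFst (shiftFst k G) := by
      funext i j
      change G _ j = G (i - 1 - k) j
      push_cast
      congr 1; ring
    rw [this, substAdd_mulFst (hG.shiftFst k), ih, pow_succ', Module.End.mul_apply]

/-- The factor xⁿ becomes (x + y)ⁿ. For n < 0, multiply by a power of x + y and cancel it. -/
theorem substAdd_shiftFst {G : ℤ → ℤ → M} (hG : BddSnd G) (n : ℤ) :
    substAdd (shiftFst n G) = expSnd 1 n (substAdd G) := by
  rcases le_total 0 n with hn | hn
  · lift n to ℕ using hn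
    rw [substAdd_mulFst_pow hG, expSnd_natCast 1 n hG.substAdd]
  · obtain ⟨l, hl⟩ : ∃ l : ℕ, n + l = 0 := ⟨(-n).toNat, by omega⟩
    have h1 : substAdd G = (mulLin 1 ^ l) (substAdd (shiftFst n G)) := by
      rw [← substAdd_mulFst_pow (hG.shiftFst n)]
      congr 1
      funext i j
      change _ = G (i - l - n) j
      rw [show i - l - n = i by omega]
    have hB := (hG.shiftFst n).substAdd
    rw [h1, ← expSnd_natCast 1 l hB]
    -- Negative powers invert positive ones: multiplication by x + y is injective on series bounded
    -- below in y, so the exponent can be lowered one at a time.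
    have h2 : ∀ (a b : ℕ) (H : ℤ → ℤ → M), BddSnd H →
        expSnd 1 (-(a : ℤ)) (expSnd 1 b H) = expSnd 1 (b - a) H := by
      intro a b H hH
      have inj : Function.Injective fun K : {K : ℤ → ℤ → M // BddSnd K} => mulLin 1 K.1 := by
        rintro ⟨K, hK⟩ ⟨K', hK'⟩ h
        have h' : mulLin 1 (K - K') = 0 := by rw [map_sub]; exact sub_eq_zero.2 h
        obtain ⟨J, hJ⟩ := hK.sub hK'
        have : ∀ n : ℕ, ∀ i, (K - K') i (J - 1 + n) = 0 := by
          intro n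
          induction n with
          | zero => intro i; exact hJ i _ (by omega)
          | succ n ih =>
            intro i
            have := congrFun (congrFun h' (i + 1)) (J - 1 + (n + 1 : ℕ))
            rw [mulLin_apply, one_smul] at this
            have e : J - 1 + ((n + 1 : ℕ) : ℤ) - 1 = J - 1 + n := by push_cast; ring
            rw [e, ih, add_zero, add_sub_cancel_right] at this
            exact this
        ext i j
        rcases lt_or_ge j J with hj | hj
        · exact sub_eq_zero.1 (hJ i j hj)
        · have := this (j - J + 1).toNat i
          rw [show J - 1 + ((j - J + 1).toNat : ℤ) = j by omega] at this
          exact sub_eq_zero.1 this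
      induction a with
      | zero => simp [expSnd_zero]
      | succ a ih =>
        have e1 := mulLin_expSnd 1 (-((a + 1 : ℕ) : ℤ)) (hH.expSnd 1 b)
        have e2 := mulLin_expSnd 1 (b - ((a + 1 : ℕ) : ℤ)) hH
        rw [show -((a + 1 : ℕ) : ℤ) + 1 = -a by push_cast; ring, ih] at e1
        rw [show (b : ℤ) - ((a + 1 : ℕ) : ℤ) + 1 = b - a by push_cast; ring] at e2
        exact congrArg Subtype.val (inj (a₁ := ⟨_, (hH.expSnd 1 b).expSnd 1 _⟩)
          (a₂ := ⟨_, hH.expSnd 1 _⟩) (e1.trans e2.symm))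
    have h3 := h2 l l _ hB
    rw [show -(l : ℤ) = n by omega, sub_self, expSnd_zero] at h3
    exact h3.symm

/-- `∑ₖ Tₖ x ^ k G`. -/
def powSumFst (T : ℕ → Module.End ℂ M) (G : ℤ → ℤ → M) : ℤ → ℤ → M := fun i j =>
  ∑ᶠ k : ℕ, T k (G (i - k) j)

theorem BddSnd.powSumFst {G : ℤ → ℤ → M} (T : ℕ → Module.End ℂ M) (hG : BddSnd G) :
    BddSnd (powSumFst T G) := by
  obtain ⟨J, hJ⟩ := hG
  refine ⟨J, fun i j hj => finsum_eq_zero_of_forall_eq_zero fun k => ?_⟩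
  rw [hJ _ _ hj, map_zero]

/-- The operators T_k need not vanish for large k, so lower bounds in both variables are required
before the substitution can be moved inside the sum over k. -/
theorem substAdd_powSumFst (T : ℕ → Module.End ℂ M) {G : ℤ → ℤ → M} (hG : BddSnd G)
    (hG' : ∀ j, ∃ I : ℤ, ∀ i < I, G i j = 0) :
    (∀ i j, ∃ N : ℕ, ∀ k, N ≤ k → (mulLin 1 ^ k) (substAdd G) i j = 0) ∧
    substAdd (powSumFst T G) = powSumLin T (substAdd G) := by
  have key : ∀ i j, ∃ N : ℕ, ∀ a k : ℕ, N ≤ a ∨ N ≤ k → G (i + a - k) (j - a) = 0 := by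
    intro i j
    obtain ⟨N, hN⟩ := hG.eventually j
    choose I hI using hG'
    -- Boundedness in y limits a to a < N; for each such a the lower bound of column j - a limits k.
    -- The sum majorizes all these bounds at once.
    refine ⟨N + ∑ a ∈ Finset.range N, (i + a - I (j - a) + 1).toNat, fun a k h => ?_⟩
    by_cases ha : N ≤ a
    · exact hN a ha _
    · have h' := Finset.single_le_sum (f := fun a : ℕ => (i + a - I (j - a) + 1).toNat)
        (fun _ _ => Nat.zero_le _) (Finset.mem_range.2 (not_le.1 ha))
      refine hI _ _ ?_
      omega
  refine ⟨fun i j => ?_, ?_⟩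
  · obtain ⟨N, hN⟩ := key i j
    refine ⟨N, fun k hk => ?_⟩
    rw [← substAdd_mulFst_pow hG]
    refine finsum_eq_zero_of_forall_eq_zero fun a => ?_
    rw [shiftFst_apply, hN a k (Or.inr hk), smul_zero]
  · funext i j
    obtain ⟨N, hN⟩ := key i j
    have e1 : ∀ k : ℕ, T k ((mulLin 1 ^ k) (substAdd G) i j) =
        ∑ᶠ a : ℕ, bc (i + a) a • T k (G (i + a - k) (j - a)) := by
      intro k
      rw [← substAdd_mulFst_pow hG, substAdd, map_finsum _ (substAdd_support (hG.shiftFst k) i j)]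
      simp only [map_smul, shiftFst_apply]
    have e2 : ∀ a : ℕ, bc (i + a) a • powSumFst T G (i + a) (j - a) =
        ∑ᶠ k : ℕ, bc (i + a) a • T k (G (i + a - k) (j - a)) := by
      intro a
      rw [powSumFst, smul_finsum']
      exact finite_support_of_eventually_zero (N := N) fun k hk => by
        rw [hN a k (Or.inr hk), map_zero]
    change ∑ᶠ a : ℕ, bc (i + a) a • powSumFst T G (i + a) (j - a) =
      ∑ᶠ k : ℕ, T k ((mulLin 1 ^ k) (substAdd G) i j)
    rw [finsum_congr e1, finsum_congr e2]
    refine finsum_comm_of_finite (((Set.finite_Iio N).prod (Set.finite_Iio N)).subset ?_)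
    rintro ⟨a, k⟩ h
    simp only [Set.mem_prod, Set.mem_Iio]
    constructor <;> by_contra hlt <;> refine h ?_
    · simp only [hN a k (Or.inl (not_lt.1 hlt)), map_zero, smul_zero]
    · simp only [hN a k (Or.inr (not_lt.1 hlt)), map_zero, smul_zero]

theorem finsum_eq_finsum_antidiagonal {f : ℕ × ℕ → M} (h : (Function.support f).Finite) :
    ∑ᶠ p, f p = ∑ᶠ n : ℕ, ∑ p ∈ Finset.HasAntidiagonal.antidiagonal n, f p := by
  classical
  have hs : (Function.support fun n : ℕ => ∑ p ∈ Finset.HasAntidiagonal.antidiagonal n, f p) ⊆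
      h.toFinset.image fun p => p.1 + p.2 := by
    intro n hn
    obtain ⟨p, hp, hp'⟩ := Finset.exists_ne_zero_of_sum_ne_zero hn
    simp only [Finset.coe_image, Set.mem_image, Set.Finite.coe_toFinset]
    exact ⟨p, hp', Finset.HasAntidiagonal.mem_antidiagonal.1 hp⟩
  rw [finsum_eq_sum f h, finsum_eq_sum_of_support_subset _ hs,
    ← Finset.sum_fiberwise_of_maps_to (g := fun p : ℕ × ℕ => p.1 + p.2)
      (fun p hp => Finset.mem_image_of_mem _ hp)]
  refine Finset.sum_congr rfl fun n _ => ?_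
  refine Finset.sum_subset ?_ ?_
  · intro p hp
    exact Finset.HasAntidiagonal.mem_antidiagonal.2 (Finset.mem_filter.1 hp).2
  · intro p hp hp'
    by_contra hne
    exact hp' (Finset.mem_filter.2 ⟨h.mem_toFinset.2 hne, Finset.HasAntidiagonal.mem_antidiagonal.1 hp⟩)

end TwoVariable

end QVA

namespace QVA

/-! ### Weak associativity. -/

section Associativity

variable {q ℓ : ℂ} {W : Type*} [AddCommGroup W] [Module ℂ W] [LieRingModule (BHat q) W]
  [LieModule ℂ (BHat q) W] (hW : IsRestricted q W) (hℓ : HasLevel q ℓ W)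

/-- This is [β_p, Y(v, x)] = ∑ₜ (p choose t) x^{p-t} Y(β_t v, x) for p ≥ 0. By definition of the
nonnegative field modes, the right-hand fields are iterated finite differences of the brackets [β_s,
Y(v, x)]; Newton's formula inverts this. -/
theorem beta_fieldMap_coeff (r : ℤ) (p : ℕ) (v : VacuumModule q ℓ) (w : W) (j : ℤ) :
    betaOp q W r p ((fieldMap hW hℓ v w).coeff j) =
      (fieldMap hW hℓ v (betaOp q W r p w)).coeff j +
        ∑ᶠ t : ℕ, bc p t • (fieldMap hW hℓ ⁅beta q r t, v⁆ w).coeff (j - p + t) := by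
  set e : ℕ → W := fun s => betaOp q W r s ((fieldMap hW hℓ v w).coeff (j - p + s)) -
    (fieldMap hW hℓ v (betaOp q W r s w)).coeff (j - p + s) with he
  have hd : ∀ t : ℕ, (fieldMap hW hℓ ⁅beta q r t, v⁆ w).coeff (j - p + t) =
      (fwdDiff 1)^[t] e 0 := by
    intro t
    rw [fwdDiff_iter_eq_sum_shift, fieldMap_beta, fieldMode_coeff,
      finsum_nat_eq_sum_range (N := t + 1), finsum_nat_eq_sum_range (N := t + 1),
      ← Finset.sum_range_reflect, ← Finset.sum_sub_distrib]
    · refine Finset.sum_congr rfl fun s hs => ?_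
      rw [Finset.mem_range] at hs
      have h1 : ((t + 1 - 1 - s : ℕ) : ℤ) = t - s := by omega
      rw [h1, bc_natCast, bc_natCast, show t + 1 - 1 - s = t - s by omega,
        Nat.choose_symm (by omega), show (t : ℤ) - s = ((t - s : ℕ) : ℤ) by omega, zpow_natCast,
        ← smul_sub, he, ← Int.cast_smul_eq_zsmul ℂ]
      push_cast
      rw [Nat.cast_sub (by omega)]
      simp only [zero_add, smul_eq_mul, mul_one]
      rw [show (t : ℤ) - (t - s) = s by ring, show j - p + t - ((t : ℤ) - s) = j - p + s by ring]
    · intro k hk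
      rw [bc_natCast_of_lt (by omega), mul_zero, zero_smul]
    · intro k hk
      rw [bc_natCast_of_lt (by omega), mul_zero, zero_smul]
  -- Newton's formula e(p) = ∑ (p choose t) Δᵗe(0).
  have hp := shift_eq_sum_fwdDiff_iter 1 e p 0
  rw [finsum_nat_eq_sum_range (N := p + 1)]
  · simp only [hd, bc_natCast, Nat.cast_smul_eq_nsmul]
    rw [← hp, he]
    simp
  · intro k hk
    rw [bc_natCast_of_lt (by omega), zero_smul]

/-- The field map of the vacuum module itself. -/
def vacField (q ℓ : ℂ) : VacuumModule q ℓ →ₗ[ℂ] VacuumModule q ℓ →ₗ[ℂ] LaurentSeries (VacuumModule q ℓ) :=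
  fieldMap (isRestricted_vacuumModule q ℓ) hasLevel_vacuumModule

/-- The coefficients of `Y_W(u, x₁) Y_W(v, x₂) w`. -/
def prodSeries (u v : VacuumModule q ℓ) (w : W) : ℤ → ℤ → W := fun i j =>
  (fieldMap hW hℓ u ((fieldMap hW hℓ v w).coeff j)).coeff i

/-- The coefficients of `Y_W(Y(u, x₀) v, x₂) w`. -/
def iterSeries (u v : VacuumModule q ℓ) (w : W) : ℤ → ℤ → W := fun i j =>
  (fieldMap hW hℓ ((vacField q ℓ u v).coeff i) w).coeff j

theorem exists_coeff_eq_zero {M : Type*} [Zero M] (f : LaurentSeries M) :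
    ∃ J : ℤ, ∀ j < J, f.coeff j = 0 :=
  ⟨f.order, fun _ hj => HahnSeries.coeff_eq_zero_of_lt_order hj⟩

theorem bddSnd_prodSeries (u v : VacuumModule q ℓ) (w : W) : BddSnd (prodSeries hW hℓ u v w) := by
  obtain ⟨J, hJ⟩ := exists_coeff_eq_zero (fieldMap hW hℓ v w)
  exact ⟨J, fun i j hj => by rw [prodSeries, hJ j hj, map_zero, HahnSeries.coeff_zero]⟩

theorem prodSeries_lower (u v : VacuumModule q ℓ) (w : W) (j : ℤ) :
    ∃ I : ℤ, ∀ i < I, prodSeries hW hℓ u v w i j = 0 :=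
  exists_coeff_eq_zero _

theorem bddFst_iterSeries (u v : VacuumModule q ℓ) (w : W) : BddFst (iterSeries hW hℓ u v w) := by
  obtain ⟨J, hJ⟩ := exists_coeff_eq_zero (vacField q ℓ u v)
  exact ⟨J, fun i j hi => by
    rw [iterSeries, hJ i hi, map_zero, LinearMap.zero_apply, HahnSeries.coeff_zero]⟩

/-- In a term of (x + y)ᵏG of fixed bidegree, either the x-exponent drops below the common bound, or
one of finitely many rows is met with the y-exponent too low. -/
theorem mulLin_pow_eventually_zero {M : Type*} [AddCommGroup M] [Module ℂ M] {G : ℤ → ℤ → M}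
    (h1 : BddFst G) (h2 : ∀ i, ∃ J : ℤ, ∀ j < J, G i j = 0) (i j : ℤ) :
    ∃ N : ℕ, ∀ k, N ≤ k → (mulLin 1 ^ k) G i j = 0 := by
  obtain ⟨I, hI⟩ := h1
  choose J hJ using h2
  refine ⟨(i - I + 1).toNat + ∑ b ∈ Finset.range (i - I + 1).toNat, (j - J (i - b) + 1).toNat,
    fun k hk => ?_⟩
  rw [mulLin_pow_apply]
  refine Finset.sum_eq_zero fun a ha => ?_
  rw [Finset.mem_range] at ha
  by_cases hb : (i - I + 1).toNat ≤ k - a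
  · rw [hI _ _ (by omega), smul_zero]
  · have h' := Finset.single_le_sum (f := fun b : ℕ => (j - J (i - b) + 1).toNat)
      (fun _ _ => Nat.zero_le _) (Finset.mem_range.2 (not_le.1 hb))
    have h3 : ((k - a : ℕ) : ℤ) = k - a := by omega
    simp only [h3] at h'
    rw [hJ _ _ (by omega), smul_zero]

theorem iterSeries_eventually_zero (u v : VacuumModule q ℓ) (w : W) (i j : ℤ) :
    ∃ N : ℕ, ∀ k, N ≤ k → (mulLin 1 ^ k) (iterSeries hW hℓ u v w) i j = 0 :=
  mulLin_pow_eventually_zero (bddFst_iterSeries hW hℓ u v w) (fun _ => exists_coeff_eq_zero _) i j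

/-- Unfold Y(β_m u, x₁) and move the modes β_p, p ≥ 0, through Y(v, x₂). The terms in β_t v resum to
(m choose t)(-x₁ + x₂)^{m-t}, written here with the sign taken out of x₁ - x₂. -/
theorem prodSeries_beta (r m : ℤ) (u v : VacuumModule q ℓ) (w : W) {N : ℕ}
    (hw : ∀ p : ℕ, N ≤ p → betaOp q W r p w = 0) (hv : ∀ t : ℕ, N ≤ t → ⁅beta q r t, v⁆ = 0) :
    prodSeries hW hℓ ⁅beta q r m, u⁆ v w =
      powSumFst (fun k => ((-1) ^ k * bc m k) • betaOp q W r (m - k)) (prodSeries hW hℓ u v w) -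
      (∑ p ∈ Finset.range N, ((-1 : ℂ) ^ (m - p) * bc m p) •
        shiftFst (m - p) (prodSeries hW hℓ u v (betaOp q W r p w)) +
      ∑ t ∈ Finset.range N, ((-1 : ℂ) ^ (m - t) * bc m t) •
        expSnd (-1) (m - t) (prodSeries hW hℓ u ⁅beta q r t, v⁆ w)) := by
  funext i j
  simp only [Pi.sub_apply, Pi.add_apply, Finset.sum_apply, Pi.smul_apply]
  rw [prodSeries, fieldMap_beta, fieldMode_coeff]
  congr 1
  simp only [beta_fieldMap_coeff hW hℓ]
  have hfin : ∀ p : ℕ, (Function.support fun t : ℕ => bc p t •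
      (fieldMap hW hℓ ⁅beta q r t, v⁆ w).coeff (j - p + t)).Finite := fun p =>
    finite_support_of_eventually_zero (N := N) fun t ht => by simp [hv t ht]
  have e1 : ∀ p : ℕ, ((-1 : ℂ) ^ (m - p) * bc m p) • (fieldMap hW hℓ u
      ((fieldMap hW hℓ v (betaOp q W r p w)).coeff j +
        ∑ᶠ t : ℕ, bc p t • (fieldMap hW hℓ ⁅beta q r t, v⁆ w).coeff (j - p + t))).coeff
          (i - (m - p)) =
      ((-1 : ℂ) ^ (m - p) * bc m p) • prodSeries hW hℓ u v (betaOp q W r p w) (i - (m - p)) j +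
      ∑ t ∈ Finset.range N, ((-1 : ℂ) ^ (m - p) * bc m p * bc p t) •
        prodSeries hW hℓ u ⁅beta q r t, v⁆ w (i - (m - p)) (j - p + t) := by
    intro p
    rw [finsum_nat_eq_sum_range (N := N) (fun t ht => by simp [hv t ht]), map_add, map_sum,
      HahnSeries.coeff_add, HahnSeries.coeff_sum, smul_add, Finset.smul_sum]
    congr 1
    refine Finset.sum_congr rfl fun t _ => ?_
    rw [map_smul, HahnSeries.coeff_smul, smul_smul]
    rfl
  rw [finsum_congr e1]
  have hbdd : ∀ t : ℕ, ∃ N' : ℕ, ∀ p : ℕ, N' ≤ p → ∀ i,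
      prodSeries hW hℓ u ⁅beta q r t, v⁆ w i (j - p + t) = 0 := fun t => by
    obtain ⟨J, hJ⟩ := bddSnd_prodSeries hW hℓ u ⁅beta q r t, v⁆ w
    exact ⟨(j + t - J + 1).toNat, fun p hp i => hJ _ _ (by omega)⟩
  have hfin1 : (Function.support fun p : ℕ => ((-1 : ℂ) ^ (m - p) * bc m p) •
      prodSeries hW hℓ u v (betaOp q W r p w) (i - (m - p)) j).Finite :=
    finite_support_of_eventually_zero (N := N) fun p hp => by
      rw [prodSeries, hw p hp]; simp
  have hfin2 : ∀ t ∈ Finset.range N, (Function.support fun p : ℕ =>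
      ((-1 : ℂ) ^ (m - p) * bc m p * bc p t) •
        prodSeries hW hℓ u ⁅beta q r t, v⁆ w (i - (m - p)) (j - p + t)).Finite := fun t _ => by
    obtain ⟨N', hN'⟩ := hbdd t
    exact finite_support_of_eventually_zero (N := N') fun p hp => by rw [hN' p hp, smul_zero]
  rw [finsum_add_distrib hfin1, finsum_sum_comm _ _ hfin2, finsum_nat_eq_sum_range (N := N)]
  · congr 1
    refine Finset.sum_congr rfl fun t _ => ?_
    obtain ⟨N', hN'⟩ := hbdd t
    rw [expSnd, finsum_nat_eq_sum_range (N := N' + t), finsum_nat_eq_sum_range (N := N'),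
      add_comm N' t, Finset.sum_range_add, Finset.smul_sum, Finset.sum_eq_zero, zero_add]
    · refine Finset.sum_congr rfl fun k _ => ?_
      -- With p = t + k, (m choose p)(p choose t) = (m choose t)(m - t choose k); terms with p < t
      -- vanish.
      have h1 := bc_mul_bc_add m t k
      rw [bc_natCast]
      push_cast
      rw [smul_smul, show j - ((t : ℤ) + k) + t = j - k by ring,
        show i - (m - ((t : ℤ) + k)) = i - (m - t) + k by ring,
        show m - ((t : ℤ) + k) = m - t - k by ring, zpow_sub₀ (by norm_num : (-1 : ℂ) ≠ 0) (m - t)]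
      congr 1
      rw [zpow_natCast, div_eq_mul_inv, ← inv_pow, show (-1 : ℂ)⁻¹ = -1 by norm_num]
      linear_combination (-(-1 : ℂ) ^ (m - t) * (-1) ^ k) * h1
    · intro k hk
      rw [Finset.mem_range] at hk
      rw [bc_natCast_of_lt hk, mul_zero, zero_smul]
    · intro k hk
      rw [show j - (k : ℤ) = j - ((k + t : ℕ) : ℤ) + t by push_cast; ring, hN' _ (by omega),
        smul_zero]
    · intro p hp
      rw [hN' _ (by omega), smul_zero]
  · intro p hp
    rw [prodSeries, hw p hp]; simp
  · exact finite_support_of_eventually_zero (N := ∑ t ∈ Finset.range N, (hbdd t).choose) fun p hp =>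
      Finset.sum_eq_zero fun t ht => by
        rw [(hbdd t).choose_spec p ((Finset.single_le_sum
          (f := fun t => (hbdd t).choose) (fun _ _ => Nat.zero_le _) ht).trans hp), smul_zero]

/-- Unfold the inner operator in x₀, then each outer operator Y_W(β_{m-k} ⋯, x₂). The creation parts
combine to ∑ₙ (m choose n)(-1)ⁿ(x₀ + x₂)ⁿ β_{m-n}; the parts acting on w give (x₂ + x₀)^{m-p},
expanded in powers of x₀. -/
theorem iterSeries_beta (r m : ℤ) (u v : VacuumModule q ℓ) (w : W) {N : ℕ}
    (hw : ∀ p : ℕ, N ≤ p → betaOp q W r p w = 0) (hv : ∀ t : ℕ, N ≤ t → ⁅beta q r t, v⁆ = 0) :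
    iterSeries hW hℓ ⁅beta q r m, u⁆ v w =
      powSumLin (fun k => ((-1) ^ k * bc m k) • betaOp q W r (m - k)) (iterSeries hW hℓ u v w) -
      (∑ p ∈ Finset.range N, ((-1 : ℂ) ^ (m - p) * bc m p) •
        expFst 1 (m - p) (iterSeries hW hℓ u v (betaOp q W r p w)) +
      ∑ t ∈ Finset.range N, ((-1 : ℂ) ^ (m - t) * bc m t) •
        shiftFst (m - t) (iterSeries hW hℓ u ⁅beta q r t, v⁆ w)) := by
  funext i j
  simp only [Pi.sub_apply, Pi.add_apply, Finset.sum_apply, Pi.smul_apply]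
  obtain ⟨I, hI⟩ := exists_coeff_eq_zero (vacField q ℓ u v)
  set K := (i - I + 1).toNat with hK
  have hu : ∀ k : ℕ, K ≤ k → (vacField q ℓ u v).coeff (i - k) = 0 := fun k hk => hI _ (by omega)
  have e0 : (vacField q ℓ ⁅beta q r m, u⁆ v).coeff i =
      (∑ k ∈ Finset.range K, ((-1) ^ k * bc m k) • ⁅beta q r (m - k), (vacField q ℓ u v).coeff (i - k)⁆) -
      ∑ t ∈ Finset.range N, ((-1 : ℂ) ^ (m - t) * bc m t) •
        (vacField q ℓ u ⁅beta q r t, v⁆).coeff (i - (m - t)) := by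
    rw [vacField, fieldMap_beta, fieldMode_coeff, finsum_nat_eq_sum_range (N := K),
      finsum_nat_eq_sum_range (N := N)]
    · rfl
    · intro t ht
      rw [betaOp_apply, hv t ht]; simp
    · intro k hk
      rw [vacField] at hu
      rw [hu k hk, map_zero, smul_zero]
  rw [iterSeries, e0]
  simp only [map_sub, map_sum, map_smul, LinearMap.sub_apply, LinearMap.sum_apply,
    LinearMap.smul_apply, HahnSeries.coeff_sub, HahnSeries.coeff_sum, HahnSeries.coeff_smul]
  rw [← sub_sub]
  congr 1
  obtain ⟨J, hJ⟩ : ∃ L : ℕ, ∀ k < K, ∀ s : ℕ, L ≤ s →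
      iterSeries hW hℓ u v w (i - k) (j - s) = 0 := by
    choose J hJ using fun k : ℕ => exists_coeff_eq_zero (fieldMap hW hℓ ((vacField q ℓ u v).coeff (i - k)) w)
    refine ⟨∑ k ∈ Finset.range K, (j - J k + 1).toNat, fun k hk s hs => hJ k _ ?_⟩
    have h' := Finset.single_le_sum (f := fun k : ℕ => (j - J k + 1).toNat)
      (fun _ _ => Nat.zero_le _) (Finset.mem_range.2 hk)
    omega
  have hz : ∀ k s : ℕ, K ≤ k ∨ J ≤ s → iterSeries hW hℓ u v w (i - k) (j - s) = 0 := by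
    intro k s h
    by_cases hk : K ≤ k
    · rw [iterSeries, hu k hk]; simp
    · exact hJ k (not_le.1 hk) s (h.resolve_left hk)
  have e1 : ∀ k : ℕ, ((-1 : ℂ) ^ k * bc m k) •
      (fieldMap hW hℓ ⁅beta q r (m - k), (vacField q ℓ u v).coeff (i - k)⁆ w).coeff j =
      (∑ᶠ s : ℕ, ((-1) ^ k * bc m k * ((-1) ^ s * bc (m - k) s)) •
        betaOp q W r (m - (k + s : ℕ)) (iterSeries hW hℓ u v w (i - k) (j - s))) -
      ∑ p ∈ Finset.range N, ((-1 : ℂ) ^ (m - p) * bc m p * bc (m - p) k) •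
        iterSeries hW hℓ u v (betaOp q W r p w) (i - k) (j - (m - p) + k) := by
    intro k
    rw [fieldMap_beta, fieldMode_coeff, smul_sub, smul_finsum', finsum_nat_eq_sum_range (N := N)
        (f := fun p : ℕ => ((-1 : ℂ) ^ (m - k - p) * bc (m - k) p) • _), Finset.smul_sum]
    · congr 1
      · refine finsum_congr fun s => ?_
        rw [smul_smul]
        push_cast
        rw [show m - ((k : ℤ) + s) = m - k - s by ring]
        rfl
      · refine Finset.sum_congr rfl fun p _ => ?_
        rw [smul_smul, show j - (m - k - (p : ℤ)) = j - (m - p) + k by ring, sub_right_comm m,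
          zpow_sub₀ (by norm_num : (-1 : ℂ) ≠ 0) (m - p)]
        have h1 := bc_mul_bc_comm m p k
        have h2 : ((-1 : ℂ) ^ (k : ℕ)) * (((-1 : ℂ) ^ (k : ℤ))⁻¹) = 1 := by
          rw [zpow_natCast]; exact mul_inv_cancel₀ (pow_ne_zero _ (by norm_num))
        congr 1
        rw [div_eq_mul_inv, mul_assoc ((-1 : ℂ) ^ (m - p)) (bc m p), h1]
        linear_combination ((-1 : ℂ) ^ (m - p) * bc m k * bc (m - k) p) * h2
    · intro p hp
      rw [hw p hp]; simp
    · refine finite_support_of_eventually_zero (N := (j - (fieldMap hW hℓ ((vacField q ℓ u v).coeff (i - k)) w).order + 1).toNat) fun s hs => ?_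
      rw [HahnSeries.coeff_eq_zero_of_lt_order (by omega), map_zero, smul_zero]
  rw [Finset.sum_congr rfl fun k _ => e1 k, Finset.sum_sub_distrib]
  congr 1
  · rw [← finsum_nat_eq_sum_range (N := K)]
    · have hfs : (Function.support fun p : ℕ × ℕ =>
          ((-1 : ℂ) ^ p.1 * bc m p.1 * ((-1) ^ p.2 * bc (m - p.1) p.2)) •
          betaOp q W r (m - (p.1 + p.2 : ℕ)) (iterSeries hW hℓ u v w (i - p.1) (j - p.2))).Finite := by
        refine ((Set.finite_Iio K).prod (Set.finite_Iio J)).subset ?_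
        rintro ⟨k, s⟩ h
        simp only [Set.mem_prod, Set.mem_Iio]
        constructor <;> by_contra hlt <;> refine h ?_
        · simp only [hz k s (Or.inl (not_lt.1 hlt)), map_zero, smul_zero]
        · simp only [hz k s (Or.inr (not_lt.1 hlt)), map_zero, smul_zero]
      -- Collecting by n = k + s turns (m choose k)(m - k choose s) into (n choose k)(m choose n),
      -- the coefficients of (x₀ + x₂)ⁿ.
      rw [finsum_prod_eq hfs, finsum_eq_finsum_antidiagonal hfs, powSumLin]
      refine finsum_congr fun n => ?_
      rw [mulLin_pow_apply, map_sum, ← Finset.Nat.sum_antidiagonal_swap,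
        Finset.Nat.sum_antidiagonal_eq_sum_range_succ_mk]
      refine Finset.sum_congr rfl fun a ha => ?_
      rw [Finset.mem_range] at ha
      simp only [Prod.swap_prod_mk, LinearMap.smul_apply, map_smul, one_pow, one_mul]
      have h1 := bc_mul_bc_add m (n - a) a
      rw [Nat.sub_add_cancel (by omega), Nat.choose_symm (by omega)] at h1
      rw [Nat.sub_add_cancel (by omega), smul_smul, show ((n - a : ℕ) : ℤ) = n - a by omega]
      rw [show ((n - a : ℕ) : ℤ) = n - a by omega] at h1
      congr 1
      have h2 : (-1 : ℂ) ^ (n - a) * (-1) ^ a = (-1) ^ n := by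
        rw [← pow_add, Nat.sub_add_cancel (by omega)]
      linear_combination ((-1 : ℂ) ^ (n - a) * (-1) ^ a) * h1 + (n.choose a : ℂ) * bc m n * h2
    · intro k hk
      refine finsum_eq_zero_of_forall_eq_zero fun s => ?_
      rw [hz k s (Or.inl hk), map_zero, smul_zero]
  · rw [Finset.sum_comm]
    refine Finset.sum_congr rfl fun p _ => ?_
    rw [expFst, finsum_nat_eq_sum_range (N := K), Finset.smul_sum]
    · refine Finset.sum_congr rfl fun k _ => ?_
      rw [smul_smul, one_pow, mul_one]
    · intro k hk
      rw [iterSeries, hu k hk]; simp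

theorem prodSeries_vac (v : VacuumModule q ℓ) (w : W) (i j : ℤ) :
    prodSeries hW hℓ (vac q ℓ) v w i j = if i = 0 then (fieldMap hW hℓ v w).coeff j else 0 := by
  rw [prodSeries, fieldMap_vac, idField_coeff]

theorem iterSeries_vac (v : VacuumModule q ℓ) (w : W) (i j : ℤ) :
    iterSeries hW hℓ (vac q ℓ) v w i j = if i = 0 then (fieldMap hW hℓ v w).coeff j else 0 := by
  rw [iterSeries, vacField, fieldMap_vac, idField_coeff]
  split_ifs <;> simp

theorem prodSeries_add (u u' v : VacuumModule q ℓ) (w : W) :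
    prodSeries hW hℓ (u + u') v w = prodSeries hW hℓ u v w + prodSeries hW hℓ u' v w := by
  funext i j
  simp [prodSeries]

theorem prodSeries_smul (c : ℂ) (u v : VacuumModule q ℓ) (w : W) :
    prodSeries hW hℓ (c • u) v w = c • prodSeries hW hℓ u v w := by
  funext i j
  simp [prodSeries]

theorem iterSeries_add (u u' v : VacuumModule q ℓ) (w : W) :
    iterSeries hW hℓ (u + u') v w = iterSeries hW hℓ u v w + iterSeries hW hℓ u' v w := by
  funext i j
  simp [iterSeries]

theorem iterSeries_smul (c : ℂ) (u v : VacuumModule q ℓ) (w : W) :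
    iterSeries hW hℓ (c • u) v w = c • iterSeries hW hℓ u v w := by
  funext i j
  simp [iterSeries]

theorem exists_annihilation_bound (r : ℤ) (v : VacuumModule q ℓ) (w : W) (hW : IsRestricted q W) :
    ∃ N : ℕ, (∀ p : ℕ, N ≤ p → betaOp q W r p w = 0) ∧
      ∀ t : ℕ, N ≤ t → ⁅beta q r t, v⁆ = 0 := by
  obtain ⟨N, hN⟩ := hW.restricted r w
  obtain ⟨N', hN'⟩ := (isRestricted_vacuumModule q ℓ).restricted r v
  exact ⟨max N N', fun p hp => hN p (by exact_mod_cast (le_max_left _ _).trans hp),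
    fun p hp => hN' p (by exact_mod_cast (le_max_right _ _).trans hp)⟩

/-- Under x₁ = x₀ + x₂ the terms of `prodSeries_beta` and `iterSeries_beta` match one by one. The
induction must cover all v and w, since these terms contain β_t v and β_p w. -/
theorem eqvMod_prodSeries_iterSeries (u v : VacuumModule q ℓ) (w : W) :
    EqvMod 1 (substAdd (prodSeries hW hℓ u v w)) (iterSeries hW hℓ u v w) := by
  induction u using vacuum_induction generalizing v w with
  | h0 =>
    have : substAdd (prodSeries hW hℓ (vac q ℓ) v w) = iterSeries hW hℓ (vac q ℓ) v w := by
      funext i j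
      rw [iterSeries_vac, substAdd, finsum_eq_single _ 0]
      · rw [bc_zero, one_smul, prodSeries_vac]
        simp
      · intro a ha
        rw [prodSeries_vac]
        split_ifs with h
        · have : i + a = ((0 : ℕ) : ℤ) := h
          rw [this, bc_natCast_of_lt (by omega), zero_smul]
        · rw [smul_zero]
    rw [this]
    exact EqvMod.refl _ _
  | hβ r m u ih =>
    obtain ⟨N, hw, hv⟩ := exists_annihilation_bound r v w hW
    have hB := fun v w => bddSnd_prodSeries hW hℓ u v w
    have hB1 : ∀ p ∈ Finset.range N, BddSnd (((-1 : ℂ) ^ (m - p) * bc m p) •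
        shiftFst (m - p) (prodSeries hW hℓ u v (betaOp q W r p w))) := fun p _ =>
      ((hB _ _).shiftFst _).smul _
    have hB2 : ∀ t ∈ Finset.range N, BddSnd (((-1 : ℂ) ^ (m - t) * bc m t) •
        expSnd (-1) (m - t) (prodSeries hW hℓ u ⁅beta q r t, v⁆ w)) := fun t _ =>
      ((hB _ _).expSnd _ _).smul _
    have hT := substAdd_powSumFst (fun k => ((-1) ^ k * bc m k) • betaOp q W r (m - k)) (hB v w)
      (prodSeries_lower hW hℓ u v w)
    rw [prodSeries_beta hW hℓ r m u v w hw hv, iterSeries_beta hW hℓ r m u v w hw hv,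
      substAdd_sub ((hB _ _).powSumFst _) ((BddSnd.sum _ hB1).add (BddSnd.sum _ hB2)),
      substAdd_add (BddSnd.sum _ hB1) (BddSnd.sum _ hB2), substAdd_sum _ hB1, substAdd_sum _ hB2,
      hT.2]
    refine ((ih v w).powSumLin _ hT.1 (iterSeries_eventually_zero hW hℓ u v w)).sub
      (EqvMod.add (EqvMod.sum _ fun p _ => ?_) (EqvMod.sum _ fun t _ => ?_))
    -- Here x₁^{m-p} becomes (x₀ + x₂)^{m-p}, expanded oppositely on the two sides; this is the only
    -- place where the power of x₀ + x₂ has to grow.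
    · rw [substAdd_smul _ ((hB _ _).shiftFst _), substAdd_shiftFst (hB _ _)]
      exact ((ih _ _).exp _ (hB _ _).substAdd (bddFst_iterSeries hW hℓ _ _ _)).smul _
    -- Here (x₁ - x₂)^{m-t} becomes x₀^{m-t}, exactly the factor of the iterate.
    · rw [substAdd_smul _ ((hB _ _).expSnd _ _), substAdd_expSnd (hB _ _)]
      exact ((ih _ _).shiftFst _).smul _
  | hadd u u' hu hu' =>
    rw [prodSeries_add, iterSeries_add, substAdd_add (bddSnd_prodSeries hW hℓ _ _ _)
      (bddSnd_prodSeries hW hℓ _ _ _)]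
    exact (hu v w).add (hu' v w)
  | hsmul c u hu =>
    rw [prodSeries_smul, iterSeries_smul, substAdd_smul _ (bddSnd_prodSeries hW hℓ _ _ _)]
    exact (hu v w).smul c

end Associativity

end QVA

namespace QVA

/-! ### Cancellation of powers of x + cy. -/

theorem BddFst.sub {M : Type*} [AddCommGroup M] {G H : ℤ → ℤ → M} (hG : BddFst G)
    (hH : BddFst H) : BddFst (G - H) := by
  obtain ⟨I, hI⟩ := hG
  obtain ⟨J, hJ⟩ := hH
  refine ⟨min I J, fun i j hi => ?_⟩
  rw [Pi.sub_apply, Pi.sub_apply, hI i j (lt_of_lt_of_le hi (min_le_left _ _)),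
    hJ i j (lt_of_lt_of_le hi (min_le_right _ _)), sub_zero]

/-- If the coefficients at x-exponent i - 1 vanish, the product at x-exponent i is just cy times
that row; so the rows vanish successively from the lower bound on. -/
theorem BddFst.eq_zero_of_mulLin {M : Type*} [AddCommGroup M] [Module ℂ M] {G : ℤ → ℤ → M} {c : ℂ}
    (hc : c ≠ 0) (hG : BddFst G) (h : mulLin c G = 0) : G = 0 := by
  obtain ⟨I, hI⟩ := hG
  have key : ∀ n : ℕ, ∀ j, G (I - 1 + n) j = 0 := by
    intro n
    induction n with
    | zero => intro j; exact hI _ j (by omega)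
    | succ n ih =>
      intro j
      have := congrFun (congrFun h (I - 1 + (n + 1 : ℕ))) (j + 1)
      have e : I - 1 + ((n + 1 : ℕ) : ℤ) - 1 = I - 1 + n := by push_cast; ring
      rw [mulLin_apply, e, ih, zero_add, add_sub_cancel_right] at this
      exact (smul_eq_zero.1 this).resolve_left hc
  funext i j
  rcases lt_or_ge i I with hi | hi
  · exact hI i j hi
  · have := key (i - I + 1).toNat j
    rwa [show I - 1 + ((i - I + 1).toNat : ℤ) = i by omega] at this

theorem BddFst.mulLin {M : Type*} [AddCommGroup M] [Module ℂ M] {G : ℤ → ℤ → M} (c : ℂ)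
    (hG : BddFst G) : BddFst (mulLin c G) := by
  obtain ⟨I, hI⟩ := hG
  refine ⟨I, fun i j hi => ?_⟩
  rw [mulLin_apply, hI i _ hi, hI _ _ (by omega), smul_zero, zero_add]

theorem BddFst.eq_of_eqvMod {M : Type*} [AddCommGroup M] [Module ℂ M] {G H : ℤ → ℤ → M} {c : ℂ}
    (hc : c ≠ 0) (hG : BddFst G) (hH : BddFst H) (h : EqvMod c G H) : G = H := by
  obtain ⟨l, hl⟩ := h
  have h' : (QVA.mulLin c ^ l) (G - H) = 0 := by rw [map_sub, hl l le_rfl, sub_self]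
  have key : ∀ (l : ℕ) (K : ℤ → ℤ → M), BddFst K → (QVA.mulLin c ^ l) K = 0 → K = 0 := by
    intro l
    induction l with
    | zero => intro K _ h; exact h
    | succ l ih =>
      intro K hK h
      rw [pow_succ, Module.End.mul_apply] at h
      exact hK.eq_zero_of_mulLin hc (ih _ (hK.mulLin c) h)
  exact sub_eq_zero.1 (key l _ (hG.sub hH) h')

theorem EqvMod.symm {M : Type*} [AddCommGroup M] [Module ℂ M] {G H : ℤ → ℤ → M} {c : ℂ}
    (h : EqvMod c G H) : EqvMod c H G := by
  obtain ⟨l, hl⟩ := h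
  exact ⟨l, fun k hk => (hl k hk).symm⟩

theorem EqvMod.trans {M : Type*} [AddCommGroup M] [Module ℂ M] {G H K : ℤ → ℤ → M} {c : ℂ}
    (h : EqvMod c G H) (h' : EqvMod c H K) : EqvMod c G K := by
  obtain ⟨l, hl⟩ := h
  obtain ⟨l', hl'⟩ := h'
  exact ⟨max l l', fun k hk => (hl k ((le_max_left _ _).trans hk)).trans
    (hl' k ((le_max_right _ _).trans hk))⟩

/-! ### Vertex operators, uniqueness, and the derivation 𝒟. -/

section VertexOperators

variable {q ℓ : ℂ} {W : Type*} [AddCommGroup W] [Module ℂ W] [LieRingModule (BHat q) W]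
  [LieModule ℂ (BHat q) W] (hW : IsRestricted q W) (hℓ : HasLevel q ℓ W)

/-- The vertex operator map of a restricted module. -/
def fieldOp : VacuumModule q ℓ →ₗ[ℂ] VertexOperator ℂ W where
  toFun v :=
    { toFun := fun w => HahnModule.of ℂ (fieldMap hW hℓ v w)
      map_add' := fun w w' => by rw [map_add, HahnModule.of_add]
      map_smul' := fun c w => by rw [map_smul, HahnModule.of_smul]; rfl }
  map_add' u v := by
    ext w : 1
    change HahnModule.of ℂ (fieldMap hW hℓ (u + v) w) = _
    rw [map_add, LinearMap.add_apply, HahnModule.of_add]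
    rfl
  map_smul' c v := by
    ext w : 1
    change HahnModule.of ℂ (fieldMap hW hℓ (c • v) w) = _
    rw [map_smul, LinearMap.smul_apply, HahnModule.of_smul]
    rfl

theorem fieldOp_coeff (v : VacuumModule q ℓ) (n : ℤ) (w : W) :
    (fieldOp hW hℓ v).coeff n w = (fieldMap hW hℓ v w).coeff n := rfl

/-- The vertex operator map of the vacuum module. -/
def vacOp (q ℓ : ℂ) : VacuumModule q ℓ →ₗ[ℂ] VertexOperator ℂ (VacuumModule q ℓ) :=
  fieldOp (isRestricted_vacuumModule q ℓ) hasLevel_vacuumModule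

theorem vacOp_coeff (v : VacuumModule q ℓ) (n : ℤ) (w : VacuumModule q ℓ) :
    (vacOp q ℓ v).coeff n w = (vacField q ℓ v w).coeff n := rfl

theorem weakAssociativity_fieldOp : WeakAssociativity (vacOp q ℓ) (fieldOp hW hℓ) := by
  intro u v w
  obtain ⟨l, hl⟩ := eqvMod_prodSeries_iterSeries hW hℓ u v w
  refine ⟨l, ?_⟩
  rw [mulAddPow_eq, mulAddPow_eq]
  exact hl l le_rfl

theorem isModuleFor_fieldOp : IsModuleFor (vac q ℓ) (vacOp q ℓ) (fieldOp hW hℓ) where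
  vacuum w n := by rw [fieldOp_coeff, fieldMap_vac, idField_coeff]
  weak_assoc := weakAssociativity_fieldOp hW hℓ

theorem isBetaField_fieldOp (r : ℤ) : IsBetaField q r (fieldOp hW hℓ (betaVec q ℓ r)) := by
  intro m w
  change (fieldMap hW hℓ (betaVec q ℓ r) w).coeff (-m - 1) = _
  rw [fieldMap_betaVec_coeff]
  congr 2
  ring

theorem IsBetaField.coeff {r : ℤ} {A : VertexOperator ℂ W} (h : IsBetaField q r A) (n : ℤ) (w : W) :
    HVertexOperator.coeff A n w = ⁅beta q r (-n - 1), w⁆ := by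
  rw [← h (-n - 1) w]
  change _ = HVertexOperator.coeff A (-(-n - 1) - 1) w
  congr 2
  ring_nf

/-- Associativity for the pair β⁽ʳ⁾, v expresses Y_W(β_m v, x) through Y_W(v, x) and β⁽ʳ⁾(x),
because the power of x₀ + x₂ cancels on series bounded below in x₀. Only the fields Y(β⁽ʳ⁾, x)
matter, so Y may be any candidate structure. -/
theorem eq_fieldOp {Y : VacuumModule q ℓ →ₗ[ℂ] VertexOperator ℂ (VacuumModule q ℓ)}
    {YW : VacuumModule q ℓ →ₗ[ℂ] VertexOperator ℂ W}
    (hY : ∀ r, IsBetaField q r (Y (betaVec q ℓ r)))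
    (h : IsModuleFor (vac q ℓ) Y YW) (hβ : ∀ r, IsBetaField q r (YW (betaVec q ℓ r))) :
    YW = fieldOp hW hℓ := by
  have key : ∀ v w n, (YW v).coeff n w = (fieldMap hW hℓ v w).coeff n := by
    intro v
    induction v using vacuum_induction with
    | h0 => intro w n; rw [h.vacuum, fieldMap_vac, idField_coeff]
    | hadd u v hu hv => intro w n; rw [map_add, map_add, map_add, LinearMap.add_apply,
        HahnSeries.coeff_add, Pi.add_apply, LinearMap.add_apply, hu, hv]
    | hsmul c v hv => intro w n; rw [map_smul, map_smul, map_smul, LinearMap.smul_apply,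
        HahnSeries.coeff_smul, Pi.smul_apply, LinearMap.smul_apply, hv]
    | hβ r m v hv =>
      intro w n
      obtain ⟨l, hl⟩ := h.weak_assoc (betaVec q ℓ r) v w
      obtain ⟨l', hl'⟩ := weakAssociativity_fieldOp hW hℓ (betaVec q ℓ r) v w
      rw [mulAddPow_eq, mulAddPow_eq] at hl hl'
      -- By induction the products Y_W(β⁽ʳ⁾, x₀ + x₂)Y_W(v, x₂)w agree for the two structures.
      have e : (fun i j => ∑ᶠ a : ℕ, ((Ring.choose (i + a) a : ℤ) : ℂ) •
          (YW (betaVec q ℓ r)).coeff (i + a) ((YW v).coeff (j - a) w)) =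
          fun i j => ∑ᶠ a : ℕ, ((Ring.choose (i + a) a : ℤ) : ℂ) •
            (fieldOp hW hℓ (betaVec q ℓ r)).coeff (i + a) ((fieldOp hW hℓ v).coeff (j - a) w) := by
        funext i j
        refine finsum_congr fun a => ?_
        rw [hv, (hβ r).coeff, (isBetaField_fieldOp hW hℓ r).coeff, fieldOp_coeff]
      rw [e] at hl
      have hz : ∃ I : ℤ, ∀ i < I, ⁅beta q r (-i - 1), v⁆ = 0 := by
        obtain ⟨N, hN⟩ := isRestricted_vacuumModule q ℓ v r
        exact ⟨-N - 1, fun i hi => hN _ (by omega)⟩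
      obtain ⟨I, hI⟩ := hz
      have b1 : BddFst fun i j => (YW ((Y (betaVec q ℓ r)).coeff i v)).coeff j w :=
        ⟨I, fun i j hi => by
          beta_reduce
          rw [(hY r).coeff, hI i hi, map_zero, map_zero]; rfl⟩
      have b2 : BddFst fun i j =>
          (fieldOp hW hℓ ((vacOp q ℓ (betaVec q ℓ r)).coeff i v)).coeff j w :=
        ⟨I, fun i j hi => by
          beta_reduce
          rw [vacOp, (isBetaField_fieldOp _ _ r).coeff, hI i hi, map_zero, map_zero]; rfl⟩
      have := congrFun (congrFun (b1.eq_of_eqvMod one_ne_zero b2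
        ((EqvMod.of_eq hl).symm.trans (EqvMod.of_eq hl'))) (-m - 1)) n
      simp only [vacOp, (hY r).coeff, (isBetaField_fieldOp _ _ r).coeff] at this
      rw [show -(-m - 1) - 1 = m by ring] at this
      rw [this, fieldOp_coeff]
  refine LinearMap.ext fun v => HVertexOperator.coeff_inj ?_
  funext n
  ext w
  rw [key, fieldOp_coeff]

theorem vacField_vac_coeff_neg (v : VacuumModule q ℓ) (n : ℤ) (hn : n < 0) :
    (vacField q ℓ v (vac q ℓ)).coeff n = 0 := by
  induction v using vacuum_induction generalizing n with
  | h0 => rw [vacField, fieldMap_vac, idField_coeff, if_neg (by omega)]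
  | hadd u v hu hv => rw [map_add, LinearMap.add_apply, HahnSeries.coeff_add, hu n hn, hv n hn,
      add_zero]
  | hsmul c v hv => rw [map_smul, LinearMap.smul_apply, HahnSeries.coeff_smul, hv n hn, smul_zero]
  | hβ r m v hv =>
    rw [vacField, fieldMap_beta, fieldMode_coeff, finsum_eq_zero_of_forall_eq_zero,
      finsum_eq_zero_of_forall_eq_zero, sub_zero]
    · intro j
      rw [betaOp_apply, beta_vac r _ (by omega)]
      simp
    · intro k
      have := hv (n - k) (by omega)
      rw [vacField] at this
      rw [this, map_zero, smul_zero]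

/-- On the vacuum the right half of the field mode disappears, as it starts with a nonnegative mode.
-/
theorem vacField_beta_vac_coeff (r m : ℤ) (v : VacuumModule q ℓ) (n : ℤ) :
    (vacField q ℓ ⁅beta q r m, v⁆ (vac q ℓ)).coeff n =
      ∑ᶠ k : ℕ, ((-1 : ℂ) ^ k * bc m k) • ⁅beta q r (m - k), (vacField q ℓ v (vac q ℓ)).coeff (n - k)⁆ := by
  rw [vacField, fieldMap_beta, fieldMode_coeff, finsum_eq_zero_of_forall_eq_zero (f := fun j : ℕ =>
    ((-1 : ℂ) ^ (m - j) * bc m j) • _), sub_zero]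
  · rfl
  · intro j
    rw [betaOp_apply, beta_vac r _ (by omega)]
    simp

theorem vacField_vac_coeff_zero (v : VacuumModule q ℓ) :
    (vacField q ℓ v (vac q ℓ)).coeff 0 = v := by
  induction v using vacuum_induction with
  | h0 => rw [vacField, fieldMap_vac, idField_coeff, if_pos rfl]
  | hadd u v hu hv => rw [map_add, LinearMap.add_apply, HahnSeries.coeff_add, hu, hv]
  | hsmul c v hv => rw [map_smul, LinearMap.smul_apply, HahnSeries.coeff_smul, hv]
  | hβ r m v hv =>
    rw [vacField_beta_vac_coeff, finsum_eq_single _ 0]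
    · simp [hv]
    · intro k hk
      rw [vacField_vac_coeff_neg _ _ (by omega), lie_zero, smul_zero]

/-- The operator `𝒟` on the vacuum module. -/
def vacD (q ℓ : ℂ) : Module.End ℂ (VacuumModule q ℓ) := Dop (vac q ℓ) (vacOp q ℓ)

theorem vacD_apply (v : VacuumModule q ℓ) : vacD q ℓ v = (vacField q ℓ v (vac q ℓ)).coeff 1 := rfl

theorem vacD_vac : vacD q ℓ (vac q ℓ) = 0 := by
  rw [vacD_apply, vacField, fieldMap_vac, idField_coeff, if_neg one_ne_zero]

/-- Since Y(v, x)1 is a power series with constant term v, only k = 0 and k = 1 contribute to the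
coefficient of x. -/
theorem vacD_beta (r m : ℤ) (v : VacuumModule q ℓ) :
    vacD q ℓ ⁅beta q r m, v⁆ = ⁅beta q r m, vacD q ℓ v⁆ - (m : ℂ) • ⁅beta q r (m - 1), v⁆ := by
  rw [vacD_apply, vacField_beta_vac_coeff, finsum_nat_eq_sum_range (N := 2)]
  · simp [Finset.sum_range_succ, vacD_apply, vacField_vac_coeff_zero, sub_eq_add_neg]
  · intro k hk
    rw [vacField_vac_coeff_neg _ _ (by omega), lie_zero, smul_zero]

end VertexOperators

end QVA

namespace QVA

/-! ### Symmetry and poles of the series f_n. -/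

section Rational

theorem negX_mul {A : Type*} [Ring A] [Algebra ℂ A] (f g : LaurentSeries A) :
    negX (f * g) = negX f * negX g := by
  ext n
  rw [negX_coeff, laurent_mul_coeff, laurent_mul_coeff, smul_finsum']
  · refine finsum_congr fun i => ?_
    rw [negX_coeff, negX_coeff, smul_mul_smul_comm, ← zpow_add₀ (by norm_num)]
    congr 2
    ring
  · exact mulSeries_finite (LinearMap.mul ℂ A) f g n

theorem negX_one {A : Type*} [Ring A] [Algebra ℂ A] : negX (1 : LaurentSeries A) = 1 := by
  ext n
  rw [negX_coeff, HahnSeries.coeff_one]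
  split_ifs with h <;> simp [h]

attribute [local instance] laurentAlgebra

/-- The substitution `x ↦ -x` as an algebra homomorphism of `ℂ((x))`. -/
def negXHom : LaurentSeries ℂ →ₐ[ℂ] LaurentSeries ℂ :=
  AlgHom.ofLinearMap negX negX_one negX_mul

theorem negXHom_apply (f : LaurentSeries ℂ) : negXHom f = negX f := rfl

theorem negX_negX {M : Type*} [AddCommGroup M] [Module ℂ M] (f : LaurentSeries M) :
    negX (negX f) = f := by
  ext n
  rw [negX_coeff, negX_coeff, smul_smul, ← mul_zpow]
  norm_num

theorem coe_coeff_nat (p : PowerSeries ℂ) (n : ℕ) :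
    (p : LaurentSeries ℂ).coeff n = PowerSeries.coeff n p := by
  rw [LaurentSeries.coeff_coe_powerSeries]

theorem coe_coeff_neg (p : PowerSeries ℂ) (n : ℤ) (hn : n < 0) :
    (p : LaurentSeries ℂ).coeff n = 0 := by
  rw [PowerSeries.coeff_coe, if_pos hn]

/-- The series `e ^ x`. -/
def expL : LaurentSeries ℂ := ((PowerSeries.exp ℂ : PowerSeries ℂ) : LaurentSeries ℂ)

theorem expL_mul_negX : expL * negX expL = 1 := by
  have h : negX expL = ((PowerSeries.evalNegHom (PowerSeries.exp ℂ) : PowerSeries ℂ) :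
      LaurentSeries ℂ) := by
    ext n
    rw [negX_coeff, expL]
    by_cases hn : n < 0
    · rw [coe_coeff_neg _ _ hn, coe_coeff_neg _ _ hn, smul_zero]
    · lift n to ℕ using not_lt.1 hn
      rw [coe_coeff_nat, coe_coeff_nat, PowerSeries.evalNegHom, PowerSeries.coeff_rescale]
      simp
  rw [h, expL, ← PowerSeries.coe_mul, PowerSeries.exp_mul_exp_neg_eq_one, PowerSeries.coe_one]

theorem ratExp_eq (a : ℂ) : ratExp a = a • expL / (1 - a • expL) ^ 2 := rfl

/-- The coefficient of x would force a = 0, and the constant term would then be 1. -/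
theorem one_sub_smul_expL_ne_zero (a : ℂ) : (1 : LaurentSeries ℂ) - a • expL ≠ 0 := by
  intro h
  have h1 := congrArg (fun f => HahnSeries.coeff f ((1 : ℕ) : ℤ)) h
  have h0 := congrArg (fun f => HahnSeries.coeff f ((0 : ℕ) : ℤ)) h
  simp only [HahnSeries.coeff_sub, HahnSeries.coeff_smul, expL, coe_coeff_nat,
    HahnSeries.coeff_one, PowerSeries.coeff_exp, HahnSeries.coeff_zero] at h0 h1
  simp at h0 h1
  rw [h1, sub_zero] at h0
  exact one_ne_zero h0

/-- The function z/(1 - z)² is invariant under z ↦ z⁻¹, and (a e^{-x})⁻¹ = a⁻¹eˣ. -/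
theorem negX_ratExp (a : ℂ) (ha : a ≠ 0) : negX (ratExp a) = ratExp a⁻¹ := by
  have he : expL ≠ 0 := fun h => by simpa [h] using expL_mul_negX
  have he' : negX expL = expL⁻¹ := eq_inv_of_mul_eq_one_right expL_mul_negX
  have hs : ∀ (c : ℂ) (f : LaurentSeries ℂ), c • f = HahnSeries.C c * f := fun c f => by
    rw [HahnSeries.C_mul_eq_smul]
  have hC : (HahnSeries.C a : LaurentSeries ℂ) ≠ 0 := by simpa using ha
  have h1 := one_sub_smul_expL_ne_zero a⁻¹
  rw [← negXHom_apply, ratExp_eq, ratExp_eq, map_div₀, map_pow, map_sub, map_one, map_smul,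
    negXHom_apply, he', hs, hs]
  rw [hs, map_inv₀] at h1
  rw [map_inv₀]
  have h2 : (HahnSeries.C a : LaurentSeries ℂ) - expL ≠ 0 := by
    intro h
    apply h1
    rw [← sub_eq_zero.1 h, inv_mul_cancel₀ hC, sub_self]
  have h3 : expL - (HahnSeries.C a : LaurentSeries ℂ) ≠ 0 := by
    rw [← neg_sub]; exact neg_ne_zero.2 h2
  have e1 : 1 - (HahnSeries.C a : LaurentSeries ℂ) * expL⁻¹ = (expL - HahnSeries.C a) * expL⁻¹ := by
    field_simp
  have e2 : 1 - (HahnSeries.C a : LaurentSeries ℂ)⁻¹ * expL =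
      (HahnSeries.C a - expL) * (HahnSeries.C a)⁻¹ := by
    field_simp
  rw [e1, e2, div_eq_div_iff (by positivity) (by positivity)]
  field_simp
  ring

theorem ratExp_coeff_of_ne_one (a : ℂ) (ha : a ≠ 1) (n : ℤ) (hn : n < 0) :
    (ratExp a).coeff n = 0 := by
  set u : PowerSeries ℂ := 1 - a • PowerSeries.exp ℂ with hu
  have hu0 : PowerSeries.constantCoeff (u ^ 2) ≠ 0 := by
    rw [map_pow, hu, map_sub, map_one]
    refine pow_ne_zero 2 ?_
    rw [PowerSeries.smul_eq_C_mul, map_mul]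
    simpa [sub_eq_zero] using fun h => ha h.symm
  have h : ratExp a = ((a • PowerSeries.exp ℂ * (u ^ 2)⁻¹ : PowerSeries ℂ) : LaurentSeries ℂ) := by
    rw [ratExp_eq, div_eq_iff (pow_ne_zero 2 (one_sub_smul_expL_ne_zero a))]
    have : ((1 : LaurentSeries ℂ) - a • expL) ^ 2 = ((u ^ 2 : PowerSeries ℂ) : LaurentSeries ℂ) := by
      rw [PowerSeries.coe_pow, hu, PowerSeries.coe_sub, PowerSeries.coe_one, PowerSeries.coe_smul,
        expL]
    rw [this, ← PowerSeries.coe_mul, mul_assoc, PowerSeries.inv_mul_cancel _ hu0, mul_one,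
      PowerSeries.coe_smul, expL]
  rw [h, coe_coeff_neg _ _ hn]

/-- Write eˣ - 1 = xu with u(0) = 1: there is a double pole with leading coefficient 1. -/
theorem ratExp_one_coeff (n : ℤ) (hn : n < 0) :
    (ratExp 1).coeff n = if n = -2 then 1 else 0 := by
  obtain ⟨u, hu⟩ : (PowerSeries.X : PowerSeries ℂ) ∣ PowerSeries.exp ℂ - 1 := by
    rw [PowerSeries.X_dvd_iff]; simp
  have hu0 : PowerSeries.constantCoeff u = 1 := by
    have := congrArg (PowerSeries.coeff 1) hu
    rw [show (1 : ℕ) = 0 + 1 from rfl, PowerSeries.coeff_succ_X_mul] at this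
    simp [PowerSeries.coeff_exp] at this
    rw [← this]
  have hu2 : PowerSeries.constantCoeff (u ^ 2) ≠ 0 := by rw [map_pow, hu0]; norm_num
  have h : ratExp 1 * HahnSeries.single 2 1 =
      ((PowerSeries.exp ℂ * (u ^ 2)⁻¹ : PowerSeries ℂ) : LaurentSeries ℂ) := by
    rw [ratExp_eq, one_smul]
    have hne := one_sub_smul_expL_ne_zero 1
    rw [one_smul] at hne
    rw [div_mul_eq_mul_div, div_eq_iff (pow_ne_zero 2 hne)]
    have : ((1 : LaurentSeries ℂ) - expL) ^ 2 =
        ((u ^ 2 * PowerSeries.X ^ 2 : PowerSeries ℂ) : LaurentSeries ℂ) := by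
      rw [show u ^ 2 * PowerSeries.X ^ 2 = (1 - PowerSeries.exp ℂ) ^ 2 by
        rw [← neg_sub (PowerSeries.exp ℂ), hu]; ring]
      rw [PowerSeries.coe_pow, PowerSeries.coe_sub, PowerSeries.coe_one, expL]
    rw [this, ← PowerSeries.coe_mul, ← mul_assoc, mul_assoc (PowerSeries.exp ℂ),
      PowerSeries.inv_mul_cancel _ hu2, mul_one, PowerSeries.coe_mul, PowerSeries.coe_pow,
      PowerSeries.coe_X, HahnSeries.single_pow, expL]
    simp
  have hc : ∀ k : ℤ, (ratExp 1).coeff (k - 2) =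
      ((PowerSeries.exp ℂ * (u ^ 2)⁻¹ : PowerSeries ℂ) : LaurentSeries ℂ).coeff k := by
    intro k
    rw [← h]
    have := HahnSeries.coeff_mul_single_add (r := (1 : ℂ)) (x := ratExp 1) (a := k - 2) (b := 2)
    rw [sub_add_cancel, mul_one] at this
    exact this.symm
  rcases eq_or_ne n (-1) with rfl | h1
  -- There is no residue, because the series with a = 1 is even.
  · have := congrArg (fun f => HahnSeries.coeff f (-1)) (negX_ratExp 1 one_ne_zero)
    simp only [negX_coeff, inv_one] at this
    have h2 : (2 : ℂ) * (ratExp 1).coeff (-1) = 0 := by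
      rw [two_mul]
      nth_rw 1 [← this]
      simp
    simpa using h2
  have hc' := hc (n + 2)
  rw [add_sub_cancel_right] at hc'
  rw [hc']
  split_ifs with h2
  · have := coe_coeff_nat (PowerSeries.exp ℂ * (u ^ 2)⁻¹) 0
    subst h2
    refine this.trans ?_
    rw [PowerSeries.coeff_zero_eq_constantCoeff, map_mul, PowerSeries.constantCoeff_inv, map_pow, hu0]
    simp
  · exact coe_coeff_neg _ _ (by omega)

variable {q : ℂ}

theorem zpow_eq_one_iff_of_not_root (hq : ∀ n : ℕ, 0 < n → q ^ n ≠ 1) (k : ℤ) : q ^ k = 1 ↔ k = 0 := by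
  refine ⟨fun h => ?_, fun h => by simp [h]⟩
  by_contra hk
  rcases lt_or_gt_of_ne hk with h' | h'
  · refine hq (-k).toNat (by omega) ?_
    rw [← zpow_natCast, Int.toNat_of_nonneg (by omega), zpow_neg, h, inv_one]
  · refine hq k.toNat (by omega) ?_
    rw [← zpow_natCast, Int.toNat_of_nonneg (by omega), h]

theorem negX_fSeries (hq0 : q ≠ 0) (n : ℤ) : negX (fSeries q n) = -fSeries q (-n) := by
  rw [fSeries, map_sub, negX_ratExp _ (zpow_ne_zero _ hq0), negX_ratExp _ (zpow_ne_zero _ hq0),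
    ← zpow_neg, ← zpow_neg, fSeries, show -(n + 1) = -n - 1 by ring,
    show -(n - 1) = -n + 1 by ring, neg_sub]

theorem fSeries_neg_coeff (hq0 : q ≠ 0) (n N : ℤ) :
    (fSeries q (-n)).coeff N = -((-1) ^ N * (fSeries q n).coeff N) := by
  have := negX_fSeries hq0 n
  rw [← neg_eq_iff_eq_neg] at this
  rw [← this]
  rfl

/-- As q is not a root of unity, qᵏ = 1 only for k = 0; so the two summands have poles only for n =
-1 and n = 1 respectively. -/
theorem fSeries_coeff (hq : ∀ n : ℕ, 0 < n → q ^ n ≠ 1) (n N : ℤ) (hN : N < 0) : (fSeries q n).coeff N =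
    if N = -2 then (if n = -1 then 1 else 0) - (if n = 1 then 1 else 0) else 0 := by
  have key : ∀ k : ℤ, (ratExp (q ^ k)).coeff N = if k = 0 then (if N = -2 then 1 else 0) else 0 := by
    intro k
    split_ifs with h h'
    · rw [h, zpow_zero, ratExp_one_coeff N hN, if_pos h']
    · rw [h, zpow_zero, ratExp_one_coeff N hN, if_neg h']
    · exact ratExp_coeff_of_ne_one _ (by rwa [ne_eq, zpow_eq_one_iff_of_not_root hq]) N hN
  rw [fSeries, HahnSeries.coeff_sub, key, key]
  simp only [show n + 1 = 0 ↔ n = -1 by omega, show n - 1 = 0 ↔ n = 1 by omega]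
  split_ifs <;> simp

end Rational

end QVA

namespace QVA

/-! ### Antisymmetry of the relations and the coefficients κ. -/

section Kappa

/-- The coefficient `δ_{r,s} - δ_{r,s+1}` of the delta function in the defining relations. -/
def deltaDiff (r s : ℤ) : ℂ := (if r = s then 1 else 0) - (if r = s + 1 then 1 else 0)

theorem structureConst_nonneg_left (q : ℂ) (r s m n : ℤ) (hm : 0 ≤ m) :
    structureConst q r s m n = deltaDiff r s * (if m + n = 0 then (m : ℂ) else 0) :=
  structureConst_of_nonneg_left q r s m n hm

theorem structureConst_negSucc (q : ℂ) (r s n : ℤ) (a : ℕ) :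
    structureConst q r s (-a - 1) n =
      (-1) ^ n * (-1) * bc (a - n - 1) a * (fSeries q (r - s)).coeff (a - n - 1) +
        deltaDiff r s * (if n = a + 1 then -((a : ℂ) + 1) else 0) := by
  rw [structureConst, expandSub, if_pos (by omega), negX_coeff, show -(-(a : ℤ) - 1) - 1 = a by ring,
    Int.toNat_natCast, show (a : ℤ) + (-n - 1) = a - n - 1 by ring]
  simp only [show -(a : ℤ) - 1 - 1 = -n - 1 ↔ n = a + 1 by omega]
  congr 1
  · change (-1) ^ (a : ℤ) * bc (a - n - 1) a * _ = _
    rw [smul_eq_mul, show (a : ℤ) - n - 1 = a + a - (n + a) - 1 by ring]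
    have h : (-1 : ℂ) ^ (a : ℤ) * (-1) ^ ((a : ℤ) + a - (n + a) - 1) = (-1) ^ n * (-1) := by
      have hne : (-1 : ℂ) ≠ 0 := by norm_num
      have hs : ∀ k : ℤ, (-1 : ℂ) ^ k * (-1) ^ k = 1 := fun k => by rw [← mul_zpow]; norm_num
      have hi : (-1 : ℂ) ^ (-n) = (-1) ^ n := by
        rw [zpow_neg]; exact inv_eq_of_mul_eq_one_right (hs n)
      rw [← zpow_add₀ hne, show (a : ℤ) + (a + a - (n + a) - 1) = a + a + (-n) + (-1) by ring,
        zpow_add₀ hne, zpow_add₀ hne, zpow_add₀ hne, hs, hi]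
      norm_num
    linear_combination (bc (a + a - (n + a) - 1) a * (fSeries q (r - s)).coeff (a + a - (n + a) - 1)) * h
  · rw [deltaDiff]
    push_cast
    split_ifs <;> ring

variable {q : ℂ}

theorem fSeries_sub_coeff (hq : ∀ n : ℕ, 0 < n → q ^ n ≠ 1) (r s N : ℤ) (hN : N < 0) :
    (fSeries q (r - s)).coeff N = if N = -2 then deltaDiff r s - deltaDiff s r else 0 := by
  rw [fSeries_coeff hq _ _ hN, deltaDiff, deltaDiff]
  simp only [show r - s = -1 ↔ s = r + 1 by omega, show r - s = 1 ↔ r = s + 1 by omega,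
    eq_comm (a := s) (b := r)]
  split_ifs <;> simp

/-- The coefficient of f involved has index b - m - 1. For m < b its binomial factor is zero, for m
= b it is the vanishing residue, and for m > b only the double pole at m = b + 1 survives; it turns
one delta coefficient into the other. -/
theorem structureConst_antisymm_of_nonneg (hq : ∀ n : ℕ, 0 < n → q ^ n ≠ 1) (r s : ℤ) (m b : ℕ) :
    structureConst q s r (-b - 1) m = -structureConst q r s m (-b - 1) := by
  rw [structureConst_negSucc, structureConst_nonneg_left _ _ _ _ _ (by omega)]
  simp only [show (m : ℤ) + (-b - 1) = 0 ↔ m = b + 1 by omega, show (m : ℤ) = b + 1 ↔ m = b + 1 by omega]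
  rcases lt_trichotomy m b with h | rfl | h
  · obtain ⟨k, hk⟩ : ∃ k : ℕ, (b : ℤ) - m - 1 = k := ⟨b - m - 1, by omega⟩
    rw [hk, bc_natCast_of_lt (by omega), if_neg (by omega), if_neg (by omega)]
    simp
  · rw [fSeries_sub_coeff hq _ _ _ (by omega), if_neg (by omega), if_neg (by omega), if_neg (by omega)]
    simp
  · rw [fSeries_sub_coeff hq _ _ _ (by omega)]
    by_cases hm : m = b + 1
    · subst hm
      push_cast
      rw [if_pos (by ring), if_pos rfl, if_pos rfl, show (b : ℤ) - (b + 1) - 1 = -2 by ring, bc_neg,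
        show (2 : ℤ) + b - 1 = ((b + 1 : ℕ) : ℤ) by push_cast; ring, bc_natCast, Nat.choose_succ_self_right,
        zpow_add₀ (by norm_num), zpow_natCast, zpow_one]
      have hs : (-1 : ℂ) ^ b * (-1) ^ b = 1 := by rw [← mul_pow]; norm_num
      push_cast
      linear_combination ((b + 1 : ℂ) * (deltaDiff s r - deltaDiff r s)) * hs
    · rw [if_neg (by omega), if_neg hm, if_neg hm]
      simp

/-- Without this the relations would force c = 0. For two negative modes it is f_{-n}(-x) = -f_n(x);
for mixed signs it says that the delta functions account for the double poles of f. -/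
theorem structureConst_antisymm (hq0 : q ≠ 0) (hq : ∀ n : ℕ, 0 < n → q ^ n ≠ 1) (r s m n : ℤ) :
    structureConst q s r n m = -structureConst q r s m n := by
  rcases lt_or_ge m 0 with hm | hm <;> rcases lt_or_ge n 0 with hn | hn
  · obtain ⟨a, rfl⟩ : ∃ a : ℕ, m = -a - 1 := ⟨(-m - 1).toNat, by omega⟩
    obtain ⟨b, rfl⟩ : ∃ b : ℕ, n = -b - 1 := ⟨(-n - 1).toNat, by omega⟩
    rw [structureConst_negSucc, structureConst_negSucc, if_neg (by omega), if_neg (by omega),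
      show (b : ℤ) - (-a - 1) - 1 = ((a + b : ℕ) : ℤ) by push_cast; ring,
      show (a : ℤ) - (-b - 1) - 1 = ((a + b : ℕ) : ℤ) by push_cast; ring, bc_natCast, bc_natCast,
      show s - r = -(r - s) by ring, fSeries_neg_coeff hq0, Nat.choose_symm_add,
      show (-(a : ℤ) - 1) = -(a + 1) by ring, show (-(b : ℤ) - 1) = -(b + 1) by ring, zpow_neg,
      zpow_neg, ← inv_zpow, ← inv_zpow, zpow_add₀ (by norm_num), zpow_add₀ (by norm_num), zpow_natCast,
      zpow_natCast, zpow_natCast, pow_add]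
    have hs : (-1 : ℂ) ^ a * (-1) ^ a = 1 := by rw [← mul_pow]; norm_num
    rw [mul_zero, mul_zero, add_zero, add_zero]
    norm_num
    linear_combination ((-1) ^ b * ((a + b).choose b : ℂ) * (fSeries q (r - s)).coeff (a + b)) * hs
  · obtain ⟨a, rfl⟩ : ∃ a : ℕ, m = -a - 1 := ⟨(-m - 1).toNat, by omega⟩
    lift n to ℕ using hn
    rw [structureConst_antisymm_of_nonneg hq, neg_neg]
  · obtain ⟨b, rfl⟩ : ∃ b : ℕ, n = -b - 1 := ⟨(-n - 1).toNat, by omega⟩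
    lift m to ℕ using hm
    rw [structureConst_antisymm_of_nonneg hq]
  · rw [structureConst_of_nonneg _ _ _ _ _ hm hn, structureConst_of_nonneg _ _ _ _ _ hn hm, neg_zero]

/-- The coefficient of `x₁ ^ (-m - 1) x₂ ^ (-n - 1)` in `ℓ f_{r - s}(-x + x₁ - x₂)`. -/
def kappa (q ℓ : ℂ) (r m s n : ℤ) : LaurentSeries ℂ :=
  if m < 0 ∧ n < 0 then
    (ℓ * ((-1) ^ (-n - 1).toNat * bc (-m - n - 2) (-m - 1).toNat)) •
      negX (LaurentSeries.hasseDeriv ℂ (-m - n - 2).toNat (fSeries q (r - s)))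
  else 0

variable {ℓ : ℂ}

theorem kappa_neg (r s : ℤ) (a b : ℕ) : kappa q ℓ r (-a - 1) s (-b - 1) =
    (ℓ * ((-1) ^ b * ((a + b).choose a : ℂ))) •
      negX (LaurentSeries.hasseDeriv ℂ (a + b) (fSeries q (r - s))) := by
  rw [kappa, if_pos (by omega)]
  have h : -(-(a : ℤ) - 1) - (-b - 1) - 2 = ((a + b : ℕ) : ℤ) := by push_cast; ring
  rw [h, bc_natCast, Int.toNat_natCast, show (-(-(a : ℤ) - 1) - 1).toNat = a by omega,
    show (-(-(b : ℤ) - 1) - 1).toNat = b by omega]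

theorem kappa_of_nonneg_left (r m s n : ℤ) (hm : 0 ≤ m) : kappa q ℓ r m s n = 0 :=
  if_neg (by omega)

theorem kappa_of_nonneg_right (r m s n : ℤ) (hn : 0 ≤ n) : kappa q ℓ r m s n = 0 :=
  if_neg (by omega)

theorem hasseDeriv_negX (k : ℕ) (f : LaurentSeries ℂ) :
    LaurentSeries.hasseDeriv ℂ k (negX f) = (-1 : ℂ) ^ k • negX (LaurentSeries.hasseDeriv ℂ k f) := by
  ext n
  rw [LaurentSeries.hasseDeriv_coeff, negX_coeff, HahnSeries.coeff_smul, negX_coeff,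
    LaurentSeries.hasseDeriv_coeff, zpow_add₀ (by norm_num), zpow_natCast, smul_comm ((-1 : ℂ) ^ k),
    ← smul_smul, smul_comm _ ((-1 : ℂ) ^ n), smul_comm _ ((-1 : ℂ) ^ k)]

theorem choose_mul_choose_add (a b k : ℕ) :
    ((a + b).choose a * (k + (a + b)).choose k : ℂ) = (b + k).choose k * (a + (b + k)).choose a := by
  rw [Nat.cast_add_choose, Nat.cast_add_choose, Nat.cast_add_choose, add_comm b k,
    Nat.cast_add_choose, show k + (a + b) = a + (k + b) by ring]
  have hne : ∀ n : ℕ, (n.factorial : ℂ) ≠ 0 := fun n => by exact_mod_cast n.factorial_ne_zero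
  have := hne a; have := hne b; have := hne k; have := hne (a + b); have := hne (k + b)
  field_simp

theorem bc_neg_sub_one (b k : ℕ) : bc (-b - 1) k = (-1) ^ k * ((b + k).choose k : ℂ) := by
  rw [show (-(b : ℤ) - 1) = -(b + 1) by ring, bc_neg,
    show (b : ℤ) + 1 + k - 1 = ((b + k : ℕ) : ℤ) by push_cast; ring, bc_natCast]

/-- On a function of -x + x₁ - x₂, differentiation in x and in x₂ agree, and ∂/∂x₂ acts on modes by
n ↦ n - 1 with factor -n. -/
theorem hasseDeriv_kappa (r m s n : ℤ) (k : ℕ) :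
    LaurentSeries.hasseDeriv ℂ k (kappa q ℓ r m s n) = ((-1) ^ k * bc n k) • kappa q ℓ r m s (n - k) := by
  rcases lt_or_ge m 0 with hm | hm
  · obtain ⟨a, rfl⟩ : ∃ a : ℕ, m = -a - 1 := ⟨(-m - 1).toNat, by omega⟩
    rcases lt_or_ge n 0 with hn | hn
    · obtain ⟨b, rfl⟩ : ∃ b : ℕ, n = -b - 1 := ⟨(-n - 1).toNat, by omega⟩
      rw [kappa_neg, show -(b : ℤ) - 1 - k = -((b + k : ℕ) : ℤ) - 1 by push_cast; ring, kappa_neg,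
        map_smul, hasseDeriv_negX, LaurentSeries.hasseDeriv_comp, bc_neg_sub_one,
        ← Nat.cast_smul_eq_nsmul ℂ, map_smul, smul_smul, smul_smul, smul_smul,
        show k + (a + b) = a + (b + k) by ring]
      congr 1
      have h := choose_mul_choose_add a b k
      rw [show k + (a + b) = a + (b + k) by ring] at h
      have hs : (-1 : ℂ) ^ k * (-1) ^ k = 1 := by rw [← mul_pow]; norm_num
      rw [pow_add]
      linear_combination (ℓ * (-1) ^ b * (-1) ^ k) * h -
        (ℓ * (-1) ^ b * (-1) ^ k * ((b + k).choose k) * ((a + (b + k)).choose a)) * hs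
    · lift n to ℕ using hn
      rw [kappa_of_nonneg_right _ _ _ _ (by omega), map_zero]
      rcases lt_or_ge n k with h | h
      · rw [bc_natCast_of_lt h, mul_zero]
        exact (zero_smul ℂ _).symm
      · rw [kappa_of_nonneg_right _ _ _ _ (by omega), smul_zero]
  · rw [kappa_of_nonneg_left _ _ _ _ hm, kappa_of_nonneg_left _ _ _ _ hm, map_zero, smul_zero]

/-- The reflection f_{-n}(-x) = -f_n(x), mode by mode. -/
theorem kappa_unitary (hq0 : q ≠ 0) (r m s n : ℤ) :
    kappa q ℓ r m s n + negX (kappa q ℓ s n r m) = 0 := by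
  rcases lt_or_ge m 0 with hm | hm
  · obtain ⟨a, rfl⟩ : ∃ a : ℕ, m = -a - 1 := ⟨(-m - 1).toNat, by omega⟩
    rcases lt_or_ge n 0 with hn | hn
    · obtain ⟨b, rfl⟩ : ∃ b : ℕ, n = -b - 1 := ⟨(-n - 1).toNat, by omega⟩
      have h : fSeries q (s - r) = -negX (fSeries q (r - s)) := by
        rw [negX_fSeries hq0, neg_neg, neg_sub]
      rw [kappa_neg, kappa_neg, map_smul, negX_negX, h, map_neg, hasseDeriv_negX, smul_neg,
        smul_smul, add_comm b a, ← Nat.choose_symm_add, ← sub_eq_add_neg]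
      have hs : (-1 : ℂ) ^ a * (-1) ^ a = 1 := by rw [← mul_pow]; norm_num
      refine (sub_smul _ _ _).symm.trans ?_
      rw [pow_add, show ℓ * ((-1) ^ b * ((a + b).choose a : ℂ)) -
        ℓ * ((-1) ^ a * ((a + b).choose a : ℂ)) * ((-1) ^ a * (-1) ^ b) = 0 by
        linear_combination (-(ℓ * (-1) ^ b * ((a + b).choose a : ℂ))) * hs]
      exact zero_smul ℂ (negX (LaurentSeries.hasseDeriv ℂ (a + b) (fSeries q (r - s))))
    · rw [kappa_of_nonneg_right _ _ _ _ hn, kappa_of_nonneg_left _ _ _ _ hn, map_zero, add_zero]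
  · rw [kappa_of_nonneg_right _ _ _ _ hm, kappa_of_nonneg_left _ _ _ _ hm, map_zero, add_zero]

theorem hasseDeriv_kappa' (hq0 : q ≠ 0) (r m s n : ℤ) (k : ℕ) :
    LaurentSeries.hasseDeriv ℂ k (kappa q ℓ r m s n) = bc m k • kappa q ℓ r (m - k) s n := by
  have h := fun m => eq_neg_of_add_eq_zero_left (kappa_unitary (ℓ := ℓ) hq0 r m s n)
  rw [h m, h (m - k), map_neg, hasseDeriv_negX, hasseDeriv_kappa, map_smul, smul_smul, ← mul_assoc,
    ← mul_pow, smul_neg]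
  norm_num

theorem kappa_neg_coeff (r s : ℤ) (a b : ℕ) (N : ℤ) : (kappa q ℓ r (-a - 1) s (-b - 1)).coeff N =
    ℓ * ((-1) ^ b * ((a + b).choose a : ℂ) * (-1) ^ N * bc (N + a + b) (a + b) *
      (fSeries q (r - s)).coeff (N + a + b)) := by
  rw [kappa_neg, HahnSeries.coeff_smul, negX_coeff, LaurentSeries.hasseDeriv_coeff, zsmul_eq_mul,
    smul_eq_mul, smul_eq_mul]
  push_cast
  rw [← add_assoc]
  change _ * (_ * (bc (N + a + b) (a + b) * _)) = _
  ring

/-- The difference of the two expansions of `ℓ Res (x₁ - x) ^ n ⋯` expressed through `kappa`. -/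
theorem kappa_coeff_eq (hq0 : q ≠ 0) (hq : ∀ n : ℕ, 0 < n → q ^ n ≠ 1) (r m s n N : ℤ) :
    ℓ * ((if 0 ≤ N then (-1) ^ N * bc n N.toNat * structureConst q r s m (n - N) else 0) -
        (if N ≤ n then (-1) ^ N * bc n (n - N).toNat * structureConst q r s m (n - N) else 0)) =
      (kappa q ℓ r m s n).coeff N +
        ℓ * (if N ≤ m then bc m (m - N).toNat * structureConst q r s (m - N) n else 0) := by
  rcases lt_or_ge n 0 with hn | hn
  swap
  -- For n ≥ 0 both expansions of (x₁ - x)ⁿ are the same polynomial, and κ is zero.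
  · lift n to ℕ using hn
    rw [kappa_of_nonneg_right _ _ _ _ (by omega), HahnSeries.coeff_zero, zero_add]
    congr 1
    have h2 : (if N ≤ m then bc m (m - N).toNat * structureConst q r s (m - N) n else 0) = 0 := by
      split_ifs
      · rw [structureConst_of_nonneg _ _ _ _ _ (by omega) (by omega), mul_zero]
      · rfl
    rw [h2]
    by_cases h0 : 0 ≤ N
    · lift N to ℕ using h0
      rw [if_pos (by omega), Int.toNat_natCast]
      split_ifs with h
      · rw [show ((n : ℤ) - N).toNat = n - N by omega, bc_natCast, bc_natCast,
          Nat.choose_symm (by omega), sub_self]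
      · rw [bc_natCast_of_lt (by omega)]; ring
    · rw [if_neg h0, if_pos (by omega), show ((n : ℤ) - N).toNat = n + (-N).toNat by omega,
        bc_natCast_of_lt (by omega)]
      ring
  obtain ⟨b, rfl⟩ : ∃ b : ℕ, n = -b - 1 := ⟨(-n - 1).toNat, by omega⟩
  rcases lt_or_ge m 0 with hm | hm
  · obtain ⟨a, rfl⟩ : ∃ a : ℕ, m = -a - 1 := ⟨(-m - 1).toNat, by omega⟩
    rw [kappa_neg_coeff, ← mul_add]
    congr 1
    rcases lt_or_ge N 0 with h0 | h0
    · rw [if_neg (by omega)]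
      -- For N < 0 only the double pole of f can contribute, at N = -a - b - 2; there the delta
      -- terms on the two sides balance it.
      by_cases hab : N + a + b = -2
      · rw [if_pos (by omega), if_pos (by omega), hab, fSeries_sub_coeff hq _ _ _ (by omega), if_pos rfl]
        obtain rfl : N = -a - b - 2 := by omega
        have e1 : -(b : ℤ) - 1 - (-a - b - 2) = (a + 1 : ℕ) := by push_cast; ring
        have e2 : -(a : ℤ) - 1 - (-a - b - 2) = (b + 1 : ℕ) := by push_cast; ring
        rw [e1, e2, Int.toNat_natCast, Int.toNat_natCast, structureConst_antisymm hq0 hq s r,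
          structureConst_nonneg_left _ _ _ _ _ (by omega),
          structureConst_nonneg_left _ _ _ _ _ (by omega), if_pos (by push_cast; ring),
          if_pos (by push_cast; ring), bc_neg_sub_one, bc_neg_sub_one, bc_neg,
          show (2 : ℤ) + (a + b : ℕ) - 1 = ((a + b + 1 : ℕ) : ℤ) by push_cast; ring, bc_natCast,
          Nat.choose_succ_self_right, show (-(a : ℤ) - b - 2) = -((a + b + 2 : ℕ) : ℤ) by push_cast; ring,
          zpow_neg, zpow_natCast, ← inv_pow, show (-1 : ℂ)⁻¹ = -1 by norm_num]
        have c1 : ((b + (a + 1)).choose (a + 1) : ℂ) * (a + 1) = (a + b + 1) * (a + b).choose a := by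
          have := Nat.add_one_mul_choose_eq (a + b) a
          rw [show b + (a + 1) = a + b + 1 by ring]
          exact_mod_cast this.symm
        have c2 : ((a + (b + 1)).choose (b + 1) : ℂ) * (b + 1) = (a + b + 1) * (a + b).choose a := by
          have := Nat.add_one_mul_choose_eq (a + b) b
          rw [show a + (b + 1) = a + b + 1 by ring, Nat.choose_symm_add]
          exact_mod_cast this.symm
        have hsa : (-1 : ℂ) ^ a * (-1) ^ a = 1 := by rw [← mul_pow]; norm_num
        have hsb : (-1 : ℂ) ^ b * (-1) ^ b = 1 := by rw [← mul_pow]; norm_num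
        simp only [pow_add, pow_one]
        push_cast
        generalize (-1 : ℂ) ^ a = sa at *
        generalize (-1 : ℂ) ^ b = sb at *
        generalize deltaDiff r s = d0
        generalize deltaDiff s r = d1
        generalize ((b + (a + 1)).choose (a + 1) : ℂ) = x1 at *
        generalize ((a + (b + 1)).choose (b + 1) : ℂ) = x2 at *
        generalize ((a + b).choose a : ℂ) = x at *
        linear_combination (-(sb * d1 * sa * sa)) * c1 + (sb * d0) * c2 -
          (sb * d1 * (a + b + 1) * x + sb * sb * sb * x * (a + b + 1) * (d0 - d1)) * hsa -
          (sb * x * (a + b + 1) * (d0 - d1)) * hsb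
      -- Away from the double pole, either f has no coefficient at this negative index, or 0 ≤ N + a
      -- + b < a + b and the binomial vanishes.
      · have h1 : bc (N + a + b) (a + b) * (fSeries q (r - s)).coeff (N + a + b) = 0 := by
          rcases lt_or_ge (N + a + b) 0 with h | h
          · rw [fSeries_sub_coeff hq _ _ _ h, if_neg hab, mul_zero]
          · obtain ⟨k, hk⟩ : ∃ k : ℕ, N + a + b = k := ⟨(N + a + b).toNat, by omega⟩
            rw [hk, bc_natCast_of_lt (by omega), zero_mul]
        rw [mul_assoc _ (bc (N + a + b) _), h1, mul_zero, zero_add, zero_sub]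
        have h2 : (if N ≤ -(a : ℤ) - 1 then bc (-a - 1) (-a - 1 - N).toNat *
            structureConst q r s (-a - 1 - N) (-b - 1) else 0) = 0 := by
          split_ifs
          · rw [structureConst_nonneg_left _ _ _ _ _ (by omega), if_neg (c := _ = (0 : ℤ)) (by omega)]
            ring
          · rfl
        rw [h2]
        split_ifs
        · rw [structureConst_antisymm hq0 hq s r, structureConst_nonneg_left _ _ _ _ _ (by omega),
            if_neg (c := _ = (0 : ℤ)) (by omega)]
          ring
        · ring
    -- For N ≥ 0 only the first expansion and κ contribute; what remains is an identity of trinomial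
    -- coefficients.
    · lift N to ℕ using h0
      rw [if_pos (by omega), if_neg (by omega), if_neg (by omega), Int.toNat_natCast, sub_zero, add_zero,
        structureConst_negSucc, if_neg (by omega), mul_zero, add_zero, bc_neg_sub_one,
        show (a : ℤ) - (-b - 1 - N) - 1 = ((a + (b + N) : ℕ) : ℤ) by push_cast; ring,
        show (N : ℤ) + a + b = ((N + (a + b) : ℕ) : ℤ) by push_cast; ring, bc_natCast, bc_natCast,
        show N + (a + b) = a + (b + N) by ring]
      have h := choose_mul_choose_add a b N
      have h' : ((a + (b + N)).choose (a + b) : ℂ) = (N + (a + b)).choose N := by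
        rw [Nat.choose_symm_add, show N + (a + b) = a + (b + N) by ring]
      rw [h', show (-(b : ℤ) - 1 - N) = -((b + N + 1 : ℕ) : ℤ) by push_cast; ring, zpow_neg, zpow_natCast,
        zpow_natCast, ← inv_pow, show (-1 : ℂ)⁻¹ = -1 by norm_num]
      have hs : (-1 : ℂ) ^ N * (-1) ^ N = 1 := by rw [← mul_pow]; norm_num
      simp only [pow_add, pow_one]
      generalize (-1 : ℂ) ^ N = sN at *
      generalize (-1 : ℂ) ^ b = sb at *
      generalize (fSeries q (r - s)).coeff _ = f
      linear_combination (-(sN * sb * f)) * h +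
        (sN * sb * f * ((b + N).choose N : ℂ) * ((a + (b + N)).choose a : ℂ)) * hs
  -- For m ≥ 0 there is no κ and only delta terms are left.
  · rw [kappa_of_nonneg_left _ _ _ _ hm, HahnSeries.coeff_zero, zero_add]
    lift m to ℕ using hm
    congr 1
    rw [structureConst_nonneg_left _ _ _ _ _ (by omega)]
    by_cases hN : (m : ℤ) + (-b - 1 - N) = 0
    · obtain rfl : N = m - b - 1 := by omega
      have h3 : (if (m : ℤ) - b - 1 ≤ -(b : ℤ) - 1 then (-1) ^ ((m : ℤ) - b - 1) *
          bc (-b - 1) (-b - 1 - ((m : ℤ) - b - 1)).toNat * (deltaDiff r s * (((m : ℕ) : ℤ) : ℂ)) else 0) =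
          0 := by
        split_ifs with h
        · obtain rfl : m = 0 := by omega
          simp
        · rfl
      rw [if_pos hN, h3,
        if_pos (c := (m : ℤ) - b - 1 ≤ m) (by omega),
        structureConst_nonneg_left _ _ _ _ _ (by omega),
        if_pos (c := (m : ℤ) - (m - b - 1) + (-b - 1) = 0) (by ring)]
      rcases lt_or_ge m (b + 1) with h | h
      · rw [if_neg (by omega), show (m : ℤ) - (m - b - 1) = ((b + 1 : ℕ) : ℤ) by push_cast; ring,
          Int.toNat_natCast, bc_natCast_of_lt h]
        ring
      · obtain ⟨k, rfl⟩ := Nat.exists_eq_add_of_le h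
        have e : ((b + 1 + k : ℕ) : ℤ) - b - 1 = k := by push_cast; ring
        rw [e, if_pos (by omega), show ((b + 1 + k : ℕ) : ℤ) - k = ((b + 1 : ℕ) : ℤ) by push_cast; ring,
          Int.toNat_natCast, Int.toNat_natCast, bc_neg_sub_one, bc_natCast, zpow_natCast]
        have hs : (-1 : ℂ) ^ k * (-1) ^ k = 1 := by rw [← mul_pow]; norm_num
        have c1 : ((b + 1 + k).choose (b + 1) : ℂ) * (b + 1) = (b + k + 1) * (b + k).choose k := by
          have := Nat.add_one_mul_choose_eq (b + k) b
          rw [show b + 1 + k = b + k + 1 by ring, ← Nat.choose_symm_add (a := b)]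
          exact_mod_cast this.symm
        push_cast
        linear_combination (deltaDiff r s * (b + 1 + k) * ((b + k).choose k : ℂ)) * hs -
          deltaDiff r s * c1
    · rw [if_neg (c := _ = (0 : ℤ)) hN]
      have h2 : (if N ≤ (m : ℤ) then bc m (m - N).toNat *
            structureConst q r s (m - N) (-b - 1) else 0) = 0 := by
          split_ifs
          · rw [structureConst_nonneg_left _ _ _ _ _ (by omega), if_neg (c := _ = (0 : ℤ)) (by omega)]
            ring
          · rfl
      rw [h2]
      simp

end Kappa

end QVA

namespace QVA

/-! ### Operators on the factors of K ⊗ (M ⊗ N). -/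

section Box

open TensorProduct

variable {K : Type*} [CommRing K] [Algebra ℂ K] {M N P : Type*} [AddCommGroup M] [Module ℂ M]
  [AddCommGroup N] [Module ℂ N] [AddCommGroup P] [Module ℂ P]

/-- The product `(k ⊗ m, k' ⊗ n) ↦ k k' ⊗ (m ⊗ n)`. -/
def boxMul : K ⊗[ℂ] M →ₗ[K] K ⊗[ℂ] N →ₗ[K] K ⊗[ℂ] (M ⊗[ℂ] N) :=
  (TensorProduct.mk K (K ⊗[ℂ] M) (K ⊗[ℂ] N)).compr₂
    (AlgebraTensorModule.distribBaseChange ℂ K M N).symm.toLinearMap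

@[simp] theorem boxMul_tmul (k k' : K) (m : M) (n : N) :
    boxMul (k ⊗ₜ[ℂ] m) (k' ⊗ₜ[ℂ] n) = (k * k') ⊗ₜ[ℂ] (m ⊗ₜ[ℂ] n) :=
  AlgebraTensorModule.distribBaseChange_symm_tmul ℂ K m n k k'

theorem baseChange_ext {Z : Type*} [AddCommMonoid Z] [Module K Z] {F G : K ⊗[ℂ] M →ₗ[K] Z}
    (h : ∀ m, F (1 ⊗ₜ m) = G (1 ⊗ₜ m)) : F = G := by
  apply LinearMap.ext
  intro x
  induction x using TensorProduct.induction_on with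
  | zero => simp
  | add x y hx hy => rw [map_add, map_add, hx, hy]
  | tmul k m => rw [show k ⊗ₜ[ℂ] m = k • ((1 : K) ⊗ₜ[ℂ] m) by simp [smul_tmul'], map_smul, map_smul, h]

/-- Reduces operator identities on K ⊗ (M ⊗ N) to product vectors, as if it were a tensor product
over K. -/
theorem box_ext {Z : Type*} [AddCommMonoid Z] [Module K Z] {F G : K ⊗[ℂ] (M ⊗[ℂ] N) →ₗ[K] Z}
    (h : ∀ y z, F (boxMul y z) = G (boxMul y z)) : F = G := by
  refine baseChange_ext fun p => ?_
  induction p using TensorProduct.induction_on with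
  | zero => simp
  | add x y hx hy => rw [tmul_add, map_add, map_add, hx, hy]
  | tmul m n => simpa using h (1 ⊗ₜ m) (1 ⊗ₜ n)

/-- The operator `f ⊗ 1`. -/
def opL (f : Module.End K (K ⊗[ℂ] M)) : Module.End K (K ⊗[ℂ] (M ⊗[ℂ] N)) :=
  (AlgebraTensorModule.distribBaseChange ℂ K M N).symm.toLinearMap ∘ₗ
    (f.rTensor (K ⊗[ℂ] N)) ∘ₗ (AlgebraTensorModule.distribBaseChange ℂ K M N).toLinearMap

/-- The operator `1 ⊗ f`. -/
def opR (f : Module.End K (K ⊗[ℂ] N)) : Module.End K (K ⊗[ℂ] (M ⊗[ℂ] N)) :=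
  (AlgebraTensorModule.distribBaseChange ℂ K M N).symm.toLinearMap ∘ₗ
    (f.lTensor (K ⊗[ℂ] M)) ∘ₗ (AlgebraTensorModule.distribBaseChange ℂ K M N).toLinearMap

@[simp] theorem opL_boxMul (f : Module.End K (K ⊗[ℂ] M)) (y : K ⊗[ℂ] M) (z : K ⊗[ℂ] N) :
    opL f (boxMul y z) = boxMul (f y) z := by
  simp [opL, boxMul]

@[simp] theorem opR_boxMul (f : Module.End K (K ⊗[ℂ] N)) (y : K ⊗[ℂ] M) (z : K ⊗[ℂ] N) :
    opR f (boxMul y z) = boxMul y (f z) := by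
  simp [opR, boxMul]

theorem opL_mul (f g : Module.End K (K ⊗[ℂ] M)) :
    (opL (f * g) : Module.End K (K ⊗[ℂ] (M ⊗[ℂ] N))) = opL f * opL g :=
  box_ext fun y z => by simp

theorem opR_mul (f g : Module.End K (K ⊗[ℂ] N)) :
    (opR (f * g) : Module.End K (K ⊗[ℂ] (M ⊗[ℂ] N))) = opR f * opR g :=
  box_ext fun y z => by simp

theorem opL_opR_comm (f : Module.End K (K ⊗[ℂ] M)) (g : Module.End K (K ⊗[ℂ] N)) :
    opL f * opR g = opR g * opL f :=
  box_ext fun y z => by simp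

theorem opL_add (f g : Module.End K (K ⊗[ℂ] M)) :
    (opL (f + g) : Module.End K (K ⊗[ℂ] (M ⊗[ℂ] N))) = opL f + opL g :=
  box_ext fun y z => by simp

theorem opR_add (f g : Module.End K (K ⊗[ℂ] N)) :
    (opR (f + g) : Module.End K (K ⊗[ℂ] (M ⊗[ℂ] N))) = opR f + opR g :=
  box_ext fun y z => by simp

theorem opL_smul_one (c : K) :
    (opL (c • (1 : Module.End K (K ⊗[ℂ] M))) : Module.End K (K ⊗[ℂ] (M ⊗[ℂ] N))) = c • 1 :=
  box_ext fun y z => by simp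

theorem opR_smul_one (c : K) :
    (opR (c • (1 : Module.End K (K ⊗[ℂ] N))) : Module.End K (K ⊗[ℂ] (M ⊗[ℂ] N))) = c • 1 :=
  box_ext fun y z => by simp

theorem opL_zero : (opL (0 : Module.End K (K ⊗[ℂ] M)) : Module.End K (K ⊗[ℂ] (M ⊗[ℂ] N))) = 0 :=
  box_ext fun y z => by simp

theorem opR_zero : (opR (0 : Module.End K (K ⊗[ℂ] N)) : Module.End K (K ⊗[ℂ] (M ⊗[ℂ] N))) = 0 :=
  box_ext fun y z => by simp

end Box

/-! ### Partial derivatives with respect to the creation operators. -/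

section Gradient

variable {q ℓ : ℂ}

/-- The vector of all partial derivatives with respect to the creation operators `β_m`, `m < 0`,
together with the vector itself. -/
def gradAux (q ℓ : ℂ) : VacuumModule q ℓ →ₗ[ℂ] VacuumModule q ℓ × (ℤ × ℤ →₀ VacuumModule q ℓ) :=
  vacLift (fun r m => LinearMap.prod (betaOp q (VacuumModule q ℓ) r m ∘ₗ LinearMap.fst ℂ _ _)
      (Finsupp.mapRange.linearMap (betaOp q (VacuumModule q ℓ) r m) ∘ₗ LinearMap.snd ℂ _ _ +
        (if m < 0 then (Finsupp.lsingle (r, m) : VacuumModule q ℓ →ₗ[ℂ] _) else 0) ∘ₗ LinearMap.fst ℂ _ _))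
    -- The extra components cancel in the commutator: applied to v, both orders give β_m v in the
    -- slot of β_n and β_n v in the slot of β_m.
    (fun r s m n => by
      apply LinearMap.ext
      rintro ⟨v, y⟩
      have h := betaOp_comm (W := VacuumModule q ℓ) hasLevel_vacuumModule r s m n
      have e : ∀ (T : Module.End ℂ (VacuumModule q ℓ)) (r m : ℤ) (v : VacuumModule q ℓ),
          Finsupp.mapRange.linearMap T ((if m < 0 then (Finsupp.lsingle (r, m) :
            VacuumModule q ℓ →ₗ[ℂ] (ℤ × ℤ →₀ VacuumModule q ℓ)) else 0) v) =
          (if m < 0 then (Finsupp.lsingle (r, m) :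
            VacuumModule q ℓ →ₗ[ℂ] (ℤ × ℤ →₀ VacuumModule q ℓ)) else 0) (T v) := by
        intro T r m v
        split_ifs <;> simp
      have hprod : ∀ (f : VacuumModule q ℓ × (ℤ × ℤ →₀ VacuumModule q ℓ) →ₗ[ℂ] VacuumModule q ℓ)
          (g : VacuumModule q ℓ × (ℤ × ℤ →₀ VacuumModule q ℓ) →ₗ[ℂ] (ℤ × ℤ →₀ VacuumModule q ℓ)) x,
          LinearMap.prod f g x = (f x, g x) := fun _ _ _ => rfl
      simp only [LinearMap.sub_apply, Module.End.mul_apply, hprod,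
        LinearMap.comp_apply, LinearMap.fst_apply, LinearMap.snd_apply, LinearMap.add_apply, map_add,
        LinearMap.smul_apply, Module.End.one_apply, e, Prod.smul_mk, Prod.mk_sub_mk]
      have h' : Finsupp.mapRange.linearMap (betaOp q (VacuumModule q ℓ) r m)
          (Finsupp.mapRange.linearMap (betaOp q (VacuumModule q ℓ) s n) y) =
          Finsupp.mapRange.linearMap (betaOp q (VacuumModule q ℓ) s n)
          (Finsupp.mapRange.linearMap (betaOp q (VacuumModule q ℓ) r m) y) +
          (structureConst q r s m n * ℓ) • y := by
        ext p
        simp [h]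
      rw [h, h', add_sub_cancel_left]
      congr 1
      abel)
    (vac q ℓ, 0) (fun r m hm => by
      simp [not_lt.2 hm, betaOp_apply, beta_vac r m hm])

theorem gradAux_fst (v : VacuumModule q ℓ) : (gradAux q ℓ v).1 = v := by
  induction v using vacuum_induction with
  | h0 => rw [gradAux, vacLift_vac]
  | hβ r m v hv =>
    rw [gradAux, vacLift_beta]
    change betaOp q _ r m (gradAux q ℓ v).1 = _
    rw [hv]; rfl
  | hadd u v hu hv => rw [map_add, Prod.fst_add, hu, hv]
  | hsmul c v hv => rw [map_smul, Prod.smul_fst, hv]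

/-- The vector of all partial derivatives with respect to the creation operators `β_m`, `m < 0`. -/
def grad (q ℓ : ℂ) : VacuumModule q ℓ →ₗ[ℂ] (ℤ × ℤ →₀ VacuumModule q ℓ) :=
  LinearMap.snd ℂ _ _ ∘ₗ gradAux q ℓ

theorem grad_vac : grad q ℓ (vac q ℓ) = 0 := by
  rw [grad, LinearMap.comp_apply, gradAux, vacLift_vac]
  rfl

theorem grad_beta (r m : ℤ) (v : VacuumModule q ℓ) : grad q ℓ ⁅beta q r m, v⁆ =
    Finsupp.mapRange.linearMap (betaOp q (VacuumModule q ℓ) r m) (grad q ℓ v) +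
      if m < 0 then Finsupp.single (r, m) v else 0 := by
  have h : grad q ℓ ⁅beta q r m, v⁆ = Finsupp.mapRange.linearMap (betaOp q (VacuumModule q ℓ) r m)
      (grad q ℓ v) + (if m < 0 then (Finsupp.lsingle (r, m) : VacuumModule q ℓ →ₗ[ℂ] _) else 0)
        (gradAux q ℓ v).1 := by
    rw [grad, LinearMap.comp_apply, gradAux, vacLift_beta]
    rfl
  rw [h, gradAux_fst]
  split_ifs <;> rfl

end Gradient

/-! ### Constant-coefficient derivations with scalars in K. -/

section Derivations

open TensorProduct

variable {q ℓ : ℂ} {K : Type*} [CommRing K] [Algebra ℂ K] {N : Type*} [AddCommGroup N] [Module ℂ N]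

/-- The operator of `β_m` on `K ⊗ V`. -/
def bOp (q ℓ : ℂ) (K : Type*) [CommRing K] [Algebra ℂ K] (r m : ℤ) :
    Module.End K (K ⊗[ℂ] VacuumModule q ℓ) :=
  (betaOp q (VacuumModule q ℓ) r m).baseChange K

@[simp] theorem bOp_tmul (r m : ℤ) (k : K) (v : VacuumModule q ℓ) :
    bOp q ℓ K r m (k ⊗ₜ v) = k ⊗ₜ ⁅beta q r m, v⁆ := rfl

theorem bOp_comm (r s m n : ℤ) : bOp q ℓ K r m * bOp q ℓ K s n =
    bOp q ℓ K s n * bOp q ℓ K r m + algebraMap ℂ K (structureConst q r s m n * ℓ) • 1 := by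
  refine baseChange_ext fun v => ?_
  have h := betaOp_comm (W := VacuumModule q ℓ) hasLevel_vacuumModule r s m n v
  simp only [betaOp_apply] at h
  rw [Module.End.mul_apply, bOp_tmul, bOp_tmul, h, tmul_add, LinearMap.add_apply,
    Module.End.mul_apply, bOp_tmul, bOp_tmul, LinearMap.smul_apply, Module.End.one_apply,
    algebraMap_smul, tmul_smul]

/-- The derivation `∑ c_{r,m} ∂/∂β_m`, with coefficients in `K`. -/
def der (c : ℤ → ℤ → K) : VacuumModule q ℓ →ₗ[ℂ] K ⊗[ℂ] VacuumModule q ℓ :=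
  Finsupp.lsum ℂ (fun p : ℤ × ℤ => TensorProduct.mk ℂ K (VacuumModule q ℓ) (c p.1 p.2)) ∘ₗ grad q ℓ

theorem der_vac (c : ℤ → ℤ → K) : der c (vac q ℓ) = 0 := by
  rw [der, LinearMap.comp_apply, grad_vac, map_zero]

/-- The Leibniz rule. The gradient has no components at nonnegative modes, so c has to vanish there
for the rule to be uniform in m. -/
theorem der_beta (c : ℤ → ℤ → K) (hc : ∀ r m, 0 ≤ m → c r m = 0) (r m : ℤ) (v : VacuumModule q ℓ) :
    der c ⁅beta q r m, v⁆ = bOp q ℓ K r m (der c v) + c r m ⊗ₜ v := by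
  rw [der, LinearMap.comp_apply, LinearMap.comp_apply, grad_beta, map_add]
  congr 1
  · generalize grad q ℓ v = y
    induction y using Finsupp.induction_linear with
    | zero => simp
    | add f g hf hg => simp only [map_add, hf, hg]
    | single p v => simp; rfl
  · split_ifs with h
    · simp
    · simp [hc r m (not_lt.1 h)]

/-- The `K`-linear extension of `der`. -/
def derOp (q ℓ : ℂ) (c : ℤ → ℤ → K) : Module.End K (K ⊗[ℂ] VacuumModule q ℓ) :=
  (der c).liftBaseChange K

theorem derOp_tmul (c : ℤ → ℤ → K) (v : VacuumModule q ℓ) : derOp q ℓ c (1 ⊗ₜ v) = der c v := by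
  rw [derOp, LinearMap.liftBaseChange_tmul, one_smul]

theorem derOp_vac (c : ℤ → ℤ → K) : derOp q ℓ c (1 ⊗ₜ vac q ℓ) = 0 := by
  rw [derOp_tmul, der_vac]

theorem derOp_bOp (c : ℤ → ℤ → K) (hc : ∀ r m, 0 ≤ m → c r m = 0) (r m : ℤ) :
    derOp q ℓ c * bOp q ℓ K r m = bOp q ℓ K r m * derOp q ℓ c + c r m • 1 := by
  refine baseChange_ext fun v => ?_
  simp [derOp_tmul, der_beta c hc, smul_tmul']

/-- The hypothesis reads F β_m - T F = G β_m - T G, written without subtraction, so agreement at v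
passes to β_m v. -/
theorem vacuum_baseChange_ext {Z : Type*} [AddCommGroup Z] [Module K Z]
    {F G : K ⊗[ℂ] VacuumModule q ℓ →ₗ[K] Z} (T : ℤ → ℤ → Module.End K Z)
    (h0 : F (1 ⊗ₜ vac q ℓ) = G (1 ⊗ₜ vac q ℓ))
    (h : ∀ r m, F ∘ₗ bOp q ℓ K r m + T r m ∘ₗ G = T r m ∘ₗ F + G ∘ₗ bOp q ℓ K r m) : F = G := by
  refine baseChange_ext fun v => ?_
  induction v using vacuum_induction with
  | h0 => exact h0
  | hβ r m v hv =>
    have h1 := LinearMap.congr_fun (h r m) (1 ⊗ₜ v)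
    simp only [LinearMap.comp_apply, LinearMap.add_apply, bOp_tmul, hv] at h1
    rw [add_comm] at h1
    exact add_left_cancel h1
  | hadd u v hu hv => rw [tmul_add, map_add, map_add, hu, hv]
  | hsmul c v hv => rw [tmul_smul, ← algebraMap_smul K c, map_smul, map_smul, hv]

theorem vacuum_box_ext {Z : Type*} [AddCommGroup Z] [Module K Z]
    {F G : K ⊗[ℂ] (N ⊗[ℂ] VacuumModule q ℓ) →ₗ[K] Z} (T : ℤ → ℤ → Module.End K Z)
    (h0 : ∀ y, F (boxMul y (1 ⊗ₜ vac q ℓ)) = G (boxMul y (1 ⊗ₜ vac q ℓ)))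
    (h : ∀ r m, F ∘ₗ opR (bOp q ℓ K r m) + T r m ∘ₗ G = T r m ∘ₗ F + G ∘ₗ opR (bOp q ℓ K r m)) :
    F = G := by
  refine box_ext fun y => LinearMap.congr_fun (?_ : F ∘ₗ boxMul y = G ∘ₗ boxMul y)
  refine vacuum_baseChange_ext T (h0 y) (fun r m => ?_)
  ext1 z
  simpa using LinearMap.congr_fun (h r m) (boxMul y z)

theorem mul_comm_step {R : Type*} [Semiring R] {x y b c d : R} (h1 : x * b = b * x + c)
    (h2 : y * b = b * y + d) (hc : c * y = y * c) (hd : d * x = x * d) :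
    x * y * b + b * (y * x) = b * (x * y) + y * x * b := by
  rw [mul_assoc, h2, mul_assoc y, h1, mul_add, mul_add, ← mul_assoc x, h1, ← mul_assoc y, h2,
    add_mul, add_mul, hc, hd]
  simp only [mul_assoc]
  abel

theorem smul_one_mul_comm (c : K) {Z : Type*} [AddCommMonoid Z] [Module K Z] (x : Module.End K Z) :
    (c • 1) * x = x * (c • 1) := by
  rw [smul_mul_assoc, mul_smul_comm, one_mul, mul_one]

/-- Each derivation has scalar commutators with all β_m, so the commutator of two of them commutes
with every β_m; it kills the vacuum. -/
theorem derOp_comm (c d : ℤ → ℤ → K) (hc : ∀ r m, 0 ≤ m → c r m = 0)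
    (hd : ∀ r m, 0 ≤ m → d r m = 0) : derOp q ℓ c * derOp q ℓ d = derOp q ℓ d * derOp q ℓ c := by
  refine vacuum_baseChange_ext (fun r m => bOp q ℓ K r m) ?_ (fun r m => ?_)
  · simp [derOp_vac]
  · have h := mul_comm_step (R := Module.End K (K ⊗[ℂ] VacuumModule q ℓ)) (derOp_bOp c hc r m)
      (derOp_bOp d hd r m) (smul_one_mul_comm _ _) (smul_one_mul_comm _ _)
    exact h

theorem derOp_add (c d : ℤ → ℤ → K) : derOp q ℓ (c + d) = derOp q ℓ c + derOp q ℓ d := by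
  refine baseChange_ext fun v => ?_
  rw [LinearMap.add_apply, derOp_tmul, derOp_tmul, derOp_tmul, der, der, der, LinearMap.comp_apply,
    LinearMap.comp_apply, LinearMap.comp_apply]
  generalize grad q ℓ v = y
  induction y using Finsupp.induction_linear with
  | zero => simp
  | add f g hf hg => simp only [map_add, hf, hg]; abel
  | single p v => simp

theorem derOp_zero : derOp q ℓ (0 : ℤ → ℤ → K) = 0 := by
  refine baseChange_ext fun v => ?_
  rw [derOp_tmul, der, LinearMap.comp_apply, LinearMap.zero_apply]
  generalize grad q ℓ v = y
  induction y using Finsupp.induction_linear with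
  | zero => simp
  | add f g hf hg => simp only [map_add, hf, hg, add_zero]
  | single p v => simp

end Derivations

end QVA

namespace QVA

/-! ### Twists: operators that shift β_m on the second factor by operators on the first. -/

section Twist

open TensorProduct

variable {q ℓ : ℂ} {K : Type*} [CommRing K] [Algebra ℂ K] {N : Type*} [AddCommGroup N] [Module ℂ N]

/-- The operator `X` on `K ⊗ (N ⊗ V)` fixes `N ⊗ 1` and shifts the operators `β_m` on `V` by the
operators `D` on `N`. -/
structure IsTwist (D : ℤ → ℤ → Module.End K (K ⊗[ℂ] N))
    (X : Module.End K (K ⊗[ℂ] (N ⊗[ℂ] VacuumModule q ℓ))) : Prop where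
  vac : ∀ y, X (boxMul y (1 ⊗ₜ vac q ℓ)) = boxMul y (1 ⊗ₜ QVA.vac q ℓ)
  beta : ∀ r m, X * opR (bOp q ℓ K r m) = (opR (bOp q ℓ K r m) + opL (D r m)) * X

namespace IsTwist

variable {D D' : ℤ → ℤ → Module.End K (K ⊗[ℂ] N)}
  {X X' : Module.End K (K ⊗[ℂ] (N ⊗[ℂ] VacuumModule q ℓ))}

theorem ext_of_beta {F G : Module.End K (K ⊗[ℂ] (N ⊗[ℂ] VacuumModule q ℓ))}
    (T : ℤ → ℤ → Module.End K (K ⊗[ℂ] (N ⊗[ℂ] VacuumModule q ℓ)))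
    (h0 : ∀ y, F (boxMul y (1 ⊗ₜ QVA.vac q ℓ)) = G (boxMul y (1 ⊗ₜ QVA.vac q ℓ)))
    (h : ∀ r m, F * opR (bOp q ℓ K r m) + T r m * G = T r m * F + G * opR (bOp q ℓ K r m)) :
    F = G :=
  vacuum_box_ext T h0 h

/-- The twist relations determine X on N ⊗ V from N ⊗ 1. This turns the identities for 𝒮 into
comparisons of shifts. -/
theorem unique (h : IsTwist D X) (h' : IsTwist D X') : X = X' := by
  refine ext_of_beta (fun r m => opR (bOp q ℓ K r m) + opL (D r m)) (fun y => ?_) (fun r m => ?_)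
  · rw [h.vac, h'.vac]
  · rw [h.beta, h'.beta]

theorem step_comm {R : Type*} [Semiring R] {x y b d : R} (h1 : x * b = (b + d) * x)
    (hb : y * b = b * y) (hd : y * d = d * y) :
    x * y * b + (b + d) * (y * x) = (b + d) * (x * y) + y * x * b := by
  rw [mul_assoc, hb, ← mul_assoc, h1, mul_assoc, mul_assoc y, h1, ← mul_assoc y, mul_add, hb, hd,
    ← add_mul, mul_assoc]

theorem comm_opL (h : IsTwist D X) (Y : Module.End K (K ⊗[ℂ] N))
    (hY : ∀ r m, Y * D r m = D r m * Y) : X * opL Y = opL Y * X := by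
  refine ext_of_beta (fun r m => opR (bOp q ℓ K r m) + opL (D r m)) (fun y => ?_) (fun r m => ?_)
  · simp [h.vac]
  · have := step_comm (R := Module.End K (K ⊗[ℂ] (N ⊗[ℂ] VacuumModule q ℓ))) (h.beta r m)
      (opL_opR_comm Y _) (by rw [← opL_mul, hY, opL_mul])
    exact this

theorem step_der {R : Type*} [Semiring R] {x y b d c : R} (h1 : x * b = (b + d) * x)
    (hb : y * b = b * y + c) (hd : y * d = d * y) (hc : x * c = c * x) :
    x * y * b + (b + d) * (y * x) = (b + d) * (x * y) + y * x * b := by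
  rw [mul_assoc, hb, mul_add, ← mul_assoc x, h1, hc, mul_assoc y, h1, ← mul_assoc y, mul_add, hb,
    hd]
  simp only [add_mul, mul_assoc]
  abel

/-- A derivation on the second factor has the same scalar commutator with the shifted β_m as with
β_m, since the shift acts on the first factor. -/
theorem comm_opR_derOp (h : IsTwist D X) (c : ℤ → ℤ → K) (hc : ∀ r m, 0 ≤ m → c r m = 0) :
    X * opR (derOp q ℓ c) = opR (derOp q ℓ c) * X := by
  refine ext_of_beta (fun r m => opR (bOp q ℓ K r m) + opL (D r m)) (fun y => ?_) (fun r m => ?_)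
  · simp [h.vac, derOp_vac]
  · have := step_der (R := Module.End K (K ⊗[ℂ] (N ⊗[ℂ] VacuumModule q ℓ))) (h.beta r m)
      (y := opR (derOp q ℓ c)) (c := c r m • 1)
      (by rw [← opR_mul, derOp_bOp c hc, opR_add, opR_mul, opR_smul_one])
      (opL_opR_comm _ _).symm (smul_one_mul_comm _ _).symm
    exact this

theorem step_mul {R : Type*} [Semiring R] {x x' b d d' : R} (h : x * b = (b + d) * x)
    (h' : x' * b = (b + d') * x') (hd : x * d' = d' * x) :
    x * x' * b = (b + (d + d')) * (x * x') := by
  rw [mul_assoc, h', ← mul_assoc, mul_add, h, hd]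
  simp only [add_mul, mul_assoc]
  abel

/-- The shift of X' passes through X by `comm_opL`, since it commutes with the shift of X. -/
protected theorem mul (h : IsTwist D X) (h' : IsTwist D' X')
    (hDD : ∀ r m s n, D' s n * D r m = D r m * D' s n) : IsTwist (D + D') (X * X') where
  vac y := by simp [h.vac, h'.vac]
  beta r m := by
    have := step_mul (R := Module.End K (K ⊗[ℂ] (N ⊗[ℂ] VacuumModule q ℓ))) (h.beta r m)
      (h'.beta r m) (h.comm_opL _ fun r' m' => hDD r' m' r m)
    rw [Pi.add_apply, Pi.add_apply, opL_add]
    exact this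

protected theorem one : IsTwist (q := q) (ℓ := ℓ) (0 : ℤ → ℤ → Module.End K (K ⊗[ℂ] N)) 1 where
  vac _ := rfl
  beta r m := by
    rw [Pi.zero_apply, Pi.zero_apply, opL_zero, add_zero, one_mul, mul_one]

theorem step_left {R : Type*} [Semiring R] {x b₁ b₂ d₁ d₂ c : R} (h : x * b₂ = (b₂ + d₁) * x)
    (hb : b₁ * b₂ = b₂ * b₁) (h₁ : d₁ * b₁ = b₁ * d₁ + c) (h₂ : d₂ * b₂ = b₂ * d₂ + c)
    (hd : d₂ * d₁ = d₁ * d₂) :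
    x * b₁ * b₂ + (b₂ + d₁) * ((b₁ + d₂) * x) =
      (b₂ + d₁) * (x * b₁) + (b₁ + d₂) * x * b₂ := by
  rw [mul_assoc x, hb, ← mul_assoc x, h, mul_assoc (b₁ + d₂), h, mul_assoc, ← mul_assoc (b₁ + d₂)]
  congr 1
  rw [← mul_assoc]
  congr 1
  simp only [add_mul, mul_add, hb, h₁, h₂, hd]
  abel

/-- For shifts by derivations the twist is formally exp(∑ c ∂ ⊗ ∂), which treats both factors alike;
so β_n on the first factor is shifted by the transposed derivation on the second. -/
theorem comm_opL_bOp {c : ℤ → ℤ → ℤ → ℤ → K}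
    {X : Module.End K (K ⊗[ℂ] (VacuumModule q ℓ ⊗[ℂ] VacuumModule q ℓ))}
    (h : IsTwist (fun r m => derOp q ℓ (c r m)) X) (hc : ∀ r m s n, 0 ≤ n → c r m s n = 0)
    (hc' : ∀ r m s n, 0 ≤ m → c r m s n = 0) (s n : ℤ) :
    X * opL (bOp q ℓ K s n) =
      (opL (bOp q ℓ K s n) + opR (derOp q ℓ (fun r m => c r m s n))) * X := by
  refine ext_of_beta (fun r m => opR (bOp q ℓ K r m) + opL (derOp q ℓ (c r m)))
    (fun y => ?_) (fun r m => ?_)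
  · simp [h.vac, derOp_vac]
  · have := step_left (R := Module.End K (K ⊗[ℂ] (VacuumModule q ℓ ⊗[ℂ] VacuumModule q ℓ)))
      (h.beta r m) (opL_opR_comm (bOp q ℓ K s n) _) (c := c r m s n • 1)
      (d₂ := opR (derOp q ℓ (fun r m => c r m s n)))
      (by rw [← opL_mul, derOp_bOp _ (hc r m), opL_add, opL_mul, opL_smul_one])
      (by rw [← opR_mul, derOp_bOp _ (fun r m hm => hc' r m s n hm), opR_add, opR_mul,
        opR_smul_one])
      (opL_opR_comm _ _).symm
    exact this

end IsTwist

theorem step_exists {R : Type*} [Semiring R] {b b' d d' c : R} (hb : b * b' = b' * b + c)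
    (h₁ : d * b' = b' * d) (h₂ : d' * b = b * d') (hd : d * d' = d' * d) :
    (b + d) * (b' + d') = (b' + d') * (b + d) + c := by
  simp only [add_mul, mul_add, hb, h₁, h₂, hd]
  abel

/-- The shifted operators satisfy the relations of level ℓ because the D commute, and their
nonnegative modes kill N ⊗ 1 because D is zero there. The universal property of V applies to them.
-/
theorem exists_isTwist (D : ℤ → ℤ → Module.End K (K ⊗[ℂ] N))
    (hD : ∀ r s m n, D r m * D s n = D s n * D r m) (hD0 : ∀ r m, 0 ≤ m → D r m = 0) :
    ∃ X : Module.End K (K ⊗[ℂ] (N ⊗[ℂ] VacuumModule q ℓ)), IsTwist D X := by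
  let Z := K ⊗[ℂ] (N ⊗[ℂ] VacuumModule q ℓ)
  let U : ℤ → ℤ → Module.End K Z := fun r m => opR (bOp q ℓ K r m) + opL (D r m)
  have hU : ∀ r s m n z, U r m (U s n z) = U s n (U r m z) + (structureConst q r s m n * ℓ) • z := by
    intro r s m n z
    have := step_exists (R := Module.End K Z) (b := opR (bOp q ℓ K r m)) (b' := opR (bOp q ℓ K s n))
      (d := opL (D r m)) (d' := opL (D s n))
      (c := algebraMap ℂ K (structureConst q r s m n * ℓ) • 1)
      (by rw [← opR_mul, bOp_comm, opR_add, opR_mul, opR_smul_one]) (opL_opR_comm _ _)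
      (opL_opR_comm _ _) (by rw [← opL_mul, hD, opL_mul])
    have e := LinearMap.congr_fun this z
    rw [LinearMap.add_apply, LinearMap.smul_apply, Module.End.one_apply, algebraMap_smul] at e
    exact e
  let Φ : VacuumModule q ℓ →ₗ[ℂ] N →ₗ[ℂ] Z := vacLift
    (fun r m => LinearMap.llcomp ℂ N Z Z ((U r m).restrictScalars ℂ))
    (fun r s m n => by
      ext φ x
      change U r m (U s n (φ x)) - U s n (U r m (φ x)) = (structureConst q r s m n * ℓ) • φ x
      rw [hU, add_sub_cancel_left])
    (TensorProduct.mk ℂ K (N ⊗[ℂ] VacuumModule q ℓ) 1 ∘ₗ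
      (TensorProduct.mk ℂ N (VacuumModule q ℓ)).flip (vac q ℓ))
    (fun r m hm => by
      ext x
      have := opR_boxMul (bOp q ℓ K r m) (1 ⊗ₜ x) (1 ⊗ₜ vac q ℓ)
      simp only [boxMul_tmul, bOp_tmul, mul_one] at this
      simp [U, hD0 r m hm, opL_zero, this, beta_vac r m hm])
  have hΦ : ∀ r m v x, Φ ⁅beta q r m, v⁆ x = U r m (Φ v x) := by
    intro r m v x
    rw [show Φ ⁅beta q r m, v⁆ = _ from vacLift_beta ..]
    rfl
  have hX : ∀ x v, ((TensorProduct.lift Φ.flip).liftBaseChange K) (boxMul (1 ⊗ₜ x) (1 ⊗ₜ v)) =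
      Φ v x := fun x v => by simp
  refine ⟨(TensorProduct.lift Φ.flip).liftBaseChange K, fun y => ?_, fun r m => ?_⟩
  · let E : K ⊗[ℂ] N →ₗ[K] Z := boxMul.flip (1 ⊗ₜ vac q ℓ)
    refine LinearMap.congr_fun (baseChange_ext (F := LinearMap.comp
      ((TensorProduct.lift Φ.flip).liftBaseChange K) E) (G := E) fun x => ?_) y
    rw [LinearMap.comp_apply]
    refine (hX x _).trans ?_
    rw [show Φ (vac q ℓ) = _ from vacLift_vac ..]
    simp [E]
  · refine baseChange_ext fun p => ?_
    induction p using TensorProduct.induction_on with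
    | zero => simp
    | add x y hx hy => rw [tmul_add, map_add, map_add, hx, hy]
    | tmul x v =>
      rw [show (1 : K) ⊗ₜ[ℂ] (x ⊗ₜ[ℂ] v) = boxMul (1 ⊗ₜ x) (1 ⊗ₜ v) by simp,
        Module.End.mul_apply, Module.End.mul_apply, opR_boxMul, bOp_tmul, hX, hX, hΦ]

end Twist

end QVA

namespace QVA

attribute [local instance] laurentAlgebra

/-! ### The legs 12, 13 and 23 of an operator. -/

section Legs

open TensorProduct

variable {q ℓ : ℂ} {K : Type*} [CommRing K] [Algebra ℂ K] {M N P : Type*} [AddCommGroup M]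
  [Module ℂ M] [AddCommGroup N] [Module ℂ N] [AddCommGroup P] [Module ℂ P]

theorem extendScalars_eq (A : M →ₗ[ℂ] K ⊗[ℂ] N) (z : K ⊗[ℂ] M) :
    extendScalars (LinearMap.mul ℂ K) A z = A.liftBaseChange K z := by
  induction z using TensorProduct.induction_on with
  | zero => simp
  | add x y hx hy => rw [map_add, map_add, hx, hy]
  | tmul k m =>
    rw [LinearMap.liftBaseChange_tmul]
    simp only [extendScalars, LinearMap.comp_apply, LinearMap.lTensor_tmul]
    generalize A m = y
    induction y using TensorProduct.induction_on with
    | zero => simp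
    | add x y hx hy => rw [tmul_add, map_add, map_add, hx, hy, smul_add]
    | tmul k' n => simp [smul_tmul']

theorem boxMul_one_tmul_right (y : K ⊗[ℂ] M) (n : N) :
    boxMul y (1 ⊗ₜ n) = TensorProduct.assoc ℂ K M N (y ⊗ₜ n) := by
  induction y using TensorProduct.induction_on with
  | zero => simp
  | add x y hx hy => rw [map_add, LinearMap.add_apply, add_tmul, map_add, hx, hy]
  | tmul k m => simp

theorem boxMul_one_tmul_left (m : M) (y : K ⊗[ℂ] N) :
    boxMul (1 ⊗ₜ m) y = TensorProduct.leftComm ℂ M K N (m ⊗ₜ y) := by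
  induction y using TensorProduct.induction_on with
  | zero => simp
  | add x y hx hy => rw [map_add, tmul_add, map_add, hx, hy]
  | tmul k m => simp

theorem box_ext₃ {Z : Type*} [AddCommMonoid Z] [Module K Z]
    {F G : K ⊗[ℂ] ((M ⊗[ℂ] N) ⊗[ℂ] P) →ₗ[K] Z}
    (h : ∀ x y z, F (boxMul (boxMul x y) z) = G (boxMul (boxMul x y) z)) : F = G := by
  refine box_ext fun p z => ?_
  refine LinearMap.congr_fun (box_ext (F := F ∘ₗ boxMul.flip z) (G := G ∘ₗ boxMul.flip z)
    fun x y => ?_) p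
  simpa using h x y z

/-- The reassociation `K ⊗ ((M ⊗ N) ⊗ P) → K ⊗ (M ⊗ (N ⊗ P))`. -/
def boxAssoc : K ⊗[ℂ] ((M ⊗[ℂ] N) ⊗[ℂ] P) →ₗ[K] K ⊗[ℂ] (M ⊗[ℂ] (N ⊗[ℂ] P)) :=
  (TensorProduct.assoc ℂ M N P).toLinearMap.baseChange K

/-- The reassociation `K ⊗ (M ⊗ (N ⊗ P)) → K ⊗ ((M ⊗ N) ⊗ P)`. -/
def boxAssocSymm : K ⊗[ℂ] (M ⊗[ℂ] (N ⊗[ℂ] P)) →ₗ[K] K ⊗[ℂ] ((M ⊗[ℂ] N) ⊗[ℂ] P) :=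
  (TensorProduct.assoc ℂ M N P).symm.toLinearMap.baseChange K

/-- The exchange `K ⊗ ((M ⊗ N) ⊗ P) → K ⊗ ((M ⊗ P) ⊗ N)`. -/
def boxRightComm : K ⊗[ℂ] ((M ⊗[ℂ] N) ⊗[ℂ] P) →ₗ[K] K ⊗[ℂ] ((M ⊗[ℂ] P) ⊗[ℂ] N) :=
  (TensorProduct.rightComm ℂ M N P).toLinearMap.baseChange K

/-- The exchange `K ⊗ (M ⊗ N) → K ⊗ (N ⊗ M)`. -/
def boxComm : K ⊗[ℂ] (M ⊗[ℂ] N) →ₗ[K] K ⊗[ℂ] (N ⊗[ℂ] M) :=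
  (TensorProduct.comm ℂ M N).toLinearMap.baseChange K

theorem boxMul_ext₂ {Z : Type*} [AddCommMonoid Z] [Module K Z]
    {F G : K ⊗[ℂ] M →ₗ[K] K ⊗[ℂ] N →ₗ[K] Z} (h : ∀ m n, F (1 ⊗ₜ m) (1 ⊗ₜ n) = G (1 ⊗ₜ m) (1 ⊗ₜ n)) :
    F = G :=
  baseChange_ext fun m => baseChange_ext fun n => h m n

@[simp] theorem boxComm_boxMul (x : K ⊗[ℂ] M) (y : K ⊗[ℂ] N) :
    boxComm (boxMul x y) = boxMul y x := by
  refine LinearMap.congr_fun (LinearMap.congr_fun (boxMul_ext₂ (F := boxMul.compr₂ boxComm)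
    (G := boxMul.flip) fun m n => ?_) x) y
  simp [boxComm]

@[simp] theorem boxAssoc_boxMul (x : K ⊗[ℂ] M) (y : K ⊗[ℂ] N) (z : K ⊗[ℂ] P) :
    boxAssoc (boxMul (boxMul x y) z) = boxMul x (boxMul y z) := by
  refine LinearMap.congr_fun (baseChange_ext (F := boxAssoc ∘ₗ boxMul (boxMul x y))
    (G := boxMul x ∘ₗ boxMul y) fun p => ?_) z
  refine LinearMap.congr_fun (LinearMap.congr_fun (boxMul_ext₂
    (F := boxMul.compr₂ (boxAssoc ∘ₗ boxMul.flip (1 ⊗ₜ p)))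
    (G := boxMul.compl₂ (boxMul.flip (1 ⊗ₜ p))) fun m n => ?_) x) y
  simp [boxAssoc]

@[simp] theorem boxAssocSymm_boxMul (x : K ⊗[ℂ] M) (y : K ⊗[ℂ] N) (z : K ⊗[ℂ] P) :
    boxAssocSymm (boxMul x (boxMul y z)) = boxMul (boxMul x y) z := by
  rw [← boxAssoc_boxMul]
  generalize boxMul (boxMul x y) z = p
  rw [boxAssoc, boxAssocSymm, ← LinearMap.comp_apply, ← LinearMap.baseChange_comp]
  simp

@[simp] theorem boxRightComm_boxMul (x : K ⊗[ℂ] M) (y : K ⊗[ℂ] N) (z : K ⊗[ℂ] P) :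
    boxRightComm (boxMul (boxMul x y) z) = boxMul (boxMul x z) y := by
  refine LinearMap.congr_fun (baseChange_ext (F := boxRightComm ∘ₗ boxMul (boxMul x y))
    (G := boxMul.flip y ∘ₗ boxMul x) fun p => ?_) z
  refine LinearMap.congr_fun (LinearMap.congr_fun (boxMul_ext₂
    (F := boxMul.compr₂ (boxRightComm ∘ₗ boxMul.flip (1 ⊗ₜ p)))
    (G := boxMul ∘ₗ (boxMul.flip (1 ⊗ₜ p))) fun m n => ?_) x) y
  simp [boxRightComm]

/-- Leg 23 of a twist is a twist over the last factor, with shifts acting on the middle one. -/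
theorem IsTwist.assoc {D : ℤ → ℤ → Module.End K (K ⊗[ℂ] N)}
    {X : Module.End K (K ⊗[ℂ] (N ⊗[ℂ] VacuumModule q ℓ))} (h : IsTwist D X) :
    IsTwist (q := q) (ℓ := ℓ) (N := M ⊗[ℂ] N) (fun r m => opR (D r m))
      (boxAssocSymm ∘ₗ opR X ∘ₗ boxAssoc) where
  vac y := by
    refine LinearMap.congr_fun (box_ext (F := (boxAssocSymm ∘ₗ opR X ∘ₗ boxAssoc) ∘ₗ
      boxMul.flip (1 ⊗ₜ QVA.vac q ℓ)) (G := boxMul.flip (1 ⊗ₜ QVA.vac q ℓ)) fun a b => ?_) y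
    simp [h.vac]
  beta r m := by
    refine box_ext₃ fun x y z => ?_
    have e := LinearMap.congr_fun (h.beta r m) (boxMul y z)
    simp only [Module.End.mul_apply, opR_boxMul] at e
    simp only [Module.End.mul_apply, LinearMap.comp_apply, opR_boxMul, boxAssoc_boxMul, e]
    generalize X (boxMul y z) = p
    refine LinearMap.congr_fun (box_ext (F := boxAssocSymm ∘ₗ boxMul x ∘ₗ
      (opR (bOp q ℓ K r m) + opL (D r m)))
      (G := (opR (bOp q ℓ K r m) + opL (opR (D r m))) ∘ₗ boxAssocSymm ∘ₗ boxMul x) fun y z => ?_) p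
    simp

/-- Leg 13 is likewise a twist over the last factor, with shifts acting on the first one. -/
theorem IsTwist.rightComm {D : ℤ → ℤ → Module.End K (K ⊗[ℂ] N)}
    {X : Module.End K (K ⊗[ℂ] (N ⊗[ℂ] VacuumModule q ℓ))} (h : IsTwist D X) :
    IsTwist (q := q) (ℓ := ℓ) (N := N ⊗[ℂ] M) (fun r m => opL (D r m))
      (boxRightComm ∘ₗ opL X ∘ₗ boxRightComm) where
  vac y := by
    refine LinearMap.congr_fun (box_ext (F := (boxRightComm ∘ₗ opL X ∘ₗ boxRightComm) ∘ₗ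
      boxMul.flip (1 ⊗ₜ QVA.vac q ℓ)) (G := boxMul.flip (1 ⊗ₜ QVA.vac q ℓ)) fun a b => ?_) y
    simp [h.vac]
  beta r m := by
    refine box_ext₃ fun x y z => ?_
    have e := LinearMap.congr_fun (h.beta r m) (boxMul x z)
    simp only [Module.End.mul_apply, opR_boxMul] at e
    simp only [Module.End.mul_apply, LinearMap.comp_apply, opR_boxMul, opL_boxMul,
      boxRightComm_boxMul, e]
    generalize X (boxMul x z) = p
    refine LinearMap.congr_fun (box_ext (F := boxRightComm ∘ₗ boxMul.flip y ∘ₗ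
      (opR (bOp q ℓ K r m) + opL (D r m)))
      (G := (opR (bOp q ℓ K r m) + opL (opL (D r m))) ∘ₗ boxRightComm ∘ₗ boxMul.flip y)
      fun x z => ?_) p
    simp

variable {V : Type*} [AddCommGroup V] [Module ℂ V]

theorem liftBaseChange_leg12 (A : V ⊗[ℂ] V →ₗ[ℂ] K ⊗[ℂ] (V ⊗[ℂ] V)) :
    (leg12 A).liftBaseChange K = opL (A.liftBaseChange K) := by
  refine baseChange_ext fun p => ?_
  rw [LinearMap.liftBaseChange_tmul, one_smul]
  induction p using TensorProduct.induction_on with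
  | zero => simp
  | add x y hx hy => rw [tmul_add, map_add, map_add, hx, hy]
  | tmul p w =>
    rw [show (1 : K) ⊗ₜ[ℂ] (p ⊗ₜ[ℂ] w) = boxMul (1 ⊗ₜ p) (1 ⊗ₜ w) by simp, opL_boxMul,
      boxMul_one_tmul_right]
    simp [leg12]

theorem liftBaseChange_leg23 (A : V ⊗[ℂ] V →ₗ[ℂ] K ⊗[ℂ] (V ⊗[ℂ] V)) :
    (leg23 A).liftBaseChange K = boxAssocSymm ∘ₗ opR (A.liftBaseChange K) ∘ₗ boxAssoc := by
  refine box_ext₃ fun x y z => ?_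
  rw [LinearMap.comp_apply, LinearMap.comp_apply, boxAssoc_boxMul]
  refine LinearMap.congr_fun (LinearMap.congr_fun (boxMul_ext₂ (F := boxMul.compr₂
    ((leg23 A).liftBaseChange K ∘ₗ boxMul.flip z)) (G := (boxMul.compl₂ (boxMul.flip z)).compr₂
    (boxAssocSymm ∘ₗ opR (A.liftBaseChange K))) fun u v => ?_) x) y
  simp only [LinearMap.compr₂_apply, LinearMap.comp_apply, LinearMap.flip_apply,
    LinearMap.compl₂_apply]
  refine LinearMap.congr_fun (baseChange_ext (F := (leg23 A).liftBaseChange K ∘ₗ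
    boxMul (boxMul (1 ⊗ₜ u) (1 ⊗ₜ v))) (G := boxAssocSymm ∘ₗ opR (A.liftBaseChange K) ∘ₗ
    boxMul (1 ⊗ₜ u) ∘ₗ boxMul (1 ⊗ₜ v)) fun w => ?_) z
  simp only [LinearMap.comp_apply]
  rw [opR_boxMul]
  simp [leg23, boxAssocSymm]
  rw [boxMul_one_tmul_left]
  rfl

theorem liftBaseChange_leg13 (A : V ⊗[ℂ] V →ₗ[ℂ] K ⊗[ℂ] (V ⊗[ℂ] V)) :
    (leg13 A).liftBaseChange K = boxRightComm ∘ₗ opL (A.liftBaseChange K) ∘ₗ boxRightComm := by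
  rw [← liftBaseChange_leg12]
  refine baseChange_ext fun p => ?_
  simp [leg13, boxRightComm]
  rfl

theorem liftBaseChange_flip (A : V ⊗[ℂ] V →ₗ[ℂ] K ⊗[ℂ] (V ⊗[ℂ] V)) :
    (((TensorProduct.comm ℂ V V).toLinearMap.lTensor K ∘ₗ A ∘ₗ
      (TensorProduct.comm ℂ V V).toLinearMap).liftBaseChange K) =
      boxComm ∘ₗ A.liftBaseChange K ∘ₗ boxComm := by
  refine baseChange_ext fun p => ?_
  simp [boxComm]
  rfl

end Legs

end QVA

namespace QVA

attribute [local instance] laurentAlgebra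

/-! ### Change of the scalar algebra. -/

section ChangeScalars

open TensorProduct

variable {q ℓ : ℂ} {K K' : Type*} [CommRing K] [Algebra ℂ K] [CommRing K'] [Algebra ℂ K']
  {M N : Type*} [AddCommGroup M] [Module ℂ M] [AddCommGroup N] [Module ℂ N]

/-- Application of an algebra homomorphism `K → K'` to the scalars of `K ⊗ M`. -/
def mapScalars (ρ : K →ₐ[ℂ] K') (M : Type*) [AddCommGroup M] [Module ℂ M] :
    K ⊗[ℂ] M →ₗ[ℂ] K' ⊗[ℂ] M :=
  ρ.toLinearMap.rTensor M

variable (ρ : K →ₐ[ℂ] K')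

@[simp] theorem mapScalars_tmul (k : K) (m : M) : mapScalars ρ M (k ⊗ₜ m) = ρ k ⊗ₜ m := rfl

theorem mapScalars_smul (k : K) (z : K ⊗[ℂ] M) :
    mapScalars ρ M (k • z) = ρ k • mapScalars ρ M z := by
  induction z using TensorProduct.induction_on with
  | zero => simp
  | add x y hx hy => rw [smul_add, map_add, hx, hy, map_add, smul_add]
  | tmul k' m => simp [smul_tmul']

theorem mapScalars_boxMul (y : K ⊗[ℂ] M) (z : K ⊗[ℂ] N) :
    mapScalars ρ (M ⊗[ℂ] N) (boxMul y z) = boxMul (mapScalars ρ M y) (mapScalars ρ N z) := by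
  induction y using TensorProduct.induction_on with
  | zero => simp
  | add x y hx hy => simp only [map_add, LinearMap.add_apply, hx, hy]
  | tmul k m =>
    induction z using TensorProduct.induction_on with
    | zero => simp
    | add x y hx hy => simp only [map_add, hx, hy]
    | tmul k n => simp

theorem mapScalars_liftBaseChange (A : M →ₗ[ℂ] K ⊗[ℂ] N) (z : K ⊗[ℂ] M) :
    (mapScalars ρ N ∘ₗ A).liftBaseChange K' (mapScalars ρ M z) =
      mapScalars ρ N (A.liftBaseChange K z) := by
  induction z using TensorProduct.induction_on with
  | zero => simp
  | add x y hx hy => simp only [map_add, hx, hy]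
  | tmul k m => simp [mapScalars_smul]

theorem mapScalars_box_induction {p : K ⊗[ℂ] (M ⊗[ℂ] N) → Prop} (h0 : p 0)
    (hadd : ∀ x y, p x → p y → p (x + y)) (h : ∀ y z, p (boxMul y z)) (x) : p x := by
  induction x using TensorProduct.induction_on with
  | zero => exact h0
  | add x y hx hy => exact hadd x y hx hy
  | tmul k z =>
    induction z using TensorProduct.induction_on with
    | zero => simpa using h0
    | add x y hx hy => rw [tmul_add]; exact hadd _ _ hx hy
    | tmul m n => simpa using h (k ⊗ₜ m) (1 ⊗ₜ n)

theorem mapScalars_opL {f : Module.End K (K ⊗[ℂ] M)} {f' : Module.End K' (K' ⊗[ℂ] M)}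
    (h : ∀ z, mapScalars ρ M (f z) = f' (mapScalars ρ M z)) (z : K ⊗[ℂ] (M ⊗[ℂ] N)) :
    mapScalars ρ (M ⊗[ℂ] N) (opL f z) = opL f' (mapScalars ρ (M ⊗[ℂ] N) z) := by
  induction z using mapScalars_box_induction with
  | h0 => simp
  | hadd x y hx hy => simp only [map_add, hx, hy]
  | h y z => simp [mapScalars_boxMul, h]

theorem mapScalars_opR {f : Module.End K (K ⊗[ℂ] N)} {f' : Module.End K' (K' ⊗[ℂ] N)}
    (h : ∀ z, mapScalars ρ N (f z) = f' (mapScalars ρ N z)) (z : K ⊗[ℂ] (M ⊗[ℂ] N)) :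
    mapScalars ρ (M ⊗[ℂ] N) (opR f z) = opR f' (mapScalars ρ (M ⊗[ℂ] N) z) := by
  induction z using mapScalars_box_induction with
  | h0 => simp
  | hadd x y hx hy => simp only [map_add, hx, hy]
  | h y z => simp [mapScalars_boxMul, h]

theorem mapScalars_bOp (r m : ℤ) (z : K ⊗[ℂ] VacuumModule q ℓ) :
    mapScalars ρ _ (bOp q ℓ K r m z) = bOp q ℓ K' r m (mapScalars ρ _ z) := by
  induction z using TensorProduct.induction_on with
  | zero => simp
  | add x y hx hy => simp only [map_add, hx, hy]
  | tmul k m => simp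

theorem mapScalars_der (c : ℤ → ℤ → K) (v : VacuumModule q ℓ) :
    mapScalars ρ _ (der c v) = der (fun r m => ρ (c r m)) v := by
  rw [der, der, LinearMap.comp_apply, LinearMap.comp_apply]
  generalize grad q ℓ v = y
  induction y using Finsupp.induction_linear with
  | zero => simp
  | add f g hf hg => simp only [map_add, hf, hg]
  | single p v => simp

theorem mapScalars_derOp (c : ℤ → ℤ → K) (z : K ⊗[ℂ] VacuumModule q ℓ) :
    mapScalars ρ _ (derOp q ℓ c z) = derOp q ℓ (fun r m => ρ (c r m)) (mapScalars ρ _ z) := by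
  have h := mapScalars_liftBaseChange ρ (der (q := q) (ℓ := ℓ) c) z
  rw [derOp, ← h, derOp]
  congr 2
  ext v
  exact mapScalars_der ρ c v

theorem IsTwist.mapScalars {D : ℤ → ℤ → Module.End K (K ⊗[ℂ] N)}
    {D' : ℤ → ℤ → Module.End K' (K' ⊗[ℂ] N)}
    (hD : ∀ r m z, QVA.mapScalars ρ N (D r m z) = D' r m (QVA.mapScalars ρ N z))
    {A : N ⊗[ℂ] VacuumModule q ℓ →ₗ[ℂ] K ⊗[ℂ] (N ⊗[ℂ] VacuumModule q ℓ)}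
    (h : IsTwist D (A.liftBaseChange K)) :
    IsTwist D' ((QVA.mapScalars ρ _ ∘ₗ A).liftBaseChange K') where
  vac y := by
    refine LinearMap.congr_fun (baseChange_ext (F := (QVA.mapScalars ρ _ ∘ₗ A).liftBaseChange K' ∘ₗ
      boxMul.flip (1 ⊗ₜ QVA.vac q ℓ)) (G := boxMul.flip (1 ⊗ₜ QVA.vac q ℓ)) fun x => ?_) y
    have e := congrArg (QVA.mapScalars ρ _) (h.vac (1 ⊗ₜ x))
    rw [← mapScalars_liftBaseChange] at e
    simpa [mapScalars_boxMul] using e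
  beta r m := by
    refine baseChange_ext fun p => ?_
    have e := congrArg (QVA.mapScalars ρ _) (LinearMap.congr_fun (h.beta r m) (1 ⊗ₜ p))
    rw [Module.End.mul_apply, Module.End.mul_apply, LinearMap.add_apply, map_add,
      mapScalars_opL ρ (hD r m), mapScalars_opR ρ (mapScalars_bOp ρ r m),
      ← mapScalars_liftBaseChange, ← mapScalars_liftBaseChange,
      mapScalars_opR ρ (mapScalars_bOp ρ r m), mapScalars_tmul, map_one] at e
    exact e

end ChangeScalars

/-! ### The substitutions x, z and x + z as algebra homomorphisms. -/

section Substitutions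

/-- The Leibniz rule for divided derivatives is Vandermonde's identity on monomials. -/
theorem hasseDeriv_mul (k : ℕ) (f g : LaurentSeries ℂ) : LaurentSeries.hasseDeriv ℂ k (f * g) =
    ∑ p ∈ Finset.HasAntidiagonal.antidiagonal k,
      LaurentSeries.hasseDeriv ℂ p.1 f * LaurentSeries.hasseDeriv ℂ p.2 g := by
  ext N
  rw [HahnSeries.coeff_sum]
  have h : ∀ p ∈ Finset.HasAntidiagonal.antidiagonal k,
      (LaurentSeries.hasseDeriv ℂ p.1 f * LaurentSeries.hasseDeriv ℂ p.2 g).coeff N =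
      ∑ᶠ i : ℤ, (bc i p.1 * bc (N + k - i) p.2) * (f.coeff i * g.coeff (N + k - i)) := by
    intro p hp
    rw [Finset.HasAntidiagonal.mem_antidiagonal] at hp
    rw [laurent_mul_coeff, ← finsum_comp_equiv (Equiv.subRight (p.1 : ℤ))]
    refine finsum_congr fun i => ?_
    have e : N - (i - p.1) + p.2 = N + k - i := by rw [← hp]; push_cast; ring
    simp only [Equiv.subRight_apply, LaurentSeries.hasseDeriv_coeff, sub_add_cancel, e,
      zsmul_eq_mul, bc]
    ring
  have hfin : ∀ c : ℤ → ℂ, (Function.support fun i : ℤ =>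
      c i * (f.coeff i * g.coeff (N + k - i))).Finite := fun c =>
    (mulSeries_finite (LinearMap.mul ℂ ℂ) f g (N + k)).subset fun i hi h0 => hi (by
      simp only [LinearMap.mul_apply'] at h0
      simp [h0])
  rw [Finset.sum_congr rfl h, ← finsum_sum_comm _ _ fun p _ => hfin _,
    LaurentSeries.hasseDeriv_coeff, laurent_mul_coeff, zsmul_eq_mul, mul_finsum]
  · refine finsum_congr fun i => ?_
    rw [← Finset.sum_mul, ← bc_add, add_sub_cancel, bc]

theorem substXZ_coeff (f : LaurentSeries ℂ) (n : ℤ) : (substXZ f).coeff n =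
    if 0 ≤ n then LaurentSeries.hasseDeriv ℂ n.toNat f else 0 := rfl

theorem hasseDeriv_one (k : ℕ) :
    LaurentSeries.hasseDeriv ℂ k (1 : LaurentSeries ℂ) = if k = 0 then 1 else 0 := by
  have h : (1 : LaurentSeries ℂ) = HahnSeries.single 0 1 := rfl
  split_ifs with hk
  · rw [hk, LaurentSeries.hasseDeriv_zero]; rfl
  · rw [h, LaurentSeries.hasseDeriv_single, Ring.choose_zero_ite, if_neg hk, zero_smul, map_zero]

/-- The substitution `f(x) ↦ f(x + z)` is an algebra homomorphism. -/
def substXZHom : LaurentSeries ℂ →ₐ[ℂ] LaurentSeries (LaurentSeries ℂ) :=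
  AlgHom.ofLinearMap substXZ (by
    apply HahnSeries.ext
    funext n
    rw [substXZ_coeff, hasseDeriv_one, HahnSeries.coeff_one]
    by_cases h : 0 ≤ n
    · rw [if_pos h]
      by_cases h1 : n = 0
      · rw [if_pos (by omega), if_pos h1]
      · rw [if_neg (by omega), if_neg h1]
    · rw [if_neg h, if_neg (by omega)]) (by
    intro f g
    apply HahnSeries.ext
    funext n
    rw [substXZ_coeff, laurent_mul_coeff]
    split_ifs with hn
    · rw [hasseDeriv_mul, Finset.Nat.sum_antidiagonal_eq_sum_range_succ
        (fun a b => LaurentSeries.hasseDeriv ℂ a f * LaurentSeries.hasseDeriv ℂ b g),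
        finsum_eq_sum_of_support_subset (s := (Finset.range n.toNat.succ).map
          ⟨((↑) : ℕ → ℤ), Nat.cast_injective⟩), Finset.sum_map]
      · refine Finset.sum_congr rfl fun a ha => ?_
        rw [Finset.mem_range] at ha
        simp only [Function.Embedding.coeFn_mk, substXZ_coeff]
        have e : (n - (a : ℤ)).toNat = n.toNat - a := by omega
        rw [if_pos (by omega), if_pos (by omega), e, Int.toNat_natCast]
      · intro i hi
        simp only [substXZ_coeff, Function.mem_support, ne_eq] at hi
        simp only [Finset.coe_map, Function.Embedding.coeFn_mk, Set.mem_image, Finset.mem_coe,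
          Finset.mem_range]
        refine ⟨i.toNat, ?_, ?_⟩
        · by_contra h
          exact hi (by rw [if_neg (c := 0 ≤ n - i) (by omega), mul_zero])
        · by_contra h
          exact hi (by rw [if_neg (c := 0 ≤ i) (by omega), zero_mul])
    · rw [finsum_eq_zero_of_forall_eq_zero]
      intro i
      rw [substXZ_coeff, substXZ_coeff]
      by_cases hi : 0 ≤ i
      · rw [if_neg (c := 0 ≤ n - i) (by omega), mul_zero]
      · rw [if_neg hi, zero_mul])

/-- The inclusion `f(x) ↦ f(x)` is an algebra homomorphism. -/
def substXHom : LaurentSeries ℂ →ₐ[ℂ] LaurentSeries (LaurentSeries ℂ) :=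
  AlgHom.ofLinearMap substX rfl (fun f g => by
    change HahnSeries.C (f * g) = HahnSeries.C f * HahnSeries.C g
    exact map_mul _ _ _)

/-- The substitution `f(x) ↦ f(z)` is an algebra homomorphism. -/
def substZHom : LaurentSeries ℂ →ₐ[ℂ] LaurentSeries (LaurentSeries ℂ) :=
  AlgHom.ofLinearMap substZ (by
    apply HahnSeries.ext
    funext n
    change HahnSeries.C ((1 : LaurentSeries ℂ).coeff n) = _
    rw [HahnSeries.coeff_one, HahnSeries.coeff_one]
    split_ifs <;> simp) (fun f g => by
    apply HahnSeries.ext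
    funext n
    change HahnSeries.C ((f * g).coeff n) = _
    rw [laurent_mul_coeff, laurent_mul_coeff]
    change (HahnSeries.C : ℂ →+* LaurentSeries ℂ).toAddMonoidHom _ = _
    refine (AddMonoidHom.map_finsum _ (mulSeries_finite (LinearMap.mul ℂ ℂ) f g n)).trans ?_
    refine finsum_congr fun i => ?_
    exact map_mul (HahnSeries.C : ℂ →+* LaurentSeries ℂ) _ _)

end Substitutions

/-! ### Construction of 𝒮, the Yang-Baxter equation and unitarity. -/

section YangBaxter

open TensorProduct

/-- The multiplication of an algebra. -/
def algMul (K : Type*) [CommRing K] [Algebra ℂ K] : K →ₗ[ℂ] K →ₗ[ℂ] K := LinearMap.mul ℂ K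

theorem extendScalars_algMul {K : Type*} [CommRing K] [Algebra ℂ K] {M N : Type*}
    [AddCommGroup M] [Module ℂ M] [AddCommGroup N] [Module ℂ N] (A : M →ₗ[ℂ] K ⊗[ℂ] N)
    (z : K ⊗[ℂ] M) : extendScalars (algMul K) A z = A.liftBaseChange K z :=
  extendScalars_eq A z

section TwistMap

variable {q ℓ : ℂ} {K : Type*} [CommRing K] [Algebra ℂ K] {c : ℤ → ℤ → ℤ → ℤ → K}
  {S : VacuumModule q ℓ ⊗[ℂ] VacuumModule q ℓ →ₗ[ℂ] K ⊗[ℂ] (VacuumModule q ℓ ⊗[ℂ] VacuumModule q ℓ)}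

namespace IsTwist

/-- The three legs commute pairwise, as suggested by the exponential form; no relation between the
three coefficient systems is needed. -/
theorem yang_baxter {c₁₂ c₁₃ c₂₃ : ℤ → ℤ → ℤ → ℤ → K}
    {S₁₂ S₁₃ S₂₃ : VacuumModule q ℓ ⊗[ℂ] VacuumModule q ℓ →ₗ[ℂ]
      K ⊗[ℂ] (VacuumModule q ℓ ⊗[ℂ] VacuumModule q ℓ)}
    (h₁₂ : IsTwist (fun r m => derOp q ℓ (c₁₂ r m)) (S₁₂.liftBaseChange K))
    (h₁₃ : IsTwist (fun r m => derOp q ℓ (c₁₃ r m)) (S₁₃.liftBaseChange K))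
    (h₂₃ : IsTwist (fun r m => derOp q ℓ (c₂₃ r m)) (S₂₃.liftBaseChange K))
    (hc₁₂ : ∀ r m s n, 0 ≤ n → c₁₂ r m s n = 0) (hc₁₃ : ∀ r m s n, 0 ≤ n → c₁₃ r m s n = 0)
    (hc₂₃ : ∀ r m s n, 0 ≤ n → c₂₃ r m s n = 0) :
    extendScalars (algMul K) (leg12 S₁₂) ∘ₗ extendScalars (algMul K) (leg13 S₁₃) ∘ₗ leg23 S₂₃ =
      extendScalars (algMul K) (leg23 S₂₃) ∘ₗ extendScalars (algMul K) (leg13 S₁₃) ∘ₗ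
        leg12 S₁₂ := by
  have h13 := h₁₃.rightComm (M := VacuumModule q ℓ)
  have h23 := h₂₃.assoc (M := VacuumModule q ℓ)
  rw [← liftBaseChange_leg13] at h13
  rw [← liftBaseChange_leg23] at h23
  set X12 := S₁₂.liftBaseChange K
  set X13 := (leg13 S₁₃).liftBaseChange K
  set X23 := (leg23 S₂₃).liftBaseChange K
  -- Both products are twists over the last factor with the same total shift.
  have c1 : X13 * X23 = X23 * X13 := by
    refine (h13.mul h23 fun r m s n => (opL_opR_comm _ _).symm).unique ?_
    rw [add_comm]
    exact h23.mul h13 fun r m s n => opL_opR_comm _ _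
  -- A twist commutes with derivations on either of its factors, so leg 12 commutes with the shifts
  -- of legs 13 and 23.
  have c2 : X13 * opL X12 = opL X12 * X13 := h13.comm_opL _ fun r m =>
    h₁₂.comm_opL (derOp q ℓ (c₁₃ r m)) fun r' m' => derOp_comm _ _ (hc₁₃ _ _) (hc₁₂ _ _)
  have c3 : X23 * opL X12 = opL X12 * X23 := h23.comm_opL _ fun r m =>
    h₁₂.comm_opR_derOp _ (hc₂₃ _ _)
  have e : opL X12 * (X13 * X23) = X23 * (X13 * opL X12) := by
    rw [c2, ← mul_assoc X23, c3, c1, mul_assoc]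
  have e12 : opL X12 = (leg12 S₁₂).liftBaseChange K := (liftBaseChange_leg12 _).symm
  rw [e12] at e
  refine LinearMap.ext fun p => ?_
  simp only [LinearMap.comp_apply, extendScalars_algMul]
  have e' := LinearMap.congr_fun e (1 ⊗ₜ p)
  simp only [Module.End.mul_apply, X13, X23, LinearMap.liftBaseChange_tmul, one_smul] at e'
  exact e'

/-- Derivations kill the vacuum, so with the vacuum in the first slot the shifts have no effect. -/
theorem vac_boxMul (h : IsTwist (fun r m => derOp q ℓ (c r m)) (S.liftBaseChange K))
    (y : K ⊗[ℂ] VacuumModule q ℓ) :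
    S.liftBaseChange K (boxMul (1 ⊗ₜ QVA.vac q ℓ) y) = boxMul (1 ⊗ₜ QVA.vac q ℓ) y := by
  refine LinearMap.congr_fun (vacuum_baseChange_ext
    (F := S.liftBaseChange K ∘ₗ boxMul ((1 : K) ⊗ₜ QVA.vac q ℓ))
    (G := boxMul ((1 : K) ⊗ₜ QVA.vac q ℓ))
    (fun r m => opR (bOp q ℓ _ r m) + opL (derOp q ℓ (c r m))) ?_ fun r m => ?_) y
  · exact h.vac (1 ⊗ₜ QVA.vac q ℓ)
  · refine LinearMap.ext fun z => ?_
    have e := LinearMap.congr_fun (h.beta r m) (boxMul (1 ⊗ₜ QVA.vac q ℓ) z)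
    simp only [Module.End.mul_apply, opR_boxMul] at e
    simp [e, derOp_vac]

theorem vac_left (h : IsTwist (fun r m => derOp q ℓ (c r m)) (S.liftBaseChange K))
    (v : VacuumModule q ℓ) : S (QVA.vac q ℓ ⊗ₜ v) = 1 ⊗ₜ (QVA.vac q ℓ ⊗ₜ v) := by
  simpa using h.vac_boxMul (1 ⊗ₜ v)

theorem vac_right {D : ℤ → ℤ → Module.End K (K ⊗[ℂ] VacuumModule q ℓ)}
    (h : IsTwist D (S.liftBaseChange K)) (v : VacuumModule q ℓ) :
    S (v ⊗ₜ QVA.vac q ℓ) = 1 ⊗ₜ (v ⊗ₜ QVA.vac q ℓ) := by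
  simpa using h.vac (1 ⊗ₜ v)

theorem beta_right {D : ℤ → ℤ → Module.End K (K ⊗[ℂ] VacuumModule q ℓ)}
    (h : IsTwist D (S.liftBaseChange K)) (r m : ℤ)
    (u v : VacuumModule q ℓ) : S (u ⊗ₜ ⁅QVA.beta q r m, v⁆) =
      opR (bOp q ℓ K r m) (S (u ⊗ₜ v)) + opL (D r m) (S (u ⊗ₜ v)) := by
  have e := LinearMap.congr_fun (h.beta r m) (boxMul (1 ⊗ₜ u) (1 ⊗ₜ v))
  simp only [Module.End.mul_apply, opR_boxMul] at e
  simpa using e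

theorem beta_left (h : IsTwist (fun r m => derOp q ℓ (c r m)) (S.liftBaseChange K))
    (hc : ∀ r m s n, 0 ≤ n → c r m s n = 0) (hc' : ∀ r m s n, 0 ≤ m → c r m s n = 0) (s n : ℤ)
    (u v : VacuumModule q ℓ) : S (⁅QVA.beta q s n, u⁆ ⊗ₜ v) =
      opL (bOp q ℓ K s n) (S (u ⊗ₜ v)) +
        opR (derOp q ℓ (fun r m => c r m s n)) (S (u ⊗ₜ v)) := by
  have e := LinearMap.congr_fun (h.comm_opL_bOp hc hc' s n) (boxMul (1 ⊗ₜ u) (1 ⊗ₜ v))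
  simp only [Module.End.mul_apply, opL_boxMul] at e
  simpa using e

theorem flip (h : IsTwist (fun r m => derOp q ℓ (c r m)) (S.liftBaseChange K))
    (hc : ∀ r m s n, 0 ≤ n → c r m s n = 0) (hc' : ∀ r m s n, 0 ≤ m → c r m s n = 0) :
    IsTwist (fun r m => derOp q ℓ (fun s n => c s n r m))
      (((TensorProduct.comm ℂ (VacuumModule q ℓ) (VacuumModule q ℓ)).toLinearMap.lTensor K ∘ₗ S ∘ₗ
        (TensorProduct.comm ℂ (VacuumModule q ℓ) (VacuumModule q ℓ)).toLinearMap).liftBaseChange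
          K) := by
  rw [liftBaseChange_flip]
  refine ⟨fun y => ?_, fun r m => ?_⟩
  · rw [LinearMap.comp_apply, LinearMap.comp_apply, boxComm_boxMul, h.vac_boxMul, boxComm_boxMul]
  · refine box_ext fun y z => ?_
    have e := LinearMap.congr_fun (h.comm_opL_bOp hc hc' r m) (boxMul z y)
    simp only [Module.End.mul_apply, opL_boxMul] at e
    simp only [Module.End.mul_apply, LinearMap.comp_apply, opR_boxMul, boxComm_boxMul]
    refine (congrArg boxComm e).trans ?_
    generalize (S.liftBaseChange K) (boxMul z y) = p
    refine LinearMap.congr_fun (box_ext (F := boxComm ∘ₗ (opL (bOp q ℓ K r m) +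
      opR (derOp q ℓ (fun s n => c s n r m))))
      (G := (opR (bOp q ℓ K r m) + opL (derOp q ℓ (fun s n => c s n r m))) ∘ₗ boxComm)
      fun y z => ?_) p
    simp

/-- The flipped operator is a twist with transposed coefficients; by `hρ` the total shift of the
product is zero, which is also the shift of the identity. -/
theorem unitary (h : IsTwist (fun r m => derOp q ℓ (c r m)) (S.liftBaseChange K))
    (ρ : K →ₐ[ℂ] K) (hρ : ∀ r m s n, c r m s n + ρ (c s n r m) = 0)
    (hc : ∀ r m s n, 0 ≤ n → c r m s n = 0) (hc' : ∀ r m s n, 0 ≤ m → c r m s n = 0)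
    (p : VacuumModule q ℓ ⊗[ℂ] VacuumModule q ℓ) :
    S.liftBaseChange K (QVA.mapScalars ρ _
      ((TensorProduct.comm ℂ (VacuumModule q ℓ) (VacuumModule q ℓ)).toLinearMap.lTensor K
        (S ((TensorProduct.comm ℂ (VacuumModule q ℓ) (VacuumModule q ℓ)) p)))) = 1 ⊗ₜ p := by
  have hT := (h.flip hc hc').mapScalars ρ (fun r m z => mapScalars_derOp ρ _ z)
  have hXT := h.mul hT fun r m s n => derOp_comm _ _
    (fun s n hn => by rw [hc' _ _ _ _ hn, map_zero]) (fun s n hn => hc _ _ _ _ hn)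
  have h1 := hXT.unique (X' := 1) (by
    convert IsTwist.one (q := q) (ℓ := ℓ) using 1
    funext r m
    rw [Pi.add_apply, Pi.add_apply, ← derOp_add, Pi.zero_apply, Pi.zero_apply, ← derOp_zero]
    congr 1
    funext s n
    exact hρ r m s n)
  have e := LinearMap.congr_fun h1 (1 ⊗ₜ p)
  simp only [Module.End.mul_apply, LinearMap.liftBaseChange_tmul, one_smul] at e
  exact e

end IsTwist

end TwistMap

theorem exists_isTwist_liftBaseChange {q ℓ : ℂ} {K : Type*} [CommRing K] [Algebra ℂ K]
    (c : ℤ → ℤ → ℤ → ℤ → K) (hc : ∀ r m s n, 0 ≤ n → c r m s n = 0)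
    (hc' : ∀ r m s n, 0 ≤ m → c r m s n = 0) :
    ∃ S : VacuumModule q ℓ ⊗[ℂ] VacuumModule q ℓ →ₗ[ℂ]
      K ⊗[ℂ] (VacuumModule q ℓ ⊗[ℂ] VacuumModule q ℓ),
      IsTwist (fun r m => derOp q ℓ (c r m)) (S.liftBaseChange K) := by
  obtain ⟨X, hX⟩ := exists_isTwist (q := q) (ℓ := ℓ) (fun r m => derOp q ℓ (c r m))
    (fun r s m n => derOp_comm _ _ (hc r m) (hc s n))
    (fun r m hm => by
      rw [show c r m = 0 from funext fun s => funext fun n => hc' _ _ _ _ hm, derOp_zero])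
  refine ⟨X.restrictScalars ℂ ∘ₗ TensorProduct.mk ℂ _ _ 1, ?_⟩
  convert hX
  refine baseChange_ext fun p => ?_
  simp

theorem mulX_eq : mulX = algMul (LaurentSeries ℂ) :=
  LinearMap.ext fun f => LinearMap.ext fun g => mulSeries_mul f g

theorem mulXZ_eq : mulXZ = algMul (LaurentSeries (LaurentSeries ℂ)) := by
  refine LinearMap.ext fun f => LinearMap.ext fun g => ?_
  rw [mulXZ, mulX_eq]
  exact mulSeries_mul f g

theorem exists_Sop (q ℓ : ℂ) : ∃ S : VacuumModule q ℓ ⊗[ℂ] VacuumModule q ℓ →ₗ[ℂ]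
    LaurentSeries ℂ ⊗[ℂ] (VacuumModule q ℓ ⊗[ℂ] VacuumModule q ℓ),
    IsTwist (fun r m => derOp q ℓ (kappa q ℓ r m)) (S.liftBaseChange (LaurentSeries ℂ)) :=
  exists_isTwist_liftBaseChange _ (fun _ _ _ _ h => kappa_of_nonneg_right _ _ _ _ h)
    (fun _ _ _ _ h => kappa_of_nonneg_left _ _ _ _ h)

/-- The quantum Yang-Baxter operator on the vacuum module. -/
def Sop (q ℓ : ℂ) : VacuumModule q ℓ ⊗[ℂ] VacuumModule q ℓ →ₗ[ℂ]
    LaurentSeries ℂ ⊗[ℂ] (VacuumModule q ℓ ⊗[ℂ] VacuumModule q ℓ) :=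
  Classical.choose (exists_Sop q ℓ)

variable {q ℓ : ℂ}

theorem isTwist_Sop : IsTwist (fun r m => derOp q ℓ (kappa q ℓ r m))
    ((Sop q ℓ).liftBaseChange (LaurentSeries ℂ)) :=
  Classical.choose_spec (exists_Sop q ℓ)

theorem isTwist_Sop_mapScalars {K : Type*} [CommRing K] [Algebra ℂ K]
    (ρ : LaurentSeries ℂ →ₐ[ℂ] K) :
    IsTwist (fun r m => derOp q ℓ (fun s n => ρ (kappa q ℓ r m s n)))
      ((mapScalars ρ _ ∘ₗ Sop q ℓ).liftBaseChange K) :=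
  isTwist_Sop.mapScalars ρ fun _ _ z => mapScalars_derOp ρ _ z

theorem changeScalars_substX {V : Type*} [AddCommGroup V] [Module ℂ V]
    (S : V ⊗[ℂ] V →ₗ[ℂ] LaurentSeries ℂ ⊗[ℂ] (V ⊗[ℂ] V)) :
    changeScalars substX S =
      mapScalars (K' := LaurentSeries (LaurentSeries ℂ)) substXHom (V ⊗[ℂ] V) ∘ₗ S := rfl

theorem changeScalars_substZ {V : Type*} [AddCommGroup V] [Module ℂ V]
    (S : V ⊗[ℂ] V →ₗ[ℂ] LaurentSeries ℂ ⊗[ℂ] (V ⊗[ℂ] V)) :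
    changeScalars substZ S =
      mapScalars (K' := LaurentSeries (LaurentSeries ℂ)) substZHom (V ⊗[ℂ] V) ∘ₗ S := rfl

theorem changeScalars_substXZ {V : Type*} [AddCommGroup V] [Module ℂ V]
    (S : V ⊗[ℂ] V →ₗ[ℂ] LaurentSeries ℂ ⊗[ℂ] (V ⊗[ℂ] V)) :
    changeScalars substXZ S =
      mapScalars (K' := LaurentSeries (LaurentSeries ℂ)) substXZHom (V ⊗[ℂ] V) ∘ₗ S := rfl

set_option maxHeartbeats 1000000 in
theorem isYangBaxter_Sop : IsYangBaxter (Sop q ℓ) := by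
  have hr : ∀ (ρ : LaurentSeries ℂ →ₐ[ℂ] LaurentSeries (LaurentSeries ℂ)) r m s n, 0 ≤ n →
      ρ (kappa q ℓ r m s n) = 0 := by
    intro ρ r m s n hn
    rw [kappa_of_nonneg_right _ _ _ _ hn, map_zero]
  have h1 := (isTwist_Sop_mapScalars (q := q) (ℓ := ℓ) (K := LaurentSeries (LaurentSeries ℂ)) substXHom)
  have h2 := (isTwist_Sop_mapScalars (q := q) (ℓ := ℓ) (K := LaurentSeries (LaurentSeries ℂ)) substXZHom)
  have h3 := (isTwist_Sop_mapScalars (q := q) (ℓ := ℓ) (K := LaurentSeries (LaurentSeries ℂ)) substZHom)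
  have h := IsTwist.yang_baxter h1 h2 h3 (hr _) (hr _) (hr _)
  rw [IsYangBaxter, mulXZ_eq, changeScalars_substX, changeScalars_substZ, changeScalars_substXZ]
  exact h

theorem Sop_vac (v : VacuumModule q ℓ) : Sop q ℓ (vac q ℓ ⊗ₜ v) = 1 ⊗ₜ (vac q ℓ ⊗ₜ v) :=
  isTwist_Sop.vac_left v

theorem Sop_vac_right (v : VacuumModule q ℓ) : Sop q ℓ (v ⊗ₜ vac q ℓ) = 1 ⊗ₜ (v ⊗ₜ vac q ℓ) :=
  isTwist_Sop.vac_right v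

theorem isUnitary_Sop (hq0 : q ≠ 0) : IsUnitary (Sop q ℓ) := by
  intro p
  rw [mulX_eq, extendScalars_algMul]
  exact isTwist_Sop.unitary negXHom (kappa_unitary hq0)
    (fun r m s n hn => kappa_of_nonneg_right _ _ _ _ hn)
    (fun r m s n hn => kappa_of_nonneg_left _ _ _ _ hn) p

end YangBaxter

end QVA

namespace QVA

attribute [local instance] laurentAlgebra

/-! ### Compatibility of 𝒮 with 𝒟. -/

section Derivative

open TensorProduct

variable {q ℓ : ℂ} {K : Type*} [CommRing K] [Algebra ℂ K] {M N : Type*} [AddCommGroup M]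
  [Module ℂ M] [AddCommGroup N] [Module ℂ N]

/-- Since [𝒟, β_n] = -n β_{n-1}, the commutator of 𝒟 with a derivation is again a derivation, with
value n c_{n-1} on β_n. -/
theorem vacD_der (c : ℤ → ℤ → K) (hc : ∀ s n, 0 ≤ n → c s n = 0) (v : VacuumModule q ℓ) :
    (vacD q ℓ).baseChange K (der c v) =
      der c (vacD q ℓ v) + der (fun s n => (n : ℂ) • c s (n - 1)) v := by
  -- At n = 0 the coefficient c_{-1} may be nonzero; the factor n removes it.
  have hc' : ∀ s n : ℤ, 0 ≤ n → (n : ℂ) • c s (n - 1) = 0 := by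
    intro s n hn
    rcases hn.eq_or_lt with rfl | hn
    · simp
    · rw [hc _ _ (by omega), smul_zero]
  have hD : ∀ (r m : ℤ) (z : K ⊗[ℂ] VacuumModule q ℓ),
      (vacD q ℓ).baseChange K (bOp q ℓ K r m z) =
        bOp q ℓ K r m ((vacD q ℓ).baseChange K z) - (m : ℂ) • bOp q ℓ K r (m - 1) z := by
    intro r m z
    induction z using TensorProduct.induction_on with
    | zero => simp
    | add x y hx hy => simp only [map_add, hx, hy, smul_add]; abel
    | tmul k v => simp [vacD_beta, tmul_sub, tmul_smul]
  induction v using vacuum_induction with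
  | h0 => simp [der_vac, vacD_vac]
  | hβ r m v hv =>
    simp only [vacD_beta, der_beta c hc, der_beta _ hc', map_add, map_sub, map_smul, hD, hv,
      LinearMap.baseChange_tmul, smul_tmul', smul_add]
    abel
  | hadd u v hu hv => simp only [map_add, hu, hv]; abel
  | hsmul a v hv =>
    simp only [map_smul]
    rw [← smul_add, ← hv, ← algebraMap_smul K a (der c v), map_smul, algebraMap_smul]

variable {δ : K →ₗ[ℂ] K}

theorem rTensor_smul_of_leibniz (hδ : ∀ a b, δ (a * b) = δ a * b + a * δ b) (k : K)
    (z : K ⊗[ℂ] M) : δ.rTensor M (k • z) = δ k • z + k • δ.rTensor M z := by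
  induction z using TensorProduct.induction_on with
  | zero => simp
  | add x y hx hy => simp only [smul_add, map_add, hx, hy]; abel
  | tmul k' m => simp [smul_tmul', hδ, add_tmul]

theorem rTensor_der (c : ℤ → ℤ → K) (v : VacuumModule q ℓ) :
    δ.rTensor _ (der c v) = der (fun r m => δ (c r m)) v := by
  rw [der, der, LinearMap.comp_apply, LinearMap.comp_apply]
  generalize grad q ℓ v = y
  induction y using Finsupp.induction_linear with
  | zero => simp
  | add f g hf hg => simp only [map_add, hf, hg]
  | single p v => simp

theorem rTensor_boxMul_right (y : K ⊗[ℂ] M) (n : N) :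
    δ.rTensor (M ⊗[ℂ] N) (boxMul y (1 ⊗ₜ n)) = boxMul (δ.rTensor M y) (1 ⊗ₜ n) := by
  induction y using TensorProduct.induction_on with
  | zero => simp
  | add x y hx hy => simp only [map_add, LinearMap.add_apply, hx, hy]
  | tmul k m => simp

theorem rTensor_opR_bOp (r m : ℤ) (z : K ⊗[ℂ] (M ⊗[ℂ] VacuumModule q ℓ)) :
    δ.rTensor _ (opR (bOp q ℓ K r m) z) = opR (bOp q ℓ K r m) (δ.rTensor _ z) := by
  induction z using TensorProduct.induction_on with
  | zero => simp
  | add x y hx hy => simp only [map_add, hx, hy]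
  | tmul k p =>
    induction p using TensorProduct.induction_on with
    | zero => simp
    | add x y hx hy => simp only [tmul_add, map_add, hx, hy]
    | tmul u v =>
      have h : ∀ k : K, k ⊗ₜ[ℂ] (u ⊗ₜ[ℂ] v) = boxMul (k ⊗ₜ u) (1 ⊗ₜ v) := by simp
      rw [LinearMap.rTensor_tmul, h, h, opR_boxMul, opR_boxMul]
      simp

theorem rTensor_opL_derOp (hδ : ∀ a b, δ (a * b) = δ a * b + a * δ b) (c : ℤ → ℤ → K)
    (z : K ⊗[ℂ] (VacuumModule q ℓ ⊗[ℂ] N)) :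
    δ.rTensor _ (opL (derOp q ℓ c) z) = opL (derOp q ℓ c) (δ.rTensor _ z) +
      opL (derOp q ℓ (fun r m => δ (c r m))) z := by
  induction z using TensorProduct.induction_on with
  | zero => simp
  | add x y hx hy => simp only [map_add, hx, hy]; abel
  | tmul k p =>
    induction p using TensorProduct.induction_on with
    | zero => simp
    | add x y hx hy => simp only [tmul_add, map_add, hx, hy]; abel
    | tmul u v =>
      have h : ∀ k : K, k ⊗ₜ[ℂ] (u ⊗ₜ[ℂ] v) = boxMul (k ⊗ₜ u) (1 ⊗ₜ v) := by simp
      have h' : ∀ (c : ℤ → ℤ → K) (k : K), derOp q ℓ c (k ⊗ₜ u) = k • der c u := by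
        intro c k
        rw [← derOp_tmul, ← map_smul, smul_tmul', smul_eq_mul, mul_one]
      rw [LinearMap.rTensor_tmul, h, h, opL_boxMul, opL_boxMul, opL_boxMul, rTensor_boxMul_right,
        h', h', h', rTensor_smul_of_leibniz hδ, rTensor_der, map_add,
        LinearMap.add_apply]

theorem vacD_opR_bOp (r m : ℤ) (z : K ⊗[ℂ] (VacuumModule q ℓ ⊗[ℂ] VacuumModule q ℓ)) :
    ((vacD q ℓ).rTensor (VacuumModule q ℓ)).lTensor K (opR (bOp q ℓ K r m) z) =
      opR (bOp q ℓ K r m) (((vacD q ℓ).rTensor (VacuumModule q ℓ)).lTensor K z) := by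
  induction z using TensorProduct.induction_on with
  | zero => simp
  | add x y hx hy => simp only [map_add, hx, hy]
  | tmul k p =>
    induction p using TensorProduct.induction_on with
    | zero => simp
    | add x y hx hy => simp only [tmul_add, map_add, hx, hy]
    | tmul u v =>
      have h : ∀ u v : VacuumModule q ℓ, k ⊗ₜ[ℂ] (u ⊗ₜ[ℂ] v) = boxMul (k ⊗ₜ u) (1 ⊗ₜ v) := by simp
      rw [LinearMap.lTensor_tmul, LinearMap.rTensor_tmul, h, h, opR_boxMul, opR_boxMul]
      simp

theorem lTensor_rTensor_boxMul (T : M →ₗ[ℂ] M) (y : K ⊗[ℂ] M) (n : N) :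
    (T.rTensor N).lTensor K (boxMul y (1 ⊗ₜ n)) = boxMul (T.baseChange K y) (1 ⊗ₜ n) := by
  induction y using TensorProduct.induction_on with
  | zero => simp
  | add x y hx hy => simp only [map_add, LinearMap.add_apply, hx, hy]
  | tmul k m => simp

theorem vacD_opL_derOp (c : ℤ → ℤ → K) (hc : ∀ s n, 0 ≤ n → c s n = 0)
    (z : K ⊗[ℂ] (VacuumModule q ℓ ⊗[ℂ] N)) :
    ((vacD q ℓ).rTensor N).lTensor K (opL (derOp q ℓ c) z) =
      opL (derOp q ℓ c) (((vacD q ℓ).rTensor N).lTensor K z) +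
        opL (derOp q ℓ (fun s n => (n : ℂ) • c s (n - 1))) z := by
  induction z using TensorProduct.induction_on with
  | zero => simp
  | add x y hx hy => simp only [map_add, hx, hy]; abel
  | tmul k p =>
    induction p using TensorProduct.induction_on with
    | zero => simp
    | add x y hx hy => simp only [tmul_add, map_add, hx, hy]; abel
    | tmul u v =>
      have h : ∀ u : VacuumModule q ℓ, k ⊗ₜ[ℂ] (u ⊗ₜ[ℂ] v) = boxMul (k ⊗ₜ u) (1 ⊗ₜ v) := by simp
      have h' : ∀ (c : ℤ → ℤ → K) (u : VacuumModule q ℓ), derOp q ℓ c (k ⊗ₜ u) = k • der c u := by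
        intro c u
        rw [← derOp_tmul, ← map_smul, smul_tmul', smul_eq_mul, mul_one]
      rw [LinearMap.lTensor_tmul, LinearMap.rTensor_tmul, h, h, opL_boxMul, opL_boxMul,
        opL_boxMul, lTensor_rTensor_boxMul, h', h', h', map_smul, vacD_der c hc, smul_add, map_add,
        LinearMap.add_apply]

/-- By induction on v: commuting 𝒟 ⊗ 1 past the shift produces the coefficients n c_{n-1}, and
differentiating the scalars produces their negatives. -/
theorem IsTwist.derivative {c : ℤ → ℤ → ℤ → ℤ → K}
    {S : VacuumModule q ℓ ⊗[ℂ] VacuumModule q ℓ →ₗ[ℂ]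
      K ⊗[ℂ] (VacuumModule q ℓ ⊗[ℂ] VacuumModule q ℓ)}
    (h : IsTwist (fun r m => derOp q ℓ (c r m)) (S.liftBaseChange K))
    (hc : ∀ r m s n, 0 ≤ n → c r m s n = 0) (hδ : ∀ a b, δ (a * b) = δ a * b + a * δ b)
    (hδc : ∀ r m s n, δ (c r m s n) = -((n : ℂ) • c r m s (n - 1)))
    (p : VacuumModule q ℓ ⊗[ℂ] VacuumModule q ℓ) :
    ((vacD q ℓ).rTensor (VacuumModule q ℓ)).lTensor K (S p) + δ.rTensor _ (S p) =
      S ((vacD q ℓ).rTensor (VacuumModule q ℓ) p) := by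
  have h1 : δ 1 = 0 := by simpa using hδ 1 1
  induction p using TensorProduct.induction_on with
  | zero => simp
  | add x y hx hy => simp only [map_add, ← hx, ← hy]; abel
  | tmul u v =>
    rw [LinearMap.rTensor_tmul]
    induction v using vacuum_induction with
    | h0 => rw [h.vac_right, h.vac_right]; simp [h1]
    | hβ r m v hv =>
      rw [h.beta_right, h.beta_right, ← hv]
      simp only [map_add, vacD_opR_bOp, vacD_opL_derOp _ (hc r m), rTensor_opR_bOp,
        rTensor_opL_derOp hδ, hδc]
      have : opL (derOp q ℓ fun s n => -((n : ℂ) • c r m s (n - 1))) (S (u ⊗ₜ[ℂ] v)) +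
          opL (derOp q ℓ fun s n => (n : ℂ) • c r m s (n - 1)) (S (u ⊗ₜ[ℂ] v)) = 0 := by
        rw [← LinearMap.add_apply, ← opL_add, ← derOp_add, show ((fun (s n : ℤ) =>
          -((n : ℂ) • c r m s (n - 1))) + fun (s n : ℤ) => (n : ℂ) • c r m s (n - 1)) = 0 by ext; simp,
          derOp_zero, opL_zero, LinearMap.zero_apply]
      rw [← eq_neg_iff_add_eq_zero] at this
      rw [this]
      abel
    | hadd v w hv hw => simp only [tmul_add, map_add, ← hv, ← hw]; abel
    | hsmul a v hv => simp only [tmul_smul, map_smul, ← hv, smul_add]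

end Derivative

theorem derivative_Sop {q ℓ : ℂ} (p : VacuumModule q ℓ ⊗[ℂ] VacuumModule q ℓ) :
    ((vacD q ℓ).rTensor (VacuumModule q ℓ)).lTensor (LaurentSeries ℂ) (Sop q ℓ p) -
        Sop q ℓ ((vacD q ℓ).rTensor (VacuumModule q ℓ) p) =
      -(LaurentSeries.derivative ℂ).rTensor (VacuumModule q ℓ ⊗[ℂ] VacuumModule q ℓ) (Sop q ℓ p) := by
  have h := isTwist_Sop.derivative (q := q) (ℓ := ℓ) (δ := LaurentSeries.derivative ℂ)
    (fun _ _ _ _ h => kappa_of_nonneg_right _ _ _ _ h)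
    (fun f g => by
      rw [LaurentSeries.derivative_apply, hasseDeriv_mul, Finset.Nat.antidiagonal_succ,
        Finset.sum_cons]
      simp [LaurentSeries.hasseDeriv_zero, add_comm])
    (fun r m s n => by
      rw [LaurentSeries.derivative_apply, hasseDeriv_kappa]
      simp only [pow_one, neg_mul, one_mul, bc, Ring.choose_one_right, Nat.cast_one]
      exact neg_smul (n : ℂ) (kappa q ℓ r m s (n - 1))) p
  rw [← h]
  abel

end QVA

namespace QVA

attribute [local instance] laurentAlgebra

/-! ### The commutator of β_m with vertex operators. -/

section Commutator

open TensorProduct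

variable {q ℓ : ℂ}

theorem mapCoeff_leftMode {W : Type*} [AddCommGroup W] [Module ℂ W] (β : ℤ → Module.End ℂ W)
    (T : Module.End ℂ W) (a : ℤ → ℂ) (hT : ∀ n w, T (β n w) = β n (T w) + a n • w) (n : ℤ)
    (g : LaurentSeries W) :
    mapCoeff T (leftMode β n g) = leftMode β n (mapCoeff T g) +
      fmul (powSer fun k => (-1) ^ k * bc n k * a (n - k)) g := by
  ext N
  rw [mapCoeff_coeff, leftMode_coeff, HahnSeries.coeff_add, leftMode_coeff, fmul,
    serAct_powSer_coeff]
  obtain ⟨J, hJ⟩ := exists_coeff_eq_zero g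
  have h0 : ∀ k : ℕ, (N - J).toNat + 1 ≤ k → g.coeff (N - k) = 0 := fun k hk => hJ _ (by omega)
  rw [finsum_nat_eq_sum_range (N := (N - J).toNat + 1),
    finsum_nat_eq_sum_range (N := (N - J).toNat + 1),
    finsum_nat_eq_sum_range (N := (N - J).toNat + 1), map_sum, ← Finset.sum_add_distrib]
  · refine Finset.sum_congr rfl fun k _ => ?_
    rw [map_smul, hT, smul_add, smul_smul]
    rfl
  · intro k hk
    rw [h0 k hk, map_zero]
  · intro k hk
    rw [mapCoeff_coeff, h0 k hk, map_zero, map_zero, smul_zero]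
  · intro k hk
    rw [h0 k hk, map_zero, smul_zero]

theorem laurent_zero_smul (f : LaurentSeries ℂ) : (0 : ℂ) • f = 0 := zero_smul ℂ f

/-- The commutator of `T` with fields. -/
def adField {W : Type*} [AddCommGroup W] [Module ℂ W] (T : Module.End ℂ W) :
    Module.End ℂ (W →ₗ[ℂ] LaurentSeries W) :=
  LinearMap.llcomp ℂ W _ _ (mapCoeff T) - LinearMap.lcomp ℂ _ T

theorem adField_apply {W : Type*} [AddCommGroup W] [Module ℂ W] (T : Module.End ℂ W)
    (φ : W →ₗ[ℂ] LaurentSeries W) (w : W) : adField T φ w = mapCoeff T (φ w) - φ (T w) := rfl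

/-- Multiplication of fields by scalar series. -/
def fieldMul {W : Type*} [AddCommGroup W] [Module ℂ W] (f : LaurentSeries ℂ) :
    Module.End ℂ (W →ₗ[ℂ] LaurentSeries W) :=
  LinearMap.llcomp ℂ W _ _ (fmul f)

theorem fieldMul_apply {W : Type*} [AddCommGroup W] [Module ℂ W] (f : LaurentSeries ℂ)
    (φ : W →ₗ[ℂ] LaurentSeries W) (w : W) : fieldMul f φ w = fmul f (φ w) := rfl

/-- Commuting T past the β in a field mode leaves scalars; they assemble into one scalar series, the
difference of the two expansions of (x₁ - x)ⁿ paired with a. -/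
theorem adField_fieldMode {W : Type*} [AddCommGroup W] [Module ℂ W] {β : ℤ → Module.End ℂ W}
    (hβ : Restricted β) (T : Module.End ℂ W) (a : ℤ → ℂ)
    (hT : ∀ n w, T (β n w) = β n (T w) + a n • w) (ha : (Function.support fun j : ℕ => a j).Finite)
    (n : ℤ) (φ : W →ₗ[ℂ] LaurentSeries W) :
    adField T (fieldMode hβ n φ) = fieldMode hβ n (adField T φ) +
      fieldMul ((powSer fun k => (-1) ^ k * bc n k * a (n - k)) -
        ∑ᶠ j : ℕ, a j • rightCoeff n j) φ := by
  have hT' : ∀ j w, φ (β j (T w)) = φ (T (β j w)) - a j • φ w := by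
    intro j w
    rw [hT, map_add, map_smul, add_sub_cancel_right]
  ext w : 1
  have hfin : (Function.support fun j : ℕ => a j • rightCoeff n j).Finite :=
    ha.subset fun j hj h0 => hj (by
      simp only at h0 ⊢
      rw [h0, laurent_zero_smul])
  have e1 : mapCoeff T (∑ᶠ j : ℕ, fmul (rightCoeff n j) (φ (β j w))) =
      ∑ᶠ j : ℕ, fmul (rightCoeff n j) (mapCoeff T (φ (β j w))) := by
    rw [map_finsum _ (rightMode_finite hβ n φ w)]
    simp only [mapCoeff_fmul]
  have e2 : fmul (∑ᶠ j : ℕ, a j • rightCoeff n j) (φ w) =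
      ∑ᶠ j : ℕ, fmul (rightCoeff n j) (a j • φ w) := by
    let Φ : LaurentSeries ℂ →+ LaurentSeries W :=
      { toFun := fun f => fmul f (φ w), map_zero' := by simp, map_add' := by simp }
    refine (AddMonoidHom.map_finsum Φ hfin).trans (finsum_congr fun j => ?_)
    simp [Φ]
  have e3 : ∑ᶠ j : ℕ, fmul (rightCoeff n j) (φ (β j (T w))) =
      (∑ᶠ j : ℕ, fmul (rightCoeff n j) (φ (T (β j w)))) -
        ∑ᶠ j : ℕ, fmul (rightCoeff n j) (a j • φ w) := by
    simp only [hT', map_sub]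
    refine finsum_sub_distrib ?_ ?_
    · obtain ⟨N, hN⟩ := hβ w
      refine finite_support_of_eventually_zero (N := N) fun k hk => ?_
      rw [hN k (by exact_mod_cast hk), map_zero, map_zero, map_zero]
    · exact ha.subset fun j hj h0 => hj (by simp only [h0, zero_smul, map_zero])
  have e4 : ∑ᶠ j : ℕ, fmul (rightCoeff n j) (mapCoeff T (φ (β j w)) - φ (T (β j w))) =
      (∑ᶠ j : ℕ, fmul (rightCoeff n j) (mapCoeff T (φ (β j w)))) -
        ∑ᶠ j : ℕ, fmul (rightCoeff n j) (φ (T (β j w))) := by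
    simp only [map_sub]
    obtain ⟨N, hN⟩ := hβ w
    refine finsum_sub_distrib ?_ ?_ <;>
    · refine finite_support_of_eventually_zero (N := N) fun k hk => ?_
      rw [hN k (by exact_mod_cast hk)]
      simp only [map_zero]
  rw [adField_apply, fieldMode_apply, LinearMap.add_apply, fieldMode_apply, fieldMode_apply, map_sub,
    mapCoeff_leftMode β T a hT, e1, e3, adField_apply, map_sub, fieldMul_apply, map_sub,
    LinearMap.sub_apply, e2]
  simp only [adField_apply]
  rw [e4]
  abel

/-- The residue is taken in x₁, so series in x factor out. -/
theorem fieldMode_fieldMul {W : Type*} [AddCommGroup W] [Module ℂ W] {β : ℤ → Module.End ℂ W}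
    (hβ : Restricted β) (n : ℤ) (f : LaurentSeries ℂ) (φ : W →ₗ[ℂ] LaurentSeries W) :
    fieldMode hβ n (fieldMul f φ) = fieldMul f (fieldMode hβ n φ) := by
  ext w : 1
  rw [fieldMode_apply, fieldMul_apply, fieldMul_apply, leftMode_fmul, fieldMode_apply, map_sub,
    map_finsum _ (rightMode_finite hβ n φ w)]
  simp only [fieldMul_apply, ← Module.End.mul_apply, ← map_mul, mul_comm f]

/-- The map `k ⊗ a ↦ k Y(a, x)`. -/
def fieldK (q ℓ : ℂ) : LaurentSeries ℂ ⊗[ℂ] VacuumModule q ℓ →ₗ[ℂ]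
    VacuumModule q ℓ →ₗ[ℂ] LaurentSeries (VacuumModule q ℓ) :=
  TensorProduct.lift (LinearMap.mk₂ ℂ (fun k a => fieldMul k (vacField q ℓ a))
    (fun _ _ _ => by ext1; simp [fieldMul_apply]) (fun _ _ _ => by ext1; simp [fieldMul_apply])
    (fun _ _ _ => by ext1; simp [fieldMul_apply]) (fun _ _ _ => by ext1; simp [fieldMul_apply]))

theorem fieldK_tmul (k : LaurentSeries ℂ) (a : VacuumModule q ℓ) :
    fieldK q ℓ (k ⊗ₜ a) = fieldMul k (vacField q ℓ a) := rfl

theorem fieldK_bOp (r m : ℤ) (z : LaurentSeries ℂ ⊗[ℂ] VacuumModule q ℓ) :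
    fieldK q ℓ (bOp q ℓ (LaurentSeries ℂ) r m z) =
      fieldMode ((isRestricted_vacuumModule q ℓ).restricted r) m (fieldK q ℓ z) := by
  induction z using TensorProduct.induction_on with
  | zero => simp
  | add x y hx hy => rw [map_add, map_add, hx, hy, map_add, map_add]
  | tmul k a =>
    rw [bOp_tmul, fieldK_tmul, fieldK_tmul, fieldMode_fieldMul, vacField, fieldMap_beta]

theorem structureConst_finite (r s n : ℤ) :
    (Function.support fun j : ℕ => structureConst q r s j n).Finite := by
  refine finite_support_of_eventually_zero (N := (1 - n).toNat + 1) fun k hk => ?_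
  rw [structureConst_nonneg_left _ _ _ _ _ (by omega), if_neg (by omega), mul_zero]

theorem coeff_finsum_single {a : ℕ → ℂ} (ha : (Function.support a).Finite) (m N : ℤ) :
    (∑ᶠ j : ℕ, a j • (HahnSeries.single (m - j) 1 : LaurentSeries ℂ)).coeff N =
      if N ≤ m then a (m - N).toNat else 0 := by
  rw [coeff_finsum (ha.subset fun j hj h0 => hj (by simp only [h0, laurent_zero_smul]))]
  simp only [HahnSeries.coeff_smul, HahnSeries.coeff_single, smul_eq_mul, mul_ite, mul_one, mul_zero]
  split_ifs with h
  · rw [finsum_eq_single _ (m - N).toNat, if_pos (by omega)]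
    intro j hj
    rw [if_neg (by omega)]
  · refine finsum_eq_zero_of_forall_eq_zero fun j => ?_
    rw [if_neg (by omega)]

/-- The scalar identity behind the commutator formula. -/
theorem commutator_scalar (hq0 : q ≠ 0) (hq : ∀ n : ℕ, 0 < n → q ^ n ≠ 1) (r m s n : ℤ) :
    (powSer fun k => (-1) ^ k * bc n k * (structureConst q r s m (n - k) * ℓ)) -
        ∑ᶠ j : ℕ, (structureConst q r s m j * ℓ) • rightCoeff n j =
      kappa q ℓ r m s n + ∑ᶠ j : ℕ, (bc m j * (structureConst q r s j n * ℓ)) •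
        (HahnSeries.single (m - j) 1 : LaurentSeries ℂ) := by
  -- Finiteness is visible only when the nonnegative mode stands on the left; antisymmetry moves it
  -- there.
  have hfin : (Function.support fun j : ℕ => structureConst q r s m j * ℓ).Finite := by
    refine (structureConst_finite (q := q) s r m).subset fun j hj h0 => hj ?_
    have h1 : structureConst q r s m j = 0 := by
      have := structureConst_antisymm hq0 hq r s m j
      simp only [h0] at this
      exact (neg_eq_zero.1 this.symm)
    simp only [h1, zero_mul]
  have e : ∑ᶠ j : ℕ, (structureConst q r s m j * ℓ) • rightCoeff n j =
      ∑ᶠ j : ℕ, (structureConst q r s m j * ℓ * ((-1) ^ (n - j) * bc n j)) •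
        (HahnSeries.single (n - j) 1 : LaurentSeries ℂ) := by
    refine finsum_congr fun j => ?_
    ext N
    simp only [rightCoeff, HahnSeries.coeff_smul, HahnSeries.coeff_single, smul_eq_mul]
    split_ifs <;> ring
  rw [e]
  ext N
  rw [HahnSeries.coeff_sub, HahnSeries.coeff_add, coeff_finsum_single, coeff_finsum_single,
    powSer_coeff]
  · have := kappa_coeff_eq (ℓ := ℓ) hq0 hq r m s n N
    have h1 : (if 0 ≤ N then (-1) ^ N.toNat * bc n N.toNat *
        (structureConst q r s m (n - (N.toNat : ℤ)) * ℓ) else 0) =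
        ℓ * if 0 ≤ N then (-1) ^ N * bc n N.toNat * structureConst q r s m (n - N) else 0 := by
      split_ifs with h
      · obtain ⟨k, rfl⟩ : ∃ k : ℕ, N = k := ⟨N.toNat, by omega⟩
        rw [Int.toNat_natCast, zpow_natCast]
        ring
      · simp
    have h2 : (if N ≤ n then structureConst q r s m ((n - N).toNat : ℤ) * ℓ *
        ((-1) ^ (n - ((n - N).toNat : ℤ)) * bc n (n - N).toNat) else 0) =
        ℓ * if N ≤ n then (-1) ^ N * bc n (n - N).toNat * structureConst q r s m (n - N) else 0 := by
      split_ifs with h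
      · rw [Int.toNat_of_nonneg (by omega), sub_sub_cancel]
        ring
      · simp
    have h3 : (if N ≤ m then bc m (m - N).toNat *
        (structureConst q r s ((m - N).toNat : ℤ) n * ℓ) else 0) =
        ℓ * if N ≤ m then bc m (m - N).toNat * structureConst q r s (m - N) n else 0 := by
      split_ifs with h
      · rw [Int.toNat_of_nonneg (by omega)]
        ring
      · simp
    rw [h1, h2, h3, ← mul_sub]
    exact this
  · exact (structureConst_finite (q := q) r s n).subset fun j hj h0 => hj (by
      simp only [h0, zero_mul, mul_zero])
  · exact hfin.subset fun j hj h0 => hj (by simp only [h0, zero_mul])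

theorem beta_finite (r : ℤ) (a : VacuumModule q ℓ) :
    (Function.support fun j : ℕ => ⁅beta q r j, a⁆).Finite := by
  obtain ⟨N, hN⟩ := isRestricted_vacuumModule q ℓ a r
  exact finite_support_of_eventually_zero (N := N.toNat) fun k hk => hN k (by omega)

theorem commutator_finite (r m : ℤ) (a : VacuumModule q ℓ) : (Function.support fun j : ℕ =>
    bc m j • fieldMul (HahnSeries.single (m - j) 1) (vacField q ℓ ⁅beta q r j, a⁆)).Finite :=
  (beta_finite r a).subset fun j hj h0 => hj (by simp only [h0, map_zero, smul_zero])

/-- The commutator `[β_m, Y(a, x)]`. -/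
theorem adField_vacField (hq0 : q ≠ 0) (hq : ∀ n : ℕ, 0 < n → q ^ n ≠ 1) (r m : ℤ)
    (a : VacuumModule q ℓ) :
    adField (betaOp q (VacuumModule q ℓ) r m) (vacField q ℓ a) =
      fieldK q ℓ (der (kappa q ℓ r m) a) +
        ∑ᶠ j : ℕ, bc m j • fieldMul (HahnSeries.single (m - j) 1) (vacField q ℓ ⁅beta q r j, a⁆) := by
  induction a using vacuum_induction with
  | h0 =>
    rw [der_vac, map_zero, zero_add, finsum_eq_zero_of_forall_eq_zero]
    · ext w n
      rw [adField_apply, vacField, fieldMap_vac, HahnSeries.coeff_sub, mapCoeff_coeff, idField_coeff,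
        idField_coeff]
      split_ifs <;> simp
    · intro j
      rw [beta_vac _ _ (by omega), map_zero, map_zero, smul_zero]
  | hβ s n a ha =>
    have hfin := structureConst_finite (q := q) r s n
    have hcomm : ∀ j : ℕ, ⁅beta q r j, ⁅beta q s n, a⁆⁆ =
        ⁅beta q s n, ⁅beta q r j, a⁆⁆ + (structureConst q r s j n * ℓ) • a := fun j =>
      betaOp_comm (W := VacuumModule q ℓ) hasLevel_vacuumModule r s j n a
    have e1 : vacField q ℓ ⁅beta q s n, a⁆ =
        fieldMode ((isRestricted_vacuumModule q ℓ).restricted s) n (vacField q ℓ a) :=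
      fieldMap_beta _ _ _ _ _
    have hA : (Function.support fun j : ℕ => structureConst q r s m j * ℓ).Finite := by
      refine (structureConst_finite (q := q) s r m).subset fun j hj h0 => hj ?_
      have := structureConst_antisymm hq0 hq r s m j
      simp only [h0] at this
      simp only [neg_eq_zero.1 this.symm, zero_mul]
    -- Passing from a to β_n a adds a scalar multiple of Y(a, x). By `commutator_scalar` it splits
    -- into κ, from the Leibniz rule for the derivation, and the scalars from moving β_j past β_n.
    rw [e1, adField_fieldMode _ _ (fun n => structureConst q r s m n * ℓ)
      (fun n w => betaOp_comm hasLevel_vacuumModule r s m n w) hA, commutator_scalar hq0 hq, ha,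
      map_add, ← fieldK_bOp, map_finsum _ (commutator_finite r m a),
      der_beta _ (fun s n hn => kappa_of_nonneg_right _ _ _ _ hn), map_add, fieldK_tmul]
    have e2 : ∀ j : ℕ, bc m j • fieldMul (HahnSeries.single (m - j) 1)
        (vacField q ℓ ⁅beta q r j, ⁅beta q s n, a⁆⁆) =
        fieldMode ((isRestricted_vacuumModule q ℓ).restricted s) n (bc m j •
          fieldMul (HahnSeries.single (m - j) 1) (vacField q ℓ ⁅beta q r j, a⁆)) +
        (bc m j * (structureConst q r s j n * ℓ)) • fieldMul (HahnSeries.single (m - j) 1)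
          (vacField q ℓ a) := by
      intro j
      rw [hcomm, map_add, map_add, smul_add, map_smul, map_smul, map_smul, fieldMode_fieldMul,
        smul_smul]
      congr 3
      exact fieldMap_beta _ _ _ _ _
    have e3 : fieldMul (∑ᶠ j : ℕ, (bc m j * (structureConst q r s j n * ℓ)) •
        (HahnSeries.single (m - j) 1 : LaurentSeries ℂ)) (vacField q ℓ a) =
        ∑ᶠ j : ℕ, (bc m j * (structureConst q r s j n * ℓ)) •
          fieldMul (HahnSeries.single (m - j) 1) (vacField q ℓ a) := by
      let Φ : LaurentSeries ℂ →+ (VacuumModule q ℓ →ₗ[ℂ] LaurentSeries (VacuumModule q ℓ)) :=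
        { toFun := fun f => fieldMul f (vacField q ℓ a)
          map_zero' := by ext1; simp [fieldMul_apply]
          map_add' := fun _ _ => by ext1; simp [fieldMul_apply] }
      have hΦ : ∀ (c : ℂ) f, Φ (c • f) = c • fieldMul f (vacField q ℓ a) := fun c f => by
        ext1; simp [Φ, fieldMul_apply]
      refine (AddMonoidHom.map_finsum Φ ?_).trans (finsum_congr fun j => hΦ _ _)
      exact hfin.subset fun j hj h0 => hj (by
        simp only at h0 ⊢
        rw [h0, zero_mul, mul_zero, laurent_zero_smul])
    have e4 : fieldMul (kappa q ℓ r m s n + ∑ᶠ j : ℕ, (bc m j * (structureConst q r s j n * ℓ)) •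
        (HahnSeries.single (m - j) 1 : LaurentSeries ℂ)) (vacField q ℓ a) =
        fieldMul (kappa q ℓ r m s n) (vacField q ℓ a) + ∑ᶠ j : ℕ,
          (bc m j * (structureConst q r s j n * ℓ)) •
          fieldMul (HahnSeries.single (m - j) 1) (vacField q ℓ a) := by
      rw [← e3]
      ext1
      simp [fieldMul_apply]
    rw [e4, finsum_congr e2, finsum_add_distrib]
    · abel
    · exact (commutator_finite r m a).subset fun j hj h0 => hj (by simp only [h0, map_zero])
    · exact hfin.subset fun j hj h0 => hj (by simp only [h0, zero_mul, mul_zero, zero_smul])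
  | hadd u v hu hv =>
    have e : ∀ j : ℕ, bc m j • fieldMul (HahnSeries.single (m - j) 1)
        (vacField q ℓ ⁅beta q r j, u + v⁆) =
        bc m j • fieldMul (HahnSeries.single (m - j) 1) (vacField q ℓ ⁅beta q r j, u⁆) +
        bc m j • fieldMul (HahnSeries.single (m - j) 1) (vacField q ℓ ⁅beta q r j, v⁆) := fun j => by
      rw [lie_add, map_add, map_add, smul_add]
    rw [map_add, map_add, hu, hv, map_add, map_add, finsum_congr e,
      finsum_add_distrib (commutator_finite r m u) (commutator_finite r m v)]
    abel
  | hsmul c v hv =>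
    have e : ∀ j : ℕ, bc m j • fieldMul (HahnSeries.single (m - j) 1)
        (vacField q ℓ ⁅beta q r j, c • v⁆) =
        c • bc m j • fieldMul (HahnSeries.single (m - j) 1) (vacField q ℓ ⁅beta q r j, v⁆) := fun j => by
      rw [lie_smul, map_smul, map_smul, smul_comm]
    rw [map_smul, map_smul, hv, map_smul, map_smul, finsum_congr e,
      ← smul_finsum' c (commutator_finite r m v), smul_add]

end Commutator

end QVA

namespace QVA

attribute [local instance] laurentAlgebra

/-! ### Skew symmetry. -/

section SkewSymmetry

open TensorProduct

variable {q ℓ : ℂ}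

theorem Yx_tmul (k : LaurentSeries ℂ) (u v : VacuumModule q ℓ) :
    Yx (vacOp q ℓ) (k ⊗ₜ (u ⊗ₜ v)) = fmul k (vacField q ℓ u v) := by
  rw [fmul_eq_mulSeries]
  rfl

theorem fmul_one {M : Type*} [AddCommGroup M] [Module ℂ M] (g : LaurentSeries M) :
    fmul (1 : LaurentSeries ℂ) g = g := by
  rw [map_one, Module.End.one_apply]

theorem Yx_one_tmul (u v : VacuumModule q ℓ) :
    Yx (vacOp q ℓ) (1 ⊗ₜ (u ⊗ₜ v)) = vacField q ℓ u v := by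
  rw [Yx_tmul, fmul_one]

theorem Yx_smul (k : LaurentSeries ℂ)
    (z : LaurentSeries ℂ ⊗[ℂ] (VacuumModule q ℓ ⊗[ℂ] VacuumModule q ℓ)) :
    Yx (vacOp q ℓ) (k • z) = fmul k (Yx (vacOp q ℓ) z) := by
  induction z using TensorProduct.induction_on with
  | zero => simp
  | add x y hx hy => rw [smul_add, map_add, hx, hy, map_add, map_add]
  | tmul k' p =>
    induction p using TensorProduct.induction_on with
    | zero => simp
    | add x y hx hy => simp only [tmul_add, smul_add, map_add, hx, hy]
    | tmul u v => rw [smul_tmul', Yx_tmul, Yx_tmul, smul_eq_mul, map_mul, Module.End.mul_apply]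

theorem Yx_boxMul (y : LaurentSeries ℂ ⊗[ℂ] VacuumModule q ℓ) (v : VacuumModule q ℓ) :
    Yx (vacOp q ℓ) (boxMul y (1 ⊗ₜ v)) = fieldK q ℓ y v := by
  induction y using TensorProduct.induction_on with
  | zero => simp
  | add x y hx hy => simp only [map_add, LinearMap.add_apply, hx, hy]
  | tmul k u => rw [boxMul_tmul, mul_one, Yx_tmul, fieldK_tmul, fieldMul_apply]

theorem opL_bOp_finite (r : ℤ) (z : LaurentSeries ℂ ⊗[ℂ] (VacuumModule q ℓ ⊗[ℂ] VacuumModule q ℓ)) :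
    (Function.support fun j : ℕ => opL (bOp q ℓ (LaurentSeries ℂ) r j) z).Finite := by
  induction z using TensorProduct.induction_on with
  | zero => simp
  | add x y hx hy =>
    refine (hx.union hy).subset fun j hj => ?_
    by_contra h
    simp only [Set.mem_union, Function.mem_support, not_or, not_not] at h
    exact hj (by simp only [map_add, h.1, h.2, add_zero])
  | tmul k p =>
    induction p using TensorProduct.induction_on with
    | zero => simp
    | add x y hx hy =>
      refine (hx.union hy).subset fun j hj => ?_
      by_contra h
      simp only [Set.mem_union, Function.mem_support, not_or, not_not] at h
      exact hj (by simp only [tmul_add, map_add, h.1, h.2, add_zero])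
    | tmul u v =>
      refine (beta_finite r u).subset fun j hj h0 => hj ?_
      simp only at h0
      have h : k ⊗ₜ[ℂ] (u ⊗ₜ[ℂ] v) = boxMul (k ⊗ₜ u) (1 ⊗ₜ v) := by simp
      simp only [h, opL_boxMul, bOp_tmul, h0, tmul_zero, map_zero, LinearMap.zero_apply]

/-- The action of `β_m` on `Y(x)`. -/
theorem mapCoeff_Yx (hq0 : q ≠ 0) (hq : ∀ n : ℕ, 0 < n → q ^ n ≠ 1) (r m : ℤ)
    (z : LaurentSeries ℂ ⊗[ℂ] (VacuumModule q ℓ ⊗[ℂ] VacuumModule q ℓ)) :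
    mapCoeff (betaOp q (VacuumModule q ℓ) r m) (Yx (vacOp q ℓ) z) =
      Yx (vacOp q ℓ) (opR (bOp q ℓ (LaurentSeries ℂ) r m) z) +
      Yx (vacOp q ℓ) (opL (derOp q ℓ (kappa q ℓ r m)) z) +
      ∑ᶠ j : ℕ, bc m j • fmul (HahnSeries.single (m - j) 1)
        (Yx (vacOp q ℓ) (opL (bOp q ℓ (LaurentSeries ℂ) r j) z)) := by
  have hf : ∀ z : LaurentSeries ℂ ⊗[ℂ] (VacuumModule q ℓ ⊗[ℂ] VacuumModule q ℓ),
      (Function.support fun j : ℕ => bc m j • fmul (HahnSeries.single (m - j) 1)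
        (Yx (vacOp q ℓ) (opL (bOp q ℓ (LaurentSeries ℂ) r j) z))).Finite := fun z =>
    (opL_bOp_finite r z).subset fun j hj h0 => hj (by
      simp only at h0 ⊢
      rw [h0, map_zero, map_zero, smul_zero])
  have hadd : ∀ x y : LaurentSeries ℂ ⊗[ℂ] (VacuumModule q ℓ ⊗[ℂ] VacuumModule q ℓ),
      ∑ᶠ j : ℕ, bc m j • fmul (HahnSeries.single (m - j) 1)
        (Yx (vacOp q ℓ) (opL (bOp q ℓ (LaurentSeries ℂ) r j) (x + y))) =
      (∑ᶠ j : ℕ, bc m j • fmul (HahnSeries.single (m - j) 1)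
        (Yx (vacOp q ℓ) (opL (bOp q ℓ (LaurentSeries ℂ) r j) x))) +
      ∑ᶠ j : ℕ, bc m j • fmul (HahnSeries.single (m - j) 1)
        (Yx (vacOp q ℓ) (opL (bOp q ℓ (LaurentSeries ℂ) r j) y)) := fun x y => by
    rw [← finsum_add_distrib (hf x) (hf y)]
    exact finsum_congr fun j => by simp only [map_add, smul_add]
  induction z using TensorProduct.induction_on with
  | zero => simp
  | add x y hx hy => rw [hadd]; simp only [map_add, hx, hy]; abel
  | tmul k p =>
    induction p using TensorProduct.induction_on with
    | zero => simp
    | add x y hx hy => rw [tmul_add, hadd]; simp only [map_add, hx, hy]; abel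
    | tmul u v =>
      have h : k ⊗ₜ[ℂ] (u ⊗ₜ[ℂ] v) = k • boxMul ((1 : LaurentSeries ℂ) ⊗ₜ u) (1 ⊗ₜ v) := by
        simp [smul_tmul']
      have e := LinearMap.congr_fun (adField_vacField (ℓ := ℓ) hq0 hq r m u) v
      rw [adField_apply, LinearMap.add_apply] at e
      have e' : (∑ᶠ j : ℕ, bc m j • fieldMul (HahnSeries.single (m - j) 1)
          (vacField q ℓ ⁅beta q r j, u⁆)) v = ∑ᶠ j : ℕ, bc m j • fmul (HahnSeries.single (m - j) 1)
          (vacField q ℓ ⁅beta q r j, u⁆ v) := by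
        refine (map_finsum (LinearMap.applyₗ v) (commutator_finite r m u)).trans ?_
        rfl
      have e2 : ∀ j : ℕ, bc m j • fmul (HahnSeries.single (m - j) 1) (Yx (vacOp q ℓ)
          (opL (bOp q ℓ (LaurentSeries ℂ) r j)
            (k • boxMul ((1 : LaurentSeries ℂ) ⊗ₜ u) (1 ⊗ₜ v)))) =
          fmul k (bc m j • fmul (HahnSeries.single (m - j) 1)
            (vacField q ℓ ⁅beta q r j, u⁆ v)) := fun j => by
        rw [map_smul, Yx_smul, opL_boxMul, bOp_tmul, boxMul_tmul, mul_one, Yx_one_tmul, map_smul,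
          ← Module.End.mul_apply, ← Module.End.mul_apply, ← map_mul, ← map_mul, mul_comm]
      rw [h, finsum_congr e2, ← map_finsum, ← e']
      · have h1 : Yx (vacOp q ℓ) (boxMul ((1 : LaurentSeries ℂ) ⊗ₜ u) (1 ⊗ₜ v)) =
            vacField q ℓ u v := by rw [boxMul_tmul, mul_one, Yx_one_tmul]
        have h2 : Yx (vacOp q ℓ) (opR (bOp q ℓ (LaurentSeries ℂ) r m)
            (boxMul ((1 : LaurentSeries ℂ) ⊗ₜ u) (1 ⊗ₜ v))) =
            vacField q ℓ u ⁅beta q r m, v⁆ := by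
          rw [opR_boxMul, bOp_tmul, boxMul_tmul, mul_one, Yx_one_tmul]
        have h3 : Yx (vacOp q ℓ) (opL (derOp q ℓ (kappa q ℓ r m))
            (boxMul ((1 : LaurentSeries ℂ) ⊗ₜ u) (1 ⊗ₜ v))) =
            fieldK q ℓ (der (kappa q ℓ r m) u) v := by
          rw [opL_boxMul, derOp_tmul, Yx_boxMul]
        rw [LinearMap.map_smul (opR _), LinearMap.map_smul (opL _), Yx_smul, Yx_smul, Yx_smul, h1, h2, h3, mapCoeff_fmul, ← map_add,
          ← map_add, add_assoc]
        exact congrArg _ (sub_eq_iff_eq_add'.1 e)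
      · exact (beta_finite r u).subset fun j hj h0 => hj (by
          simp only at h0 ⊢
          rw [h0, map_zero, LinearMap.zero_apply, map_zero, smul_zero])

/-- The operator `e ^ (x D)`. -/
def expD {M : Type*} [AddCommGroup M] [Module ℂ M] (D : Module.End ℂ M) :
    Module.End ℂ (LaurentSeries M) :=
  serAct (AlgHom.id ℂ _) (powSer fun a => (a.factorial : ℂ)⁻¹ • D ^ a)

theorem expD_coeff {M : Type*} [AddCommGroup M] [Module ℂ M] (D : Module.End ℂ M)
    (g : LaurentSeries M) (n : ℤ) :
    (expD D g).coeff n = ∑ᶠ a : ℕ, (a.factorial : ℂ)⁻¹ • (D ^ a) (g.coeff (n - a)) :=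
  serAct_powSer_coeff _ _ _ _

theorem negX_fmul_single {M : Type*} [AddCommGroup M] [Module ℂ M] (i : ℤ) (a : ℂ)
    (g : LaurentSeries M) : negX (fmul (HahnSeries.single i a) g) =
      fmul (HahnSeries.single i ((-1) ^ i * a)) (negX g) := by
  ext n
  rw [negX_coeff, fmul_single, fmul_single, negX_coeff, smul_smul, smul_smul, mul_right_comm,
    ← zpow_add₀ (by norm_num), add_sub_cancel]

/-- Replacing x by -x turns e^{xD} into e^{-xD}, its inverse. -/
theorem expD_negX_expD {M : Type*} [AddCommGroup M] [Module ℂ M] (D : Module.End ℂ M)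
    (g : LaurentSeries M) : expD D (negX (expD D g)) = negX g := by
  have h1 : negX (expD D g) = expD (-D) (negX g) := by
    ext n
    rw [negX_coeff, expD_coeff, expD_coeff]
    obtain ⟨J, hJ⟩ := exists_coeff_eq_zero g
    have h0 : ∀ k : ℕ, (n - J).toNat + 1 ≤ k → g.coeff (n - k) = 0 := fun k hk => hJ _ (by omega)
    rw [smul_finsum']
    · refine finsum_congr fun a => ?_
      rw [negX_coeff, neg_pow, Module.End.mul_apply, map_smul, map_smul, smul_comm]
      congr 1
      rw [show ((-1 : Module.End ℂ M) ^ a) = ((-1 : ℂ) ^ a) • 1 by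
        rcases Nat.even_or_odd a with h | h <;> simp [h.neg_one_pow], LinearMap.smul_apply,
        Module.End.one_apply, smul_smul, zpow_sub₀ (by norm_num)]
      congr 1
      rw [zpow_natCast, div_mul_cancel₀ _ (by simp)]
    · exact finite_support_of_eventually_zero fun k hk => by rw [h0 k hk, map_zero, smul_zero]
  have h2 : expD D * expD (-D) = 1 := by
    rw [expD, expD, ← map_mul, powSer_mul]
    rw [← map_one (serAct (AlgHom.id ℂ (Module.End ℂ M)))]
    congr 1
    apply HahnSeries.ext
    funext n
    rw [powSer_coeff, HahnSeries.coeff_one]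
    have key : ∀ N : ℕ, ∑ k ∈ Finset.HasAntidiagonal.antidiagonal N,
        ((k.1.factorial : ℂ)⁻¹ • D ^ k.1) * ((k.2.factorial : ℂ)⁻¹ • (-D) ^ k.2) =
        if N = 0 then 1 else 0 := by
      intro N
      have h3 := (Commute.neg_right (Commute.refl D)).add_pow' N
      rw [add_neg_cancel] at h3
      have h4 : ((N.factorial : ℂ)⁻¹) • ((0 : Module.End ℂ M) ^ N) =
          if N = 0 then 1 else 0 := by
        split_ifs with h
        · simp [h]
        · rw [zero_pow h, smul_zero]
      rw [← h4, h3, Finset.smul_sum]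
      refine Finset.sum_congr rfl fun k hk => ?_
      rw [Finset.HasAntidiagonal.mem_antidiagonal] at hk
      rw [smul_mul_smul_comm, ← Nat.cast_smul_eq_nsmul ℂ, smul_smul]
      congr 1
      have := Nat.choose_mul_factorial_mul_factorial (show k.1 ≤ N by omega)
      rw [show N - k.1 = k.2 by omega] at this
      have hN : (N.factorial : ℂ) ≠ 0 := Nat.cast_ne_zero.2 (Nat.factorial_ne_zero _)
      have h1' : (k.1.factorial : ℂ) ≠ 0 := Nat.cast_ne_zero.2 (Nat.factorial_ne_zero _)
      have h2' : (k.2.factorial : ℂ) ≠ 0 := Nat.cast_ne_zero.2 (Nat.factorial_ne_zero _)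
      field_simp
      rw [← this]
      push_cast
      ring
    by_cases hn : 0 ≤ n
    · rw [if_pos hn, key]
      by_cases h0 : n = 0
      · rw [if_pos h0, if_pos (by omega)]
      · rw [if_neg h0, if_neg (by omega)]
    · rw [if_neg hn, if_neg (by omega)]
  rw [h1, ← Module.End.mul_apply, h2, Module.End.one_apply]

/-- This is e^{xD} β_m e^{-xD} = ∑ (m choose k)(-x)ᵏ β_{m-k}, the Taylor form of [D, β_m] = -m
β_{m-1}; it is proved degree by degree. -/
theorem expD_mapCoeff {W : Type*} [AddCommGroup W] [Module ℂ W] (β : ℤ → Module.End ℂ W)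
    (D : Module.End ℂ W) (hD : ∀ m, D * β m = β m * D - (m : ℂ) • β (m - 1)) (m : ℤ)
    (g : LaurentSeries W) : expD D (mapCoeff (β m) g) = leftMode β m (expD D g) := by
  have key : ∀ N : ℕ, ((N.factorial : ℂ)⁻¹ • D ^ N) * β m =
      ∑ k ∈ Finset.HasAntidiagonal.antidiagonal N,
        (((-1 : ℂ) ^ k.1 * bc m k.1) • β (m - k.1)) * ((k.2.factorial : ℂ)⁻¹ • D ^ k.2) := by
    intro N
    induction N with
    | zero => simp
    | succ N ih =>
      have hN : (N : ℂ) + 1 ≠ 0 := Nat.cast_add_one_ne_zero N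
      have hpow : ∀ k : ℕ, ((k + 1).factorial : ℂ)⁻¹ • D ^ (k + 1) =
          ((k : ℂ) + 1)⁻¹ • (D * ((k.factorial : ℂ)⁻¹ • D ^ k)) := fun k => by
        rw [mul_smul_comm, smul_smul, ← pow_succ', Nat.factorial_succ]
        push_cast
        rw [mul_inv]
      have hpow' : ∀ k : ℕ, ((k : ℂ) + 1) • (((k + 1).factorial : ℂ)⁻¹ • D ^ (k + 1)) =
          D * ((k.factorial : ℂ)⁻¹ • D ^ k) := fun k => by
        rw [hpow, smul_smul, mul_inv_cancel₀ (Nat.cast_add_one_ne_zero k), one_smul]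
      have e1 : ∑ k ∈ Finset.HasAntidiagonal.antidiagonal (N + 1), (k.2 : ℂ) •
          ((((-1 : ℂ) ^ k.1 * bc m k.1) • β (m - k.1)) * ((k.2.factorial : ℂ)⁻¹ • D ^ k.2)) =
          ∑ k ∈ Finset.HasAntidiagonal.antidiagonal N,
            ((((-1 : ℂ) ^ k.1 * bc m k.1) • β (m - k.1)) * (D * ((k.2.factorial : ℂ)⁻¹ • D ^ k.2))) := by
        rw [Finset.Nat.sum_antidiagonal_succ', Nat.cast_zero, zero_smul, zero_add]
        refine Finset.sum_congr rfl fun k _ => ?_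
        rw [← hpow', Nat.cast_add, Nat.cast_one]
        exact (mul_smul_comm _ _ _).symm
      have e2 : ∑ k ∈ Finset.HasAntidiagonal.antidiagonal (N + 1), (k.1 : ℂ) •
          ((((-1 : ℂ) ^ k.1 * bc m k.1) • β (m - k.1)) * ((k.2.factorial : ℂ)⁻¹ • D ^ k.2)) =
          ∑ k ∈ Finset.HasAntidiagonal.antidiagonal N,
            ((-(((-1 : ℂ) ^ k.1 * bc m k.1) • (((m - k.1 : ℤ) : ℂ) • β (m - k.1 - 1)))) *
              ((k.2.factorial : ℂ)⁻¹ • D ^ k.2)) := by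
        rw [Finset.Nat.sum_antidiagonal_succ, Nat.cast_zero, zero_smul, zero_add]
        refine Finset.sum_congr rfl fun k _ => ?_
        rw [← smul_mul_assoc, smul_smul, smul_smul, ← neg_smul,
          show m - ((k.1 + 1 : ℕ) : ℤ) = m - k.1 - 1 by push_cast; ring]
        congr 2
        have h1 := succ_mul_bc_succ m k.1
        push_cast
        rw [pow_succ]
        linear_combination (-1) * (-1 : ℂ) ^ k.1 * h1
      have e3 : ((N : ℂ) + 1) • ∑ k ∈ Finset.HasAntidiagonal.antidiagonal (N + 1),
          ((((-1 : ℂ) ^ k.1 * bc m k.1) • β (m - k.1)) * ((k.2.factorial : ℂ)⁻¹ • D ^ k.2)) =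
          D * ∑ k ∈ Finset.HasAntidiagonal.antidiagonal N,
            ((((-1 : ℂ) ^ k.1 * bc m k.1) • β (m - k.1)) * ((k.2.factorial : ℂ)⁻¹ • D ^ k.2)) := by
        have : ∀ k ∈ Finset.HasAntidiagonal.antidiagonal (N + 1), ((N : ℂ) + 1) •
            ((((-1 : ℂ) ^ k.1 * bc m k.1) • β (m - k.1)) * ((k.2.factorial : ℂ)⁻¹ • D ^ k.2)) =
            (k.2 : ℂ) •
            ((((-1 : ℂ) ^ k.1 * bc m k.1) • β (m - k.1)) * ((k.2.factorial : ℂ)⁻¹ • D ^ k.2)) +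
            (k.1 : ℂ) •
            ((((-1 : ℂ) ^ k.1 * bc m k.1) • β (m - k.1)) * ((k.2.factorial : ℂ)⁻¹ • D ^ k.2)) := by
          intro k hk
          rw [← add_smul]
          congr 1
          rw [add_comm (k.2 : ℂ)]
          exact_mod_cast (Finset.HasAntidiagonal.mem_antidiagonal.1 hk).symm
        rw [Finset.smul_sum, Finset.sum_congr rfl this, Finset.sum_add_distrib, e1, e2, Finset.mul_sum,
          ← Finset.sum_add_distrib]
        refine Finset.sum_congr rfl fun k _ => ?_
        have h5 : ∀ c : ℂ, D * (c • β (m - k.1)) =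
            c • β (m - k.1) * D + -(c • (((m - k.1 : ℤ) : ℂ) • β (m - k.1 - 1))) := fun c => by
          rw [mul_smul_comm, hD, smul_sub, smul_mul_assoc, sub_eq_add_neg]
        rw [← mul_assoc, ← mul_assoc D, ← add_mul, h5]
      rw [hpow, smul_mul_assoc, mul_assoc, ih, ← e3, smul_smul, inv_mul_cancel₀ hN, one_smul]
  have hring : (powSer fun a => (a.factorial : ℂ)⁻¹ • D ^ a) * HahnSeries.single (0 : ℤ) (β m) =
      leftSer β m * powSer fun a => (a.factorial : ℂ)⁻¹ • D ^ a := by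
    rw [leftSer, powSer_mul]
    apply HahnSeries.ext
    funext n
    rw [HahnSeries.coeff_mul_single_zero, powSer_coeff, powSer_coeff]
    split_ifs
    · exact key _
    · rw [zero_mul]
  have h1 : mapCoeff (β m) g = serAct (AlgHom.id ℂ _) (HahnSeries.single (0 : ℤ) (β m)) g := by
    ext n
    simp
  rw [h1, expD, leftMode, ← Module.End.mul_apply, ← Module.End.mul_apply, ← map_mul, ← map_mul, hring]

theorem expD_vacD_mapCoeff (r m : ℤ) (g : LaurentSeries (VacuumModule q ℓ)) :
    expD (vacD q ℓ) (mapCoeff (betaOp q (VacuumModule q ℓ) r m) g) =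
      leftMode (betaOp q (VacuumModule q ℓ) r) m (expD (vacD q ℓ) g) :=
  expD_mapCoeff _ _ (fun m => LinearMap.ext fun v => vacD_beta r m v) m g

/-- Both sides turn β_m on v into the left mode; on the vacuum the right mode contributes nothing.
-/
theorem vacField_vac_eq (v : VacuumModule q ℓ) :
    vacField q ℓ v (vac q ℓ) = expD (vacD q ℓ) (HahnSeries.single 0 v) := by
  induction v using vacuum_induction with
  | h0 =>
    ext n
    rw [vacField, fieldMap_vac, idField_coeff, expD_coeff, finsum_eq_single _ 0]
    · simp [HahnSeries.coeff_single]
    · intro a ha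
      rw [HahnSeries.coeff_single]
      split_ifs
      · obtain ⟨b, rfl⟩ := Nat.exists_eq_succ_of_ne_zero ha
        rw [pow_succ, Module.End.mul_apply, vacD_vac, map_zero, smul_zero]
      · rw [map_zero, smul_zero]
  | hβ r m v hv =>
    have h : (HahnSeries.single (0 : ℤ) ⁅beta q r m, v⁆ : LaurentSeries _) =
        mapCoeff (betaOp q (VacuumModule q ℓ) r m) (HahnSeries.single 0 v) := by
      ext n
      rw [mapCoeff_coeff, HahnSeries.coeff_single, HahnSeries.coeff_single]
      split_ifs
      · rfl
      · rw [map_zero]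
    rw [h, expD_vacD_mapCoeff, ← hv, vacField, fieldMap_beta, fieldMode_apply,
      finsum_eq_zero_of_forall_eq_zero, sub_zero]
    intro j
    rw [betaOp_apply, beta_vac _ _ (by omega), map_zero, map_zero]
  | hadd u v hu hv => rw [map_add, LinearMap.add_apply, hu, hv, HahnSeries.single_add, map_add]
  | hsmul c v hv =>
    rw [map_smul, LinearMap.smul_apply, hv, ← map_smul]
    congr 1
    ext n
    simp [HahnSeries.coeff_single]

/-- Induction on u. The shift in 𝒮(v ⊗ β_m u) absorbs the κ term of the commutator formula;
conjugation by e^{xD} and x ↦ -x then produce exactly the field-mode recursion of Y(β_m u, x)v. -/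
theorem skewSymmetry_Sop (hq0 : q ≠ 0) (hq : ∀ n : ℕ, 0 < n → q ^ n ≠ 1) (u v : VacuumModule q ℓ) :
    expD (vacD q ℓ) (negX (Yx (vacOp q ℓ) (Sop q ℓ (v ⊗ₜ u)))) = vacField q ℓ u v := by
  induction u using vacuum_induction generalizing v with
  | h0 =>
    rw [Sop_vac_right, Yx_tmul, map_one, Module.End.one_apply, vacField_vac_eq, expD_negX_expD,
      vacField, fieldMap_vac]
    ext n
    rw [negX_coeff, idField_coeff, HahnSeries.coeff_single]
    split_ifs with h
    · simp [h]
    · rw [smul_zero]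
  | hβ r m u hu =>
    have h1 := isTwist_Sop.beta_right r m v u
    -- Annihilation operators on the first factor commute with 𝒮, because κ vanishes at nonnegative
    -- modes.
    have h2 : ∀ j : ℕ, opL (bOp q ℓ (LaurentSeries ℂ) r j) (Sop q ℓ (v ⊗ₜ u)) =
        Sop q ℓ (⁅beta q r j, v⁆ ⊗ₜ u) := fun j => by
      rw [isTwist_Sop.beta_left (fun _ _ _ _ h => kappa_of_nonneg_right _ _ _ _ h)
        (fun _ _ _ _ h => kappa_of_nonneg_left _ _ _ _ h) r j v u, show (fun r' m' =>
          kappa q ℓ r' m' r (j : ℤ)) = 0 from funext fun r' => funext fun m' =>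
          kappa_of_nonneg_right _ _ _ _ (by omega), derOp_zero, opR_zero, LinearMap.zero_apply,
        add_zero]
    have h3 := mapCoeff_Yx hq0 hq r m (Sop q ℓ (v ⊗ₜ u))
    have hf := (opL_bOp_finite r (Sop q ℓ (v ⊗ₜ u)))
    simp only [h2] at h3 hf
    rw [← map_add, ← h1, ← sub_eq_iff_eq_add] at h3
    rw [← h3, map_sub, map_sub]
    have h4 : negX (mapCoeff (betaOp q (VacuumModule q ℓ) r m) (Yx (vacOp q ℓ) (Sop q ℓ (v ⊗ₜ u)))) =
        mapCoeff (betaOp q (VacuumModule q ℓ) r m) (negX (Yx (vacOp q ℓ) (Sop q ℓ (v ⊗ₜ u)))) := by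
      ext n
      simp
    rw [h4, expD_vacD_mapCoeff, hu, vacField, fieldMap_beta, fieldMode_apply, ← vacField, map_finsum,
      map_finsum]
    · congr 1
      refine finsum_congr fun j => ?_
      have h5 : rightCoeff m j = bc m j • HahnSeries.single (m - (j : ℤ)) ((-1) ^ (m - j) * 1) := by
        ext N
        simp only [rightCoeff, HahnSeries.coeff_smul, HahnSeries.coeff_single, smul_eq_mul]
        split_ifs <;> ring
      rw [betaOp_apply, ← hu, map_smul, negX_fmul_single, expD, map_smul, serAct_fmul_comm, h5,
        map_smul, LinearMap.smul_apply]
    · exact hf.subset fun j hj h0 => hj (by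
        simp only at h0 ⊢
        rw [h0, map_zero, map_zero, smul_zero, map_zero])
    · exact hf.subset fun j hj h0 => hj (by
        simp only at h0 ⊢
        rw [h0, map_zero, map_zero, smul_zero])
  | hadd x y hx hy => rw [tmul_add, map_add, map_add, map_add, map_add, hx, hy, map_add,
      LinearMap.add_apply]
  | hsmul c x hx => rw [tmul_smul, map_smul, map_smul, map_smul, map_smul, hx, map_smul,
      LinearMap.smul_apply]

end SkewSymmetry

end QVA

namespace QVA

attribute [local instance] laurentAlgebra

/-! ### Transport of left modes along linear maps. -/

section SeriesModules

variable {A : Type*} [Ring A] [Algebra ℂ A] {A' : Type*} [Ring A'] [Algebra ℂ A']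
  {M N : Type*} [AddCommGroup M] [Module ℂ M] [AddCommGroup N] [Module ℂ N]

theorem mapCoeff_comp_apply {P : Type*} [AddCommGroup P] [Module ℂ P] (T : N →ₗ[ℂ] P)
    (U : M →ₗ[ℂ] N) (g : LaurentSeries M) : mapCoeff T (mapCoeff U g) = mapCoeff (T ∘ₗ U) g := by
  ext n
  simp

theorem mapCoeff_serAct (ρ : A →ₐ[ℂ] Module.End ℂ M) (ρ' : A →ₐ[ℂ] Module.End ℂ N) (T : M →ₗ[ℂ] N)
    (hT : ∀ a m, T (ρ a m) = ρ' a (T m)) (f : LaurentSeries A) (g : LaurentSeries M) :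
    mapCoeff T (serAct ρ f g) = serAct ρ' f (mapCoeff T g) := by
  ext n
  rw [mapCoeff_coeff, serAct_coeff, serAct_coeff, map_finsum]
  · simp [hT]
  · exact mulSeries_finite ρ.toLinearMap f g n

/-- A correction in commuting T with each β_n becomes a correction to the left mode, with the same
binomial expansion applied to its coefficients. -/
theorem mapCoeff_leftMode_sum {ι : Type*} (s : Finset ι) (ρ : A →ₐ[ℂ] Module.End ℂ N)
    (β : ℤ → Module.End ℂ M) (β' : ℤ → Module.End ℂ N) (T : M →ₗ[ℂ] N) (U : ι → M →ₗ[ℂ] N)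
    (a : ι → ℤ → A) (hT : ∀ n w, T (β n w) = β' n (T w) + ∑ t ∈ s, ρ (a t n) (U t w)) (n : ℤ)
    (g : LaurentSeries M) :
    mapCoeff T (leftMode β n g) = leftMode β' n (mapCoeff T g) + ∑ t ∈ s,
      serAct ρ (powSer fun k => ((-1) ^ k * bc n k) • a t (n - k)) (mapCoeff (U t) g) := by
  ext N
  rw [mapCoeff_coeff, leftMode_coeff, HahnSeries.coeff_add, leftMode_coeff, HahnSeries.coeff_sum]
  simp only [serAct_powSer_coeff]
  obtain ⟨J, hJ⟩ := exists_coeff_eq_zero g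
  have h0 : ∀ k : ℕ, (N - J).toNat + 1 ≤ k → g.coeff (N - k) = 0 := fun k hk => hJ _ (by omega)
  have h1 : ∀ t ∈ s, ∑ᶠ k : ℕ, ρ (((-1) ^ k * bc n k) • a t (n - k))
      ((mapCoeff (U t) g).coeff (N - k)) = ∑ k ∈ Finset.range ((N - J).toNat + 1),
      ((-1) ^ k * bc n k) • ρ (a t (n - k)) (U t (g.coeff (N - k))) := fun t _ => by
    rw [finsum_nat_eq_sum_range (N := (N - J).toNat + 1)]
    · simp
    · intro k hk
      rw [mapCoeff_coeff, h0 k hk, map_zero, map_zero]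
  rw [Finset.sum_congr rfl h1, Finset.sum_comm, finsum_nat_eq_sum_range (N := (N - J).toNat + 1),
    finsum_nat_eq_sum_range (N := (N - J).toNat + 1), map_sum, ← Finset.sum_add_distrib]
  · refine Finset.sum_congr rfl fun k _ => ?_
    rw [map_smul, hT, smul_add, Finset.smul_sum, mapCoeff_coeff]
  · intro k hk
    rw [mapCoeff_coeff, h0 k hk, map_zero, map_zero, smul_zero]
  · intro k hk
    rw [h0 k hk, map_zero, smul_zero]

theorem mapCoeff_leftMode_add (ρ : A →ₐ[ℂ] Module.End ℂ N) (β : ℤ → Module.End ℂ M)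
    (β' : ℤ → Module.End ℂ N) (T ι : M →ₗ[ℂ] N) (a : ℤ → A)
    (hT : ∀ n w, T (β n w) = β' n (T w) + ρ (a n) (ι w)) (n : ℤ) (g : LaurentSeries M) :
    mapCoeff T (leftMode β n g) = leftMode β' n (mapCoeff T g) +
      serAct ρ (powSer fun k => ((-1) ^ k * bc n k) • a (n - k)) (mapCoeff ι g) := by
  simpa using mapCoeff_leftMode_sum {()} ρ β β' T (fun _ => ι) (fun _ => a) (by simpa using hT) n g

theorem mapCoeff_leftMode_of_comm (β : ℤ → Module.End ℂ M)
    (β' : ℤ → Module.End ℂ N) (T : M →ₗ[ℂ] N) (hT : ∀ n w, T (β n w) = β' n (T w)) (n : ℤ)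
    (g : LaurentSeries M) : mapCoeff T (leftMode β n g) = leftMode β' n (mapCoeff T g) := by
  rw [mapCoeff_leftMode_add (Algebra.ofId ℂ (Module.End ℂ N)) β β' T 0 0 (by simp [hT])]
  simp

theorem serAct_comm_apply (ρ : A →ₐ[ℂ] Module.End ℂ M) (ρ' : A' →ₐ[ℂ] Module.End ℂ M)
    (f : LaurentSeries A) (f' : LaurentSeries A')
    (h : ∀ i j m, ρ (f.coeff i) (ρ' (f'.coeff j) m) = ρ' (f'.coeff j) (ρ (f.coeff i) m))
    (g : LaurentSeries M) : serAct ρ f (serAct ρ' f' g) = serAct ρ' f' (serAct ρ f g) := by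
  let E := Module.End ℂ M
  have h1 : ∀ (f : LaurentSeries A) g, serAct ρ f g =
      serAct (AlgHom.id ℂ E) (mapCoeff ρ.toLinearMap f) g := fun f g => by
    ext n; simp [serAct_coeff, E]
  have h2 : ∀ (f : LaurentSeries A') g, serAct ρ' f g =
      serAct (AlgHom.id ℂ E) (mapCoeff ρ'.toLinearMap f) g := fun f g => by
    ext n; simp [serAct_coeff, E]
  rw [h1, h2, h2, h1, ← Module.End.mul_apply, ← Module.End.mul_apply, ← map_mul, ← map_mul]
  congr 2
  apply HahnSeries.ext
  funext n
  rw [laurent_mul_coeff, laurent_mul_coeff]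
  refine finsum_eq_of_bijective (fun i => n - i) (Equiv.subLeft n).bijective fun i => ?_
  rw [sub_sub_cancel]
  ext m
  simp [h, E]

end SeriesModules

/-! ### The hexagon identity over general scalars. -/

section Hexagon

open TensorProduct

variable {q ℓ : ℂ} {K : Type*} [CommRing K] [Algebra ℂ K] {M N : Type*} [AddCommGroup M]
  [Module ℂ M] [AddCommGroup N] [Module ℂ N]

/-- The action of `K((z))` on `(K ⊗ M)((z))`. -/
def scalarAct (K M : Type*) [CommRing K] [Algebra ℂ K] [AddCommGroup M] [Module ℂ M] :
    LaurentSeries K →ₐ[ℂ] Module.End ℂ (LaurentSeries (K ⊗[ℂ] M)) :=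
  serAct (Algebra.lsmul ℂ ℂ (K ⊗[ℂ] M))

theorem mapCoeff_scalarAct (T : K ⊗[ℂ] M →ₗ[K] K ⊗[ℂ] N) (f : LaurentSeries K)
    (g : LaurentSeries (K ⊗[ℂ] M)) :
    mapCoeff (T.restrictScalars ℂ) (scalarAct K M f g) =
      scalarAct K N f (mapCoeff (T.restrictScalars ℂ) g) :=
  mapCoeff_serAct _ _ _ (fun a m => by simp) f g

/-- The inclusion `M → K ⊗ M`. -/
def incl (K M : Type*) [CommRing K] [Algebra ℂ K] [AddCommGroup M] [Module ℂ M] :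
    M →ₗ[ℂ] K ⊗[ℂ] M := TensorProduct.mk ℂ K M 1

theorem incl_apply (m : M) : incl K M m = 1 ⊗ₜ m := rfl

/-- The map `k ⊗ (u ⊗ v) ↦ k(z) Y(u, z) v`. -/
def fieldKK (q ℓ : ℂ) (K : Type*) [CommRing K] [Algebra ℂ K] :
    LaurentSeries K ⊗[ℂ] (VacuumModule q ℓ ⊗[ℂ] VacuumModule q ℓ) →ₗ[ℂ]
      LaurentSeries (K ⊗[ℂ] VacuumModule q ℓ) :=
  TensorProduct.lift ((scalarAct K (VacuumModule q ℓ)).toLinearMap.compl₂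
    (mapCoeff (incl K (VacuumModule q ℓ)) ∘ₗ TensorProduct.lift (vacField q ℓ)))

theorem fieldKK_tmul (k : LaurentSeries K) (u v : VacuumModule q ℓ) :
    fieldKK q ℓ K (k ⊗ₜ (u ⊗ₜ v)) =
      scalarAct K _ k (mapCoeff (incl K (VacuumModule q ℓ)) (vacField q ℓ u v)) := rfl

theorem fieldKK_smul (k : LaurentSeries K)
    (z : LaurentSeries K ⊗[ℂ] (VacuumModule q ℓ ⊗[ℂ] VacuumModule q ℓ)) :
    fieldKK q ℓ K (k • z) = scalarAct K _ k (fieldKK q ℓ K z) := by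
  induction z using TensorProduct.induction_on with
  | zero => simp
  | add x y hx hy => rw [smul_add, map_add, hx, hy, map_add, map_add]
  | tmul k' p =>
    induction p using TensorProduct.induction_on with
    | zero => simp
    | add x y hx hy => simp only [tmul_add, smul_add, map_add, hx, hy]
    | tmul u v =>
      rw [smul_tmul', fieldKK_tmul, fieldKK_tmul, smul_eq_mul, map_mul, Module.End.mul_apply]

theorem vacField_beta (s n : ℤ) (u v : VacuumModule q ℓ) :
    vacField q ℓ ⁅beta q s n, u⁆ v = leftMode (betaOp q (VacuumModule q ℓ) s) n (vacField q ℓ u v) -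
      ∑ᶠ j : ℕ, fmul (rightCoeff n j) (vacField q ℓ u ⁅beta q s j, v⁆) :=
  LinearMap.congr_fun (fieldMap_beta (isRestricted_vacuumModule q ℓ) hasLevel_vacuumModule s n u) v

theorem vacField_beta_finite (s n : ℤ) (u v : VacuumModule q ℓ) : (Function.support fun j : ℕ =>
    fmul (rightCoeff n j) (vacField q ℓ u ⁅beta q s j, v⁆)).Finite :=
  (beta_finite s v).subset fun j hj h0 => hj (by
    simp only at h0 ⊢
    rw [h0, map_zero, map_zero])

theorem scalarAct_leftMode (s n : ℤ) (k : LaurentSeries K)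
    (g : LaurentSeries (K ⊗[ℂ] VacuumModule q ℓ)) :
    scalarAct K _ k (leftMode (fun m => (bOp q ℓ K s m).restrictScalars ℂ) n g) =
      leftMode (fun m => (bOp q ℓ K s m).restrictScalars ℂ) n (scalarAct K _ k g) := by
  refine serAct_comm_apply _ _ _ _ (fun i j m => ?_) g
  rw [leftSer, powSer_coeff]
  split_ifs <;> simp

theorem bOp_finite (r : ℤ) (y : K ⊗[ℂ] VacuumModule q ℓ) :
    (Function.support fun j : ℕ => bOp q ℓ K r j y).Finite := by
  induction y using TensorProduct.induction_on with
  | zero => simp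
  | add x y hx hy =>
    refine (hx.union hy).subset fun j hj => ?_
    by_contra h
    simp only [Set.mem_union, Function.mem_support, not_or, not_not] at h
    exact hj (by simp only [map_add, h.1, h.2, add_zero])
  | tmul k v => exact (beta_finite r v).subset fun j hj h0 => hj (by
      simp only at h0 ⊢
      rw [bOp_tmul, h0, tmul_zero])

/-- The recursion for `Y(β_n u, z) v`, with scalars extended. -/
theorem fieldKK_bOp (s n : ℤ) (y y' : LaurentSeries K ⊗[ℂ] VacuumModule q ℓ) :
    fieldKK q ℓ K (boxMul (bOp q ℓ (LaurentSeries K) s n y) y') =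
      leftMode (fun m => (bOp q ℓ K s m).restrictScalars ℂ) n (fieldKK q ℓ K (boxMul y y')) -
      ∑ᶠ j : ℕ, fmul (rightCoeff n j)
        (fieldKK q ℓ K (boxMul y (bOp q ℓ (LaurentSeries K) s j y'))) := by
  have hf : ∀ y y' : LaurentSeries K ⊗[ℂ] VacuumModule q ℓ,
      (Function.support fun j : ℕ => fmul (rightCoeff n j)
        (fieldKK q ℓ K (boxMul y (bOp q ℓ (LaurentSeries K) s j y')))).Finite := fun y y' =>
    (bOp_finite s y').subset fun j hj h0 => hj (by
      simp only at h0 ⊢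
      rw [h0, map_zero, map_zero, map_zero])
  induction y using TensorProduct.induction_on with
  | zero => simp
  | add x z hx hz =>
    have := finsum_add_distrib (hf x y') (hf z y')
    simp only [map_add, LinearMap.add_apply, hx, hz, this]
    abel
  | tmul k u =>
    induction y' using TensorProduct.induction_on with
    | zero => simp
    | add x z hx hz =>
      have := finsum_add_distrib (hf (k ⊗ₜ u) x) (hf (k ⊗ₜ u) z)
      simp only [map_add, hx, hz, this]
      abel
    | tmul k' v =>
      have h1 := vacField_beta_finite s n u v
      simp only [bOp_tmul, boxMul_tmul, fieldKK_tmul]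
      rw [vacField_beta, map_sub, map_sub, mapCoeff_leftMode_of_comm _
        (fun m => (bOp q ℓ K s m).restrictScalars ℂ) _ (fun m w => by simp [incl_apply, betaOp_apply])]
      congr 1
      · exact scalarAct_leftMode _ _ _ _
      · rw [← LinearMap.comp_apply, map_finsum _ h1]
        refine finsum_congr fun j => ?_
        rw [LinearMap.comp_apply, mapCoeff_fmul]
        exact serAct_fmul_comm _ _ _ _

theorem fieldKK_vac {ρ : K →ₐ[ℂ] LaurentSeries K} (hρ : ∀ k, ρ k = HahnSeries.single 0 k)
    (y : K ⊗[ℂ] VacuumModule q ℓ) :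
    fieldKK q ℓ K (boxMul (1 ⊗ₜ vac q ℓ) (mapScalars ρ _ y)) = HahnSeries.single 0 y := by
  induction y using TensorProduct.induction_on with
  | zero => simp
  | add x z hx hz => rw [map_add, map_add, map_add, hx, hz, HahnSeries.single_add]
  | tmul k v =>
    rw [mapScalars_tmul, boxMul_tmul, one_mul, fieldKK_tmul, hρ, vacField, fieldMap_vac]
    ext n
    rw [scalarAct, serAct_single, mapCoeff_coeff, idField_coeff, HahnSeries.coeff_single, sub_zero]
    split_ifs with h
    · simp [incl_apply, smul_tmul']
    · rw [map_zero, map_zero]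

/-- The derivation property of `∑ c_{s,n} ∂/∂β_n` with respect to the vertex operators. -/
theorem mapCoeff_der {ρ : K →ₐ[ℂ] LaurentSeries K} (hρ : ∀ k, ρ k = HahnSeries.single 0 k)
    (c : ℤ → ℤ → K) (hc : ∀ s n, 0 ≤ n → c s n = 0) (c' : ℤ → ℤ → LaurentSeries K)
    (hc' : ∀ s n, c' s n = powSer fun k => ((-1) ^ k * bc n k) • c s (n - k))
    (hc0 : ∀ s n, 0 ≤ n → c' s n = 0) (u v : VacuumModule q ℓ) :
    mapCoeff (der c) (vacField q ℓ u v) =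
      fieldKK q ℓ K (boxMul (1 ⊗ₜ u) (mapScalars ρ _ (der c v))) +
      fieldKK q ℓ K (boxMul (der c' u) (1 ⊗ₜ v)) := by
  induction u using vacuum_induction generalizing v with
  | h0 =>
    rw [fieldKK_vac hρ, der_vac, map_zero, LinearMap.zero_apply, map_zero, add_zero, vacField,
      fieldMap_vac]
    ext n
    rw [mapCoeff_coeff, idField_coeff, HahnSeries.coeff_single]
    split_ifs
    · rfl
    · rw [map_zero]
  | hadd x y hx hy =>
    simp only [map_add, LinearMap.add_apply, tmul_add, hx, hy]
    abel
  | hsmul a x hx =>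
    have h1 : (1 : LaurentSeries K) ⊗ₜ[ℂ] (a • x) =
        algebraMap ℂ (LaurentSeries K) a • ((1 : LaurentSeries K) ⊗ₜ[ℂ] x) := by
      rw [tmul_smul, algebraMap_smul]
    rw [h1, map_smul (vacField q ℓ), LinearMap.smul_apply, map_smul (mapCoeff _), hx,
      map_smul (der c'), ← algebraMap_smul (LaurentSeries K) a (der c' x), map_smul boxMul,
      map_smul boxMul, LinearMap.smul_apply, LinearMap.smul_apply, algebraMap_smul, algebraMap_smul,
      map_smul, map_smul, smul_add]
  | hβ s n u hu =>
    have h1 := vacField_beta_finite s n u v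
    have h2 := fieldKK_bOp s n (1 ⊗ₜ u) (mapScalars ρ _ (der c v))
    have h3 := fieldKK_bOp s n (der c' u) (1 ⊗ₜ v)
    -- The right half of the field mode contains only nonnegative modes, and with these the
    -- derivation commutes.
    have h4 : ∀ j : ℕ, bOp q ℓ (LaurentSeries K) s j (mapScalars ρ _ (der c v)) =
        mapScalars ρ _ (der c ⁅beta q s j, v⁆) := fun j => by
      rw [← mapScalars_bOp, der_beta c hc, hc s j (by omega), zero_tmul, add_zero]
    have hf2 : (Function.support fun j : ℕ => fmul (rightCoeff n j)
        (fieldKK q ℓ K (boxMul (1 ⊗ₜ u) (mapScalars ρ _ (der c ⁅beta q s j, v⁆))))).Finite :=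
      (beta_finite s v).subset fun j hj h0 => hj (by
        simp only at h0 ⊢
        rw [h0]
        simp only [map_zero])
    have hf3 : (Function.support fun j : ℕ => fmul (rightCoeff n j)
        (fieldKK q ℓ K (boxMul (der c' u) (1 ⊗ₜ ⁅beta q s j, v⁆)))).Finite :=
      (beta_finite s v).subset fun j hj h0 => hj (by
        simp only at h0 ⊢
        rw [h0, tmul_zero]
        simp only [map_zero])
    simp only [bOp_tmul, h4] at h2 h3
    rw [der_beta c' hc0, map_add, LinearMap.add_apply, map_add, h2, h3, boxMul_tmul, mul_one,
      fieldKK_tmul, vacField_beta, map_sub,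
      mapCoeff_leftMode_add (Algebra.lsmul ℂ ℂ (K ⊗[ℂ] VacuumModule q ℓ)) _
        (fun m => (bOp q ℓ K s m).restrictScalars ℂ) _ (incl K _) (fun m => c s m) (fun m w => by
          rw [betaOp_apply, der_beta c hc]
          simp [incl_apply, smul_tmul']), hu, map_add, map_finsum _ h1, hc']
    have h5 : ∑ᶠ j : ℕ, mapCoeff (der c) (fmul (rightCoeff n j) (vacField q ℓ u ⁅beta q s j, v⁆)) =
        ∑ᶠ j : ℕ, fmul (rightCoeff n j)
          (fieldKK q ℓ K (boxMul (1 ⊗ₜ u) (mapScalars ρ _ (der c ⁅beta q s j, v⁆)))) +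
        ∑ᶠ j : ℕ, fmul (rightCoeff n j)
          (fieldKK q ℓ K (boxMul (der c' u) (1 ⊗ₜ ⁅beta q s j, v⁆))) := by
      rw [← finsum_add_distrib hf2 hf3]
      refine finsum_congr fun j => ?_
      rw [mapCoeff_fmul, hu, map_add]
    rw [h5, scalarAct]
    abel

theorem fieldKK_derOp {ρ : K →ₐ[ℂ] LaurentSeries K} (hρ : ∀ k, ρ k = HahnSeries.single 0 k)
    (c : ℤ → ℤ → K) (hc : ∀ s n, 0 ≤ n → c s n = 0) (c' : ℤ → ℤ → LaurentSeries K)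
    (hc' : ∀ s n, c' s n = powSer fun k => ((-1) ^ k * bc n k) • c s (n - k))
    (hc0 : ∀ s n, 0 ≤ n → c' s n = 0)
    (y : LaurentSeries K ⊗[ℂ] (VacuumModule q ℓ ⊗[ℂ] VacuumModule q ℓ)) :
    fieldKK q ℓ K (opR (derOp q ℓ fun s n => ρ (c s n)) y + opL (derOp q ℓ c') y) =
      mapCoeff ((derOp q ℓ c).restrictScalars ℂ) (fieldKK q ℓ K y) := by
  induction y using TensorProduct.induction_on with
  | zero => simp
  | add x z hx hz =>
    simp only [map_add] at hx hz ⊢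
    rw [← hx, ← hz]
    abel
  | tmul k p =>
    induction p using TensorProduct.induction_on with
    | zero => simp
    | add x z hx hz =>
      simp only [tmul_add, map_add] at hx hz ⊢
      rw [← hx, ← hz]
      abel
    | tmul u v =>
      have h : k ⊗ₜ[ℂ] (u ⊗ₜ[ℂ] v) = k • boxMul ((1 : LaurentSeries K) ⊗ₜ u) (1 ⊗ₜ v) := by
        simp [smul_tmul']
      have h6 : ((derOp q ℓ c).restrictScalars ℂ) ∘ₗ incl K (VacuumModule q ℓ) = der c := by
        ext v
        simp [incl_apply, derOp_tmul]
      have h7 := mapCoeff_der hρ c hc c' hc' hc0 u v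
      rw [mapScalars_der] at h7
      rw [h, LinearMap.map_smul (opR _), LinearMap.map_smul (opL _), ← smul_add, fieldKK_smul,
        fieldKK_smul, mapCoeff_scalarAct]
      congr 1
      rw [opR_boxMul, opL_boxMul, derOp_tmul, derOp_tmul, map_add, ← h7,
        boxMul_tmul, mul_one, fieldKK_tmul, map_one, Module.End.one_apply, mapCoeff_comp_apply, h6]

/-- Right multiplication by a vector. -/
def boxRight {K M N : Type*} [CommRing K] [Algebra ℂ K] [AddCommGroup M] [Module ℂ M]
    [AddCommGroup N] [Module ℂ N] (w : N) : K ⊗[ℂ] M →ₗ[ℂ] K ⊗[ℂ] (M ⊗[ℂ] N) :=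
  (boxMul.flip (1 ⊗ₜ w)).restrictScalars ℂ

theorem boxRight_apply (w : N) (y : K ⊗[ℂ] M) : boxRight w y = boxMul y (1 ⊗ₜ w) := rfl

theorem box_tmul_induction {p : K ⊗[ℂ] (M ⊗[ℂ] N) → Prop} (h0 : p 0)
    (hadd : ∀ x y, p x → p y → p (x + y)) (h : ∀ y w, p (boxMul y (1 ⊗ₜ w))) (x) : p x := by
  induction x using TensorProduct.induction_on with
  | zero => exact h0
  | add x y hx hy => exact hadd x y hx hy
  | tmul k z =>
    induction z using TensorProduct.induction_on with
    | zero => simpa using h0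
    | add x y hx hy => rw [tmul_add]; exact hadd _ _ hx hy
    | tmul m n => simpa using h (k ⊗ₜ m) n

/-- Induction on w. The shift on the factor Y(u, z)v is a derivation; by `fieldKK_derOp` it
distributes as the derivation with coefficients c on v plus that with the Taylor-shifted
coefficients c' on u, which are the shifts of legs 23 and 13. -/
theorem IsTwist.hexagon {Z : LaurentSeries K ⊗[ℂ] ((VacuumModule q ℓ ⊗[ℂ] VacuumModule q ℓ) ⊗[ℂ]
      VacuumModule q ℓ) →ₗ[ℂ] LaurentSeries (K ⊗[ℂ] (VacuumModule q ℓ ⊗[ℂ] VacuumModule q ℓ))}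
    (hZ : ∀ y w, Z (boxMul y (1 ⊗ₜ w)) = mapCoeff (boxRight w) (fieldKK q ℓ K y))
    {ρ : K →ₐ[ℂ] LaurentSeries K} (hρ : ∀ k, ρ k = HahnSeries.single 0 k)
    {c : ℤ → ℤ → ℤ → ℤ → K} (hc : ∀ r m s n, 0 ≤ n → c r m s n = 0)
    {c' : ℤ → ℤ → ℤ → ℤ → LaurentSeries K}
    (hc' : ∀ r m s n, c' r m s n = powSer fun k => ((-1) ^ k * bc n k) • c r m s (n - k))
    (hc0 : ∀ r m s n, 0 ≤ n → c' r m s n = 0)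
    {S : VacuumModule q ℓ ⊗[ℂ] VacuumModule q ℓ →ₗ[ℂ]
      K ⊗[ℂ] (VacuumModule q ℓ ⊗[ℂ] VacuumModule q ℓ)}
    (hS : IsTwist (fun r m => derOp q ℓ (c r m)) (S.liftBaseChange K))
    {X : Module.End (LaurentSeries K) (LaurentSeries K ⊗[ℂ]
      ((VacuumModule q ℓ ⊗[ℂ] VacuumModule q ℓ) ⊗[ℂ] VacuumModule q ℓ))}
    (hX : IsTwist (fun r m => opR (derOp q ℓ fun s n => ρ (c r m s n)) +
      opL (derOp q ℓ (c' r m))) X) (u v w : VacuumModule q ℓ) :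
    mapCoeff (S ∘ₗ (TensorProduct.mk ℂ _ _).flip w) (vacField q ℓ u v) =
      Z (X (boxMul (1 ⊗ₜ (u ⊗ₜ v)) (1 ⊗ₜ w))) := by
  have hb : ∀ r m x, Z (opR (bOp q ℓ _ r m) x) =
      mapCoeff ((opR (bOp q ℓ K r m)).restrictScalars ℂ) (Z x) := by
    intro r m x
    induction x using box_tmul_induction with
    | h0 => simp
    | hadd x y hx hy => simp only [map_add, hx, hy]
    | h y w =>
      rw [opR_boxMul, bOp_tmul, hZ, hZ, mapCoeff_comp_apply]
      congr 2
      refine LinearMap.ext fun z => ?_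
      simp [boxRight_apply]
  have hd : ∀ r m x, Z (opL (opR (derOp q ℓ fun s n => ρ (c r m s n)) +
      opL (derOp q ℓ (c' r m))) x) =
      mapCoeff ((opL (derOp q ℓ (c r m))).restrictScalars ℂ) (Z x) := by
    intro r m x
    induction x using box_tmul_induction with
    | h0 => simp
    | hadd x y hx hy => rw [map_add, map_add, map_add, map_add, hx, hy]
    | h y w =>
      rw [opL_boxMul, hZ, hZ, LinearMap.add_apply, fieldKK_derOp hρ (c r m) (hc r m) _ (hc' r m)
        (hc0 r m), mapCoeff_comp_apply, mapCoeff_comp_apply]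
      congr 2
      refine LinearMap.ext fun z => ?_
      simp [boxRight_apply]
  induction w using vacuum_induction with
  | h0 =>
    rw [hX.vac, hZ, fieldKK_tmul, map_one, Module.End.one_apply, mapCoeff_comp_apply]
    congr 2
    refine LinearMap.ext fun a => ?_
    simpa [boxRight_apply, incl_apply] using hS.vac_right a
  | hβ r m w hw =>
    have e := LinearMap.congr_fun (hX.beta r m) (boxMul (1 ⊗ₜ (u ⊗ₜ v)) (1 ⊗ₜ w))
    rw [Module.End.mul_apply, Module.End.mul_apply, opR_boxMul, bOp_tmul, LinearMap.add_apply] at e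
    rw [e, map_add, hb, hd, ← hw, mapCoeff_comp_apply, mapCoeff_comp_apply, ← LinearMap.add_apply,
      ← map_add]
    congr 2
    refine LinearMap.ext fun a => ?_
    exact hS.beta_right r m a w
  | hadd x y hx hy =>
    rw [tmul_add, map_add (boxMul _), map_add X, map_add Z, ← hx, ← hy, map_add (LinearMap.flip _),
      LinearMap.comp_add, map_add mapCoeff, LinearMap.add_apply]
  | hsmul a x hx =>
    have h1 : (1 : LaurentSeries K) ⊗ₜ[ℂ] (a • x) =
        algebraMap ℂ (LaurentSeries K) a • ((1 : LaurentSeries K) ⊗ₜ[ℂ] x) := by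
      rw [tmul_smul, algebraMap_smul]
    rw [h1, map_smul (boxMul _), map_smul X, algebraMap_smul, map_smul Z, ← hx,
      LinearMap.map_smul (LinearMap.flip _), LinearMap.comp_smul, map_smul mapCoeff,
      LinearMap.smul_apply]

/-- The map `(u ⊗ v) ⊗ w ⊗ k ↦ k(z) (Y(u, z) v ⊗ w)`. -/
def fieldOneKK (q ℓ : ℂ) (K : Type*) [CommRing K] [Algebra ℂ K] :
    LaurentSeries K ⊗[ℂ] ((VacuumModule q ℓ ⊗[ℂ] VacuumModule q ℓ) ⊗[ℂ] VacuumModule q ℓ) →ₗ[ℂ]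
      LaurentSeries (K ⊗[ℂ] (VacuumModule q ℓ ⊗[ℂ] VacuumModule q ℓ)) :=
  TensorProduct.lift
    ((mulSeries (TensorProduct.mk ℂ K (VacuumModule q ℓ ⊗[ℂ] VacuumModule q ℓ))).compl₂
      (TensorProduct.lift ((mapCoeff ∘ₗ (TensorProduct.mk ℂ _ _).flip).flip ∘ₗ
        TensorProduct.lift (series (vacOp q ℓ)))))

theorem fieldOneKK_boxMul (y : LaurentSeries K ⊗[ℂ] (VacuumModule q ℓ ⊗[ℂ] VacuumModule q ℓ))
    (w : VacuumModule q ℓ) :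
    fieldOneKK q ℓ K (boxMul y (1 ⊗ₜ w)) = mapCoeff (boxRight w) (fieldKK q ℓ K y) := by
  induction y using TensorProduct.induction_on with
  | zero => simp
  | add x z hx hz => simp only [map_add, LinearMap.add_apply, hx, hz]
  | tmul k p =>
    induction p using TensorProduct.induction_on with
    | zero => simp
    | add x z hx hz => simp only [tmul_add, map_add, LinearMap.add_apply, hx, hz]
    | tmul u v =>
      rw [boxMul_tmul, mul_one, fieldKK_tmul]
      have h : fieldOneKK q ℓ K (k ⊗ₜ ((u ⊗ₜ v) ⊗ₜ w)) =
          mulSeries (TensorProduct.mk ℂ K (VacuumModule q ℓ ⊗[ℂ] VacuumModule q ℓ))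
            k (mapCoeff ((TensorProduct.mk ℂ (VacuumModule q ℓ) (VacuumModule q ℓ)).flip w)
              (vacField q ℓ u v)) := rfl
      rw [h]
      ext n
      rw [mapCoeff_coeff, scalarAct, serAct_coeff, mulSeries_coeff, map_finsum]
      · refine finsum_congr fun i => ?_
        simp [boxRight_apply, incl_apply, smul_tmul']
      · exact mulSeries_finite (Algebra.lsmul ℂ ℂ (K ⊗[ℂ] VacuumModule q ℓ)).toLinearMap k _ n

theorem liftBaseChange_one_tmul (A : M →ₗ[ℂ] K ⊗[ℂ] N) (m : M) :
    A.liftBaseChange K (1 ⊗ₜ m) = A m := by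
  rw [LinearMap.liftBaseChange_tmul, one_smul]

end Hexagon

/-! ### The hexagon identity for 𝒮. -/

section HexagonSop

open TensorProduct

variable {q ℓ : ℂ}

/-- The Taylor expansion of κ(x + z), with x-derivatives traded for changes of the mode n. -/
theorem substXZ_kappa (r m s n : ℤ) : substXZHom (kappa q ℓ r m s n) =
    powSer fun k => ((-1) ^ k * bc n k) • kappa q ℓ r m s (n - k) := by
  apply HahnSeries.ext
  funext N
  refine (substXZ_coeff _ N).trans ?_
  rw [powSer_coeff]
  split_ifs
  · exact hasseDeriv_kappa _ _ _ _ _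
  · rfl

theorem hexagon_Sop (u v w : VacuumModule q ℓ) (n : ℤ) :
    Sop q ℓ ((vacOp q ℓ u).coeff n v ⊗ₜ w) =
      (YzOne (vacOp q ℓ) (extendScalars mulXZ (leg23 (changeScalars substX (Sop q ℓ)))
        (leg13 (changeScalars substXZ (Sop q ℓ)) ((u ⊗ₜ v) ⊗ₜ w)))).coeff n := by
  rw [mulXZ_eq, changeScalars_substX, changeScalars_substXZ, extendScalars_algMul]
  have h13 := (isTwist_Sop_mapScalars (q := q) (ℓ := ℓ) (K := LaurentSeries (LaurentSeries ℂ))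
    substXZHom).rightComm (M := VacuumModule q ℓ)
  have h23 := (isTwist_Sop_mapScalars (q := q) (ℓ := ℓ) (K := LaurentSeries (LaurentSeries ℂ))
    substXHom).assoc (M := VacuumModule q ℓ)
  rw [← liftBaseChange_leg13] at h13
  rw [← liftBaseChange_leg23] at h23
  have hX := h23.mul h13 fun r m s n => opL_opR_comm _ _
  have e := IsTwist.hexagon (Z := YzOne (vacOp q ℓ)) 
    (fun y w => fieldOneKK_boxMul (K := LaurentSeries ℂ) y w)
    (ρ := substXHom) (fun k => rfl) (c := kappa q ℓ)
    (fun r m s n hn => kappa_of_nonneg_right r m s n hn)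
    (c' := fun r m s n => substXZHom (kappa q ℓ r m s n)) (fun r m s n => substXZ_kappa r m s n)
    (fun r m s n hn => by rw [kappa_of_nonneg_right r m s n hn, map_zero])
    isTwist_Sop hX u v w
  have e' := congrArg (fun f => f.coeff n) e
  simp only [mapCoeff_coeff] at e'
  refine Eq.trans e' ?_
  congr 2
  rw [Module.End.mul_apply, boxMul_tmul, mul_one, ]
  exact congrArg _ (liftBaseChange_one_tmul _ _)

end HexagonSop

end QVA

namespace QVA

attribute [local instance] laurentAlgebra

/-! ### The substitution x₂ - x₁. -/

section ShiftedScalars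

theorem serAct_left_comm {A M : Type*} [CommRing A] [Algebra ℂ A] [AddCommGroup M] [Module ℂ M]
    (ρ : A →ₐ[ℂ] Module.End ℂ M) (f g : LaurentSeries A) (h : LaurentSeries M) :
    serAct ρ f (serAct ρ g h) = serAct ρ g (serAct ρ f h) := by
  rw [← Module.End.mul_apply, ← Module.End.mul_apply, ← map_mul, ← map_mul, mul_comm]

/-- The substitution `x ↦ -x` as an algebra homomorphism of `A((x))`. -/
def negXAlgHom (A : Type*) [Ring A] [Algebra ℂ A] : LaurentSeries A →ₐ[ℂ] LaurentSeries A :=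
  AlgHom.ofLinearMap negX negX_one negX_mul

/-- The substitution `f(x) ↦ f(x₂ - x₁)`, expanded in nonnegative powers of `x₁`. -/
def substSub : LaurentSeries ℂ →ₐ[ℂ] LaurentSeries (LaurentSeries ℂ) :=
  (negXAlgHom (LaurentSeries ℂ)).comp substXZHom

theorem substSub_eq (f : LaurentSeries ℂ) :
    substSub f = powSer fun k => (-1 : ℂ) ^ k • LaurentSeries.hasseDeriv ℂ k f := by
  apply HahnSeries.ext
  funext n
  change (negX (substXZ f)).coeff n = _
  rw [negX_coeff, substXZ_coeff, powSer_coeff]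
  split_ifs with h
  · rw [← zpow_natCast, Int.toNat_of_nonneg h]
  · exact smul_zero _

theorem substSub_coeff (f : LaurentSeries ℂ) (a b : ℤ) :
    ((substSub f).coeff a).coeff b = expandSub f a b := by
  rw [substSub_eq, powSer_coeff, expandSub]
  split_ifs with h
  · rw [HahnSeries.coeff_smul, LaurentSeries.hasseDeriv_coeff, ← zpow_natCast,
      Int.toNat_of_nonneg h, add_comm b, zsmul_eq_mul, smul_eq_mul, mul_assoc]
  · rfl

end ShiftedScalars

/-! ### 𝒮-locality. -/

section Locality

open TensorProduct

variable {q ℓ : ℂ}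

/-- The action of `ℂ((x₂))((x₁))` on `M((x₂))((x₁))`. -/
def seriesAct (M : Type*) [AddCommGroup M] [Module ℂ M] :
    LaurentSeries (LaurentSeries ℂ) →ₐ[ℂ] Module.End ℂ (LaurentSeries (LaurentSeries M)) :=
  serAct fmul

/-- The map `v ⊗ u ↦ Y(v, x₂) Y(u, x₁)`. -/
def oppProd (q ℓ : ℂ) : VacuumModule q ℓ ⊗[ℂ] VacuumModule q ℓ →ₗ[ℂ]
    VacuumModule q ℓ →ₗ[ℂ] LaurentSeries (LaurentSeries (VacuumModule q ℓ)) :=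
  TensorProduct.lift ((LinearMap.llcomp ℂ (VacuumModule q ℓ) (LaurentSeries (VacuumModule q ℓ))
    (LaurentSeries (LaurentSeries (VacuumModule q ℓ))) ∘ₗ mapCoeff ∘ₗ vacField q ℓ).compl₂
      (vacField q ℓ))

/-- The map `f ⊗ (v ⊗ u) ↦ f(x₂ - x₁) Y(v, x₂) Y(u, x₁)`. -/
def oppSeries (q ℓ : ℂ) : LaurentSeries ℂ ⊗[ℂ] (VacuumModule q ℓ ⊗[ℂ] VacuumModule q ℓ) →ₗ[ℂ]
    VacuumModule q ℓ →ₗ[ℂ] LaurentSeries (LaurentSeries (VacuumModule q ℓ)) :=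
  TensorProduct.lift ((LinearMap.llcomp ℂ (VacuumModule q ℓ)
    (LaurentSeries (LaurentSeries (VacuumModule q ℓ)))
    (LaurentSeries (LaurentSeries (VacuumModule q ℓ))) ∘ₗ
      (seriesAct (VacuumModule q ℓ)).toLinearMap ∘ₗ substSub.toLinearMap).compl₂ (oppProd q ℓ))

theorem oppSeries_tmul (f : LaurentSeries ℂ) (v u w : VacuumModule q ℓ) :
    oppSeries q ℓ (f ⊗ₜ (v ⊗ₜ u)) w =
      seriesAct _ (substSub f) (mapCoeff (vacField q ℓ v) (vacField q ℓ u w)) := rfl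

theorem oppSeries_one_tmul (v u w : VacuumModule q ℓ) :
    oppSeries q ℓ (1 ⊗ₜ (v ⊗ₜ u)) w = mapCoeff (vacField q ℓ v) (vacField q ℓ u w) := by
  rw [oppSeries_tmul]
  have h : substSub (1 : LaurentSeries ℂ) = 1 := substSub.map_one'
  have h' : seriesAct (VacuumModule q ℓ) 1 = 1 := (seriesAct _).map_one'
  rw [h, h', Module.End.one_apply]

theorem substSub_mul (f g : LaurentSeries ℂ) : substSub (f * g) = substSub f * substSub g :=
  map_mul substSub f g

theorem oppSeries_smul (k : LaurentSeries ℂ)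
    (z : LaurentSeries ℂ ⊗[ℂ] (VacuumModule q ℓ ⊗[ℂ] VacuumModule q ℓ)) (w : VacuumModule q ℓ) :
    oppSeries q ℓ (k • z) w = seriesAct _ (substSub k) (oppSeries q ℓ z w) := by
  induction z using TensorProduct.induction_on with
  | zero => simp
  | add x y hx hy => simp only [smul_add, map_add, LinearMap.add_apply, hx, hy]
  | tmul k' p =>
    induction p using TensorProduct.induction_on with
    | zero => simp
    | add x y hx hy => simp only [tmul_add, smul_add, map_add, LinearMap.add_apply, hx, hy]
    | tmul u v =>
      rw [smul_tmul', oppSeries_tmul, oppSeries_tmul, smul_eq_mul, substSub_mul, map_mul,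
        Module.End.mul_apply]

theorem oppSeries_der (c : ℤ → ℤ → LaurentSeries ℂ) (v u w : VacuumModule q ℓ) :
    oppSeries q ℓ (boxMul (der c v) (1 ⊗ₜ u)) w = ∑ p ∈ (grad q ℓ v).support,
      seriesAct _ (substSub (c p.1 p.2)) (mapCoeff (vacField q ℓ (grad q ℓ v p)) (vacField q ℓ u w)) := by
  rw [der, LinearMap.comp_apply, Finsupp.lsum_apply, Finsupp.sum, map_sum, LinearMap.sum_apply,
    map_sum, LinearMap.sum_apply]
  refine Finset.sum_congr rfl fun p _ => ?_
  rw [TensorProduct.mk_apply, boxMul_tmul, mul_one, oppSeries_tmul]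

theorem fieldK_der (c : ℤ → ℤ → LaurentSeries ℂ) (v w : VacuumModule q ℓ) :
    fieldK q ℓ (der c v) w = ∑ p ∈ (grad q ℓ v).support,
      fmul (c p.1 p.2) (vacField q ℓ (grad q ℓ v p) w) := by
  rw [der, LinearMap.comp_apply, Finsupp.lsum_apply, Finsupp.sum, map_sum, LinearMap.sum_apply]
  refine Finset.sum_congr rfl fun p _ => ?_
  rw [TensorProduct.mk_apply, fieldK_tmul, fieldMul_apply]

theorem substSub_kappa (hq0 : q ≠ 0) (r m s n : ℤ) : substSub (kappa q ℓ r m s n) =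
    powSer fun k => ((-1) ^ k * bc m k) • kappa q ℓ r (m - k) s n := by
  rw [substSub_eq]
  congr 1
  funext k
  rw [hasseDeriv_kappa' hq0, smul_smul]

/-- Recognizes the binomially weighted delta terms of the brackets with β_{m-k} as the expansion of
one power (x₂ - x₁)^{m-i}. -/
theorem substSub_single (m : ℤ) (i : ℕ) : bc m i • substSub (HahnSeries.single (m - i) 1) =
    powSer fun k => ((-1) ^ k * bc m k) •
      (bc (m - k) i • (HahnSeries.single (m - k - i) 1 : LaurentSeries ℂ)) := by
  rw [substSub_eq]
  apply HahnSeries.ext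
  funext n
  rw [HahnSeries.coeff_smul, powSer_coeff, powSer_coeff]
  split_ifs
  · generalize n.toNat = k
    rw [LaurentSeries.hasseDeriv_single]
    have h := bc_mul_bc_comm m i k
    rw [smul_smul, smul_smul]
    apply HahnSeries.ext
    funext N
    rw [HahnSeries.coeff_smul, HahnSeries.coeff_smul, HahnSeries.coeff_single,
      HahnSeries.coeff_single, sub_right_comm]
    split_ifs
    · simp only [smul_eq_mul, zsmul_eq_mul, mul_one]
      change _ * _ * bc (m - i) k = _
      linear_combination (-1 : ℂ) ^ k * h
    · rw [smul_zero, smul_zero]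
  · exact smul_zero _

theorem powSer_neg {M : Type*} [AddCommGroup M] [Module ℂ M] (p : ℕ → M) :
    (powSer fun k => -p k) = -powSer p := by
  apply HahnSeries.ext
  funext n
  rw [HahnSeries.coeff_neg, powSer_coeff, powSer_coeff]
  split_ifs <;> simp

/-- The commutator of `Y(v, x₂)` and `Res_{x} (x - x₁) ^ m β(x)`. -/
theorem mapCoeff_vacField_leftMode (hq0 : q ≠ 0) (hq : ∀ n : ℕ, 0 < n → q ^ n ≠ 1) (r m : ℤ)
    (v u w : VacuumModule q ℓ) :
    mapCoeff (vacField q ℓ v) (leftMode (betaOp q (VacuumModule q ℓ) r) m (vacField q ℓ u w)) =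
      leftMode (fun n => mapCoeff (betaOp q (VacuumModule q ℓ) r n)) m
        (oppSeries q ℓ (1 ⊗ₜ (v ⊗ₜ u)) w) -
      oppSeries q ℓ (boxMul (der (kappa q ℓ r m) v) (1 ⊗ₜ u)) w -
      ∑ᶠ i : ℕ, bc m i • seriesAct _ (substSub (HahnSeries.single (m - i) 1))
        (oppSeries q ℓ (1 ⊗ₜ (⁅beta q r i, v⁆ ⊗ₜ u)) w) := by
  obtain ⟨N, hN⟩ := (isRestricted_vacuumModule q ℓ).restricted r v
  have hN' : ∀ i : ℕ, N ≤ i → ⁅beta q r i, v⁆ = 0 := fun i hi => hN i (by exact_mod_cast hi)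
  -- The corrections are the two finite families of the commutator formula: the vectors β_i v with i
  -- < N, and the components of the gradient of v weighted by κ.
  have key := mapCoeff_leftMode_sum ((Finset.range N).disjSum (grad q ℓ v).support)
    (fmul (M := VacuumModule q ℓ)) (betaOp q (VacuumModule q ℓ) r)
    (fun n => mapCoeff (betaOp q (VacuumModule q ℓ) r n)) (vacField q ℓ v)
    (Sum.elim (fun i => vacField q ℓ ⁅beta q r i, v⁆) fun p => vacField q ℓ (grad q ℓ v p))
    (Sum.elim (fun i n => -(bc n i • (HahnSeries.single (n - i) 1 : LaurentSeries ℂ)))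
      fun p n => -kappa q ℓ r n p.1 p.2) (fun n a => by
      have e := LinearMap.congr_fun (adField_vacField (ℓ := ℓ) hq0 hq r n v) a
      have e' : (∑ᶠ j : ℕ, bc n j • fieldMul (HahnSeries.single (n - j) 1)
          (vacField q ℓ ⁅beta q r j, v⁆)) a = ∑ j ∈ Finset.range N,
          fmul (bc n j • (HahnSeries.single (n - j) 1 : LaurentSeries ℂ))
            (vacField q ℓ ⁅beta q r j, v⁆ a) := by
        rw [finsum_nat_eq_sum_range (N := N) (fun j hj => by rw [hN' j hj, map_zero, map_zero,
          smul_zero]), LinearMap.sum_apply]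
        refine Finset.sum_congr rfl fun j _ => ?_
        rw [map_smul]
        rfl
      rw [adField_apply, LinearMap.add_apply, e', fieldK_der] at e
      rw [Finset.sum_disjSum]
      simp only [Sum.elim_inl, Sum.elim_inr, map_neg, LinearMap.neg_apply, Finset.sum_neg_distrib]
      rw [← neg_add, ← sub_eq_add_neg, add_comm (∑ j ∈ Finset.range N, _), ← e,
        sub_sub_cancel]) m (vacField q ℓ u w)
  rw [key, Finset.sum_disjSum, oppSeries_one_tmul, oppSeries_der, finsum_nat_eq_sum_range (N := N)]
  · simp only [Sum.elim_inl, Sum.elim_inr, smul_neg, powSer_neg, map_neg, LinearMap.neg_apply,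
      Finset.sum_neg_distrib, ← substSub_single, ← substSub_kappa hq0, oppSeries_one_tmul, seriesAct,
      map_smul, LinearMap.smul_apply]
    abel
  · intro i hi
    rw [hN' i hi, zero_tmul, tmul_zero, map_zero, LinearMap.zero_apply, map_zero, smul_zero]

theorem seriesAct_leftMode (r m : ℤ) (k : LaurentSeries (LaurentSeries ℂ))
    (g : LaurentSeries (LaurentSeries (VacuumModule q ℓ))) :
    seriesAct _ k (leftMode (fun n => mapCoeff (betaOp q (VacuumModule q ℓ) r n)) m g) =
      leftMode (fun n => mapCoeff (betaOp q (VacuumModule q ℓ) r n)) m (seriesAct _ k g) := by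
  refine serAct_comm_apply _ _ _ _ (fun i j x => ?_) g
  rw [leftSer, powSer_coeff]
  split_ifs
  · simp [mapCoeff_fmul]
  · simp

/-- The recursion for `f(x₂ - x₁) Y(v, x₂) Y(β_m u, x₁) w`. -/
theorem oppSeries_opR_bOp (hq0 : q ≠ 0) (hq : ∀ n : ℕ, 0 < n → q ^ n ≠ 1) (r m : ℤ)
    (z : LaurentSeries ℂ ⊗[ℂ] (VacuumModule q ℓ ⊗[ℂ] VacuumModule q ℓ)) (w : VacuumModule q ℓ) :
    oppSeries q ℓ (opR (bOp q ℓ (LaurentSeries ℂ) r m) z) w +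
      oppSeries q ℓ (opL (derOp q ℓ (kappa q ℓ r m)) z) w =
    leftMode (fun n => mapCoeff (betaOp q (VacuumModule q ℓ) r n)) m (oppSeries q ℓ z w) -
      (∑ᶠ j : ℕ, fmul (rightCoeff m j) (oppSeries q ℓ z ⁅beta q r j, w⁆)) -
      ∑ᶠ i : ℕ, bc m i • seriesAct _ (substSub (HahnSeries.single (m - i) 1))
        (oppSeries q ℓ (opL (bOp q ℓ (LaurentSeries ℂ) r i) z) w) := by
  have hf1 : ∀ z : LaurentSeries ℂ ⊗[ℂ] (VacuumModule q ℓ ⊗[ℂ] VacuumModule q ℓ),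
      (Function.support fun j : ℕ =>
        fmul (rightCoeff m j) (oppSeries q ℓ z ⁅beta q r j, w⁆)).Finite := fun z =>
    (beta_finite r w).subset fun j hj h0 => hj (by
      simp only at h0 ⊢
      rw [h0, map_zero, map_zero])
  have hf2 : ∀ z : LaurentSeries ℂ ⊗[ℂ] (VacuumModule q ℓ ⊗[ℂ] VacuumModule q ℓ),
      (Function.support fun i : ℕ =>
        bc m i • seriesAct _ (substSub (HahnSeries.single (m - i) 1))
        (oppSeries q ℓ (opL (bOp q ℓ (LaurentSeries ℂ) r i) z) w)).Finite := fun z =>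
    (opL_bOp_finite r z).subset fun j hj h0 => hj (by
      simp only at h0 ⊢
      rw [h0, map_zero, LinearMap.zero_apply, map_zero, smul_zero])
  have hadd : ∀ x y : LaurentSeries ℂ ⊗[ℂ] (VacuumModule q ℓ ⊗[ℂ] VacuumModule q ℓ),
      (∑ᶠ j : ℕ, fmul (rightCoeff m j) (oppSeries q ℓ (x + y) ⁅beta q r j, w⁆) =
        (∑ᶠ j : ℕ, fmul (rightCoeff m j) (oppSeries q ℓ x ⁅beta q r j, w⁆)) +
        ∑ᶠ j : ℕ, fmul (rightCoeff m j) (oppSeries q ℓ y ⁅beta q r j, w⁆)) ∧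
      ∑ᶠ i : ℕ, bc m i • seriesAct _ (substSub (HahnSeries.single (m - i) 1))
          (oppSeries q ℓ (opL (bOp q ℓ (LaurentSeries ℂ) r i) (x + y)) w) =
        (∑ᶠ i : ℕ, bc m i • seriesAct _ (substSub (HahnSeries.single (m - i) 1))
          (oppSeries q ℓ (opL (bOp q ℓ (LaurentSeries ℂ) r i) x) w)) +
        ∑ᶠ i : ℕ, bc m i • seriesAct _ (substSub (HahnSeries.single (m - i) 1))
          (oppSeries q ℓ (opL (bOp q ℓ (LaurentSeries ℂ) r i) y) w) := fun x y => by
    rw [← finsum_add_distrib (hf1 x) (hf1 y), ← finsum_add_distrib (hf2 x) (hf2 y)]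
    exact ⟨finsum_congr fun j => by simp only [map_add, LinearMap.add_apply],
      finsum_congr fun j => by simp only [map_add, LinearMap.add_apply, smul_add]⟩
  induction z using TensorProduct.induction_on with
  | zero => simp
  | add x y hx hy =>
    rw [(hadd x y).1, (hadd x y).2]
    simp only [map_add, LinearMap.add_apply] at hx hy ⊢
    rw [add_add_add_comm, hx, hy]
    abel
  | tmul k p =>
    induction p using TensorProduct.induction_on with
    | zero => simp
    | add x y hx hy =>
      rw [tmul_add, (hadd _ _).1, (hadd _ _).2]
      simp only [map_add, LinearMap.add_apply] at hx hy ⊢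
      rw [add_add_add_comm, hx, hy]
      abel
    | tmul v u =>
      have h : k ⊗ₜ[ℂ] (v ⊗ₜ[ℂ] u) = k • boxMul ((1 : LaurentSeries ℂ) ⊗ₜ v) (1 ⊗ₜ u) := by
        simp [smul_tmul']
      have e1 : ∀ j : ℕ, fmul (rightCoeff m j) (oppSeries q ℓ
          (k • boxMul ((1 : LaurentSeries ℂ) ⊗ₜ v) (1 ⊗ₜ u)) ⁅beta q r j, w⁆) =
          seriesAct _ (substSub k) (mapCoeff (vacField q ℓ v)
            (fmul (rightCoeff m j) (vacField q ℓ u ⁅beta q r j, w⁆))) := fun j => by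
        rw [oppSeries_smul, boxMul_tmul, mul_one, oppSeries_one_tmul, mapCoeff_fmul]
        exact (serAct_fmul_comm _ _ _ _).symm
      have e2 : ∀ i : ℕ, bc m i • seriesAct _ (substSub (HahnSeries.single (m - i) 1))
          (oppSeries q ℓ (opL (bOp q ℓ (LaurentSeries ℂ) r i)
            (k • boxMul ((1 : LaurentSeries ℂ) ⊗ₜ v) (1 ⊗ₜ u))) w) =
          seriesAct _ (substSub k) (bc m i • seriesAct _ (substSub (HahnSeries.single (m - i) 1))
            (oppSeries q ℓ (1 ⊗ₜ (⁅beta q r i, v⁆ ⊗ₜ u)) w)) := fun i => by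
        rw [LinearMap.map_smul (opL _), oppSeries_smul, opL_boxMul, bOp_tmul, boxMul_tmul, mul_one,
          map_smul]
        congr 1
        exact serAct_left_comm _ _ _ _
      have h3 : (Function.support fun i : ℕ =>
          bc m i • seriesAct _ (substSub (HahnSeries.single (m - i) 1))
            (oppSeries q ℓ (1 ⊗ₜ (⁅beta q r i, v⁆ ⊗ₜ u)) w)).Finite :=
        (beta_finite r v).subset fun j hj h0 => hj (by
          simp only at h0 ⊢
          rw [h0, zero_tmul, tmul_zero, map_zero, LinearMap.zero_apply, map_zero, smul_zero])
      rw [h, finsum_congr e1, finsum_congr e2, ← map_finsum _ h3, LinearMap.map_smul (opR _),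
        LinearMap.map_smul (opL _), oppSeries_smul, oppSeries_smul, oppSeries_smul,
        ← seriesAct_leftMode, opR_boxMul, opL_boxMul, bOp_tmul, derOp_tmul, boxMul_tmul, boxMul_tmul,
        mul_one]
      have h4 : ∑ᶠ j : ℕ, seriesAct _ (substSub k) (mapCoeff (vacField q ℓ v)
            (fmul (rightCoeff m j) (vacField q ℓ u ⁅beta q r j, w⁆))) =
          seriesAct _ (substSub k) (mapCoeff (vacField q ℓ v)
            (∑ᶠ j : ℕ, fmul (rightCoeff m j) (vacField q ℓ u ⁅beta q r j, w⁆))) :=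
        (map_finsum ((seriesAct _ (substSub k)) ∘ₗ (mapCoeff (vacField q ℓ v)))
          (vacField_beta_finite r m u w)).symm
      rw [h4, ← map_add, ← map_sub, ← map_sub]
      congr 1
      rw [oppSeries_one_tmul v ⁅beta q r m, u⁆, vacField_beta, map_sub,
        mapCoeff_vacField_leftMode hq0 hq]
      abel

/-- The coefficients of a series in `M((x₂))((x₁))`. -/
def coeffs (M : Type*) [AddCommGroup M] [Module ℂ M] :
    LaurentSeries (LaurentSeries M) →ₗ[ℂ] ℤ → ℤ → M where
  toFun g i j := (g.coeff i).coeff j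
  map_add' _ _ := rfl
  map_smul' _ _ := rfl

section Coeffs

variable {M : Type*} [AddCommGroup M] [Module ℂ M]

theorem coeffs_apply (g : LaurentSeries (LaurentSeries M)) (i j : ℤ) :
    coeffs M g i j = (g.coeff i).coeff j := rfl

theorem bddFst_coeffs (g : LaurentSeries (LaurentSeries M)) : BddFst (coeffs M g) := by
  obtain ⟨I, hI⟩ := exists_coeff_eq_zero g
  exact ⟨I, fun i j hi => by rw [coeffs_apply, hI i hi, HahnSeries.coeff_zero]⟩

theorem finite_support_coeff_sub (g : LaurentSeries M) (n : ℤ) :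
    (Function.support fun k : ℕ => g.coeff (n - k)).Finite := by
  obtain ⟨I, hI⟩ := exists_coeff_eq_zero g
  exact finite_support_of_eventually_zero (N := (n - I + 1).toNat) fun k hk => hI _ (by omega)

theorem coeffs_leftMode (β : ℤ → Module.End ℂ M) (m : ℤ) (g : LaurentSeries (LaurentSeries M)) :
    coeffs M (leftMode (fun n => mapCoeff (β n)) m g) =
      powSumFst (fun k => ((-1) ^ k * bc m k) • β (m - k)) (coeffs M g) := by
  funext i j
  rw [coeffs_apply, leftMode_coeff, coeff_finsum, powSumFst]
  · rfl
  · exact (finite_support_coeff_sub g i).subset fun k hk h => hk (by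
      simp only at h ⊢
      rw [h, map_zero, smul_zero])

theorem coeffs_rightCoeff (m : ℤ) (p : ℕ) (g : LaurentSeries (LaurentSeries M)) :
    coeffs M (fmul (rightCoeff m p) g) =
      ((-1 : ℂ) ^ (m - p) * bc m p) • shiftFst (m - p) (coeffs M g) := by
  funext i j
  rw [coeffs_apply, rightCoeff, fmul_single]
  rfl

theorem coeffs_seriesAct_single (n : ℤ) (g : LaurentSeries (LaurentSeries M)) :
    coeffs M (seriesAct M (substSub (HahnSeries.single n 1)) g) = expFst (-1) n (coeffs M g) := by
  funext i j
  rw [coeffs_apply, substSub_eq, seriesAct, serAct_powSer_coeff, coeff_finsum, expFst]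
  · refine finsum_congr fun k => ?_
    rw [LaurentSeries.hasseDeriv_single, map_smul, LinearMap.smul_apply, HahnSeries.coeff_smul,
      fmul_single, coeffs_apply, smul_smul, mul_comm]
    congr 2
    · simp [bc]
    · ring
  · exact (finite_support_coeff_sub g i).subset fun k hk h => hk (by
      simp only at h ⊢
      rw [h, map_zero])

theorem mulLin_pow_powSumFst (c : ℂ) (l : ℕ) (T : ℕ → Module.End ℂ M) (G : ℤ → ℤ → M)
    (hG : ∀ j, ∃ I : ℤ, ∀ i < I, G i j = 0) :
    (mulLin c ^ l) (powSumFst T G) = powSumFst T ((mulLin c ^ l) G) := by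
  change (mulLin c ^ l) (fun i j => ∑ᶠ k : ℕ, T k (shiftFst k G i j)) = _
  rw [mulLin_pow_finsum]
  · funext i j
    refine finsum_congr fun k => ?_
    rw [mulLin_pow_map, mulLin_pow_shiftFst]
    rfl
  · intro i j
    obtain ⟨I, hI⟩ := hG j
    exact finite_support_of_eventually_zero (N := (i - I + 1).toNat) fun k hk => by
      rw [shiftFst_apply, hI _ (by omega), map_zero]

end Coeffs

/-- The counterpart of `prodSeries_beta`: 𝒮 has absorbed the κ terms, and the only difference left
is the direction in which the power of x₁ - x₂ is expanded. -/
theorem coeffs_oppSeries_Sop_beta (hq0 : q ≠ 0) (hq : ∀ n : ℕ, 0 < n → q ^ n ≠ 1) (r m : ℤ)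
    (u v w : VacuumModule q ℓ) {N : ℕ}
    (hw : ∀ p : ℕ, N ≤ p → betaOp q (VacuumModule q ℓ) r p w = 0)
    (hv : ∀ t : ℕ, N ≤ t → ⁅beta q r t, v⁆ = 0) :
    coeffs _ (oppSeries q ℓ (Sop q ℓ (v ⊗ₜ ⁅beta q r m, u⁆)) w) =
      powSumFst (fun k => ((-1) ^ k * bc m k) • betaOp q (VacuumModule q ℓ) r (m - k))
        (coeffs _ (oppSeries q ℓ (Sop q ℓ (v ⊗ₜ u)) w)) -
      (∑ p ∈ Finset.range N, ((-1 : ℂ) ^ (m - p) * bc m p) • shiftFst (m - p)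
        (coeffs _ (oppSeries q ℓ (Sop q ℓ (v ⊗ₜ u)) (betaOp q (VacuumModule q ℓ) r p w))) +
      ∑ t ∈ Finset.range N, bc m t • expFst (-1) (m - t)
        (coeffs _ (oppSeries q ℓ (Sop q ℓ (⁅beta q r t, v⁆ ⊗ₜ u)) w))) := by
  have h2 : ∀ j : ℕ, opL (bOp q ℓ (LaurentSeries ℂ) r j) (Sop q ℓ (v ⊗ₜ u)) =
      Sop q ℓ (⁅beta q r j, v⁆ ⊗ₜ u) := fun j => by
    rw [isTwist_Sop.beta_left (fun _ _ _ _ h => kappa_of_nonneg_right _ _ _ _ h)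
      (fun _ _ _ _ h => kappa_of_nonneg_left _ _ _ _ h) r j v u, show (fun r' m' =>
        kappa q ℓ r' m' r (j : ℤ)) = 0 from funext fun r' => funext fun m' =>
        kappa_of_nonneg_right _ _ _ _ (by omega), derOp_zero, opR_zero, LinearMap.zero_apply,
      add_zero]
  rw [isTwist_Sop.beta_right r m v u, map_add, LinearMap.add_apply, oppSeries_opR_bOp hq0 hq,
    finsum_nat_eq_sum_range (N := N), finsum_nat_eq_sum_range (N := N), map_sub, map_sub, map_sum,
    map_sum, coeffs_leftMode, sub_sub]
  · simp only [coeffs_rightCoeff, map_smul, coeffs_seriesAct_single, h2]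
    rfl
  · intro t ht
    rw [h2, hv t ht, zero_tmul, map_zero, map_zero, LinearMap.zero_apply, map_zero, smul_zero]
  · intro p hp
    have := hw p hp
    rw [betaOp_apply] at this
    rw [this, map_zero, map_zero]

/-- The exponent must not depend on w, as locality is an identity of operators. It can be chosen
from u and v alone, because only the powers attached to β_t v need to be cleared. -/
theorem exists_mulLin_pow_prodSeries_eq (hq0 : q ≠ 0) (hq : ∀ n : ℕ, 0 < n → q ^ n ≠ 1)
    (u v : VacuumModule q ℓ) : ∃ l : ℕ, ∀ l', l ≤ l' → ∀ w,
      (mulLin (-1) ^ l') (prodSeries (isRestricted_vacuumModule q ℓ) hasLevel_vacuumModule u v w) =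
        (mulLin (-1) ^ l') (coeffs _ (oppSeries q ℓ (Sop q ℓ (v ⊗ₜ u)) w)) := by
  induction u using vacuum_induction generalizing v with
  | h0 =>
    refine ⟨0, fun l' _ w => ?_⟩
    congr 1
    funext i j
    rw [prodSeries_vac, Sop_vac_right, oppSeries_one_tmul, coeffs_apply, mapCoeff_coeff, vacField,
      fieldMap_vac, idField_coeff]
    split_ifs with h
    · rfl
    · rw [map_zero, HahnSeries.coeff_zero]
  | hβ r m u ih =>
    obtain ⟨N, hN⟩ := (isRestricted_vacuumModule q ℓ).restricted r v
    choose L hL using ih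
    -- N bounds the modes not killing v and is independent of w; |m - t| keeps the exponent m - t +
    -- l' above the bound for β_t v.
    refine ⟨L v + ∑ t ∈ Finset.range N, (L ⁅beta q r t, v⁆ + (m - t).natAbs), fun l' hl' w => ?_⟩
    obtain ⟨N', hw, hv⟩ := exists_annihilation_bound r v w (isRestricted_vacuumModule q ℓ)
    rw [prodSeries_beta _ _ r m u v w hw hv, coeffs_oppSeries_Sop_beta hq0 hq r m u v w hw hv,
      map_sub, map_sub, map_add, map_add, map_sum, map_sum, map_sum, map_sum,
      mulLin_pow_powSumFst _ _ _ _ (prodSeries_lower _ _ u v w),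
      mulLin_pow_powSumFst _ _ _ _ (fun j => by
        obtain ⟨I, hI⟩ := bddFst_coeffs (oppSeries q ℓ (Sop q ℓ (v ⊗ₜ u)) w)
        exact ⟨I, fun i hi => hI i j hi⟩), hL v l' (by omega) w]
    congr 2
    · refine Finset.sum_congr rfl fun p _ => ?_
      rw [map_smul, map_smul, mulLin_pow_shiftFst, mulLin_pow_shiftFst, hL v l' (by omega)]
    -- The range here may depend on w, but its terms with t ≥ N are zero.
    · refine Finset.sum_congr rfl fun t _ => ?_
      rcases le_or_gt N t with ht | ht
      · have h0 : ⁅beta q r t, v⁆ = 0 := hN t (by exact_mod_cast ht)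
        rw [h0, zero_tmul, map_zero, map_zero, LinearMap.zero_apply, map_zero]
        have e1 : prodSeries (isRestricted_vacuumModule q ℓ) hasLevel_vacuumModule u 0 w = 0 := by
          funext i j
          simp [prodSeries]
        have e2 : expSnd (-1) (m - t) (0 : ℤ → ℤ → VacuumModule q ℓ) = 0 := by
          funext i j
          simp [expSnd]
        have e3 : expFst (-1) (m - t) (0 : ℤ → ℤ → VacuumModule q ℓ) = 0 := by
          funext i j
          simp [expFst]
        rw [e1, e2, e3, smul_zero, smul_zero]
      · have h' := Finset.single_le_sum (f := fun t : ℕ => L ⁅beta q r t, v⁆ + (m - t).natAbs)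
          (fun _ _ => Nat.zero_le _) (Finset.mem_range.2 ht)
        obtain ⟨n', hn'⟩ : ∃ n' : ℕ, m - t + l' = n' := ⟨(m - t + l').toNat, by omega⟩
        rw [map_smul, map_smul, mulLin_pow_expSnd' _ _ n' _ hn' (bddSnd_prodSeries _ _ _ _ _),
          mulLin_pow_expFst _ (by norm_num) _ n' _ hn' (bddFst_coeffs _),
          hL ⁅beta q r t, v⁆ n' (by omega), smul_smul, mul_comm]
        congr 2
        -- The sign (-1)^{l' + n'} from reversing x₁ - x₂ equals the sign (-1)^{m-t} in the product
        -- recursion.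
        have : (m - t : ℤ) = ((l' + n' : ℕ) : ℤ) - 2 * l' := by push_cast; omega
        rw [this, zpow_sub₀ (by norm_num), zpow_natCast, zpow_mul]
        norm_num
  | hadd u u' hu hu' =>
    obtain ⟨l, hl⟩ := hu v
    obtain ⟨k, hk⟩ := hu' v
    refine ⟨max l k, fun l' h w => ?_⟩
    rw [prodSeries_add, tmul_add, map_add, map_add, map_add, LinearMap.add_apply, map_add, map_add,
      hl l' ((le_max_left _ _).trans h), hk l' ((le_max_right _ _).trans h)]
  | hsmul c u hu =>
    obtain ⟨l, hl⟩ := hu v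
    refine ⟨l, fun l' h w => ?_⟩
    rw [prodSeries_smul, tmul_smul, map_smul, map_smul, map_smul, LinearMap.smul_apply, map_smul,
      map_smul, hl l' h]

theorem exists_eq_sum_tmul {K M N : Type*} [AddCommGroup K] [Module ℂ K] [AddCommGroup M]
    [Module ℂ M] [AddCommGroup N] [Module ℂ N] (z : K ⊗[ℂ] (M ⊗[ℂ] N)) :
    ∃ (n : ℕ) (f : Fin n → K) (a : Fin n → M) (b : Fin n → N),
      z = ∑ t, f t ⊗ₜ (a t ⊗ₜ b t) := by
  have hadd : ∀ x y : K ⊗[ℂ] (M ⊗[ℂ] N),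
      (∃ (n : ℕ) (f : Fin n → K) (a : Fin n → M) (b : Fin n → N), x = ∑ t, f t ⊗ₜ (a t ⊗ₜ b t)) →
      (∃ (n : ℕ) (f : Fin n → K) (a : Fin n → M) (b : Fin n → N), y = ∑ t, f t ⊗ₜ (a t ⊗ₜ b t)) →
      ∃ (n : ℕ) (f : Fin n → K) (a : Fin n → M) (b : Fin n → N),
        x + y = ∑ t, f t ⊗ₜ (a t ⊗ₜ b t) := by
    rintro _ _ ⟨n, f, a, b, rfl⟩ ⟨n', f', a', b', rfl⟩
    exact ⟨n + n', Fin.append f f', Fin.append a a', Fin.append b b', by simp [Fin.sum_univ_add]⟩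
  induction z using TensorProduct.induction_on with
  | zero => exact ⟨0, Fin.elim0, Fin.elim0, Fin.elim0, by simp⟩
  | add x y hx hy => exact hadd x y hx hy
  | tmul k p =>
    induction p using TensorProduct.induction_on with
    | zero => exact ⟨0, Fin.elim0, Fin.elim0, Fin.elim0, by simp⟩
    | add x y hx hy => rw [tmul_add]; exact hadd _ _ hx hy
    | tmul a b => exact ⟨1, fun _ => k, fun _ => a, fun _ => b, by simp⟩

/-- The support is finite only after bounding the x₁-exponent, uniformly, and then the x₂-exponent
for each x₁-exponent; this justifies the sum over pairs. -/
theorem oppSeries_tmul_coeff (f : LaurentSeries ℂ) (v u w : VacuumModule q ℓ) (i j : ℤ) :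
    ((oppSeries q ℓ (f ⊗ₜ (v ⊗ₜ u)) w).coeff i).coeff j = ∑ᶠ p : ℤ × ℤ,
      expandSub f p.1 p.2 • (vacField q ℓ v ((vacField q ℓ u w).coeff (i - p.1))).coeff (j - p.2) := by
  obtain ⟨I, hI⟩ := exists_coeff_eq_zero (substSub f)
  obtain ⟨I', hI'⟩ := exists_coeff_eq_zero (vacField q ℓ u w)
  have hfin : (Function.support fun a : ℤ => fmul ((substSub f).coeff a)
      ((mapCoeff (vacField q ℓ v) (vacField q ℓ u w)).coeff (i - a))).Finite := by
    refine (Set.finite_Icc I (i - I')).subset fun a ha => ?_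
    by_contra h
    rw [Set.mem_Icc, not_and_or, not_le, not_le] at h
    refine ha ?_
    simp only
    rcases h with h | h
    · rw [hI a h, map_zero, LinearMap.zero_apply]
    · rw [mapCoeff_coeff, hI' _ (by omega), map_zero, map_zero]
  rw [oppSeries_tmul, seriesAct, serAct_coeff, coeff_finsum hfin, ← finsum_prod_eq (f := fun a b =>
    expandSub f a b • (vacField q ℓ v ((vacField q ℓ u w).coeff (i - a))).coeff (j - b))]
  · refine finsum_congr fun a => ?_
    rw [fmul_coeff]
    simp only [substSub_coeff, mapCoeff_coeff]
  · choose J hJ using fun a => exists_coeff_eq_zero ((substSub f).coeff a)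
    choose J' hJ' using fun a : ℤ =>
      exists_coeff_eq_zero (vacField q ℓ v ((vacField q ℓ u w).coeff (i - a)))
    refine ((Set.finite_Icc I (i - I')).biUnion fun a _ => ((Set.finite_Icc (J a) (j - J' a)).image
      fun b => (a, b))).subset ?_
    rintro ⟨a, b⟩ hab
    simp only [Function.mem_support, ← substSub_coeff] at hab
    refine Set.mem_biUnion (x := a) ?_ ⟨b, ?_, rfl⟩
    · constructor <;> by_contra h <;> refine hab ?_
      · rw [hI a (by omega), HahnSeries.coeff_zero, zero_smul]
      · rw [hI' (i - a) (by omega), map_zero, HahnSeries.coeff_zero, smul_zero]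
    · constructor <;> by_contra h <;> refine hab ?_
      · rw [hJ a b (by omega), zero_smul]
      · rw [hJ' a (j - b) (by omega), smul_zero]

theorem S_locality_vacOp (hq0 : q ≠ 0) (hq : ∀ n : ℕ, 0 < n → q ^ n ≠ 1) (u v : VacuumModule q ℓ) :
    ∃ (r : ℕ) (u' v' : Fin r → VacuumModule q ℓ) (f : Fin r → LaurentSeries ℂ) (k : ℕ), ∀ w,
      mulSubPow k (fun i j => (vacOp q ℓ u).coeff i ((vacOp q ℓ v).coeff j w)) =
      mulSubPow k (fun i j => ∑ t : Fin r, ∑ᶠ p : ℤ × ℤ, expandSub (f t) p.1 p.2 •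
        (vacOp q ℓ (v' t)).coeff (j - p.2) ((vacOp q ℓ (u' t)).coeff (i - p.1) w)) := by
  obtain ⟨n, f, a, b, h⟩ := exists_eq_sum_tmul (Sop q ℓ (v ⊗ₜ u))
  obtain ⟨l, hl⟩ := exists_mulLin_pow_prodSeries_eq hq0 hq u v
  refine ⟨n, b, a, f, l, fun w => ?_⟩
  rw [mulSubPow_eq, mulSubPow_eq]
  refine (hl l le_rfl w).trans ?_
  congr 1
  funext i j
  rw [h, map_sum, LinearMap.sum_apply, coeffs_apply, HahnSeries.coeff_sum, HahnSeries.coeff_sum]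
  exact Finset.sum_congr rfl fun t _ => oppSeries_tmul_coeff _ _ _ _ _ _

end Locality

end QVA

namespace QVA

attribute [local instance] laurentAlgebra

/-! ### A Fock space action, showing that V is nonzero. -/

section Fock

/-- The constant-coefficient derivation part of the operator of `β_m` on the Fock space. -/
def fockDer (q ℓ : ℂ) (r m : ℤ) :
    Derivation ℂ (MvPolynomial (ℤ × ℤ) ℂ) (MvPolynomial (ℤ × ℤ) ℂ) :=
  MvPolynomial.mkDerivation ℂ fun p =>
    MvPolynomial.C ((if m < 0 then 1 / 2 else 1) * (structureConst q r p.1 m p.2 * ℓ))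

theorem fockDer_X (q ℓ : ℂ) (r m s n : ℤ) : fockDer q ℓ r m (MvPolynomial.X (s, n)) =
    MvPolynomial.C ((if m < 0 then 1 / 2 else 1) * (structureConst q r s m n * ℓ)) :=
  MvPolynomial.mkDerivation_X _ _ _

theorem fockDer_comm (q ℓ : ℂ) (r m s n : ℤ) (f : MvPolynomial (ℤ × ℤ) ℂ) :
    fockDer q ℓ r m (fockDer q ℓ s n f) = fockDer q ℓ s n (fockDer q ℓ r m f) := by
  have h : ⁅fockDer q ℓ r m, fockDer q ℓ s n⁆ = 0 := by
    refine MvPolynomial.derivation_ext fun p => ?_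
    rw [Derivation.commutator_apply, fockDer_X, fockDer_X]
    simp [MvPolynomial.derivation_C]
  have := Derivation.congr_fun h f
  rwa [Derivation.commutator_apply, Derivation.zero_apply, sub_eq_zero] at this

/-- The operator of `β_m` on the Fock space. -/
def fockOp (q ℓ : ℂ) (r m : ℤ) : Module.End ℂ (MvPolynomial (ℤ × ℤ) ℂ) :=
  (if m < 0 then LinearMap.mulLeft ℂ (MvPolynomial.X (r, m)) else 0) + (fockDer q ℓ r m).toLinearMap

theorem fockOp_apply (q ℓ : ℂ) (r m : ℤ) (f : MvPolynomial (ℤ × ℤ) ℂ) : fockOp q ℓ r m f =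
    (if m < 0 then MvPolynomial.X (r, m) else 0) * f + fockDer q ℓ r m f := by
  rw [fockOp, LinearMap.add_apply]
  split_ifs <;> simp

/-- Creation operators do not commute with each other here, so each carries half the cocycle as a
derivation; by antisymmetry two halves make a whole. -/
theorem fockOp_comm {q ℓ : ℂ} (hq0 : q ≠ 0) (hq : ∀ n : ℕ, 0 < n → q ^ n ≠ 1) (r s m n : ℤ) :
    fockOp q ℓ r m * fockOp q ℓ s n - fockOp q ℓ s n * fockOp q ℓ r m =
      (structureConst q r s m n * ℓ) • 1 := by
  refine LinearMap.ext fun f => ?_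
  have hX : ∀ r m s n : ℤ, fockDer q ℓ r m (if n < 0 then MvPolynomial.X (s, n) else 0) =
      MvPolynomial.C (if n < 0 then
        (if m < 0 then 1 / 2 else 1) * (structureConst q r s m n * ℓ) else 0) := fun r m s n => by
    split_ifs with h h'
    · rw [fockDer_X, if_pos h']
    · rw [fockDer_X, if_neg h']
    · rw [map_zero, map_zero]
  rw [LinearMap.sub_apply, Module.End.mul_apply, Module.End.mul_apply, LinearMap.smul_apply,
    Module.End.one_apply]
  simp only [fockOp_apply, map_add, Derivation.leibniz, hX, smul_eq_mul]
  rw [fockDer_comm q ℓ r m s n, MvPolynomial.smul_eq_C_mul]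
  have h : (if n < 0 then (if m < 0 then 1 / 2 else 1) * (structureConst q r s m n * ℓ) else 0) -
      (if m < 0 then (if n < 0 then 1 / 2 else 1) * (structureConst q s r n m * ℓ) else 0) =
      structureConst q r s m n * ℓ := by
    rw [structureConst_antisymm hq0 hq r s m n]
    split_ifs with h1 h2 h2
    · ring
    · ring
    · ring
    · rw [structureConst_nonneg_left _ _ _ _ _ (by omega)]
      split_ifs with h3
      · rw [show m = 0 by omega]; simp
      · simp
  have h' := congrArg (MvPolynomial.C (σ := ℤ × ℤ)) h
  rw [map_sub] at h'
  linear_combination f * h'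

theorem vac_ne_zero {q ℓ : ℂ} (hq0 : q ≠ 0) (hq : ∀ n : ℕ, 0 < n → q ^ n ≠ 1) : vac q ℓ ≠ 0 := by
  intro h
  have h1 := vacLift_vac (q := q) (ℓ := ℓ) (fockOp q ℓ) (fockOp_comm hq0 hq) 1 fun r m hm => by
    rw [fockOp_apply, if_neg (by omega)]; simp
  rw [h, map_zero] at h1
  exact zero_ne_one h1

end Fock

/-! ### The filtration by the number of modes, and vectors killed by annihilation operators. -/

section Filtration

variable {q ℓ : ℂ}

theorem grad_apply_of_nonneg (v : VacuumModule q ℓ) (s n : ℤ) (hn : 0 ≤ n) :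
    grad q ℓ v (s, n) = 0 := by
  induction v using vacuum_induction with
  | h0 => rw [grad_vac]; rfl
  | hβ r m v hv =>
    rw [grad_beta, Finsupp.add_apply, Finsupp.mapRange.linearMap_apply, Finsupp.mapRange_apply, hv,
      map_zero, zero_add]
    split_ifs with h
    · rw [Finsupp.single_eq_of_ne]
      rintro ⟨⟩
      omega
    · rfl
  | hadd u v hu hv => rw [map_add, Finsupp.add_apply, hu, hv, add_zero]
  | hsmul c v hv => rw [map_smul, Finsupp.smul_apply, hv, smul_zero]

theorem grad_beta_apply (r m : ℤ) (v : VacuumModule q ℓ) (p : ℤ × ℤ) :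
    grad q ℓ ⁅beta q r m, v⁆ p =
      ⁅beta q r m, grad q ℓ v p⁆ + if m < 0 ∧ p = (r, m) then v else 0 := by
  rw [grad_beta, Finsupp.add_apply, Finsupp.mapRange.linearMap_apply, Finsupp.mapRange_apply]
  congr 1
  by_cases h : m < 0
  · rw [if_pos h, Finsupp.single_apply]
    simp [h, eq_comm]
  · rw [if_neg h, if_neg (by tauto)]
    rfl

/-- The annihilation operators as partial derivatives. -/
theorem beta_eq_grad (r m : ℤ) (hm : 0 ≤ m) (v : VacuumModule q ℓ) :
    ⁅beta q r m, v⁆ = (ℓ * m) • (grad q ℓ v (r, -m) - grad q ℓ v (r - 1, -m)) := by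
  induction v using vacuum_induction with
  | h0 => rw [grad_vac, beta_vac r m hm]; simp
  | hβ s n v hv =>
    have h := betaOp_comm (W := VacuumModule q ℓ) hasLevel_vacuumModule r s m n v
    simp only [betaOp_apply] at h
    rw [h, hv, grad_beta_apply, grad_beta_apply, lie_smul, lie_sub, structureConst_nonneg_left _ _ _ _ _ hm,
      add_sub_add_comm, smul_add]
    congr 1
    simp only [Prod.mk.injEq, deltaDiff]
    by_cases h0 : m + n = 0
    · rcases hm.eq_or_lt with rfl | hm'
      · simp
      · have e1 : (n < 0 ∧ r = s ∧ -m = n) = (r = s) := by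
          simp only [eq_iff_iff]; constructor
          · exact fun h => h.2.1
          · intro h; omega
        have e2 : (n < 0 ∧ r - 1 = s ∧ -m = n) = (r = s + 1) := by
          simp only [eq_iff_iff]; constructor <;> intro h <;> omega
        simp only [e1, e2, if_pos h0]
        split_ifs <;> first | omega | simp [mul_comm]
    · rw [if_neg h0, if_neg (c := n < 0 ∧ r = s ∧ -m = n) (by omega),
        if_neg (c := n < 0 ∧ r - 1 = s ∧ -m = n) (by omega)]
      simp
  | hadd u v hu hv => rw [lie_add, hu, hv, map_add, Finsupp.add_apply, Finsupp.add_apply]; module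
  | hsmul c v hv => rw [lie_smul, hv, map_smul, Finsupp.smul_apply, Finsupp.smul_apply]; module

/-- By `beta_eq_grad` and ℓ ≠ 0, neighbouring derivatives ∂_{r,n}v and ∂_{r-1,n}v agree; a nonzero
one would give infinitely many nonzero components. -/
theorem grad_eq_zero (hℓ : ℓ ≠ 0) {v : VacuumModule q ℓ}
    (hv : ∀ r m : ℤ, 0 < m → ⁅beta q r m, v⁆ = 0) : grad q ℓ v = 0 := by
  have hstep : ∀ r n : ℤ, n < 0 → grad q ℓ v (r, n) = grad q ℓ v (r - 1, n) := by
    intro r n hn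
    have h := beta_eq_grad r (-n) (by omega) v
    rw [hv r (-n) (by omega), neg_neg] at h
    have hne : ℓ * ((-n : ℤ) : ℂ) ≠ 0 := mul_ne_zero hℓ (by exact_mod_cast (by omega : -n ≠ 0))
    exact sub_eq_zero.1 ((smul_eq_zero.1 h.symm).resolve_left hne)
  ext ⟨s, n⟩
  rw [Finsupp.zero_apply]
  rcases lt_or_ge n 0 with hn | hn
  · by_contra hne
    have hall : ∀ k : ℕ, grad q ℓ v (s - k, n) ≠ 0 := by
      intro k
      induction k with
      | zero => simpa using hne
      | succ k ih =>
        rw [hstep _ _ hn, sub_sub] at ih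
        push_cast
        exact ih
    have hinj : Function.Injective fun k : ℕ => (s - (k : ℤ), n) := fun a b h => by
      simp only [Prod.mk.injEq] at h
      omega
    exact Set.infinite_range_of_injective hinj ((grad q ℓ v).support.finite_toSet.subset (by
      rintro _ ⟨k, rfl⟩
      exact Finsupp.mem_support_iff.2 (hall k)))
  · exact grad_apply_of_nonneg v s n hn

/-- The span of the products of less than `D` operators `β_m` applied to the vacuum vector. -/
def numFilt (q ℓ : ℂ) : ℕ → Submodule ℂ (VacuumModule q ℓ)
  | 0 => ⊥
  | D + 1 => Submodule.span ℂ ({vac q ℓ} ∪ (numFilt q ℓ D : Set (VacuumModule q ℓ)) ∪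
      {v | ∃ s n : ℤ, ∃ u ∈ numFilt q ℓ D, v = ⁅beta q s n, u⁆})

theorem numFilt_succ_le {D : ℕ} {X : Submodule ℂ (VacuumModule q ℓ)} (h0 : vac q ℓ ∈ X)
    (h1 : numFilt q ℓ D ≤ X) (h2 : ∀ s n, ∀ u ∈ numFilt q ℓ D, ⁅beta q s n, u⁆ ∈ X) :
    numFilt q ℓ (D + 1) ≤ X := by
  rw [numFilt, Submodule.span_le]
  rintro v ((rfl | hv) | ⟨s, n, u, hu, rfl⟩)
  · exact h0
  · exact h1 hv
  · exact h2 s n u hu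

theorem numFilt_zero_le (X : Submodule ℂ (VacuumModule q ℓ)) : numFilt q ℓ 0 ≤ X := bot_le

theorem vac_mem_numFilt (D : ℕ) : vac q ℓ ∈ numFilt q ℓ (D + 1) :=
  Submodule.subset_span (Or.inl (Or.inl rfl))

theorem numFilt_le_succ (D : ℕ) : numFilt q ℓ D ≤ numFilt q ℓ (D + 1) := fun _ hv =>
  Submodule.subset_span (Or.inl (Or.inr hv))

theorem numFilt_mono : Monotone (numFilt q ℓ) := monotone_nat_of_le_succ numFilt_le_succ

theorem beta_mem_numFilt {D : ℕ} (s n : ℤ) {u : VacuumModule q ℓ} (hu : u ∈ numFilt q ℓ D) :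
    ⁅beta q s n, u⁆ ∈ numFilt q ℓ (D + 1) :=
  Submodule.subset_span (Or.inr ⟨s, n, u, hu, rfl⟩)

theorem exists_mem_numFilt (v : VacuumModule q ℓ) : ∃ D, v ∈ numFilt q ℓ D := by
  induction v using vacuum_induction with
  | h0 => exact ⟨1, vac_mem_numFilt 0⟩
  | hβ r m v hv => exact ⟨_, beta_mem_numFilt r m hv.choose_spec⟩
  | hadd u v hu hv =>
    obtain ⟨D, hD⟩ := hu
    obtain ⟨D', hD'⟩ := hv
    exact ⟨max D D', add_mem (numFilt_mono (le_max_left _ _) hD) (numFilt_mono (le_max_right _ _) hD')⟩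
  | hsmul c v hv => exact ⟨_, Submodule.smul_mem _ c hv.choose_spec⟩

theorem grad_mem_numFilt {D : ℕ} (p : ℤ × ℤ) :
    ∀ v ∈ numFilt q ℓ (D + 1), grad q ℓ v p ∈ numFilt q ℓ D := by
  induction D with
  | zero =>
    refine numFilt_succ_le (X := (numFilt q ℓ 0).comap (Finsupp.lapply p ∘ₗ grad q ℓ)) ?_ (numFilt_zero_le _) ?_
    · simp [grad_vac]
    · intro s n u hu
      rw [(Submodule.mem_bot ℂ).1 hu, lie_zero]
      exact zero_mem _
  | succ D ih =>
    refine numFilt_succ_le (X := (numFilt q ℓ (D + 1)).comap (Finsupp.lapply p ∘ₗ grad q ℓ)) ?_ ?_ ?_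
    · simp [grad_vac]
    · exact fun v hv => numFilt_le_succ _ (ih v hv)
    · intro s n u hu
      change grad q ℓ ⁅beta q s n, u⁆ p ∈ numFilt q ℓ (D + 1)
      rw [grad_beta_apply]
      refine add_mem (beta_mem_numFilt s n (ih u hu)) ?_
      split_ifs
      exacts [hu, zero_mem _]

theorem beta_nonneg_mem_numFilt {D : ℕ} (r m : ℤ) (hm : 0 ≤ m) {v : VacuumModule q ℓ}
    (hv : v ∈ numFilt q ℓ (D + 1)) : ⁅beta q r m, v⁆ ∈ numFilt q ℓ D := by
  rw [beta_eq_grad r m hm]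
  exact Submodule.smul_mem _ _ (sub_mem (grad_mem_numFilt _ v hv) (grad_mem_numFilt _ v hv))

/-- The operator `∑ β_m ∂/∂β_m` counting the creation operators. -/
def euler (q ℓ : ℂ) : Module.End ℂ (VacuumModule q ℓ) :=
  Finsupp.lsum ℂ (fun p : ℤ × ℤ => betaOp q (VacuumModule q ℓ) p.1 p.2) ∘ₗ grad q ℓ

/-- The middle sum arises from moving β_n past the modes in the Euler operator; it consists of
derivatives of v, so it is of lower degree. -/
theorem euler_beta (s n : ℤ) (v : VacuumModule q ℓ) : euler q ℓ ⁅beta q s n, v⁆ =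
    ⁅beta q s n, euler q ℓ v⁆ +
      ∑ p ∈ (grad q ℓ v).support, (structureConst q p.1 s p.2 n * ℓ) • grad q ℓ v p +
      if n < 0 then ⁅beta q s n, v⁆ else 0 := by
  rw [euler, LinearMap.comp_apply, LinearMap.comp_apply, grad_beta, map_add]
  congr 1
  · rw [← betaOp_apply s n, Finsupp.lsum_apply, Finsupp.lsum_apply, Finsupp.sum, Finsupp.sum, map_sum,
      ← Finset.sum_add_distrib, Finset.sum_subset (s₁ := (Finsupp.mapRange.linearMap _ (grad q ℓ v)).support)
      (s₂ := (grad q ℓ v).support) (Finsupp.support_mapRange (hf := map_zero _))]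
    · exact Finset.sum_congr rfl fun p _ => betaOp_comm hasLevel_vacuumModule p.1 s p.2 n _
    · intro p _ hp
      rw [Finsupp.notMem_support_iff.1 hp, map_zero]
  · split_ifs
    · simp [betaOp_apply]
    · simp

/-- Modulo fewer modes the creation operators commute, and the Euler operator counts them. -/
theorem euler_sub_mem_numFilt {D : ℕ} :
    ∀ v ∈ numFilt q ℓ (D + 1), euler q ℓ v - (D : ℂ) • v ∈ numFilt q ℓ D := by
  induction D with
  | zero =>
    refine numFilt_succ_le (X := (numFilt q ℓ 0).comap (euler q ℓ - ((0 : ℕ) : ℂ) • LinearMap.id))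
      ?_ (numFilt_zero_le _) ?_
    · simp [euler, grad_vac]
    · intro s n u hu
      rw [(Submodule.mem_bot ℂ).1 hu, lie_zero]
      exact zero_mem _
  | succ D ih =>
    have hE : ∀ v ∈ numFilt q ℓ (D + 1), euler q ℓ v ∈ numFilt q ℓ (D + 1) := fun v hv => by
      have := add_mem (numFilt_le_succ _ (ih v hv)) (Submodule.smul_mem _ (D : ℂ) hv)
      rwa [sub_add_cancel] at this
    refine numFilt_succ_le
      (X := (numFilt q ℓ (D + 1)).comap (euler q ℓ - ((D + 1 : ℕ) : ℂ) • LinearMap.id)) ?_ (fun v hv => sub_mem (hE _ hv) (Submodule.smul_mem _ _ hv)) ?_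
    · have := vac_mem_numFilt (q := q) (ℓ := ℓ) D
      exact sub_mem (hE _ this) (Submodule.smul_mem _ _ this)
    · intro s n u hu
      rcases lt_or_ge n 0 with hn | hn
      · change euler q ℓ ⁅beta q s n, u⁆ - ((D + 1 : ℕ) : ℂ) • ⁅beta q s n, u⁆ ∈
          numFilt q ℓ (D + 1)
        rw [euler_beta, if_pos hn]
        have e : ⁅beta q s n, euler q ℓ u⁆ +
            ∑ p ∈ (grad q ℓ u).support, (structureConst q p.1 s p.2 n * ℓ) • grad q ℓ u p +
            ⁅beta q s n, u⁆ - ((D + 1 : ℕ) : ℂ) • ⁅beta q s n, u⁆ =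
            ⁅beta q s n, euler q ℓ u - (D : ℂ) • u⁆ +
            ∑ p ∈ (grad q ℓ u).support, (structureConst q p.1 s p.2 n * ℓ) • grad q ℓ u p := by
          rw [lie_sub, lie_smul]
          push_cast
          module
        rw [e]
        exact add_mem (beta_mem_numFilt s n (ih u hu)) (sum_mem fun p _ =>
          Submodule.smul_mem _ _ (numFilt_le_succ _ (grad_mem_numFilt p u hu)))
      · have := numFilt_le_succ _ (beta_nonneg_mem_numFilt s n hn hu)
        exact sub_mem (hE _ this) (Submodule.smul_mem _ _ this)

theorem numFilt_one_le : numFilt q ℓ 1 ≤ Submodule.span ℂ {vac q ℓ} :=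
  numFilt_succ_le (Submodule.mem_span_singleton_self _) (numFilt_zero_le _) fun s n u hu => by
    rw [(Submodule.mem_bot ℂ).1 hu, lie_zero]
    exact zero_mem _

/-- The gradient of v vanishes, so the Euler operator kills v; as it acts by D modulo lower degree,
v descends through the filtration until degree 0. -/
theorem mem_span_vac (hℓ : ℓ ≠ 0) {v : VacuumModule q ℓ}
    (hv : ∀ r m : ℤ, 0 < m → ⁅beta q r m, v⁆ = 0) : v ∈ Submodule.span ℂ {vac q ℓ} := by
  have h0 : euler q ℓ v = 0 := by
    rw [euler, LinearMap.comp_apply, grad_eq_zero hℓ hv, map_zero]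
  have key : ∀ D, v ∈ numFilt q ℓ (D + 1) → v ∈ numFilt q ℓ 1 := by
    intro D
    induction D with
    | zero => exact id
    | succ D ih =>
      intro h
      have := euler_sub_mem_numFilt v h
      rw [h0, zero_sub, neg_mem_iff] at this
      exact ih ((Submodule.smul_mem_iff _ (by exact_mod_cast D.succ_ne_zero)).1 this)
  obtain ⟨D, hD⟩ := exists_mem_numFilt v
  exact numFilt_one_le (key D (numFilt_le_succ _ hD))

end Filtration

/-! ### Irreducibility. -/

section Irreducible

open TensorProduct

variable {q ℓ : ℂ}

/-- A nonzero space of vectors of `U ⊗ V` stable under the annihilation operators contains a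
nonzero multiple of the vacuum vector. -/
theorem exists_tmul_vac_mem (hℓ : ℓ ≠ 0) {U : Type*} [AddCommGroup U] [Module ℂ U]
    {X : Submodule ℂ (U ⊗[ℂ] VacuumModule q ℓ)} (hX : X ≠ ⊥)
    (h : ∀ r m : ℤ, 0 ≤ m → ∀ z ∈ X, (betaOp q (VacuumModule q ℓ) r m).lTensor U z ∈ X) :
    ∃ a : U, a ⊗ₜ vac q ℓ ∈ X ∧ a ⊗ₜ[ℂ] vac q ℓ ≠ 0 := by
  let B := Module.Free.chooseBasis ℂ U
  let E := TensorProduct.equivFinsuppOfBasisLeft (N := VacuumModule q ℓ) B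
  have hE : ∀ r m z i, E ((betaOp q (VacuumModule q ℓ) r m).lTensor U z) i =
      ⁅beta q r m, E z i⁆ := fun r m z i => by
    induction z using TensorProduct.induction_on with
    | zero => simp
    | add x y hx hy => simp only [map_add, Finsupp.add_apply, hx, hy, lie_add]
    | tmul a v =>
      rw [LinearMap.lTensor_tmul, TensorProduct.equivFinsuppOfBasisLeft_apply_tmul_apply,
        TensorProduct.equivFinsuppOfBasisLeft_apply_tmul_apply, betaOp_apply, lie_smul]
  have key : ∀ D : ℕ, ∀ z ∈ X, z ≠ 0 → (∀ i, E z i ∈ numFilt q ℓ D) →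
      ∃ a : U, a ⊗ₜ vac q ℓ ∈ X ∧ a ⊗ₜ[ℂ] vac q ℓ ≠ 0 := by
    intro D
    induction D with
    | zero =>
      intro z _ hz hD
      refine (hz (E.injective (Finsupp.ext fun i => ?_))).elim
      rw [(Submodule.mem_bot ℂ).1 (hD i), map_zero, Finsupp.zero_apply]
    | succ D ih =>
      intro z hz hz0 hD
      -- Either z is killed by all positive modes and every coordinate is a multiple of the vacuum,
      -- or some positive mode gives a nonzero vector of lower degree.
      by_cases hk : ∀ r m : ℤ, 0 < m → (betaOp q (VacuumModule q ℓ) r m).lTensor U z = 0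
      · have hv : ∀ i, ∃ c : ℂ, c • vac q ℓ = E z i := fun i =>
          Submodule.mem_span_singleton.1 (mem_span_vac hℓ fun r m hm => by
            rw [← hE, hk r m hm, map_zero, Finsupp.zero_apply])
        choose c hc using hv
        have hsum : z = (∑ i ∈ (E z).support, c i • B i) ⊗ₜ vac q ℓ := by
          refine E.injective (Finsupp.ext fun j => ?_)
          rw [sum_tmul, map_sum, Finsupp.finsetSum_apply]
          simp only [E, TensorProduct.equivFinsuppOfBasisLeft_apply_tmul_apply, map_smul,
            Module.Basis.repr_self, Finsupp.smul_apply, Finsupp.single_apply, smul_eq_mul]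
          rw [Finset.sum_eq_single j]
          · rw [if_pos rfl, mul_one, hc]
          · intro i _ hi
            rw [if_neg hi, mul_zero, zero_smul]
          · intro hj
            rw [if_pos rfl, mul_one, hc]
            exact Finsupp.notMem_support_iff.1 hj
        exact ⟨_, hsum ▸ hz, hsum ▸ hz0⟩
      · push Not at hk
        obtain ⟨r, m, hm, hne⟩ := hk
        exact ih _ (h r m hm.le z hz) hne fun i => by
          rw [hE]
          exact beta_nonneg_mem_numFilt r m hm.le (hD i)
  obtain ⟨z, hz, hz0⟩ := Submodule.exists_mem_ne_zero_of_ne_bot hX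
  choose D hD using fun i => exists_mem_numFilt (E z i)
  refine key (∑ i ∈ (E z).support, D i) z hz hz0 fun i => ?_
  by_cases hi : i ∈ (E z).support
  · exact numFilt_mono (Finset.single_le_sum (f := D) (fun _ _ => Nat.zero_le _) hi) (hD i)
  · rw [Finsupp.notMem_support_iff.1 hi]
    exact zero_mem _

theorem isIrreducible_vacOp (hq0 : q ≠ 0) (hq : ∀ n : ℕ, 0 < n → q ^ n ≠ 1) (hℓ : ℓ ≠ 0) :
    IsIrreducible (vacOp q ℓ) := by
  refine ⟨⟨vac q ℓ, 0, vac_ne_zero hq0 hq⟩, fun X hX => or_iff_not_imp_left.2 fun hbot => ?_⟩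
  have hβ : ∀ r m : ℤ, ∀ v ∈ X, ⁅beta q r m, v⁆ ∈ X := fun r m v hv => by
    have := hX (betaVec q ℓ r) (-m - 1) v hv
    rwa [vacOp_coeff, vacField, fieldMap_betaVec_coeff, show -(-m - 1) - 1 = m by ring] at this
  obtain ⟨a, ha, ha0⟩ := exists_tmul_vac_mem hℓ (U := ℂ)
    (X := X.comap (TensorProduct.lid ℂ (VacuumModule q ℓ)).toLinearMap) (fun h => hbot (by
      rw [Submodule.eq_bot_iff] at h ⊢
      intro v hv
      have := h (1 ⊗ₜ v) (by simpa using hv)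
      simpa using congrArg (TensorProduct.lid ℂ (VacuumModule q ℓ)) this))
    (fun r m _ z hz => by
      have e : ∀ z, TensorProduct.lid ℂ (VacuumModule q ℓ)
          ((betaOp q (VacuumModule q ℓ) r m).lTensor ℂ z) =
          ⁅beta q r m, TensorProduct.lid ℂ (VacuumModule q ℓ) z⁆ := fun z => by
        induction z using TensorProduct.induction_on with
        | zero => simp
        | add x y hx hy => rw [map_add, map_add, map_add, hx, hy, lie_add]
        | tmul a v => simp [betaOp_apply]
      change _ ∈ X
      exact (e z).symm ▸ hβ r m _ hz)
  have hvac : vac q ℓ ∈ X := by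
    have ha' : a • vac q ℓ ∈ X := ha
    refine (Submodule.smul_mem_iff _ ?_).1 ha'
    rintro rfl
    exact ha0 (zero_tmul _ _)
  exact eq_top_iff.2 fun v _ => vacuum_span X hvac hβ v

end Irreducible

end QVA

namespace QVA

attribute [local instance] laurentAlgebra

/-! ### Injectivity of f ⊗ u ⊗ v ↦ f(x) Y(u, x)v. -/

section Injectivity

open TensorProduct

variable {q ℓ : ℂ}

/-- Taking the difference of the relations at m + 1 and m lowers every binomial index by one. -/
theorem eq_zero_of_sum_choose_smul {M : Type*} [AddCommGroup M] [Module ℂ M] {J N : ℕ} {s : ℕ → M}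
    (h : ∀ m : ℕ, N ≤ m → ∑ j ∈ Finset.range J, (m.choose j : ℂ) • s j = 0) :
    ∀ j < J, s j = 0 := by
  induction J generalizing s with
  | zero => intro j hj; omega
  | succ J ih =>
    have h1 : ∀ j < J, s (j + 1) = 0 := by
      refine ih (s := fun j => s (j + 1)) fun m hm => ?_
      have h2 := h (m + 1) (by omega)
      have h3 := h m hm
      rw [Finset.sum_range_succ'] at h2 h3
      simp only [Nat.choose_zero_right, Nat.choose_succ_succ, Nat.cast_add, add_smul,
        Finset.sum_add_distrib] at h2 h3
      rwa [add_assoc, h3, add_zero] at h2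
    have h4 := h N le_rfl
    rw [Finset.sum_range_succ', Finset.sum_eq_zero fun j hj => by
      rw [h1 j (Finset.mem_range.1 hj), smul_zero]] at h4
    intro j hj
    cases j with
    | zero => simpa using h4
    | succ j => exact h1 j (by omega)

theorem opR_bOp_tmul (r m : ℤ) (k : LaurentSeries ℂ) (u v : VacuumModule q ℓ) :
    opR (bOp q ℓ (LaurentSeries ℂ) r m) (k ⊗ₜ (u ⊗ₜ v)) = k ⊗ₜ (u ⊗ₜ ⁅beta q r m, v⁆) := by
  have h : ∀ v : VacuumModule q ℓ, k ⊗ₜ[ℂ] (u ⊗ₜ[ℂ] v) = boxMul (k ⊗ₜ u) (1 ⊗ₜ v) := by simp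
  rw [h, h, opR_boxMul, bOp_tmul]

theorem opL_bOp_tmul (r m : ℤ) (k : LaurentSeries ℂ) (u v : VacuumModule q ℓ) :
    opL (bOp q ℓ (LaurentSeries ℂ) r m) (k ⊗ₜ (u ⊗ₜ v)) = k ⊗ₜ (⁅beta q r m, u⁆ ⊗ₜ v) := by
  have h : ∀ u : VacuumModule q ℓ, k ⊗ₜ[ℂ] (u ⊗ₜ[ℂ] v) = boxMul (k ⊗ₜ u) (1 ⊗ₜ v) := by simp
  rw [h, h, opL_boxMul, bOp_tmul]

theorem opR_bOp_finite (r : ℤ)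
    (z : LaurentSeries ℂ ⊗[ℂ] (VacuumModule q ℓ ⊗[ℂ] VacuumModule q ℓ)) :
    ∃ N : ℕ, ∀ j : ℕ, N ≤ j → opR (bOp q ℓ (LaurentSeries ℂ) r j) z = 0 := by
  have hadd : ∀ x y : LaurentSeries ℂ ⊗[ℂ] (VacuumModule q ℓ ⊗[ℂ] VacuumModule q ℓ),
      (∃ N : ℕ, ∀ j : ℕ, N ≤ j → opR (bOp q ℓ (LaurentSeries ℂ) r j) x = 0) →
      (∃ N : ℕ, ∀ j : ℕ, N ≤ j → opR (bOp q ℓ (LaurentSeries ℂ) r j) y = 0) →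
      ∃ N : ℕ, ∀ j : ℕ, N ≤ j → opR (bOp q ℓ (LaurentSeries ℂ) r j) (x + y) = 0 := by
    rintro x y ⟨N, hN⟩ ⟨N', hN'⟩
    exact ⟨max N N', fun j hj => by
      rw [map_add, hN j ((le_max_left _ _).trans hj), hN' j ((le_max_right _ _).trans hj), add_zero]⟩
  induction z using TensorProduct.induction_on with
  | zero => exact ⟨0, fun j _ => map_zero _⟩
  | add x y hx hy => exact hadd x y hx hy
  | tmul k p =>
    induction p using TensorProduct.induction_on with
    | zero => exact ⟨0, fun j _ => by rw [tmul_zero, map_zero]⟩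
    | add x y hx hy => rw [tmul_add]; exact hadd _ _ hx hy
    | tmul u v =>
      obtain ⟨N, hN⟩ := (isRestricted_vacuumModule q ℓ).restricted r v
      exact ⟨N, fun j hj => by
        rw [opR_bOp_tmul, show ⁅beta q r j, v⁆ = 0 from hN j (by exact_mod_cast hj), tmul_zero,
          tmul_zero]⟩

theorem fmul_single_one_zero {M : Type*} [AddCommGroup M] [Module ℂ M] (g : LaurentSeries M) :
    fmul (HahnSeries.single 0 1) g = g := by
  ext n
  simp

theorem fmul_single_single {M : Type*} [AddCommGroup M] [Module ℂ M] (a b : ℤ)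
    (g : LaurentSeries M) : fmul (HahnSeries.single a 1) (fmul (HahnSeries.single b 1) g) =
      fmul (HahnSeries.single (a + b) 1) g := by
  ext n
  simp [sub_sub]

theorem mapCoeff_Yx_of_nonneg (hq0 : q ≠ 0) (hq : ∀ n : ℕ, 0 < n → q ^ n ≠ 1) (r m : ℤ) (hm : 0 ≤ m)
    (z : LaurentSeries ℂ ⊗[ℂ] (VacuumModule q ℓ ⊗[ℂ] VacuumModule q ℓ)) :
    mapCoeff (betaOp q (VacuumModule q ℓ) r m) (Yx (vacOp q ℓ) z) =
      Yx (vacOp q ℓ) (opR (bOp q ℓ (LaurentSeries ℂ) r m) z) +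
      ∑ᶠ j : ℕ, bc m j • fmul (HahnSeries.single (m - j) 1)
        (Yx (vacOp q ℓ) (opL (bOp q ℓ (LaurentSeries ℂ) r j) z)) := by
  rw [mapCoeff_Yx hq0 hq, show kappa q ℓ r m = 0 from funext fun s => funext fun n =>
    kappa_of_nonneg_left _ _ _ _ hm, derOp_zero, opL_zero, LinearMap.zero_apply, map_zero, add_zero]

/-- For large m the mode β_m kills the second factor of z, so the commutator formula leaves ∑ⱼ (m
choose j) x^{m-j} Y(x)(β_j ⊗ 1)z = 0. Dividing by xᵐ gives a polynomial relation in m, and all its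
coefficients vanish. -/
theorem Yx_opL_eq_zero (hq0 : q ≠ 0) (hq : ∀ n : ℕ, 0 < n → q ^ n ≠ 1)
    {z : LaurentSeries ℂ ⊗[ℂ] (VacuumModule q ℓ ⊗[ℂ] VacuumModule q ℓ)}
    (hz : Yx (vacOp q ℓ) z = 0) (r : ℤ) (j : ℕ) :
    Yx (vacOp q ℓ) (opL (bOp q ℓ (LaurentSeries ℂ) r j) z) = 0 := by
  obtain ⟨N, hN⟩ := opR_bOp_finite r z
  obtain ⟨J, hJ⟩ := (opL_bOp_finite r z).bddAbove
  have hJ' : ∀ j : ℕ, J + 1 ≤ j → opL (bOp q ℓ (LaurentSeries ℂ) r j) z = 0 := fun j hj => by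
    by_contra h
    have := hJ h
    omega
  rcases le_or_gt (J + 1) j with hj | hj
  · rw [hJ' j hj, map_zero]
  have key := eq_zero_of_sum_choose_smul (N := N) (J := J + 1)
    (s := fun j : ℕ => fmul (HahnSeries.single (-(j : ℤ)) 1)
      (Yx (vacOp q ℓ) (opL (bOp q ℓ (LaurentSeries ℂ) r j) z))) (fun m hm => by
    have h := mapCoeff_Yx_of_nonneg hq0 hq r m (by omega) z
    rw [hz, hN m hm, map_zero, map_zero, zero_add, finsum_nat_eq_sum_range (N := J + 1)] at h
    · have h' := congrArg (fmul (HahnSeries.single (-(m : ℤ)) 1)) h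
      rw [map_zero, map_sum] at h'
      rw [h']
      refine Finset.sum_congr rfl fun j _ => ?_
      rw [map_smul, fmul_single_single, bc_natCast, show -(m : ℤ) + (m - j) = -j by ring]
    · intro j hj
      rw [hJ' j hj, map_zero, map_zero, smul_zero]) j hj
  have := congrArg (fmul (HahnSeries.single (j : ℤ) 1)) key
  rwa [fmul_single_single, add_neg_cancel, fmul_single_one_zero, map_zero] at this

theorem Yx_opR_eq_zero (hq0 : q ≠ 0) (hq : ∀ n : ℕ, 0 < n → q ^ n ≠ 1)
    {z : LaurentSeries ℂ ⊗[ℂ] (VacuumModule q ℓ ⊗[ℂ] VacuumModule q ℓ)}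
    (hz : Yx (vacOp q ℓ) z = 0) (r m : ℤ) (hm : 0 ≤ m) :
    Yx (vacOp q ℓ) (opR (bOp q ℓ (LaurentSeries ℂ) r m) z) = 0 := by
  have h := mapCoeff_Yx_of_nonneg hq0 hq r m hm z
  rwa [hz, map_zero, finsum_eq_zero_of_forall_eq_zero fun j => by
    rw [Yx_opL_eq_zero hq0 hq hz, map_zero, smul_zero], add_zero, eq_comm] at h

theorem Yx_injective (hq0 : q ≠ 0) (hq : ∀ n : ℕ, 0 < n → q ^ n ≠ 1) (hℓ : ℓ ≠ 0) :
    Function.Injective (Yx (vacOp q ℓ)) := by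
  suffices h : ∀ z, Yx (vacOp q ℓ) z = 0 → z = 0 by
    intro x y hxy
    have hneg := add_smul (1 : ℂ) (-1) y
    rw [one_smul, add_neg_cancel, zero_smul, eq_comm] at hneg
    have hxy' : x + (-1 : ℂ) • y = 0 := h _ (by
      rw [map_add, hxy, ← map_add, hneg, map_zero])
    rw [← add_zero x, ← hneg, ← add_assoc, add_comm x y, add_assoc, hxy', add_zero]
  intro z hz
  by_contra hz0
  let e := TensorProduct.assoc ℂ (LaurentSeries ℂ) (VacuumModule q ℓ) (VacuumModule q ℓ)
  have heR : ∀ r m x, e ((betaOp q (VacuumModule q ℓ) r m).lTensor _ x) =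
      opR (bOp q ℓ (LaurentSeries ℂ) r m) (e x) := by
    intro r m x
    induction x using TensorProduct.induction_on with
    | zero => simp
    | add x y hx hy => simp only [map_add, hx, hy]
    | tmul y v =>
      induction y using TensorProduct.induction_on with
      | zero => simp
      | add x y hx hy => simp only [add_tmul, map_add, hx, hy]
      | tmul k u =>
        rw [LinearMap.lTensor_tmul, TensorProduct.assoc_tmul, TensorProduct.assoc_tmul, opR_bOp_tmul,
          betaOp_apply]
  have heL : ∀ r m y v, e ((betaOp q (VacuumModule q ℓ) r m).lTensor _ y ⊗ₜ v) =
      opL (bOp q ℓ (LaurentSeries ℂ) r m) (e (y ⊗ₜ v)) := by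
    intro r m y v
    induction y using TensorProduct.induction_on with
    | zero => simp
    | add x y hx hy => simp only [add_tmul, map_add, hx, hy]
    | tmul k u =>
      rw [LinearMap.lTensor_tmul, TensorProduct.assoc_tmul, TensorProduct.assoc_tmul, opL_bOp_tmul,
        betaOp_apply]
  let X : Submodule ℂ ((LaurentSeries ℂ ⊗[ℂ] VacuumModule q ℓ) ⊗[ℂ] VacuumModule q ℓ) :=
    LinearMap.ker (Yx (vacOp q ℓ) ∘ₗ e.toLinearMap)
  let X' : Submodule ℂ (LaurentSeries ℂ ⊗[ℂ] VacuumModule q ℓ) :=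
    X.comap ((TensorProduct.mk ℂ _ _).flip (vac q ℓ))
  -- First the second factor and then the first is brought down to the vacuum, leaving a kernel
  -- element f ⊗ 1 ⊗ 1 with f ≠ 0; but its image is f(x)1.
  obtain ⟨y, hy, hy0⟩ := exists_tmul_vac_mem (q := q)
    (U := LaurentSeries ℂ ⊗[ℂ] VacuumModule q ℓ) hℓ (X := X)
    (fun h => hz0 (e.symm.map_eq_zero_iff.1 ((Submodule.eq_bot_iff _).1 h (e.symm z) (by
      change Yx (vacOp q ℓ) (e (e.symm z)) = 0
      rwa [LinearEquiv.apply_symm_apply]))))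
    (fun r m hm x hx => by
      change Yx (vacOp q ℓ) (e _) = 0
      rw [heR]
      exact Yx_opR_eq_zero hq0 hq hx r m hm)
  obtain ⟨f, hf, hf0⟩ := exists_tmul_vac_mem (q := q) (U := LaurentSeries ℂ) hℓ
    (X := X')
    (fun h => by
      refine hy0 ?_
      rw [(Submodule.eq_bot_iff _).1 h y hy, zero_tmul])
    (fun r m hm y hy => by
      change Yx (vacOp q ℓ) (e (_ ⊗ₜ vac q ℓ)) = 0
      rw [heL]
      lift m to ℕ using hm
      exact Yx_opL_eq_zero hq0 hq hy r m)
  have h0 : Yx (vacOp q ℓ) (f ⊗ₜ (vac q ℓ ⊗ₜ vac q ℓ)) = 0 := hf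
  refine hf0 ?_
  have hf' : f = 0 := by
    ext n
    have h1 := congrArg (fun g : LaurentSeries (VacuumModule q ℓ) => g.coeff n) h0
    simp only [Yx_tmul, fmul_coeff, HahnSeries.coeff_zero] at h1
    rw [finsum_eq_single _ n] at h1
    · rw [vacField, fieldMap_vac, idField_coeff, sub_self, if_pos rfl] at h1
      exact (smul_eq_zero.1 h1).resolve_right (vac_ne_zero hq0 hq)
    · intro i hi
      rw [vacField, fieldMap_vac, idField_coeff, if_neg (by omega), smul_zero]
  rw [hf', zero_tmul]

end Injectivity

/-! ### Non-degeneracy from injectivity of Y(x). -/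

section Nondegenerate

open TensorProduct

/-- Expand along a basis of Q: the family, even if infinite, may be tested on each coordinate. -/
theorem rTensor_eq_zero {ι P P' Q : Type*} [AddCommGroup P] [Module ℂ P] [AddCommGroup P']
    [Module ℂ P'] [AddCommGroup Q] [Module ℂ Q] {α : ι → P →ₗ[ℂ] P'}
    (hα : ∀ p, (∀ i, α i p = 0) → p = 0) {z : P ⊗[ℂ] Q} (hz : ∀ i, (α i).rTensor Q z = 0) :
    z = 0 := by
  let B := Module.Free.chooseBasis ℂ Q
  have h : ∀ i z b, TensorProduct.equivFinsuppOfBasisRight B ((α i).rTensor Q z) b =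
      α i (TensorProduct.equivFinsuppOfBasisRight B z b) := fun i z b => by
    induction z using TensorProduct.induction_on with
    | zero => simp
    | add x y hx hy => simp only [map_add, Finsupp.add_apply, hx, hy]
    | tmul p u =>
      rw [LinearMap.rTensor_tmul, TensorProduct.equivFinsuppOfBasisRight_apply_tmul_apply,
        TensorProduct.equivFinsuppOfBasisRight_apply_tmul_apply, map_smul]
  refine (TensorProduct.equivFinsuppOfBasisRight B).map_eq_zero_iff.1 (Finsupp.ext fun b => hα _ fun i => ?_)
  rw [← h, hz, map_zero, Finsupp.zero_apply]

theorem lTensor_eq_zero {ι P Q Q' : Type*} [AddCommGroup P] [Module ℂ P] [AddCommGroup Q]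
    [Module ℂ Q] [AddCommGroup Q'] [Module ℂ Q'] {α : ι → Q →ₗ[ℂ] Q'}
    (hα : ∀ p, (∀ i, α i p = 0) → p = 0) {z : P ⊗[ℂ] Q} (hz : ∀ i, (α i).lTensor P z = 0) :
    z = 0 := by
  refine (TensorProduct.comm ℂ P Q).map_eq_zero_iff.1 (rTensor_eq_zero hα fun i => ?_)
  have h : (α i).rTensor P ∘ₗ (TensorProduct.comm ℂ P Q).toLinearMap =
      (TensorProduct.comm ℂ P Q').toLinearMap ∘ₗ (α i).lTensor P := TensorProduct.ext' fun _ _ => rfl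
  have h' := LinearMap.congr_fun h z
  rwa [LinearMap.comp_apply, LinearMap.comp_apply, hz, map_zero] at h'

section MulSeries

variable {M N P M' N' P' : Type*} [AddCommGroup M] [Module ℂ M] [AddCommGroup N] [Module ℂ N]
  [AddCommGroup P] [Module ℂ P] [AddCommGroup M'] [Module ℂ M'] [AddCommGroup N'] [Module ℂ N']
  [AddCommGroup P'] [Module ℂ P']

theorem mapCoeff_mulSeries (B : M →ₗ[ℂ] N →ₗ[ℂ] P) (B' : M' →ₗ[ℂ] N' →ₗ[ℂ] P') (S : M →ₗ[ℂ] M')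
    (T : N →ₗ[ℂ] N') (φ : P →ₗ[ℂ] P') (h : ∀ a b, φ (B a b) = B' (S a) (T b))
    (f : LaurentSeries M) (g : LaurentSeries N) :
    mapCoeff φ (mulSeries B f g) = mulSeries B' (mapCoeff S f) (mapCoeff T g) := by
  apply HahnSeries.ext
  funext n
  rw [mapCoeff_coeff, mulSeries_coeff, mulSeries_coeff, map_finsum _ (mulSeries_finite B f g n)]
  exact finsum_congr fun i => h _ _

theorem mapCoeff_mapCoeff (S : M →ₗ[ℂ] N) (T : N →ₗ[ℂ] P) (f : LaurentSeries M) :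
    mapCoeff T (mapCoeff S f) = mapCoeff (T ∘ₗ S) f := rfl

end MulSeries

variable {V : Type*} [AddCommGroup V] [Module ℂ V] (Y : V →ₗ[ℂ] VertexOperator ℂ V)

/-- The map `t ⊗ a ⊗ b ↦ t ⊗ Y(a, x) b`. -/
def seriesTensor (W : Type*) [AddCommGroup W] [Module ℂ W] :
    (W ⊗[ℂ] V) ⊗[ℂ] V →ₗ[ℂ] LaurentSeries (W ⊗[ℂ] V) :=
  TensorProduct.lift (TensorProduct.lift
    (LinearMap.lcomp ℂ (V →ₗ[ℂ] LaurentSeries (W ⊗[ℂ] V)) (series Y) ∘ₗ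
      LinearMap.llcomp ℂ V (LaurentSeries V) (LaurentSeries (W ⊗[ℂ] V)) ∘ₗ
      mapCoeff ∘ₗ TensorProduct.mk ℂ W V))

/-- The map `t ⊗ a ⊗ b ⊗ f ↦ t ⊗ Y(a, x) b ⊗ f(x)`. -/
def seriesTensorMul (W F : Type*) [AddCommGroup W] [Module ℂ W] [AddCommGroup F] [Module ℂ F] :
    ((W ⊗[ℂ] V) ⊗[ℂ] V) ⊗[ℂ] LaurentSeries F →ₗ[ℂ] LaurentSeries ((W ⊗[ℂ] V) ⊗[ℂ] F) :=
  TensorProduct.lift ((mulSeries (TensorProduct.mk ℂ (W ⊗[ℂ] V) F).flip).flip ∘ₗ seriesTensor Y W)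

theorem seriesTensorMul_tmul {W F : Type*} [AddCommGroup W] [Module ℂ W] [AddCommGroup F]
    [Module ℂ F] (t : W) (a b : V) (f : LaurentSeries F) :
    seriesTensorMul Y W F (((t ⊗ₜ a) ⊗ₜ b) ⊗ₜ f) =
      mulSeries (TensorProduct.mk ℂ (W ⊗[ℂ] V) F).flip f
        (mapCoeff (TensorProduct.mk ℂ W V t) (series Y a b)) := rfl

theorem tensor_ext₄ {A B C D Z : Type*} [AddCommGroup A] [Module ℂ A] [AddCommGroup B] [Module ℂ B]
    [AddCommGroup C] [Module ℂ C] [AddCommGroup D] [Module ℂ D] [AddCommGroup Z] [Module ℂ Z]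
    {S T : ((A ⊗[ℂ] B) ⊗[ℂ] C) ⊗[ℂ] D →ₗ[ℂ] Z}
    (h : ∀ a b c d, S (((a ⊗ₜ b) ⊗ₜ c) ⊗ₜ d) = T (((a ⊗ₜ b) ⊗ₜ c) ⊗ₜ d)) : S = T := by
  refine TensorProduct.ext (TensorProduct.ext_threefold fun a b c => LinearMap.ext fun d => h a b c d)

/-- Contraction of the first tensor factor with a functional. -/
def contractLeft {W : Type*} [AddCommGroup W] [Module ℂ W] (N : Type*) [AddCommGroup N] [Module ℂ N]
    (φ : Module.Dual ℂ W) : W ⊗[ℂ] N →ₗ[ℂ] N :=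
  (TensorProduct.lid ℂ N).toLinearMap ∘ₗ φ.rTensor N

theorem contractLeft_tmul {W N : Type*} [AddCommGroup W] [Module ℂ W] [AddCommGroup N] [Module ℂ N]
    (φ : Module.Dual ℂ W) (w : W) (n : N) : contractLeft N φ (w ⊗ₜ n) = φ w • n := by
  simp [contractLeft]

theorem contractLeft_eq_zero {W N : Type*} [AddCommGroup W] [Module ℂ W] [AddCommGroup N]
    [Module ℂ N] (z : W ⊗[ℂ] N) (h : ∀ φ : Module.Dual ℂ W, contractLeft N φ z = 0) : z = 0 :=
  rTensor_eq_zero (α := fun φ : Module.Dual ℂ W => φ)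
    (fun p hp => (Module.forall_dual_apply_eq_zero_iff ℂ p).1 hp) fun φ =>
      (TensorProduct.lid ℂ N).map_eq_zero_iff.1 (h φ)

/-- Contracting W and the coefficients F with all linear functionals loses nothing and reduces the
map to Y(x). -/
theorem seriesTensorMul_injective (hY : Function.Injective (Yx Y)) (W F : Type*) [AddCommGroup W]
    [Module ℂ W] [AddCommGroup F] [Module ℂ F] :
    Function.Injective (seriesTensorMul Y W F) := by
  rw [injective_iff_map_eq_zero]
  intro z hz
  refine rTensor_eq_zero (α := fun φ : Module.Dual ℂ W => (contractLeft V φ).rTensor V)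
    (fun p hp => rTensor_eq_zero (α := fun φ : Module.Dual ℂ W => contractLeft V φ)
      contractLeft_eq_zero hp) fun φ => ?_
  refine lTensor_eq_zero (α := fun ψ : Module.Dual ℂ F => mapCoeff ψ) (fun f hf => ?_) fun ψ => ?_
  · apply HahnSeries.ext
    funext n
    refine (Module.forall_dual_apply_eq_zero_iff ℂ _).1 fun ψ => ?_
    rw [← mapCoeff_coeff, hf ψ, HahnSeries.coeff_zero]
  refine (TensorProduct.comm ℂ (V ⊗[ℂ] V) (LaurentSeries ℂ)).map_eq_zero_iff.1 (hY ?_)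
  rw [map_zero]
  have key : Yx Y ∘ₗ (TensorProduct.comm ℂ (V ⊗[ℂ] V) (LaurentSeries ℂ)).toLinearMap ∘ₗ
      (mapCoeff ψ).lTensor (V ⊗[ℂ] V) ∘ₗ ((contractLeft V φ).rTensor V).rTensor (LaurentSeries F) =
      mapCoeff (TensorProduct.lift ((LinearMap.lsmul ℂ V ∘ₗ ψ).flip ∘ₗ contractLeft V φ)) ∘ₗ
        seriesTensorMul Y W F := by
    refine tensor_ext₄ fun t a b f => ?_
    simp only [LinearMap.comp_apply, seriesTensorMul_tmul]
    rw [mapCoeff_mulSeries _ (LinearMap.lsmul ℂ V) ψ (contractLeft V φ) _ (fun x y => by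
      simp), mapCoeff_mapCoeff, LinearMap.rTensor_tmul, LinearMap.rTensor_tmul,
      LinearMap.lTensor_tmul, contractLeft_tmul]
    have e1 : contractLeft V φ ∘ₗ TensorProduct.mk ℂ W V t = φ t • LinearMap.id := by
      ext v
      simp [contractLeft_tmul]
    have e2 : mapCoeff (φ t • (LinearMap.id : V →ₗ[ℂ] V)) (series Y a b) = φ t • series Y a b := by
      ext n
      simp
    rw [e1, e2]
    change Yx Y (mapCoeff ψ f ⊗ₜ ((φ t • a) ⊗ₜ b)) = _
    rw [← smul_tmul', tmul_smul, map_smul, map_smul]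
    rfl
  have := LinearMap.congr_fun key z
  simp only [LinearMap.comp_apply, hz, map_zero] at this
  exact this

/-- The map `t ⊗ a ⊗ b ⊗ f ↦ T(t ⊗ Y(a, x) b ⊗ f(x))`. -/
def seriesTensorMap {W F G : Type*} [AddCommGroup W] [Module ℂ W] [AddCommGroup F] [Module ℂ F]
    [AddCommGroup G] [Module ℂ G] (T : (W ⊗[ℂ] V) ⊗[ℂ] F →ₗ[ℂ] G) :
    ((W ⊗[ℂ] V) ⊗[ℂ] V) ⊗[ℂ] LaurentSeries F →ₗ[ℂ] LaurentSeries G :=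
  mapCoeff T ∘ₗ seriesTensorMul Y W F

theorem seriesTensorMap_tmul {W F G : Type*} [AddCommGroup W] [Module ℂ W] [AddCommGroup F]
    [Module ℂ F] [AddCommGroup G] [Module ℂ G] (B : F →ₗ[ℂ] G →ₗ[ℂ] G) (L : W →ₗ[ℂ] V →ₗ[ℂ] G) (t : W)
    (a b : V) (f : LaurentSeries F) :
    seriesTensorMap Y (TensorProduct.lift (B.flip ∘ₗ TensorProduct.lift L)) (((t ⊗ₜ a) ⊗ₜ b) ⊗ₜ f) =
      mulSeries B f (mapCoeff (L t) (series Y a b)) := by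
  rw [seriesTensorMap, LinearMap.comp_apply, seriesTensorMul_tmul,
    mapCoeff_mulSeries _ B LinearMap.id (TensorProduct.lift L) _ (fun x y => rfl), mapCoeff_mapCoeff]
  rfl

theorem seriesTensorMap_injective (hY : Function.Injective (Yx Y)) {W F G : Type*} [AddCommGroup W]
    [Module ℂ W] [AddCommGroup F] [Module ℂ F] [AddCommGroup G] [Module ℂ G]
    {T : (W ⊗[ℂ] V) ⊗[ℂ] F →ₗ[ℂ] G} (hT : Function.Injective T) :
    Function.Injective (seriesTensorMap Y T) := by
  rw [seriesTensorMap, LinearMap.coe_comp]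
  refine Function.Injective.comp (fun f g h => ?_) (seriesTensorMul_injective Y hY _ _)
  apply HahnSeries.ext
  funext k
  refine hT ?_
  rw [← mapCoeff_coeff, ← mapCoeff_coeff, h]

/-- The map `t ⊗ a ↦ t ⊗ a` from `V^{⊗ n} ⊗ V` to `V^{⊗ (n + 1)}`. -/
def tensorSnoc (V : Type*) [AddCommGroup V] [Module ℂ V] (n : ℕ) :
    (⨂[ℂ] _ : Fin n, V) ⊗[ℂ] V →ₗ[ℂ] ⨂[ℂ] _ : Fin (n + 1), V :=
  TensorProduct.lift (PiTensorProduct.lift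
    (PiTensorProduct.tprod ℂ (s := fun _ : Fin (n + 1) => V)).curryRight)

theorem tensorSnoc_tprod (n : ℕ) (v : Fin n → V) (a : V) :
    tensorSnoc V n (PiTensorProduct.tprod ℂ v ⊗ₜ a) =
      PiTensorProduct.tprod ℂ (Fin.snoc v a : Fin (n + 1) → V) := by
  rw [tensorSnoc, TensorProduct.lift.tmul, PiTensorProduct.lift.tprod]
  rfl

theorem tensorSnoc_surjective (n : ℕ) : Function.Surjective (tensorSnoc V n) := by
  rw [← LinearMap.range_eq_top, eq_top_iff, ← PiTensorProduct.span_tprod_eq_top, Submodule.span_le]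
  rintro _ ⟨v, rfl⟩
  refine ⟨PiTensorProduct.tprod ℂ (Fin.init v : Fin n → V) ⊗ₜ v (Fin.last n), ?_⟩
  rw [tensorSnoc_tprod]
  exact congrArg _ (Fin.snoc_init_self v)

universe u

variable {V : Type u} [AddCommGroup V] [Module ℂ V] (Y : V →ₗ[ℂ] VertexOperator ℂ V)

/-- The map `v⁽¹⁾ ⊗ ⋯ ⊗ v⁽ⁿ⁾ ↦ Y(v⁽¹⁾, x₁) ⋯ Y(v⁽ⁿ⁾, xₙ)`. -/
def tensorY (n : ℕ) :
    (⨂[ℂ] _ : Fin n, V) →ₗ[ℂ] V →ₗ[ℂ] iterLaurent (ModuleCat.of ℂ V) n :=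
  PiTensorProduct.lift (iterY Y n)

theorem tensorY_tensorSnoc (n : ℕ) (t : ⨂[ℂ] _ : Fin n, V) (a b : V) :
    tensorY Y (n + 1) (tensorSnoc V n (t ⊗ₜ a)) b = mapCoeff (tensorY Y n t) (series Y a b) := by
  induction t using PiTensorProduct.induction_on with
  | smul_tprod c v =>
    rw [← smul_tmul', map_smul, map_smul, map_smul, map_smul, tensorSnoc_tprod, LinearMap.smul_apply,
      LinearMap.smul_apply, tensorY, tensorY, PiTensorProduct.lift.tprod, PiTensorProduct.lift.tprod]
    congr 1
    change mapCoeff (iterY Y n (Fin.init (Fin.snoc v a : Fin (n + 1) → V)))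
      (series Y ((Fin.snoc v a : Fin (n + 1) → V) (Fin.last n)) b) = _
    rw [Fin.init_snoc, Fin.snoc_last]
  | add x y hx hy =>
    rw [add_tmul, map_add, map_add, map_add, map_add, LinearMap.add_apply, LinearMap.add_apply, hx, hy]
    rfl

/-- The map `t ⊗ v ⊗ f ↦ f Y(v⁽¹⁾, x₁) ⋯ Y(v⁽ⁿ⁾, xₙ) v` for `t = v⁽¹⁾ ⊗ ⋯ ⊗ v⁽ⁿ⁾`. -/
def tensorYMul (n : ℕ) : ((⨂[ℂ] _ : Fin n, V) ⊗[ℂ] V) ⊗[ℂ] iterLaurent (ModuleCat.of ℂ ℂ) n →ₗ[ℂ]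
    iterLaurent (ModuleCat.of ℂ V) n :=
  TensorProduct.lift ((iterMul (ModuleCat.of ℂ V) n).flip ∘ₗ TensorProduct.lift (tensorY Y n))

theorem tensorYMul_tensorSnoc (n : ℕ) :
    tensorYMul Y (n + 1) ∘ₗ ((tensorSnoc V n).rTensor V).rTensor _ =
      seriesTensorMap Y (tensorYMul Y n) := by
  refine tensor_ext₄ fun t a b f => ?_
  change iterMul (ModuleCat.of ℂ V) (n + 1) f (tensorY Y (n + 1) (tensorSnoc V n (t ⊗ₜ a)) b) = _
  rw [tensorY_tensorSnoc]
  exact (seriesTensorMap_tmul Y _ _ t a b f).symm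

/-- A free last vector, in place of the vacuum, makes the induction work: the last vertex operator
is peeled off by `seriesTensorMap_injective`, and surjectivity of `tensorSnoc` transfers the result
to V^{⊗(n+1)}. -/
theorem tensorYMul_injective (hY : Function.Injective (Yx Y)) (n : ℕ) :
    Function.Injective (tensorYMul Y n) := by
  induction n with
  | zero =>
    let s : V → ((⨂[ℂ] _ : Fin 0, V) ⊗[ℂ] V) ⊗[ℂ] ℂ := fun v =>
      (PiTensorProduct.tprod ℂ (fun _ : Fin 0 => (0 : V)) ⊗ₜ v) ⊗ₜ 1
    have hadd : ∀ v w, s (v + w) = s v + s w := fun v w => by simp only [s, tmul_add, add_tmul]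
    have hsmul : ∀ (c : ℂ) v, s (c • v) = c • s v := fun c v => by
      simp only [s, tmul_smul, smul_tmul']
    have hs : Function.Surjective s := by
      intro z
      induction z using TensorProduct.induction_on with
      | zero => exact ⟨0, by simp [s]⟩
      | add x y hx hy =>
        obtain ⟨v, rfl⟩ := hx
        obtain ⟨w, rfl⟩ := hy
        exact ⟨_, hadd v w⟩
      | tmul x c =>
        suffices h : ∃ v, s v = x ⊗ₜ 1 by
          obtain ⟨v, hv⟩ := h
          refine ⟨c • v, ?_⟩
          rw [hsmul, hv, ← tmul_smul, smul_eq_mul, mul_one]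
        induction x using TensorProduct.induction_on with
        | zero => exact ⟨0, by simp [s]⟩
        | add x y hx hy =>
          obtain ⟨v, hv⟩ := hx
          obtain ⟨w, hw⟩ := hy
          exact ⟨v + w, by rw [hadd, hv, hw, add_tmul]⟩
        | tmul t a =>
          induction t using PiTensorProduct.induction_on with
          | smul_tprod c' v =>
            refine ⟨c' • a, ?_⟩
            rw [hsmul, Subsingleton.elim v fun _ => 0, ← smul_tmul', ← smul_tmul']
          | add x y hx hy =>
            obtain ⟨v, hv⟩ := hx
            obtain ⟨w, hw⟩ := hy
            exact ⟨v + w, by rw [hadd, hv, hw, add_tmul, add_tmul]⟩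
    have hl : Function.LeftInverse (tensorYMul Y 0) s := by
      intro v
      change (1 : ℂ) • tensorY Y 0 (PiTensorProduct.tprod ℂ _) v = v
      rw [one_smul, tensorY, PiTensorProduct.lift.tprod]
      rfl
    exact (hl.rightInverse_of_surjective hs).injective
  | succ n ih =>
    have h := seriesTensorMap_injective Y hY ih
    rw [← tensorYMul_tensorSnoc] at h
    refine Function.Injective.of_comp_right (f := tensorYMul Y (n + 1))
      (g := ((tensorSnoc V n).rTensor V).rTensor _) h ?_
    exact LinearMap.rTensor_surjective _ (LinearMap.rTensor_surjective _ (tensorSnoc_surjective n))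

/-- Inserting a nonzero vacuum as the last vector is injective, also after tensoring with the scalar
series. -/
theorem isNondegenerate_of_Yx_injective {vac : V} (hvac : vac ≠ 0)
    (hY : Function.Injective (Yx Y)) : IsNondegenerate vac Y := by
  intro n _
  have h : Zmap vac Y n = tensorYMul Y n ∘ₗ
      ((TensorProduct.mk ℂ (⨂[ℂ] _ : Fin n, V) V).flip vac).rTensor _ := by
    refine TensorProduct.ext' fun t f => ?_
    change iterMul (ModuleCat.of ℂ V) n f (PiTensorProduct.lift
      ((LinearMap.applyₗ vac).compMultilinearMap (iterY Y n)) t) =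
      iterMul (ModuleCat.of ℂ V) n f (tensorY Y n t vac)
    congr 1
    induction t using PiTensorProduct.induction_on with
    | smul_tprod c v =>
      rw [map_smul, map_smul, tensorY, PiTensorProduct.lift.tprod, PiTensorProduct.lift.tprod]
      rfl
    | add x y hx hy => rw [map_add, map_add, hx, hy]; rfl
  rw [h, LinearMap.coe_comp]
  refine (tensorYMul_injective Y hY n).comp ?_
  refine Module.Flat.rTensor_preserves_injective_linearMap _ ?_
  rw [injective_iff_map_eq_zero]
  intro t ht
  refine (Module.forall_dual_apply_eq_zero_iff ℂ t).1 fun φ => ?_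
  have := congrArg (contractLeft V φ) ht
  rw [map_zero] at this
  exact (smul_eq_zero.1 ((contractLeft_tmul φ t vac).symm.trans this)).resolve_right hvac

end Nondegenerate

/-! ### The quantum vertex algebra structure and the uniqueness of 𝒮. -/

section Uniqueness

open TensorProduct

variable {q ℓ : ℂ}

theorem isQuantumVertexAlgebra_Sop (hq0 : q ≠ 0) (hq : ∀ n : ℕ, 0 < n → q ^ n ≠ 1)
    (h : IsWeakQuantumVertexAlgebra (vac q ℓ) (vacOp q ℓ)) :
    IsQuantumVertexAlgebra (vac q ℓ) (vacOp q ℓ) (Sop q ℓ) where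
  toIsWeakQuantumVertexAlgebra := h
  yang_baxter := isYangBaxter_Sop
  unitary := isUnitary_Sop hq0
  S_vacuum := Sop_vac
  S_derivative := derivative_Sop
  S_skew_symmetry u v n := by
    have := congrArg (fun g : LaurentSeries (VacuumModule q ℓ) => g.coeff n)
      (skewSymmetry_Sop hq0 hq u v)
    simp only [expD_coeff] at this
    exact this.symm
  hexagon := hexagon_Sop

theorem expD_injective {M : Type*} [AddCommGroup M] [Module ℂ M] (D : Module.End ℂ M) :
    Function.Injective (expD D) := by
  intro f g h
  have h1 := expD_negX_expD D f
  rw [h, expD_negX_expD] at h1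
  rw [← negX_negX f, ← h1, negX_negX]

/-- Skew symmetry alone suffices: e^{xD} and x ↦ -x are injective, and so is Y(x) when ℓ ≠ 0. -/
theorem eq_Sop (hq0 : q ≠ 0) (hq : ∀ n : ℕ, 0 < n → q ^ n ≠ 1) (hℓ : ℓ ≠ 0)
    {S : VacuumModule q ℓ ⊗[ℂ] VacuumModule q ℓ →ₗ[ℂ]
      LaurentSeries ℂ ⊗[ℂ] (VacuumModule q ℓ ⊗[ℂ] VacuumModule q ℓ)}
    (h : IsQuantumVertexAlgebra (vac q ℓ) (vacOp q ℓ) S) : S = Sop q ℓ := by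
  refine TensorProduct.ext' fun v u => Yx_injective hq0 hq hℓ ?_
  have h1 : expD (vacD q ℓ) (negX (Yx (vacOp q ℓ) (S (v ⊗ₜ u)))) = vacField q ℓ u v := by
    apply HahnSeries.ext
    funext n
    rw [expD_coeff]
    exact (h.S_skew_symmetry u v n).symm
  have h2 := expD_injective _ (h1.trans (skewSymmetry_Sop hq0 hq u v).symm)
  rw [← negX_negX (Yx (vacOp q ℓ) (S (v ⊗ₜ u))), h2, negX_negX]

theorem isWeakQuantumVertexAlgebra_vacOp (hq0 : q ≠ 0) (hq : ∀ n : ℕ, 0 < n → q ^ n ≠ 1) :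
    IsWeakQuantumVertexAlgebra (vac q ℓ) (vacOp q ℓ) where
  vacuum := (isModuleFor_fieldOp (isRestricted_vacuumModule q ℓ) hasLevel_vacuumModule).vacuum
  creation_regular := vacField_vac_coeff_neg
  creation := vacField_vac_coeff_zero
  weak_assoc := weakAssociativity_fieldOp _ _
  S_locality := S_locality_vacOp hq0 hq

end Uniqueness

end QVA

end

theorem theorem4p7 (q : ℂ) (hq0 : q ≠ 0) (hq : ∀ n : ℕ, 0 < n → q ^ n ≠ 1) (ℓ : ℂ) :
    ∃ Y : QVA.VacuumModule q ℓ →ₗ[ℂ] VertexOperator ℂ (QVA.VacuumModule q ℓ),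
      (QVA.IsWeakQuantumVertexAlgebra (QVA.vac q ℓ) Y ∧
        ∀ r : ℤ, QVA.IsBetaField q r (Y (QVA.betaVec q ℓ r))) ∧
      (∀ Y' : QVA.VacuumModule q ℓ →ₗ[ℂ] VertexOperator ℂ (QVA.VacuumModule q ℓ),
        QVA.IsWeakQuantumVertexAlgebra (QVA.vac q ℓ) Y' →
        (∀ r : ℤ, QVA.IsBetaField q r (Y' (QVA.betaVec q ℓ r))) → Y' = Y) ∧
      (ℓ ≠ 0 →
        QVA.IsIrreducible Y ∧
        QVA.IsNondegenerate (QVA.vac q ℓ) Y ∧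
        ∃! S : TensorProduct ℂ (QVA.VacuumModule q ℓ) (QVA.VacuumModule q ℓ) →ₗ[ℂ]
            TensorProduct ℂ (LaurentSeries ℂ)
              (TensorProduct ℂ (QVA.VacuumModule q ℓ) (QVA.VacuumModule q ℓ)),
          QVA.IsQuantumVertexAlgebra (QVA.vac q ℓ) Y S) ∧
      (∀ (W : Type*) [AddCommGroup W] [Module ℂ W] [LieRingModule (QVA.BHat q) W]
        [LieModule ℂ (QVA.BHat q) W],
        QVA.IsRestricted q W → QVA.HasLevel q ℓ W →
        ∃! YW : QVA.VacuumModule q ℓ →ₗ[ℂ] VertexOperator ℂ W,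
          QVA.IsModuleFor (QVA.vac q ℓ) Y YW ∧
            ∀ r : ℤ, QVA.IsBetaField q r (YW (QVA.betaVec q ℓ r))) := by
  have hY := QVA.isWeakQuantumVertexAlgebra_vacOp (ℓ := ℓ) hq0 hq
  -- A competing structure Y' is a module over itself, so module uniqueness applies with Y' in both
  -- roles.
  refine ⟨QVA.vacOp q ℓ, ⟨hY, QVA.isBetaField_fieldOp _ _⟩, fun Y' h hβ =>
    QVA.eq_fieldOp _ _ hβ ⟨h.vacuum, h.weak_assoc⟩ hβ, fun hℓ =>
    ⟨QVA.isIrreducible_vacOp hq0 hq hℓ,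
      QVA.isNondegenerate_of_Yx_injective _ (QVA.vac_ne_zero hq0 hq) (QVA.Yx_injective hq0 hq hℓ),
      QVA.Sop q ℓ, QVA.isQuantumVertexAlgebra_Sop hq0 hq hY, fun S hS => QVA.eq_Sop hq0 hq hℓ hS⟩,
    fun W _ _ _ _ hW hlevel => ⟨QVA.fieldOp hW hlevel,
      ⟨QVA.isModuleFor_fieldOp hW hlevel, QVA.isBetaField_fieldOp hW hlevel⟩,
      fun YW h => QVA.eq_fieldOp hW hlevel (QVA.isBetaField_fieldOp _ _) h.1 h.2⟩⟩
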